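/- **Setting.** Let $d\ge 2$. Let $\eta\in C^\infty(\mathbb R;\mathbb R)$ with $\operatorname{supp}\eta\subset[-\tfrac23,\tfrac23]$ and $\sum_{n\in\mathbb Z}\eta(s-n)=1$ for all $s\in\mathbb R$; put $\sigma_k(\xi)=\prod_{j=1}^d\eta(\xi_j-k_j)$ and $\square_k=\mathcal F^{-1}\sigma_k\mathcal F$ for $k\in\mathbb Z^d$, where $\mathcal F f(\xi)=(2\pi)^{-d/2}\int f(x)e^{-i\langle x,\xi\rangle}dx$. For $c\ge1$ let $$\mathcal U_2(t)=\mathcal F^{-1}e^{it(c^2+|\xi|^2-|\xi|^4/c^2)}\mathcal F,\qquad \mathcal A_2f(t)=\int_0^t\mathcal U_2(t-\tau)f(\tau)\,d\tau,\qquad K(c)=10-\tfrac12\lceil\log_2 c^{-2}\rceil .$$ Write $\langle y\rangle=(1+|y|^2)^{1/2}$, and for $T>0$ $$\|F\|_{L^{p_1,p_2}_{x_i;(x_j)_{j\ne i},t}}=\Big\|\,\|F\|_{L^{p_2}_{(x_j)_{j\neq i},t}(\mathbb R^{d-1}\times[-T,T])}\Big\|_{L^{p_1}_{x_i}(\mathbb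 R)} .$$ Functions $\psi_0$ on $\mathbb R^d$ and $f$ on $[-T,T]\times\mathbb R^d$ are measurable, complex valued and of at most polynomial growth in the mean, i.e. $(1+|x|)^{-N}\psi_0\in L^1(\mathbb R^d)$, resp. $(1+|x|)^{-N}f\in L^1([-T,T]\times\mathbb R^d)$, for some $N\in\mathbb N$ (this contains all the Lebesgue spaces below); an estimate with infinite right-hand side is void. **Lemma (maximal function estimates).** Fix $d,\eta$ as above, $2\le q\le\infty$, and $a,M>0$. There are constants $C>0$ and $c_0\ge1$, depending only on $d,\eta,q,a,M$, such that the following holds for all $c\ge1$, all $0<T\le Mc^2$, all $k\in\mathbb Z^d$ and all $h,i\in\{1,\dots,d\}$. 1. If $q>8/d$ and $|k|\ge a\,K(c)$, then $$\|\square_k\,\mathcal U_2(t)\psi_0\|_{L^{q,\infty}_{x_i;(x_j)_{j\ne i},t}}\le C\,c^{d/2}\langle k\rangle^{1/q}\|\square_k\psi_0\|_{L^2}.$$ 2. If $q>4/d$ and $|k|\le a\,K(c)$, then $$\|\square_k\,\mathcal U_2(t)\psi_0\|_{L^{q,\infty}_{x_i;(x_j)_{j\ne i},t}}\le C\,c\,\langle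 k\rangle^{1/q}\|\square_k\psi_0\|_{L^2};$$ moreover, if $c\ge c_0$, this holds for every $T>0$, with the same $C$. 3. If $q>8/d$ and $|k_i|\ge a\,K(c)^2$, then $$\|\square_k\,\mathcal A_2f\|_{L^{q,\infty}_{x_i;(x_j)_{j\ne i},t}}\le C\,c^{1+d/2}\langle k_i\rangle^{-3/2+1/q}\|\square_kf\|_{L^{1,2}_{x_i;(x_j)_{j\ne i},t}}.$$ 4. If $q>8/d$, $h\ne i$ and $|k_i|\ge a\,c$, then $$\|\square_k\,\mathcal A_2f\|_{L^{q,\infty}_{x_h;(x_j)_{j\ne h},t}}\le C\,c^{1+d/2}\langle k_i\rangle^{-3/2+1/q}\|\square_kf\|_{L^{1,2}_{x_i;(x_j)_{j\ne i},t}}.$$ 5. If $q>8/d$ and $|k_i|\ge a\,c$ ($h=i$ allowed), then $$\|\square_k\,\partial_{x_i}^2\mathcal A_2f\|_{L^{q,\infty}_{x_h;(x_j)_{j\ne h},t}}\le C\,c^{1+d/2}\langle k_i\rangle^{1/2+1/q}\|\square_kf\|_{L^{1,2}_{x_i;(x_j)_{j\ne i},t}}.$$ -/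

import Mathlib

open MeasureTheory
open scoped ENNReal ContDiff

noncomputable section

namespace MaxFun

/-- Physical space (and frequency space) `ℝ^d` with the Euclidean norm. -/
abbrev Sp (d : ℕ) : Type := EuclideanSpace ℝ (Fin d)

/-- The one-dimensional smooth bump `η` generating a frequency-uniform partition of unity:
`supp η ⊆ [-2/3, 2/3]` and `∑_{n ∈ ℤ} η(s - n) = 1` for every `s`. -/
structure IsUniformBump (η : ℝ → ℝ) : Prop where
  smooth : ContDiff ℝ ∞ η
  supp : tsupport η ⊆ Set.Icc (-(2 / 3)) (2 / 3)
  sum_one : ∀ s : ℝ, HasSum (fun n : ℤ => η (s - n)) 1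

/-- `σ_k(ξ) = ∏_j η(ξ_j - k_j)`. -/
def sigma {d : ℕ} (η : ℝ → ℝ) (k : Fin d → ℤ) (ξ : Sp d) : ℝ := ∏ j, η (ξ j - k j)

/-- The Euclidean norm `|k|` of a lattice point. -/
def latNorm {d : ℕ} (k : Fin d → ℤ) : ℝ := √(∑ j, (k j : ℝ) ^ 2)

/-- The Japanese bracket `⟨r⟩ = (1 + r²)^{1/2}`. -/
def jap (r : ℝ) : ℝ := √(1 + r ^ 2)

/-- The frequency threshold `K(c) = 10 - ½ ⌈log₂ ε⌉`, with `ε = c⁻²`. -/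
def threshold (c : ℝ) : ℝ := 10 - (1 / 2) * (⌈Real.logb 2 ((c ^ 2)⁻¹)⌉ : ℝ)

/-- The convolution kernel `(2π)^{-d} ∫ e^{i⟨x,ξ⟩} m(ξ) dξ` of the Fourier multiplier `m(D)`. -/
def multKernel {d : ℕ} (m : Sp d → ℂ) (x : Sp d) : ℂ :=
  (((2 * Real.pi) ^ d)⁻¹ : ℝ) * ∫ ξ : Sp d, Complex.exp (Complex.I * (inner ℝ x ξ : ℝ)) * m ξ

/-- The Fourier multiplier `m(D) f = ℱ⁻¹ (m · ℱ f)`, as the convolution of `f` with its kernel. It is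
used only for smooth compactly supported `m`, so the kernel is a Schwartz function and the
convolution makes sense for every function `f` of at most polynomial growth in the mean. -/
def mult {d : ℕ} (m : Sp d → ℂ) (f : Sp d → ℂ) (x : Sp d) : ℂ :=
  ∫ y : Sp d, multKernel m (x - y) * f y

/-- The symbol `e^{it(c² + |ξ|² - |ξ|⁴/c²)}` of `𝒰₂(t)`. -/
def symU {d : ℕ} (c t : ℝ) (ξ : Sp d) : ℂ :=
  Complex.exp (Complex.I * ((t * (c ^ 2 + ‖ξ‖ ^ 2 - ‖ξ‖ ^ 4 / c ^ 2) : ℝ) : ℂ))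

/-- `□_k ψ = σ_k(D) ψ`. -/
def box {d : ℕ} (η : ℝ → ℝ) (k : Fin d → ℤ) (ψ : Sp d → ℂ) : Sp d → ℂ :=
  mult (fun ξ => (sigma η k ξ : ℂ)) ψ

/-- `□_k 𝒰₂(t) ψ`. -/
def boxU {d : ℕ} (η : ℝ → ℝ) (c : ℝ) (k : Fin d → ℤ) (ψ : Sp d → ℂ) (t : ℝ) : Sp d → ℂ :=
  mult (fun ξ => (sigma η k ξ : ℂ) * symU c t ξ) ψ

/-- `□_k 𝒜₂ f (t) = ∫₀ᵗ □_k 𝒰₂(t - τ) f(τ) dτ`. -/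
def boxA {d : ℕ} (η : ℝ → ℝ) (c : ℝ) (k : Fin d → ℤ) (f : ℝ → Sp d → ℂ) (t : ℝ) (x : Sp d) : ℂ :=
  ∫ τ in (0 : ℝ)..t, boxU η c k (f τ) (t - τ) x

/-- `□_k ∂²_{x_i} 𝒜₂ f (t) = ∫₀ᵗ □_k ∂²_{x_i} 𝒰₂(t - τ) f(τ) dτ`; the symbol of `∂²_{x_i}` is
`(i ξ_i)²`. -/
def boxD2A {d : ℕ} (η : ℝ → ℝ) (c : ℝ) (k : Fin d → ℤ) (i : Fin d) (f : ℝ → Sp d → ℂ)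
    (t : ℝ) (x : Sp d) : ℂ :=
  ∫ τ in (0 : ℝ)..t,
    mult (fun ξ => (sigma η k ξ : ℂ) * (Complex.I * (ξ i : ℂ)) ^ 2 * symU c (t - τ) ξ) (f τ) x

/-- The point of `ℝ^d` whose `i`-th coordinate is `s` and whose other coordinates are `y`. -/
def insertCoord {d : ℕ} (i : Fin d) (s : ℝ) (y : {j : Fin d // j ≠ i} → ℝ) : Sp d :=
  WithLp.toLp 2 (fun j => if h : j = i then s else y ⟨j, h⟩)

/-- The time interval `[-T, T]`. -/
def timeI (T : ℝ) : Set ℝ := Set.Icc (-T) T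

/-- The anisotropic norm of `L^{p₁,p₂}_{x_i;(x_j)_{j≠i},t}` over `ℝ^d × [-T, T]`:
the `L^{p₂}` norm in `((x_j)_{j≠i}, t)`, followed by the `L^{p₁}` norm in `x_i`. -/
def anisoNorm {d : ℕ} (p₁ p₂ : ℝ≥0∞) (i : Fin d) (T : ℝ) (F : ℝ → Sp d → ℂ) : ℝ≥0∞ :=
  eLpNorm (fun s : ℝ =>
      eLpNorm (fun z : ({j : Fin d // j ≠ i} → ℝ) × ℝ => F z.2 (insertCoord i s z.1)) p₂
        (volume.prod (volume.restrict (timeI T))))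
    p₁ volume

/-- `ψ` is a measurable function of at most polynomial growth in the mean: `ψ (1 + |x|)^{-N} ∈ L¹`
for some `N`. All Lebesgue spaces `L^p(ℝ^d)`, `1 ≤ p ≤ ∞`, consist of such functions. -/
def IsTempered {d : ℕ} (ψ : Sp d → ℂ) : Prop :=
  ∃ N : ℕ, Integrable (fun x : Sp d => ((1 + ‖x‖) ^ N)⁻¹ • ψ x)

/-- The same for functions on `[-T, T] × ℝ^d`: `f (1 + |x|)^{-N} ∈ L¹([-T, T] × ℝ^d)` for some `N`.
All the spaces `L^{p₁,p₂}_{x_i;(x_j)_{j≠i},t}` and `L^a_t L^b_x` over `[-T, T] × ℝ^d` consist of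
such functions. -/
def IsTemperedOn {d : ℕ} (T : ℝ) (f : ℝ → Sp d → ℂ) : Prop :=
  ∃ N : ℕ, Integrable (fun p : ℝ × Sp d => ((1 + ‖p.2‖) ^ N)⁻¹ • f p.1 p.2)
    ((volume.restrict (timeI T)).prod volume)

end MaxFun

end

/-! Everything is reduced to pointwise bounds for one oscillatory kernel. Replace `sigma η k` by a
slightly wider cutoff `amp`. The plane waves `wave w c k (t, x)`, localized by `amp`, are vectors of
L² in frequency with Gram kernel `ker w c k (t - t') (x - x')`. By `mult_eq_integral_ker_mul_box`
the localized evolution is a convolution of `ker` with □_kψ. Hence it is, up to a factor at most 1,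
the inner product of these waves with one vector Ψ. `exists_synthesis` and the time-zero Schur bound
`exists_ker_schur` give ‖Ψ‖ ≲ ‖□_kψ‖.

Maximal functions come from TT* (`lintegral_inner_rpow_le`). On each hyperplane x_i = s a nearly
maximizing point is selected measurably. If the Gram kernel is at most A(1 + |s - s'|/D)^{-m}
uniformly in the selected points, Young's inequality yields the constant √A D^{1/q}, provided mq > 2
(`exists_eLpNorm_maxInner_le`).

The kernel is studied by expanding the symbol exactly about k and rescaling by a length L
(`norm_ker_eq`). With a small constant δ = `delta d`, the rescaled Hessian is definite in two
regimes: |k| ≤ δc with c ≥ 1/δ (take L = c), and c ≤ δ|k| (take L = |k|, the quartic term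
dominating). Definiteness makes the phase difference at shift u nonstationary along u, which gives
decay of order d/2 without stationary phase (`exists_osc_sq_le_of_nondegenerate`). After undoing the
drift along the group velocity this is decay at scale D = ⟨k⟩ for all times, and mq > 2 becomes q >
4/d. For the remaining |k| ≲ c the Hessian may degenerate. There only finite speed on |t| ≲ c² is
used: D = c²⟨k⟩, at the price c^{2/q} ≤ c. Estimates 1 and 2 follow, since c ≤ c^{d/2}, and since a
K(c) ≤ δc for large c, so that low frequencies become dispersive for every T.

For the Duhamel term the source is sliced along hyperplanes x_i = s, and Minkowski's inequality
leaves an L² problem on each slice (`anisoNorm_retarded_le`).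

If |k| ≲ c, a weighted Cauchy-Schwarz inequality at the propagation scale c³ is used. It needs the
kernel in L² on a space-time slab. The tangential variables are removed by Bessel's inequality. The
time integral becomes a double integral of |φ(s) - φ(s')|^{θ-1}, whose singularities are integrable
because the phase difference has only simple zeros in suitable variables (`exists_double_sing_le`).
The count of powers of c at the end is what requires q > 8/d.

If c ≤ δ|k|, wave packets cross x_i = s in the direction of sign k_i, and the kernel is negligible
on the other side (`exists_ker_one_sided`). Up to this negligible part the sources in (0, t] may be
dropped, or replaced by all sources at positive times (nonpositive times if t < 0). That set does
not depend on t, so the Duhamel integral becomes a free wave and the maximal bound applies again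
(`exists_retarded_high`).

Two derivatives cost nothing new: ξ_i = k_i(1 + ⟨w, ξ - k⟩) with w = e_i/k_i, and the amplitude
carries the factor 1 + ⟨w, ·⟩ for this purpose. -/

namespace MaxFun

/-! ### Duality and TT* for families of vectors in a Hilbert space -/

section Hilbert

variable {Ω H : Type*} [MeasurableSpace Ω] {μ : Measure Ω} [NormedAddCommGroup H]
  [InnerProductSpace ℂ H] [CompleteSpace H]

/-- The squared norm of a superposition is controlled by the moduli of the Gram kernel. -/
theorem enorm_sq_integral_smul_le {f : Ω → ℂ} {e : Ω → H}
    (hfe : Integrable (fun w => f w • e w) μ) :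
    ‖∫ w, f w • e w ∂μ‖ₑ ^ 2 ≤
      ∫⁻ w, ∫⁻ w', ‖f w‖ₑ * ‖f w'‖ₑ * ‖inner ℂ (e w) (e w')‖ₑ ∂μ ∂μ := by
  set Ψ := ∫ w, f w • e w ∂μ with hΨ
  have h1 : ∀ v : H, ‖inner ℂ v Ψ‖ₑ ≤ ∫⁻ w, ‖f w‖ₑ * ‖inner ℂ v (e w)‖ₑ ∂μ := fun v => by
    rw [hΨ, ← integral_inner hfe v]
    refine (enorm_integral_le_lintegral_enorm _).trans (le_of_eq ?_)
    simp [inner_smul_right, enorm_mul]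
  have h2 : ‖Ψ‖ₑ ^ 2 = ‖inner ℂ Ψ Ψ‖ₑ := by
    rw [inner_self_eq_norm_sq_to_K, enorm_pow]
    congr 1
    rw [← ofReal_norm, ← ofReal_norm]
    simp
  rw [h2]
  -- The bound `h1` is used twice, first with v = Ψ and then with v = e w; the second use produces
  -- the Gram kernel.
  refine (h1 Ψ).trans (lintegral_mono fun w => ?_)
  have h3 : ‖inner ℂ Ψ (e w)‖ₑ = ‖inner ℂ (e w) Ψ‖ₑ := by
    rw [← inner_conj_symm, RCLike.enorm_conj]
  simp only [mul_assoc]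
  rw [h3]
  refine (mul_le_mul_right (h1 (e w)) _).trans ?_
  exact lintegral_const_mul_le _ _

/-- The `TT*` principle: a bound for the quadratic form of the moduli of the Gram kernel on
`L^{q'}` gives an `L^q` bound for the coefficients `⟨e_w, ψ⟩`. -/
theorem lintegral_inner_rpow_le [SigmaFinite μ] {e : Ω → H} (he : StronglyMeasurable e) {b : ℝ}
    (hb : ∀ w, ‖e w‖ ≤ b) {q : ℝ} (hq : 2 ≤ q) {B : ℝ≥0∞}
    (hB : ∀ h : Ω → ℝ≥0∞, Measurable h →
      ∫⁻ w, ∫⁻ w', h w * h w' * ‖inner ℂ (e w) (e w')‖ₑ ∂μ ∂μ ≤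
        B * (∫⁻ w, h w ^ (q / (q - 1)) ∂μ) ^ (2 * (q - 1) / q)) (ψ : H) :
    (∫⁻ w, ‖inner ℂ (e w) ψ‖ₑ ^ q ∂μ) ^ (2 / q) ≤ B * ‖ψ‖ₑ ^ 2 := by
  have hq0 : 0 < q := by linarith
  have hq1 : 0 < q - 1 := by linarith
  set f : Ω → ℂ := fun w => inner ℂ (e w) ψ with hf
  have hfm : StronglyMeasurable f := he.inner stronglyMeasurable_const
  have hfb : ∀ w, ‖f w‖ ≤ b * ‖ψ‖ := fun w =>
    (norm_inner_le_norm _ _).trans (mul_le_mul_of_nonneg_right (hb w) (norm_nonneg _))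
  set S := spanningSets μ with hS
  -- On a set of finite measure the quantity X is finite because f is bounded, so a power of X can
  -- be cancelled at the end.
  have key : ∀ n, (∫⁻ w in S n, ‖f w‖ₑ ^ q ∂μ) ^ (2 / q) ≤ B * ‖ψ‖ₑ ^ 2 := by
    intro n
    set X := ∫⁻ w in S n, ‖f w‖ₑ ^ q ∂μ with hX
    have hSn : μ (S n) < ⊤ := measure_spanningSets_lt_top μ n
    have hSm : MeasurableSet (S n) := measurableSet_spanningSets μ n
    have hXfin : X ≠ ⊤ := by
      refine ne_of_lt (lt_of_le_of_lt (setLIntegral_mono (g := fun _ => ENNReal.ofReal (b * ‖ψ‖) ^ q)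
        measurable_const fun w _ => ?_) ?_)
      · refine ENNReal.rpow_le_rpow ?_ hq0.le
        rw [← ofReal_norm]
        exact ENNReal.ofReal_le_ofReal (hfb w)
      · rw [setLIntegral_const]
        exact ENNReal.mul_lt_top (ENNReal.rpow_lt_top_of_nonneg hq0.le ENNReal.ofReal_ne_top) hSn
    -- the test function
    set h : Ω → ℂ := (S n).indicator (fun w => ((‖f w‖ ^ (q - 2) : ℝ) : ℂ) * f w) with hh
    have hnorm : ∀ w, ‖((‖f w‖ ^ (q - 2) : ℝ) : ℂ) * f w‖ = ‖f w‖ ^ (q - 1) := by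
      intro w
      rw [norm_mul, Complex.norm_real, Real.norm_of_nonneg (by positivity)]
      rcases eq_or_lt_of_le (norm_nonneg (f w)) with h0 | h0
      · rw [← h0, mul_zero, Real.zero_rpow hq1.ne']
      · nth_rewrite 2 [← Real.rpow_one ‖f w‖]
        rw [← Real.rpow_add h0]; congr 1; ring
    have hhm : StronglyMeasurable h := by
      refine StronglyMeasurable.indicator ?_ hSm
      refine StronglyMeasurable.mul ?_ hfm
      have : Measurable fun w => ((‖f w‖ ^ (q - 2) : ℝ) : ℂ) :=
        Complex.measurable_ofReal.comp (hfm.measurable.norm.pow_const _)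
      exact this.stronglyMeasurable
    have hhe : Integrable (fun w => h w • e w) μ := by
      have : (fun w => h w • e w) = (S n).indicator
          (fun w => (((‖f w‖ ^ (q - 2) : ℝ) : ℂ) * f w) • e w) := by
        ext w; by_cases hw : w ∈ S n <;> simp [hh, hw]
      rw [this, integrable_indicator_iff hSm]
      refine Measure.integrableOn_of_bounded (M := (b * ‖ψ‖) ^ (q - 1) * b) hSn.ne ?_ ?_
      · refine StronglyMeasurable.aestronglyMeasurable ?_
        refine StronglyMeasurable.smul ?_ he
        refine StronglyMeasurable.mul ?_ hfm
        exact (Complex.measurable_ofReal.comp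
          (hfm.measurable.norm.pow_const (q - 2))).stronglyMeasurable
      · refine Filter.Eventually.of_forall fun w => ?_
        rw [norm_smul, hnorm]
        have := hfb w
        gcongr
        · exact Real.rpow_nonneg (le_trans (norm_nonneg _) this) _
        · exact hb w
    have hhn : ∀ w, ‖h w‖ₑ ^ (q / (q - 1)) = (S n).indicator (fun w => ‖f w‖ₑ ^ q) w := by
      intro w
      by_cases hw : w ∈ S n
      · simp only [hh, Set.indicator_of_mem hw]
        rw [← ofReal_norm, hnorm, ← ENNReal.ofReal_rpow_of_nonneg (norm_nonneg _) hq1.le,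
          ← ENNReal.rpow_mul, ofReal_norm]
        congr 1; field_simp
      · simp only [hh, Set.indicator_of_notMem hw, enorm_zero]
        exact ENNReal.zero_rpow_of_pos (by positivity)
    have hG := hB (fun w => ‖h w‖ₑ) hhm.enorm
    simp only [hhn] at hG
    rw [lintegral_indicator hSm, ← hX] at hG
    have hI := (enorm_sq_integral_smul_le hhe).trans hG
    -- pair with `ψ`
    have hpair : X ≤ ‖∫ w, h w • e w ∂μ‖ₑ * ‖ψ‖ₑ := by
      have h1 : inner ℂ (∫ w, h w • e w ∂μ) ψ = ((∫ w in S n, ‖f w‖ ^ q ∂μ : ℝ) : ℂ) := by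
        rw [← inner_conj_symm, ← integral_inner hhe ψ, ← integral_conj, ← integral_complex_ofReal,
          ← integral_indicator hSm]
        congr 1; ext w
        by_cases hw : w ∈ S n
        · simp only [hh, Set.indicator_of_mem hw, inner_conj_symm, inner_smul_left]
          change (starRingEnd ℂ) (_ * f w) * f w = _
          rw [map_mul, Complex.conj_ofReal, mul_assoc, mul_comm _ (f w), Complex.mul_conj,
            ← Complex.ofReal_mul, Complex.normSq_eq_norm_sq]
          congr 1
          rcases eq_or_lt_of_le (norm_nonneg (f w)) with h0 | h0
          · rw [← h0, Real.zero_rpow hq0.ne']; simp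
          · rw [← Real.rpow_natCast, ← Real.rpow_add h0]; congr 1; norm_num
        · simp [hh, Set.indicator_of_notMem hw]
      have h2 : X = ‖inner ℂ (∫ w, h w • e w ∂μ) ψ‖ₑ := by
        rw [h1, ← ofReal_norm, Complex.norm_real, Real.norm_of_nonneg
          (integral_nonneg fun w => by positivity), integral_eq_lintegral_of_nonneg_ae
          (Filter.Eventually.of_forall fun w => by positivity)
          (hfm.measurable.norm.pow_const _).aestronglyMeasurable]
        have : ∀ w, ENNReal.ofReal (‖f w‖ ^ q) = ‖f w‖ₑ ^ q := fun w => by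
          rw [← ENNReal.ofReal_rpow_of_nonneg (norm_nonneg _) hq0.le, ofReal_norm]
        simp only [this]
        rw [ENNReal.ofReal_toReal hXfin]
      rw [h2, ← ofReal_norm, ← ofReal_norm, ← ofReal_norm,
        ← ENNReal.ofReal_mul (norm_nonneg _)]
      exact ENNReal.ofReal_le_ofReal (norm_inner_le_norm _ _)
    have hsq : X ^ 2 ≤ B * X ^ (2 * (q - 1) / q) * ‖ψ‖ₑ ^ 2 := by
      calc X ^ 2 ≤ (‖∫ w, h w • e w ∂μ‖ₑ * ‖ψ‖ₑ) ^ 2 := by gcongr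
        _ = ‖∫ w, h w • e w ∂μ‖ₑ ^ 2 * ‖ψ‖ₑ ^ 2 := mul_pow _ _ _
        _ ≤ _ := by gcongr
    rcases eq_or_ne X 0 with h0 | h0
    · rw [h0, ENNReal.zero_rpow_of_pos (by positivity)]; exact zero_le
    -- The second factor is the one on the right of `hsq`; cancelling it leaves the claim.
    have h3 : X ^ 2 = X ^ (2 / q) * X ^ (2 * (q - 1) / q) := by
      rw [← ENNReal.rpow_add _ _ h0 hXfin, ← ENNReal.rpow_natCast]
      congr 1; field_simp; push_cast; ring
    have h4 : X ^ (2 * (q - 1) / q) ≠ 0 := by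
      rw [Ne, ENNReal.rpow_eq_zero_iff]; push Not
      exact ⟨fun h => absurd h h0, fun h => absurd h hXfin⟩
    have h5 : X ^ (2 * (q - 1) / q) ≠ ⊤ := ENNReal.rpow_ne_top_of_nonneg (by positivity) hXfin
    rw [h3, mul_assoc, mul_comm _ (‖ψ‖ₑ ^ 2), ← mul_assoc] at hsq
    exact (ENNReal.mul_le_mul_iff_left h4 h5).1 hsq
  have hlim : ∫⁻ w, ‖f w‖ₑ ^ q ∂μ = ⨆ n, ∫⁻ w in S n, ‖f w‖ₑ ^ q ∂μ := by
    rw [← setLIntegral_univ, ← iUnion_spanningSets μ]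
    exact setLIntegral_iUnion_of_directed _ (monotone_spanningSets μ).directed_le
  have hle : ∫⁻ w, ‖f w‖ₑ ^ q ∂μ ≤ (B * ‖ψ‖ₑ ^ 2) ^ (q / 2) := by
    rw [hlim]
    refine iSup_le fun n => ?_
    calc ∫⁻ w in S n, ‖f w‖ₑ ^ q ∂μ
        = ((∫⁻ w in S n, ‖f w‖ₑ ^ q ∂μ) ^ (2 / q)) ^ (q / 2) := by
          rw [← ENNReal.rpow_mul]
          have : 2 / q * (q / 2) = 1 := by field_simp
          rw [this, ENNReal.rpow_one]
      _ ≤ _ := ENNReal.rpow_le_rpow (key n) (by positivity)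
  calc (∫⁻ w, ‖f w‖ₑ ^ q ∂μ) ^ (2 / q) ≤ ((B * ‖ψ‖ₑ ^ 2) ^ (q / 2)) ^ (2 / q) :=
        ENNReal.rpow_le_rpow hle (by positivity)
    _ = B * ‖ψ‖ₑ ^ 2 := by
        rw [← ENNReal.rpow_mul]
        have : q / 2 * (2 / q) = 1 := by field_simp
        rw [this, ENNReal.rpow_one]

end Hilbert
end MaxFun

/-! ### Young's inequality on the line, Schur's test, Bessel's inequality and its dual -/

namespace MaxFun

/-- Young's inequality for the quadratic form of a convolution kernel on the line. -/
theorem lintegral_quadratic_conv_le {W h : ℝ → ℝ≥0∞} (hW : Measurable W) (hh : Measurable h)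
    {q : ℝ} (hq : 2 ≤ q) :
    ∫⁻ s, ∫⁻ s', h s * h s' * W (s - s') ≤
      (∫⁻ s, W s ^ (q / 2)) ^ (2 / q) * (∫⁻ s, h s ^ (q / (q - 1))) ^ (2 * (q - 1) / q) := by
  have hq0 : 0 < q := by linarith
  have hq1 : 0 < q - 1 := by linarith
  set p := q / (q - 1) with hp
  have hp0 : 0 < p := by positivity
  set A := ∫⁻ s, h s ^ p with hA
  set D := ∫⁻ s, W s ^ (q / 2) with hD
  -- Hölder with exponents 1/q, 1/q, 1 - 2/q. The weighted product of these three functions is h(s)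
  -- h(s') W(s - s'), and their integrals are A D, A D and A².
  let f : Fin 3 → ℝ × ℝ → ℝ≥0∞ := ![fun z => h z.1 ^ p * W (z.1 - z.2) ^ (q / 2),
    fun z => h z.2 ^ p * W (z.1 - z.2) ^ (q / 2), fun z => h z.1 ^ p * h z.2 ^ p]
  let r : Fin 3 → ℝ := ![1 / q, 1 / q, 1 - 2 / q]
  have hf : ∀ i, Measurable (f i) := by
    intro i; fin_cases i <;> simp only [f] <;> simp <;> fun_prop
  have h2q : 0 ≤ 1 - 2 / q := by rw [sub_nonneg, div_le_one hq0]; exact hq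
  have key := ENNReal.lintegral_prod_norm_pow_le (μ := (volume : Measure ℝ).prod volume)
    Finset.univ (f := f) (fun i _ => (hf i).aemeasurable) (p := r)
    (by simp [r, Fin.sum_univ_three]; ring)
    (by intro i _; fin_cases i <;> simp [r] <;> first | positivity | simpa using h2q)
  simp only [Fin.prod_univ_three, f, r] at key
  simp only [Matrix.cons_val_zero, Matrix.cons_val_one, Matrix.cons_val] at key
  have i0 : ∫⁻ z : ℝ × ℝ, h z.1 ^ p * W (z.1 - z.2) ^ (q / 2) ∂((volume : Measure ℝ).prod volume)
      = A * D := by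
    rw [lintegral_prod _ (by fun_prop)]
    have : ∀ x, ∫⁻ y, h x ^ p * W (x - y) ^ (q / 2) = h x ^ p * D := fun x => by
      rw [lintegral_const_mul _ (by fun_prop), lintegral_sub_left_eq_self (fun y => W y ^ (q / 2))]
    simp only [this]
    rw [lintegral_mul_const _ (by fun_prop)]
  have i1 : ∫⁻ z : ℝ × ℝ, h z.2 ^ p * W (z.1 - z.2) ^ (q / 2) ∂((volume : Measure ℝ).prod volume)
      = A * D := by
    rw [lintegral_prod_symm _ (by fun_prop)]
    have : ∀ y, ∫⁻ x, h y ^ p * W (x - y) ^ (q / 2) = h y ^ p * D := fun y => by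
      rw [lintegral_const_mul _ (by fun_prop), lintegral_sub_right_eq_self (fun x => W x ^ (q / 2))]
    simp only [this]
    rw [lintegral_mul_const _ (by fun_prop)]
  have i2 : ∫⁻ z : ℝ × ℝ, h z.1 ^ p * h z.2 ^ p ∂((volume : Measure ℝ).prod volume)
      = A * A := by
    exact lintegral_prod_mul (f := fun s => h s ^ p) (g := fun s => h s ^ p) (by fun_prop)
      (by fun_prop)
  rw [i0, i1, i2] at key
  have lhs : ∀ z : ℝ × ℝ, (h z.1 ^ p * W (z.1 - z.2) ^ (q / 2)) ^ (1 / q) *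
      (h z.2 ^ p * W (z.1 - z.2) ^ (q / 2)) ^ (1 / q) * (h z.1 ^ p * h z.2 ^ p) ^ (1 - 2 / q)
      = h z.1 * h z.2 * W (z.1 - z.2) := by
    intro z
    have e1 : ∀ a : ℝ≥0∞, (a ^ p) ^ (1 / q) * (a ^ p) ^ (1 - 2 / q) = a := fun a => by
      rw [← ENNReal.rpow_add_of_nonneg _ _ (by positivity) h2q, ← ENNReal.rpow_mul]
      have : p * (1 / q + (1 - 2 / q)) = 1 := by rw [hp]; field_simp; ring
      rw [this, ENNReal.rpow_one]
    have e2 : ∀ a : ℝ≥0∞, (a ^ (q / 2)) ^ (1 / q) * (a ^ (q / 2)) ^ (1 / q) = a := fun a => by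
      rw [← ENNReal.rpow_add_of_nonneg _ _ (by positivity) (by positivity), ← ENNReal.rpow_mul]
      have : q / 2 * (1 / q + 1 / q) = 1 := by field_simp; norm_num
      rw [this, ENNReal.rpow_one]
    simp only [ENNReal.mul_rpow_of_nonneg _ _ h2q,
      ENNReal.mul_rpow_of_nonneg _ _ (by positivity : (0 : ℝ) ≤ 1 / q)]
    calc _ = ((h z.1 ^ p) ^ (1 / q) * (h z.1 ^ p) ^ (1 - 2 / q)) *
          ((h z.2 ^ p) ^ (1 / q) * (h z.2 ^ p) ^ (1 - 2 / q)) *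
          ((W (z.1 - z.2) ^ (q / 2)) ^ (1 / q) * (W (z.1 - z.2) ^ (q / 2)) ^ (1 / q)) := by ring
      _ = _ := by rw [e1, e1, e2]
  simp only [lhs] at key
  rw [lintegral_prod _ (by fun_prop)] at key
  refine key.trans (le_of_eq ?_)
  have hq' : (0 : ℝ) ≤ 1 / q := by positivity
  rw [← ENNReal.rpow_add_of_nonneg _ _ hq' hq', ENNReal.mul_rpow_of_nonneg _ _ (by positivity),
    ENNReal.mul_rpow_of_nonneg _ _ h2q, mul_comm (A ^ _), mul_assoc,
    ← ENNReal.rpow_add_of_nonneg _ _ h2q h2q, ← ENNReal.rpow_add_of_nonneg _ _ (by positivity)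
      (by positivity)]
  congr 2
  · ring
  · field_simp; ring

section Hilbert

variable {Ω H : Type*} [MeasurableSpace Ω] {μ : Measure Ω} [NormedAddCommGroup H]
  [InnerProductSpace ℂ H] [CompleteSpace H]

/-- Schur's test for a symmetric kernel. -/
theorem lintegral_quadratic_schur_le [SFinite μ] {k : Ω → Ω → ℝ≥0∞}
    (hk : Measurable (Function.uncurry k)) (hsymm : ∀ w w', k w w' = k w' w) {B : ℝ≥0∞}
    (hB : ∀ w, ∫⁻ w', k w w' ∂μ ≤ B) {h : Ω → ℝ≥0∞} (hh : Measurable h) :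
    ∫⁻ w, ∫⁻ w', h w * h w' * k w w' ∂μ ∂μ ≤ B * ∫⁻ w, h w ^ 2 ∂μ := by
  have h1 : ∀ a b : ℝ≥0∞, a * b ≤ 2⁻¹ * a ^ 2 + 2⁻¹ * b ^ 2 := by
    intro a b
    have h2 : (2 : ℝ≥0∞) ≠ 0 := two_ne_zero
    have h3 : (2 : ℝ≥0∞) ≠ ⊤ := ENNReal.ofNat_ne_top
    rw [← ENNReal.mul_le_mul_iff_right h2 h3, mul_add, ← mul_assoc, ← mul_assoc, ← mul_assoc,
      ENNReal.mul_inv_cancel h2 h3, one_mul, one_mul]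
    rcases eq_or_ne a ⊤ with rfl | ha
    · simp
    rcases eq_or_ne b ⊤ with rfl | hb
    · simp
    lift a to NNReal using ha
    lift b to NNReal using hb
    exact_mod_cast two_mul_le_add_sq a b
  have hm : Measurable fun z : Ω × Ω => k z.1 z.2 := hk
  have hm1 : ∀ w, Measurable (k w) := fun w => hk.of_uncurry_left
  set X := ∫⁻ w, ∫⁻ w', h w ^ 2 * k w w' ∂μ ∂μ with hX
  have hXB : X ≤ B * ∫⁻ w, h w ^ 2 ∂μ := by
    rw [← lintegral_const_mul _ (by fun_prop)]
    refine lintegral_mono fun w => ?_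
    rw [lintegral_const_mul _ (hm1 w), mul_comm]
    gcongr; exact hB w
  have hX' : ∫⁻ w, ∫⁻ w', h w' ^ 2 * k w w' ∂μ ∂μ = X := by
    rw [lintegral_lintegral_swap]
    · simp only [hX]
      congr 1; ext w; congr 1; ext w'; rw [hsymm]
    · exact Measurable.aemeasurable (by fun_prop)
  calc ∫⁻ w, ∫⁻ w', h w * h w' * k w w' ∂μ ∂μ
      ≤ ∫⁻ w, ∫⁻ w', (2⁻¹ * (h w ^ 2 * k w w') + 2⁻¹ * (h w' ^ 2 * k w w')) ∂μ ∂μ := by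
        refine lintegral_mono fun w => lintegral_mono fun w' => ?_
        calc h w * h w' * k w w' ≤ (2⁻¹ * h w ^ 2 + 2⁻¹ * h w' ^ 2) * k w w' := by
              gcongr; exact h1 _ _
          _ = _ := by ring
    _ = 2⁻¹ * X + 2⁻¹ * X := by
        have : ∀ w, ∫⁻ w', (2⁻¹ * (h w ^ 2 * k w w') + 2⁻¹ * (h w' ^ 2 * k w w')) ∂μ =
            2⁻¹ * ∫⁻ w', h w ^ 2 * k w w' ∂μ + 2⁻¹ * ∫⁻ w', h w' ^ 2 * k w w' ∂μ := fun w => by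
          have := hm1 w
          rw [lintegral_add_left (by fun_prop), lintegral_const_mul 2⁻¹ (by fun_prop),
            lintegral_const_mul 2⁻¹ (f := fun w' => h w' ^ 2 * k w w') (by fun_prop)]
        simp only [this]
        have m1 : Measurable fun w => ∫⁻ w', h w ^ 2 * k w w' ∂μ :=
          Measurable.lintegral_prod_right' (f := fun z : Ω × Ω => h z.1 ^ 2 * k z.1 z.2)
            (by fun_prop)
        have m2 : Measurable fun w => ∫⁻ w', h w' ^ 2 * k w w' ∂μ :=
          Measurable.lintegral_prod_right' (f := fun z : Ω × Ω => h z.2 ^ 2 * k z.1 z.2)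
            (by fun_prop)
        rw [lintegral_add_left (by fun_prop), lintegral_const_mul _ m1, lintegral_const_mul _ m2,
          hX']
    _ = X := by rw [← add_mul, ENNReal.inv_two_add_inv_two, one_mul]
    _ ≤ _ := hXB

/-- Bessel's inequality for a continuous family with Schur-bounded Gram kernel. -/
theorem lintegral_inner_sq_le [SigmaFinite μ] {e : Ω → H} (he : StronglyMeasurable e) {b : ℝ}
    (hb : ∀ w, ‖e w‖ ≤ b) {B : ℝ≥0∞}
    (hB : ∀ w, ∫⁻ w', ‖inner ℂ (e w) (e w')‖ₑ ∂μ ≤ B) (ψ : H) :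
    ∫⁻ w, ‖inner ℂ (e w) ψ‖ₑ ^ 2 ∂μ ≤ B * ‖ψ‖ₑ ^ 2 := by
  have hm : Measurable (Function.uncurry fun w w' => ‖inner ℂ (e w) (e w')‖ₑ) := by
    have : StronglyMeasurable fun z : Ω × Ω => inner ℂ (e z.1) (e z.2) :=
      (he.comp_measurable measurable_fst).inner (he.comp_measurable measurable_snd)
    exact this.enorm
  have := lintegral_inner_rpow_le he hb (le_refl (2 : ℝ)) (B := B) (fun h hh => by
    have := lintegral_quadratic_schur_le (μ := μ) (h := h) hm
      (fun w w' => by rw [← inner_conj_symm, RCLike.enorm_conj]) hB hh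
    refine this.trans (le_of_eq ?_)
    norm_num) ψ
  norm_num at this
  exact this

/-- The synthesis operator dual to Bessel's inequality. -/
theorem exists_synthesis [SigmaFinite μ] {e : Ω → H} (he : StronglyMeasurable e) {b : ℝ}
    (hb : ∀ w, ‖e w‖ ≤ b) {B : ℝ} (hB0 : 0 ≤ B)
    (hB : ∀ w, ∫⁻ w', ‖inner ℂ (e w) (e w')‖ₑ ∂μ ≤ ENNReal.ofReal B) {g : Ω → ℂ}
    (hg : MemLp g 2 μ) :
    ∃ Ψ : H, ‖Ψ‖ₑ ≤ ENNReal.ofReal (√B) * eLpNorm g 2 μ ∧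
      ∀ v, inner ℂ v Ψ = ∫ w, g w * inner ℂ v (e w) ∂μ := by
  have hbes := fun v => lintegral_inner_sq_le he hb hB v
  have hmem : ∀ v, MemLp (fun w => inner ℂ (e w) v) 2 μ := fun v => by
    refine ⟨(he.inner stronglyMeasurable_const).aestronglyMeasurable, ?_⟩
    rw [eLpNorm_lt_top_iff_lintegral_rpow_enorm_lt_top (by norm_num) (by norm_num)]
    norm_num
    exact (hbes v).trans_lt (ENNReal.mul_lt_top ENNReal.ofReal_lt_top (by simp))
  have hnorm : ∀ v, eLpNorm (fun w => inner ℂ (e w) v) 2 μ ≤ ENNReal.ofReal (√B) * ‖v‖ₑ := by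
    intro v
    have h1 : eLpNorm (fun w => inner ℂ (e w) v) 2 μ ^ 2 ≤ (ENNReal.ofReal (√B) * ‖v‖ₑ) ^ 2 := by
      have := eLpNorm_nnreal_pow_eq_lintegral (f := fun w => inner ℂ (e w) v) (μ := μ)
        (p := 2) (by norm_num)
      norm_num at this
      rw [this, mul_pow, ← ENNReal.ofReal_pow (Real.sqrt_nonneg _), Real.sq_sqrt hB0]
      exact hbes v
    exact (ENNReal.pow_le_pow_left_iff two_ne_zero).1 h1
  let G : Lp ℂ 2 μ := hg.toLp g
  let T : H →ₗ[ℂ] Lp ℂ 2 μ :=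
    { toFun := fun v => (hmem v).toLp _
      map_add' := fun u v => by
        rw [← MemLp.toLp_add]; congr 1; ext w; simp
      map_smul' := fun c v => by
        rw [RingHom.id_apply, ← MemLp.toLp_const_smul]; congr 1; ext w; simp }
  have hT : ∀ v, ‖T v‖ ≤ √B * ‖v‖ := fun v => by
    change ‖(hmem v).toLp _‖ ≤ _
    rw [Lp.norm_toLp]
    refine ENNReal.toReal_le_of_le_ofReal (by positivity) ((hnorm v).trans (le_of_eq ?_))
    rw [ENNReal.ofReal_mul (Real.sqrt_nonneg _), ofReal_norm]
  let T' : H →L[ℂ] Lp ℂ 2 μ := T.mkContinuous (√B) hT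
  -- Bessel's inequality bounds the analysis operator v ↦ ⟨e_w, v⟩ by √B; the synthesized vector is
  -- its adjoint applied to g.
  refine ⟨ContinuousLinearMap.adjoint T' G, ?_, fun v => ?_⟩
  · have h1 : ‖ContinuousLinearMap.adjoint T' G‖ ≤ √B * ‖G‖ := by
      refine (ContinuousLinearMap.le_opNorm _ _).trans ?_
      gcongr
      rw [LinearIsometryEquiv.norm_map]
      exact LinearMap.mkContinuous_norm_le _ (Real.sqrt_nonneg _) _
    rw [← ofReal_norm]
    refine (ENNReal.ofReal_le_ofReal h1).trans (le_of_eq ?_)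
    rw [ENNReal.ofReal_mul (Real.sqrt_nonneg _), Lp.norm_toLp, ENNReal.ofReal_toReal hg.2.ne]
  · rw [ContinuousLinearMap.adjoint_inner_right]
    change inner ℂ ((hmem v).toLp _) (hg.toLp g) = _
    rw [L2.inner_def]
    refine integral_congr_ae ?_
    filter_upwards [(hmem v).coeFn_toLp, hg.coeFn_toLp] with w h1 h2
    rw [h1, h2, RCLike.inner_apply, inner_conj_symm]

end Hilbert
end MaxFun

/-! ### Maximal functions of Gram kernels -/

namespace MaxFun

/-- The integral of `(1 + a|x|)^{-r}`. -/
theorem lintegral_one_add_mul_norm {E : Type*} [NormedAddCommGroup E] [NormedSpace ℝ E]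
    [FiniteDimensional ℝ E] [MeasurableSpace E] [BorelSpace E] (μ : Measure E)
    [μ.IsAddHaarMeasure] {r : ℝ} (hr : (Module.finrank ℝ E : ℝ) < r) {a : ℝ} (ha : 0 < a) :
    ∫⁻ x : E, ENNReal.ofReal ((1 + a * ‖x‖) ^ (-r)) ∂μ =
      ENNReal.ofReal ((∫ x : E, (1 + ‖x‖) ^ (-r) ∂μ) * (a ^ Module.finrank ℝ E)⁻¹) := by
  have h1 := Measure.integral_comp_smul μ (fun x : E => (1 + ‖x‖) ^ (-r)) a
  have h2 : Integrable (fun x : E => (1 + ‖a • x‖) ^ (-r)) μ :=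
    (integrable_one_add_norm hr).comp_smul ha.ne'
  have h3 : ∀ x : E, (1 + ‖a • x‖) ^ (-r) = (1 + a * ‖x‖) ^ (-r) := fun x => by
    rw [norm_smul, Real.norm_of_nonneg ha.le]
  simp only [h3] at h1 h2
  rw [← ofReal_integral_eq_lintegral_ofReal h2
    (Filter.Eventually.of_forall fun x => by positivity), h1, smul_eq_mul,
    abs_of_nonneg (by positivity), mul_comm]

section Hilbert

variable {Z H : Type*} [NormedAddCommGroup H] [InnerProductSpace ℂ H]
  [TopologicalSpace Z] [TopologicalSpace.SeparableSpace Z] [Nonempty Z]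

/-- The maximal function `s ↦ sup_z |⟨e_{s,z}, ψ⟩|`, over a countable dense set of `z`. -/
noncomputable def maxInner (e : ℝ → Z → H) (ψ : H) (s : ℝ) : ℝ≥0∞ :=
  ⨆ n, ‖inner ℂ (e s (TopologicalSpace.denseSeq Z n)) ψ‖ₑ

/-- By continuity the points satisfying the inequality form a closed set, and it contains a dense
sequence. Hence the countable supremum is the true one. -/
theorem enorm_inner_le_maxInner {e : ℝ → Z → H} (he : Continuous (Function.uncurry e)) (ψ : H)
    (s : ℝ) (z : Z) : ‖inner ℂ (e s z) ψ‖ₑ ≤ maxInner e ψ s := by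
  have hc : Continuous fun z => ‖inner ℂ (e s z) ψ‖ₑ := by
    have : Continuous (e s) := he.comp (Continuous.prodMk_right s)
    fun_prop
  have hcl : IsClosed {z | ‖inner ℂ (e s z) ψ‖ₑ ≤ maxInner e ψ s} :=
    isClosed_le hc continuous_const
  have hsub : Set.range (TopologicalSpace.denseSeq Z) ⊆
      {z | ‖inner ℂ (e s z) ψ‖ₑ ≤ maxInner e ψ s} := by
    rintro _ ⟨n, rfl⟩
    exact le_iSup (fun n => ‖inner ℂ (e s (TopologicalSpace.denseSeq Z n)) ψ‖ₑ) n
  have := (TopologicalSpace.denseRange_denseSeq Z).closure_range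
  exact hcl.closure_subset_iff.2 hsub (this ▸ Set.mem_univ z)

variable [CompleteSpace H]

/-- Linearization of the supremum. Selecting the best of finitely many points replaces the maximal
function by the coefficients along one measurable curve of vectors. Since `W` bounds the Gram kernel
uniformly in the points, the selection does not affect it, and TT* with Young's inequality applies.
Monotone convergence then admits all points of the dense sequence. -/
theorem lintegral_maxInner_rpow_le {e : ℝ → Z → H} (he : Continuous (Function.uncurry e)) {b : ℝ}
    (hb : ∀ s z, ‖e s z‖ ≤ b) {W : ℝ → ℝ≥0∞} (hWm : Measurable W)
    (hW : ∀ s z s' z', ‖inner ℂ (e s z) (e s' z')‖ₑ ≤ W (s - s')) {q : ℝ} (hq : 2 ≤ q) (ψ : H) :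
    (∫⁻ s, maxInner e ψ s ^ q) ^ (2 / q) ≤ (∫⁻ s, W s ^ (q / 2)) ^ (2 / q) * ‖ψ‖ₑ ^ 2 := by
  have hq0 : 0 < q := by linarith
  set z := TopologicalSpace.denseSeq Z with hz
  have hcn : ∀ n, Continuous fun s => e s (z n) := fun n => he.comp (Continuous.prodMk_left _)
  -- measurable selection of an almost maximizing index among the first `n`
  have sel : ∀ n : ℕ, ∃ e' : ℝ → H, StronglyMeasurable e' ∧ (∀ s, ∃ j, e' s = e s (z j)) ∧
      ∀ s, ∀ j ≤ n, ‖inner ℂ (e s (z j)) ψ‖ₑ ≤ ‖inner ℂ (e' s) ψ‖ₑ := by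
    intro n
    induction n with
    | zero =>
      refine ⟨fun s => e s (z 0), (hcn 0).stronglyMeasurable, fun s => ⟨0, rfl⟩, ?_⟩
      intro s j hj
      rw [Nat.le_zero.1 hj]
    | succ n ih =>
      classical
      obtain ⟨e', h1, h2, h3⟩ := ih
      set A : Set ℝ := {s | ‖inner ℂ (e' s) ψ‖ₑ < ‖inner ℂ (e s (z (n + 1))) ψ‖ₑ} with hA
      have hAm : MeasurableSet A := measurableSet_lt
        (h1.inner stronglyMeasurable_const).enorm
        (((hcn (n + 1)).stronglyMeasurable).inner stronglyMeasurable_const).enorm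
      refine ⟨fun s => if s ∈ A then e s (z (n + 1)) else e' s,
        StronglyMeasurable.ite hAm (hcn (n + 1)).stronglyMeasurable h1, fun s => ?_, ?_⟩
      · by_cases hs : s ∈ A
        · exact ⟨n + 1, by simp [hs]⟩
        · simpa [hs] using h2 s
      · intro s j hj
        by_cases hs : s ∈ A
        · simp only [hs, if_true]
          rcases Nat.le_succ_iff.1 hj with h | h
          · exact (h3 s j h).trans (le_of_lt hs)
          · rw [h]
        · simp only [hs, if_false]
          rcases Nat.le_succ_iff.1 hj with h | h
          · exact h3 s j h
          · rw [h]; exact not_lt.1 hs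
  have key : ∀ n : ℕ, ∫⁻ s, (⨆ j ≤ n, ‖inner ℂ (e s (z j)) ψ‖ₑ) ^ q ≤
      ((∫⁻ s, W s ^ (q / 2)) ^ (2 / q) * ‖ψ‖ₑ ^ 2) ^ (q / 2) := by
    intro n
    obtain ⟨e', h1, h2, h3⟩ := sel n
    have h4 := lintegral_inner_rpow_le (μ := volume) h1 (b := b) (fun s => by
      obtain ⟨j, hj⟩ := h2 s
      rw [hj]; exact hb _ _) hq (B := (∫⁻ s, W s ^ (q / 2)) ^ (2 / q)) (fun h hh => by
        refine le_trans (lintegral_mono fun s => lintegral_mono fun s' => ?_)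
          (lintegral_quadratic_conv_le hWm hh hq)
        obtain ⟨j, hj⟩ := h2 s
        obtain ⟨j', hj'⟩ := h2 s'
        rw [hj, hj']
        gcongr
        exact hW _ _ _ _) ψ
    calc ∫⁻ s, (⨆ j ≤ n, ‖inner ℂ (e s (z j)) ψ‖ₑ) ^ q
        ≤ ∫⁻ s, ‖inner ℂ (e' s) ψ‖ₑ ^ q := by
          refine lintegral_mono fun s => ENNReal.rpow_le_rpow ?_ hq0.le
          exact iSup₂_le fun j hj => h3 s j hj
      _ = ((∫⁻ s, ‖inner ℂ (e' s) ψ‖ₑ ^ q) ^ (2 / q)) ^ (q / 2) := by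
          rw [← ENNReal.rpow_mul]
          have : 2 / q * (q / 2) = 1 := by field_simp
          rw [this, ENNReal.rpow_one]
      _ ≤ _ := ENNReal.rpow_le_rpow h4 (by positivity)
  have hsup : ∀ s, maxInner e ψ s ^ q = ⨆ n : ℕ, (⨆ j ≤ n, ‖inner ℂ (e s (z j)) ψ‖ₑ) ^ q := by
    intro s
    have h1 : maxInner e ψ s = ⨆ n : ℕ, ⨆ j ≤ n, ‖inner ℂ (e s (z j)) ψ‖ₑ :=
      (biSup_le_eq_iSup (f := fun j => ‖inner ℂ (e s (z j)) ψ‖ₑ)).symm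
    rw [h1]
    exact (ENNReal.orderIsoRpow q hq0).map_iSup _
  have hfin : ∫⁻ s, maxInner e ψ s ^ q ≤
      ((∫⁻ s, W s ^ (q / 2)) ^ (2 / q) * ‖ψ‖ₑ ^ 2) ^ (q / 2) := by
    simp only [hsup]
    rw [lintegral_iSup]
    · exact iSup_le key
    · intro n
      refine Measurable.pow_const ?_ _
      refine Measurable.biSup _ (Set.to_countable _) fun j _ => ?_
      exact (((hcn j).stronglyMeasurable).inner stronglyMeasurable_const).enorm
    · intro n m hnm s
      refine ENNReal.rpow_le_rpow ?_ hq0.le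
      exact biSup_mono fun j hj => hj.trans hnm
  calc (∫⁻ s, maxInner e ψ s ^ q) ^ (2 / q)
      ≤ (((∫⁻ s, W s ^ (q / 2)) ^ (2 / q) * ‖ψ‖ₑ ^ 2) ^ (q / 2)) ^ (2 / q) :=
        ENNReal.rpow_le_rpow hfin (by positivity)
    _ = _ := by
        rw [← ENNReal.rpow_mul]
        have : q / 2 * (2 / q) = 1 := by field_simp
        rw [this, ENNReal.rpow_one]

/-- The maximal function bound for Gram kernels decaying like `(1 + |s|/D)^{-m}`. -/
theorem exists_eLpNorm_maxInner_le (q : ℝ≥0∞) (hq : 2 ≤ q) (m : ℝ)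
    (hm : q ≠ ⊤ → 1 < m * q.toReal / 2) :
    ∃ C : ℝ, 0 < C ∧ ∀ {Z H : Type} [NormedAddCommGroup H] [InnerProductSpace ℂ H]
      [CompleteSpace H] [TopologicalSpace Z] [TopologicalSpace.SeparableSpace Z] [Nonempty Z]
      (e : ℝ → Z → H), Continuous (Function.uncurry e) → ∀ A D : ℝ, 0 ≤ A → 0 < D →
      (∀ s z s' z', ‖inner ℂ (e s z) (e s' z')‖ ≤ A * (1 + D⁻¹ * |s - s'|) ^ (-m)) →
      ∀ ψ : H, eLpNorm (maxInner e ψ) q volume ≤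
        ENNReal.ofReal (C * √A * D ^ (1 / q).toReal) * ‖ψ‖ₑ := by
  set J : ℝ := ∫ s : ℝ, (1 + ‖s‖) ^ (-(m * q.toReal / 2)) with hJ
  have hJ0 : 0 ≤ J := integral_nonneg fun s => by positivity
  -- For finite q the factor from J is what scaling leaves of the L^{q/2} norm of the profile. For q
  -- = ∞ the exponents vanish and Cauchy-Schwarz suffices. The summand 1 makes positivity immediate.
  refine ⟨J ^ (1 / q).toReal + 1, by positivity, ?_⟩
  intro Z H _ _ _ _ _ _ e he A D hA hD hW ψ
  have hbn : ∀ s z, ‖e s z‖ ≤ √A := fun s z => by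
    have := hW s z s z
    rw [inner_self_eq_norm_sq_to_K] at this
    simp only [sub_self, abs_zero, mul_zero, add_zero, Real.one_rpow, mul_one] at this
    refine Real.le_sqrt_of_sq_le ?_
    simpa using this
  have hψ : ‖ψ‖ₑ = ENNReal.ofReal ‖ψ‖ := (ofReal_norm _).symm
  rcases eq_or_ne q ⊤ with rfl | hqt
  · have h1 : ∀ s, maxInner e ψ s ≤ ENNReal.ofReal (√A) * ‖ψ‖ₑ := fun s => by
      refine iSup_le fun n => ?_
      rw [hψ, ← ENNReal.ofReal_mul (Real.sqrt_nonneg _), ← ofReal_norm]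
      refine ENNReal.ofReal_le_ofReal ((norm_inner_le_norm _ _).trans ?_)
      gcongr; exact hbn _ _
    rw [eLpNorm_exponent_top]
    refine (eLpNormEssSup_le_of_ae_enorm_bound (C := ENNReal.ofReal (√A) * ‖ψ‖ₑ)
      (Filter.Eventually.of_forall fun s => by simpa using h1 s)).trans ?_
    gcongr
    simp
    nlinarith [Real.sqrt_nonneg A]
  · have hq0 : q ≠ 0 := fun h => by rw [h] at hq; simp at hq
    set p := q.toReal with hp
    have hp2 : 2 ≤ p := by
      have := ENNReal.toReal_mono hqt hq
      simpa using this
    have hp0 : 0 < p := by linarith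
    have h1q : (1 / q).toReal = 1 / p := by simp [hp]
    rw [h1q]
    set W : ℝ → ℝ≥0∞ := fun s => ENNReal.ofReal (A * (1 + D⁻¹ * ‖s‖) ^ (-m)) with hWd
    have hWm : Measurable W := by simp only [hWd]; fun_prop
    have hWint : ∫⁻ s, W s ^ (p / 2) = ENNReal.ofReal (A ^ (p / 2) * (J * D)) := by
      have : ∀ s, W s ^ (p / 2) = ENNReal.ofReal (A ^ (p / 2)) *
          ENNReal.ofReal ((1 + D⁻¹ * ‖s‖) ^ (-(m * p / 2))) := fun s => by
        rw [hWd, ENNReal.ofReal_rpow_of_nonneg (by positivity) (by positivity),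
          ← ENNReal.ofReal_mul (by positivity), Real.mul_rpow hA (by positivity),
          ← Real.rpow_mul (by positivity)]
        congr 3; ring
      simp only [this]
      rw [lintegral_const_mul _ (by fun_prop), lintegral_one_add_mul_norm volume
        (by simpa using hm hqt) (by positivity), ← ENNReal.ofReal_mul (by positivity)]
      simp [hJ]
    have hmain := lintegral_maxInner_rpow_le he hbn hWm (fun s z s' z' => by
      rw [← ofReal_norm]
      exact ENNReal.ofReal_le_ofReal (hW s z s' z')) hp2 ψ
    rw [eLpNorm_eq_lintegral_rpow_enorm_toReal hq0 hqt, ← hp]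
    simp only [enorm_eq_self]
    have hsq : ((∫⁻ s, maxInner e ψ s ^ p) ^ (1 / p)) ^ 2 ≤
        (ENNReal.ofReal (J ^ (1 / p) * √A * D ^ (1 / p)) * ‖ψ‖ₑ) ^ 2 := by
      rw [← ENNReal.rpow_natCast, ← ENNReal.rpow_mul]
      have e1 : 1 / p * ((2 : ℕ) : ℝ) = 2 / p := by push_cast; ring
      rw [e1]
      refine hmain.trans (le_of_eq ?_)
      rw [hWint, mul_pow]
      congr 1
      rw [ENNReal.ofReal_rpow_of_nonneg (by positivity) (by positivity),
        ← ENNReal.ofReal_pow (by positivity)]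
      congr 1
      rw [Real.mul_rpow (by positivity) (by positivity), ← Real.rpow_mul hA,
        Real.mul_rpow hJ0 hD.le, mul_pow, mul_pow, Real.sq_sqrt hA, ← Real.rpow_natCast,
        ← Real.rpow_natCast, ← Real.rpow_mul hJ0, ← Real.rpow_mul hD.le, e1]
      have : p / 2 * (2 / p) = 1 := by field_simp
      rw [this, Real.rpow_one]; ring
    refine ((ENNReal.pow_le_pow_left_iff two_ne_zero).1 hsq).trans ?_
    gcongr
    linarith

end Hilbert
end MaxFun

/-! ### Nonstationary phase, uniform in compact parameters -/

namespace MaxFun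

/-- A smooth function agreeing with `y⁻¹` away from a neighbourhood of the origin. -/
theorem exists_smooth_inv {c : ℝ} (hc : 0 < c) :
    ∃ θ : ℝ → ℝ, ContDiff ℝ ∞ θ ∧ ∀ y, c ≤ |y| → θ y * y = 1 := by
  let β : ContDiffBump (0 : ℝ) := ⟨c / 4, c / 2, by positivity, by linarith⟩
  refine ⟨fun y => (1 - β y) * y⁻¹, ?_, fun y hy => ?_⟩
  · rw [contDiff_iff_contDiffAt]
    intro y
    by_cases hy : y = 0
    · have h0 : (fun y => (1 - β y) * y⁻¹) =ᶠ[nhds y] fun _ => 0 := by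
        rw [hy]
        filter_upwards [β.eventuallyEq_one] with z hz
        simp [hz]
      exact contDiffAt_const.congr_of_eventuallyEq h0
    · exact (contDiffAt_const.sub β.contDiffAt).mul (contDiffAt_inv ℝ hy)
  · have h1 : β y = 0 := β.zero_of_le_dist (by
      rw [dist_zero_right, Real.norm_eq_abs]; exact le_trans (by simp [β]; linarith) hy)
    have : y ≠ 0 := fun h => by rw [h, abs_zero] at hy; linarith
    simp [h1, this]

section IBP

variable {P E : Type*} [NormedAddCommGroup P] [NormedSpace ℝ P] [NormedAddCommGroup E]
  [NormedSpace ℝ E]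

/-- The amplitudes produced by repeated integration by parts along the direction `e p`. -/
noncomputable def ibpSeq (θg : P × E → ℝ) (e : P → E) (a : P × E → ℝ) : ℕ → P × E → ℝ
  | 0 => a
  | n + 1 => fun z => fderiv ℝ (fun w => ibpSeq θg e a n w * θg w) z (0, e z.1)

theorem contDiff_ibpSeq {θg : P × E → ℝ} {e : P → E} {a : P × E → ℝ} (hθ : ContDiff ℝ ∞ θg)
    (he : ContDiff ℝ ∞ e) (ha : ContDiff ℝ ∞ a) (n : ℕ) : ContDiff ℝ ∞ (ibpSeq θg e a n) := by
  induction n with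
  | zero => exact ha
  | succ n ih =>
    have h1 : ContDiff ℝ ∞ (fun w => ibpSeq θg e a n w * θg w) := ih.mul hθ
    have h2 : ContDiff ℝ ∞ (fderiv ℝ (fun w => ibpSeq θg e a n w * θg w)) :=
      h1.fderiv_right (by simp)
    exact h2.clm_apply (contDiff_const.prodMk (he.comp contDiff_fst))

/-- Integration by parts does not enlarge supports: off the closed set the product vanishes
identically near the point, hence so does its derivative. -/
theorem ibpSeq_eq_zero {θg : P × E → ℝ} {e : P → E} {a : P × E → ℝ} {S : Set E} (hS : IsClosed S)
    (ha : ∀ p, ∀ ζ ∉ S, a (p, ζ) = 0) (n : ℕ) (p : P) {ζ : E} (hζ : ζ ∉ S) :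
    ibpSeq θg e a n (p, ζ) = 0 := by
  induction n generalizing p ζ with
  | zero => exact ha p ζ hζ
  | succ n ih =>
    have : (fun w : P × E => ibpSeq θg e a n w * θg w) =ᶠ[nhds (p, ζ)] fun _ => 0 := by
      have ho : IsOpen (Prod.snd ⁻¹' Sᶜ : Set (P × E)) := hS.isOpen_compl.preimage continuous_snd
      filter_upwards [ho.mem_nhds (show (p, ζ) ∈ _ from hζ)] with w hw
      rw [show w = (w.1, w.2) from rfl, ih w.1 hw, zero_mul]
    simp only [ibpSeq]
    rw [this.fderiv_eq]
    simp

variable [FiniteDimensional ℝ E] [MeasurableSpace E] [BorelSpace E]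

/-- Nonstationary phase: if the derivative of the phase along `e p` is `lam * g` with `g` bounded
away from zero on the support of the amplitude, the oscillatory integral decays rapidly, uniformly
for parameters in a compact set. -/
theorem exists_nonstationary_bound (μ : Measure E) [μ.IsAddHaarMeasure] {P₀ : Set P}
    (hP₀ : IsCompact P₀) {S : Set E} (hS : IsCompact S) {a g : P × E → ℝ} {e : P → E}
    (ha : ContDiff ℝ ∞ a) (hg : ContDiff ℝ ∞ g) (he : ContDiff ℝ ∞ e)
    (haS : ∀ p, ∀ ζ ∉ S, a (p, ζ) = 0) {c : ℝ} (hc : 0 < c)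
    (hgc : ∀ p ∈ P₀, ∀ ζ ∈ S, c ≤ |g (p, ζ)|) (N : ℕ) :
    ∃ C : ℝ, 0 < C ∧ ∀ p ∈ P₀, ∀ (ϕ : E → ℝ) (lam : ℝ), ContDiff ℝ ∞ ϕ →
      (∀ ζ, HasDerivAt (fun h : ℝ => ϕ (ζ + h • e p)) (lam * g (p, ζ)) 0) →
      ‖∫ ζ, (a (p, ζ) : ℂ) * Complex.exp (Complex.I * (ϕ ζ : ℝ)) ∂μ‖ ≤ C / (1 + |lam|) ^ N := by
  obtain ⟨θ, hθ, hθ1⟩ := exists_smooth_inv hc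
  set b := ibpSeq (fun w => θ (g w)) e a with hb
  have hbs : ∀ n, ContDiff ℝ ∞ (b n) := contDiff_ibpSeq (hθ.comp hg) he ha
  have hbS : ∀ n p, ∀ ζ ∉ S, b n (p, ζ) = 0 := fun n p ζ hζ =>
    ibpSeq_eq_zero hS.isClosed haS n p hζ
  have hcs : ∀ n p, HasCompactSupport fun ζ => b n (p, ζ) := fun n p =>
    HasCompactSupport.intro hS (hbS n p)
  -- uniform bounds on the iterated amplitudes
  have hM : ∀ n, ∃ M : ℝ, 0 ≤ M ∧ ∀ p ∈ P₀, ∀ ζ, |b n (p, ζ)| ≤ M := by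
    intro n
    obtain ⟨M, hM⟩ := ((hP₀.prod hS).exists_bound_of_continuousOn (hbs n).continuous.continuousOn)
    refine ⟨max M 0, le_max_right _ _, fun p hp ζ => ?_⟩
    by_cases hζ : ζ ∈ S
    · exact (hM (p, ζ) ⟨hp, hζ⟩).trans (le_max_left _ _)
    · rw [hbS n p ζ hζ]; simp
  have hint : ∀ n, ∃ M : ℝ, 0 ≤ M ∧ ∀ p ∈ P₀, ∀ ϕ : E → ℝ,
      ‖∫ ζ, (b n (p, ζ) : ℂ) * Complex.exp (Complex.I * (ϕ ζ : ℝ)) ∂μ‖ ≤ M := by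
    intro n
    obtain ⟨M, hM0, hM⟩ := hM n
    refine ⟨M * μ.real S, by positivity, fun p hp ϕ => ?_⟩
    have h1 : ∫ ζ, (b n (p, ζ) : ℂ) * Complex.exp (Complex.I * (ϕ ζ : ℝ)) ∂μ =
        ∫ ζ in S, (b n (p, ζ) : ℂ) * Complex.exp (Complex.I * (ϕ ζ : ℝ)) ∂μ := by
      refine (setIntegral_eq_integral_of_forall_compl_eq_zero fun ζ hζ => ?_).symm
      rw [hbS n p ζ hζ]; simp
    rw [h1]
    refine norm_setIntegral_le_of_norm_le_const hS.measure_lt_top fun ζ _ => ?_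
    rw [norm_mul, mul_comm Complex.I, Complex.norm_exp_ofReal_mul_I, mul_one, Complex.norm_real]
    exact hM p hp ζ
  -- One integration by parts along `e p` with f = b_n θ(g). Since θ(g) g = 1 on S, the derivative
  -- of the exponential times f gives back i·lam·b_n times the exponential, while the derivative of
  -- f is b_{n+1}.
  have step : ∀ n, ∀ p ∈ P₀, ∀ (ϕ : E → ℝ) (lam : ℝ), ContDiff ℝ ∞ ϕ →
      (∀ ζ, HasDerivAt (fun h : ℝ => ϕ (ζ + h • e p)) (lam * g (p, ζ)) 0) →
      |lam| * ‖∫ ζ, (b n (p, ζ) : ℂ) * Complex.exp (Complex.I * (ϕ ζ : ℝ)) ∂μ‖ =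
        ‖∫ ζ, (b (n + 1) (p, ζ) : ℂ) * Complex.exp (Complex.I * (ϕ ζ : ℝ)) ∂μ‖ := by
    intro n p hp ϕ lam hϕ hd
    set f : E → ℝ := fun ζ => b n (p, ζ) * θ (g (p, ζ)) with hf
    have hins : ContDiff ℝ ∞ (fun ζ : E => (p, ζ)) := contDiff_const.prodMk contDiff_id
    have hfs : ContDiff ℝ ∞ f := ((hbs n).mul (hθ.comp hg)).comp hins
    have hfc : HasCompactSupport f := (hcs n p).mul_right
    have hfd : ∀ ζ, fderiv ℝ f ζ (e p) = b (n + 1) (p, ζ) := by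
      intro ζ
      have h1 : HasFDerivAt (fun w : P × E => b n w * θ (g w))
          (fderiv ℝ (fun w : P × E => b n w * θ (g w)) (p, ζ)) (p, ζ) :=
        (((hbs n).mul (hθ.comp hg)).differentiable (by simp) _).hasFDerivAt
      have h2 : HasFDerivAt (fun ζ : E => (p, ζ)) (ContinuousLinearMap.inr ℝ P E) ζ :=
        hasFDerivAt_prodMk_right p ζ
      have h3 := h1.comp ζ h2
      rw [show f = (fun w : P × E => b n w * θ (g w)) ∘ fun ζ => (p, ζ) from rfl, h3.fderiv]
      simp [b, ibpSeq]
    set F : E → ℂ := fun ζ => (f ζ : ℂ) with hF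
    have hFs : ContDiff ℝ ∞ F := Complex.ofRealCLM.contDiff.comp hfs
    have hFc : HasCompactSupport F := hfc.comp_left (g := Complex.ofReal) (by simp)
    have hFd : ∀ ζ, fderiv ℝ F ζ (e p) = (b (n + 1) (p, ζ) : ℂ) := by
      intro ζ
      have h1 := (Complex.ofRealCLM.hasFDerivAt (x := f ζ)).comp ζ
        (hfs.differentiable (by simp) ζ).hasFDerivAt
      rw [show F = Complex.ofRealCLM ∘ f from rfl, h1.fderiv]
      simp [hfd]
    set G : E → ℂ := fun ζ => Complex.exp (Complex.I * (ϕ ζ : ℝ)) with hG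
    have hGs : ContDiff ℝ ∞ G :=
      (contDiff_const.mul (Complex.ofRealCLM.contDiff.comp hϕ)).cexp
    have hGd : ∀ ζ, fderiv ℝ G ζ (e p) = (lam * g (p, ζ) : ℝ) * Complex.I * G ζ := by
      intro ζ
      have h1 : HasDerivAt (fun h : ℝ => G (ζ + h • e p)) (fderiv ℝ G ζ (e p)) 0 := by
        have h2 : HasFDerivAt G (fderiv ℝ G ζ) (ζ + (0 : ℝ) • e p) := by
          rw [zero_smul, add_zero]; exact (hGs.differentiable (by simp) ζ).hasFDerivAt
        have h3 : HasDerivAt (fun h : ℝ => ζ + h • e p) (e p) 0 := by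
          simpa using ((hasDerivAt_id (0 : ℝ)).smul_const (e p)).const_add ζ
        exact h2.comp_hasDerivAt 0 h3
      have h4 := (((hd ζ).ofReal_comp).const_mul Complex.I).cexp
      rw [h1.unique h4]
      simp only [zero_smul, add_zero, hG]
      ring
    have hparts := integral_mul_fderiv_eq_neg_fderiv_mul_of_integrable (μ := μ) (f := F) (g := G)
      (v := e p)
      (Continuous.integrable_of_hasCompactSupport
        (((hFs.continuous_fderiv (by simp)).clm_apply continuous_const).mul hGs.continuous)
        (HasCompactSupport.mul_right (hFc.fderiv_apply ℝ (e p))))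
      (Continuous.integrable_of_hasCompactSupport
        (hFs.continuous.mul ((hGs.continuous_fderiv (by simp)).clm_apply continuous_const))
        hFc.mul_right)
      (Continuous.integrable_of_hasCompactSupport (hFs.continuous.mul hGs.continuous) hFc.mul_right)
      (fun x _ => hFs.differentiable (by simp) x) (fun x _ => hGs.differentiable (by simp) x)
    have hl : ∀ ζ, F ζ * fderiv ℝ G ζ (e p) = (lam * Complex.I) * ((b n (p, ζ) : ℂ) * G ζ) := by
      intro ζ
      rw [hGd]
      by_cases hζ : ζ ∈ S
      · have := hθ1 _ (hgc p hp ζ hζ)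
        have h1 : (θ (g (p, ζ)) : ℂ) * (g (p, ζ) : ℂ) = 1 := by exact_mod_cast this
        simp only [hF, hf]
        push_cast
        linear_combination (lam * Complex.I * (b n (p, ζ) : ℂ) * G ζ) * h1
      · simp [hF, hf, hbS n p ζ hζ]
    simp only [hl, hFd] at hparts
    rw [integral_const_mul] at hparts
    have := congrArg norm hparts
    rw [norm_mul, norm_mul, Complex.norm_I, mul_one, Complex.norm_real, norm_neg] at this
    exact this
  have iter : ∀ n, ∀ p ∈ P₀, ∀ (ϕ : E → ℝ) (lam : ℝ), ContDiff ℝ ∞ ϕ →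
      (∀ ζ, HasDerivAt (fun h : ℝ => ϕ (ζ + h • e p)) (lam * g (p, ζ)) 0) →
      |lam| ^ n * ‖∫ ζ, (b 0 (p, ζ) : ℂ) * Complex.exp (Complex.I * (ϕ ζ : ℝ)) ∂μ‖ =
        ‖∫ ζ, (b n (p, ζ) : ℂ) * Complex.exp (Complex.I * (ϕ ζ : ℝ)) ∂μ‖ := by
    intro n p hp ϕ lam hϕ hd
    induction n with
    | zero => simp
    | succ n ih => rw [← step n p hp ϕ lam hϕ hd, ← ih]; ring
  -- The bounds with no and with N integrations by parts are added, which covers small and large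
  -- `lam` together.
  obtain ⟨M0, hM00, hM0⟩ := hint 0
  obtain ⟨M1, hM10, hM1⟩ := hint N
  refine ⟨2 ^ N * (M0 + M1) + 1, by positivity, fun p hp ϕ lam hϕ hd => ?_⟩
  have h0 := hM0 p hp ϕ
  have h1 := hM1 p hp ϕ
  rw [← iter N p hp ϕ lam hϕ hd] at h1
  change ‖∫ ζ, (b 0 (p, ζ) : ℂ) * Complex.exp (Complex.I * (ϕ ζ : ℝ)) ∂μ‖ ≤ _
  set X := ‖∫ ζ, (b 0 (p, ζ) : ℂ) * Complex.exp (Complex.I * (ϕ ζ : ℝ)) ∂μ‖ with hX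
  have hX0 : 0 ≤ X := norm_nonneg _
  rw [le_div_iff₀ (by positivity)]
  have h2 : (1 + |lam|) ^ N ≤ 2 ^ N * (1 + |lam| ^ N) := by
    have h3 : 1 + |lam| ≤ 2 * max 1 |lam| := by
      linarith [le_max_left 1 |lam|, le_max_right 1 |lam|]
    calc (1 + |lam|) ^ N ≤ (2 * max 1 |lam|) ^ N := by gcongr
      _ = 2 ^ N * (max 1 |lam|) ^ N := mul_pow _ _ _
      _ ≤ _ := by
        gcongr
        rcases max_cases 1 |lam| with ⟨h, _⟩ | ⟨h, _⟩ <;> rw [h]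
        · rw [one_pow]; linarith [pow_nonneg (abs_nonneg lam) N]
        · linarith
  calc X * (1 + |lam|) ^ N ≤ X * (2 ^ N * (1 + |lam| ^ N)) := by gcongr
    _ = 2 ^ N * (X + |lam| ^ N * X) := by ring
    _ ≤ 2 ^ N * (M0 + M1) := by gcongr
    _ ≤ _ := by linarith

end IBP
end MaxFun

/-! ### The rescaled model integral and its decay off the cone |y| ≲ |τ| -/

namespace MaxFun

variable {d : ℕ}

/-- One-dimensional cutoff, equal to `1` on `[-2/3, 2/3]` and supported in `[-5/6, 5/6]`. -/
noncomputable def bump₁ : ContDiffBump (0 : ℝ) := ⟨2 / 3, 5 / 6, by norm_num, by norm_num⟩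

/-- The cube `[-5/6, 5/6]^d`. -/
def cube (d : ℕ) : Set (Sp d) := {ζ | ∀ j, |ζ j| ≤ 5 / 6}

/-- The amplitude `∏_j bump₁(ζ_j) · (1 + ⟨w, ζ⟩)`. -/
noncomputable def amp (w ζ : Sp d) : ℝ := (∏ j, bump₁ (ζ j)) * (1 + inner ℝ w ζ)

theorem contDiff_amp : ContDiff ℝ ∞ (fun z : Sp d × Sp d => amp z.1 z.2) := by
  unfold amp
  refine ContDiff.mul (contDiff_prod fun j _ => ?_) ?_
  · exact bump₁.contDiff.comp ((EuclideanSpace.proj (𝕜 := ℝ) j).contDiff.comp contDiff_snd)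
  · exact contDiff_const.add (contDiff_fst.inner ℝ contDiff_snd)

theorem amp_eq_zero (w : Sp d) {ζ : Sp d} (hζ : ζ ∉ cube d) : amp w ζ = 0 := by
  simp only [cube, Set.mem_ofPred_eq, not_forall, not_le] at hζ
  obtain ⟨j, hj⟩ := hζ
  unfold amp
  rw [Finset.prod_eq_zero (Finset.mem_univ j), zero_mul]
  refine bump₁.zero_of_le_dist ?_
  rw [dist_zero_right, Real.norm_eq_abs]
  exact hj.le

theorem norm_sq_le_of_mem_cube {ζ : Sp d} (hζ : ζ ∈ cube d) : ‖ζ‖ ^ 2 ≤ d := by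
  rw [EuclideanSpace.norm_sq_eq]
  calc ∑ j, ‖ζ j‖ ^ 2 ≤ ∑ _j : Fin d, (1 : ℝ) := by
        refine Finset.sum_le_sum fun j _ => ?_
        have := hζ j
        rw [Real.norm_eq_abs]
        nlinarith [abs_nonneg (ζ j)]
    _ = d := by simp

/-- A radius containing the cube. -/
noncomputable def rad (d : ℕ) : ℝ := √d + 1

theorem one_le_rad : 1 ≤ rad d := by unfold rad; linarith [Real.sqrt_nonneg (d : ℝ)]

theorem norm_le_of_mem_cube {ζ : Sp d} (hζ : ζ ∈ cube d) : ‖ζ‖ ≤ rad d := by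
  have := Real.le_sqrt_of_sq_le (norm_sq_le_of_mem_cube hζ)
  unfold rad; linarith

theorem isCompact_cube : IsCompact (cube d) := by
  refine Metric.isCompact_of_isClosed_isBounded ?_ ?_
  · have : cube d = ⋂ j, {ζ : Sp d | |ζ j| ≤ 5 / 6} := by ext; simp [cube]
    rw [this]
    exact isClosed_iInter fun j => isClosed_le (by fun_prop) continuous_const
  · exact (Metric.isBounded_closedBall (x := (0 : Sp d)) (r := rad d)).subset fun ζ hζ => by
      simpa using norm_le_of_mem_cube hζ

/-- The nonlinear part of the rescaled phase. -/
noncomputable def quart (α : ℝ) (κ : Sp d) (m : ℝ) (ζ : Sp d) : ℝ :=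
  α * ‖ζ‖ ^ 2 - 2 * ‖κ‖ ^ 2 * ‖ζ‖ ^ 2 - 4 * inner ℝ κ ζ ^ 2 - 4 * m * inner ℝ κ ζ * ‖ζ‖ ^ 2
    - m ^ 2 * (‖ζ‖ ^ 2) ^ 2

/-- The derivative of `quart` at `ζ` in the direction `e`. -/
noncomputable def dquart (α : ℝ) (κ : Sp d) (m : ℝ) (e ζ : Sp d) : ℝ :=
  2 * α * inner ℝ ζ e - 4 * ‖κ‖ ^ 2 * inner ℝ ζ e - 8 * inner ℝ κ ζ * inner ℝ κ e
    - 4 * m * (inner ℝ κ e * ‖ζ‖ ^ 2 + 2 * inner ℝ κ ζ * inner ℝ ζ e)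
    - 4 * m ^ 2 * ‖ζ‖ ^ 2 * inner ℝ ζ e

theorem contDiff_quart (α : ℝ) (κ : Sp d) (m : ℝ) : ContDiff ℝ ∞ (quart α κ m) := by
  have h1 : ContDiff ℝ ∞ fun ζ : Sp d => ‖ζ‖ ^ 2 := contDiff_norm_sq ℝ
  have h2 : ContDiff ℝ ∞ fun ζ : Sp d => inner ℝ κ ζ := contDiff_const.inner ℝ contDiff_id
  unfold quart
  fun_prop

theorem hasDerivAt_quart (α : ℝ) (κ : Sp d) (m : ℝ) (ζ e : Sp d) :
    HasDerivAt (fun h : ℝ => quart α κ m (ζ + h • e)) (dquart α κ m e ζ) 0 := by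
  have hl : HasDerivAt (fun h : ℝ => ζ + h • e) e 0 := by
    simpa using ((hasDerivAt_id (0 : ℝ)).smul_const e).const_add ζ
  have h1 : HasDerivAt (fun h : ℝ => ‖ζ + h • e‖ ^ 2) (2 * inner ℝ ζ e) 0 := by
    simpa using hl.norm_sq
  have h2 : HasDerivAt (fun h : ℝ => inner ℝ κ (ζ + h • e)) (inner ℝ κ e) 0 := by
    simpa using (hasDerivAt_const (0 : ℝ) κ).inner ℝ hl
  have := ((((h1.const_mul α).sub (h1.const_mul (2 * ‖κ‖ ^ 2))).sub ((h2.pow 2).const_mul 4)).sub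
    ((h2.const_mul (4 * m)).mul h1)).sub ((h1.pow 2).const_mul (m ^ 2))
  refine this.congr_deriv ?_
  simp only [zero_smul, add_zero, dquart]
  ring

/-- The model oscillatory integral. -/
noncomputable def osc (w : Sp d) (α : ℝ) (κ : Sp d) (m : ℝ) (y : Sp d) (τ : ℝ) : ℂ :=
  ∫ ζ : Sp d, ((amp w ζ ^ 2 : ℝ) : ℂ) *
    Complex.exp (Complex.I * ((inner ℝ y ζ + τ * quart α κ m ζ : ℝ) : ℂ))

theorem exists_amp_le (d : ℕ) : ∃ M : ℝ, 0 < M ∧ ∀ w ζ : Sp d, ‖w‖ ≤ 1 → |amp w ζ| ≤ M := by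
  obtain ⟨M, hM⟩ := ((isCompact_closedBall (0 : Sp d) 1).prod
    (isCompact_cube (d := d))).exists_bound_of_continuousOn
    (contDiff_amp (d := d)).continuous.continuousOn
  refine ⟨max M 1, by positivity, fun w ζ hw => ?_⟩
  by_cases hζ : ζ ∈ cube d
  · exact (hM (w, ζ) ⟨by simpa using hw, hζ⟩).trans (le_max_left _ _)
  · rw [amp_eq_zero w hζ, abs_zero]; positivity

theorem exists_norm_osc_le (d : ℕ) : ∃ C : ℝ, 0 < C ∧ ∀ (w : Sp d) (α : ℝ) (κ : Sp d) (m : ℝ)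
    (y : Sp d) (τ : ℝ), ‖w‖ ≤ 1 → ‖osc w α κ m y τ‖ ≤ C := by
  obtain ⟨M, hM0, hM⟩ := exists_amp_le d
  refine ⟨M ^ 2 * volume.real (cube d) + 1, by positivity, fun w α κ m y τ hw => ?_⟩
  unfold osc
  rw [← setIntegral_eq_integral_of_forall_compl_eq_zero (s := cube d)
    (fun ζ hζ => by rw [amp_eq_zero w hζ]; simp)]
  refine (norm_setIntegral_le_of_norm_le_const isCompact_cube.measure_lt_top (C := M ^ 2)
    fun ζ _ => ?_).trans (by linarith)
  rw [norm_mul, mul_comm Complex.I, Complex.norm_exp_ofReal_mul_I, mul_one, Complex.norm_real,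
    norm_pow, Real.norm_eq_abs]
  gcongr
  exact hM w ζ hw

theorem contDiff_phase (α : ℝ) (κ : Sp d) (m : ℝ) (y : Sp d) (τ : ℝ) :
    ContDiff ℝ ∞ fun ζ : Sp d => inner ℝ y ζ + τ * quart α κ m ζ :=
  (contDiff_const.inner ℝ contDiff_id).add (contDiff_const.mul (contDiff_quart α κ m))

theorem hasDerivAt_phase (α : ℝ) (κ : Sp d) (m : ℝ) (y : Sp d) (τ : ℝ) (ζ e : Sp d) :
    HasDerivAt (fun h : ℝ => inner ℝ y (ζ + h • e) + τ * quart α κ m (ζ + h • e))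
      (inner ℝ y e + τ * dquart α κ m e ζ) 0 := by
  have hl : HasDerivAt (fun h : ℝ => ζ + h • e) e 0 := by
    simpa using ((hasDerivAt_id (0 : ℝ)).smul_const e).const_add ζ
  have h2 : HasDerivAt (fun h : ℝ => inner ℝ y (ζ + h • e)) (inner ℝ y e) 0 := by
    simpa using (hasDerivAt_const (0 : ℝ) y).inner ℝ hl
  exact h2.add ((hasDerivAt_quart α κ m ζ e).const_mul τ)

/-- Rapid decay of the model integral outside the cone `|y| ≲ |τ|`. -/
theorem exists_osc_nonstationary (d : ℕ) (A : ℝ) : ∃ A₀ : ℝ, 0 < A₀ ∧ ∀ N : ℕ, ∃ C : ℝ, 0 < C ∧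
    ∀ (w : Sp d) (α : ℝ) (κ : Sp d) (m : ℝ) (y : Sp d) (τ : ℝ), ‖w‖ ≤ 1 → |α| ≤ 1 → ‖κ‖ ≤ A →
      |m| ≤ 1 → A₀ * |τ| ≤ ‖y‖ → ‖osc w α κ m y τ‖ ≤ C / (1 + ‖y‖) ^ N := by
  set D : ℝ × Sp d × ℝ × Sp d × Sp d → ℝ := fun z => dquart z.1 z.2.1 z.2.2.1 z.2.2.2.1 z.2.2.2.2
    with hD
  have hDs : ContDiff ℝ ∞ D := by
    simp only [hD, dquart]
    have e1 : ContDiff ℝ ∞ fun z : ℝ × Sp d × ℝ × Sp d × Sp d =>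
      (inner ℝ z.2.2.2.2 z.2.2.2.1 : ℝ) := ContDiff.inner ℝ (by fun_prop) (by fun_prop)
    have e2 : ContDiff ℝ ∞ fun z : ℝ × Sp d × ℝ × Sp d × Sp d =>
      (inner ℝ z.2.1 z.2.2.2.2 : ℝ) := ContDiff.inner ℝ (by fun_prop) (by fun_prop)
    have e3 : ContDiff ℝ ∞ fun z : ℝ × Sp d × ℝ × Sp d × Sp d =>
      (inner ℝ z.2.1 z.2.2.2.1 : ℝ) := ContDiff.inner ℝ (by fun_prop) (by fun_prop)
    have e4 : ContDiff ℝ ∞ fun z : ℝ × Sp d × ℝ × Sp d × Sp d => ‖z.2.1‖ ^ 2 :=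
      ContDiff.norm_sq ℝ (by fun_prop)
    have e5 : ContDiff ℝ ∞ fun z : ℝ × Sp d × ℝ × Sp d × Sp d => ‖z.2.2.2.2‖ ^ 2 :=
      ContDiff.norm_sq ℝ (by fun_prop)
    fun_prop
  obtain ⟨M, hM⟩ := ((isCompact_Icc (a := (-1 : ℝ)) (b := 1)).prod
    ((isCompact_closedBall (0 : Sp d) A).prod ((isCompact_Icc (a := (-1 : ℝ)) (b := 1)).prod
    ((isCompact_sphere (0 : Sp d) 1).prod (isCompact_cube (d := d)))))).exists_bound_of_continuousOn
    hDs.continuous.continuousOn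
  have hM' : ∀ (α : ℝ) (κ : Sp d) (m : ℝ) (e ζ : Sp d), |α| ≤ 1 → ‖κ‖ ≤ A → |m| ≤ 1 → ‖e‖ = 1 →
      ζ ∈ cube d → |dquart α κ m e ζ| ≤ max M 1 := fun α κ m e ζ h1 h2 h3 h4 h5 =>
    (hM (α, κ, m, e, ζ) ⟨abs_le.1 h1, by simpa using h2, abs_le.1 h3, by simpa using h4, h5⟩).trans
      (le_max_left _ _)
  set M' := max M 1 with hM'd
  have hM'0 : 0 < M' := by positivity
  -- With this aperture the nonlinear part of the derivative along y/|y| is at most |y|/2, so the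
  -- whole derivative is at least |y|/2.
  refine ⟨2 * M', by positivity, fun N => ?_⟩
  -- parameters: `w, α, κ, m, e, s` with `s = τ / |y|`
  set P₀ : Set (Sp d × ℝ × Sp d × ℝ × Sp d × ℝ) := (Metric.closedBall (0 : Sp d) 1) ×ˢ (Set.Icc (-1 : ℝ) 1) ×ˢ
    (Metric.closedBall (0 : Sp d) A) ×ˢ (Set.Icc (-1 : ℝ) 1) ×ˢ (Metric.sphere (0 : Sp d) 1) ×ˢ
    (Set.Icc (-(2 * M')⁻¹) (2 * M')⁻¹) with hP₀
  have hP₀c : IsCompact P₀ := (isCompact_closedBall _ _).prod (isCompact_Icc.prod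
    ((isCompact_closedBall _ _).prod (isCompact_Icc.prod ((isCompact_sphere _ _).prod
      isCompact_Icc))))
  obtain ⟨C, hC0, hC⟩ := exists_nonstationary_bound (volume : Measure (Sp d)) hP₀c
    (isCompact_cube (d := d)) (a := fun z : (Sp d × ℝ × Sp d × ℝ × Sp d × ℝ) × Sp d => amp z.1.1 z.2 ^ 2)
    (g := fun z : (Sp d × ℝ × Sp d × ℝ × Sp d × ℝ) × Sp d => ‖z.1.2.2.2.2.1‖ ^ 2 + z.1.2.2.2.2.2 *
      D (z.1.2.1, z.1.2.2.1, z.1.2.2.2.1, z.1.2.2.2.2.1, z.2))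
    (e := fun p : (Sp d × ℝ × Sp d × ℝ × Sp d × ℝ) => p.2.2.2.2.1)
    ((contDiff_amp.comp (f := fun z : (Sp d × ℝ × Sp d × ℝ × Sp d × ℝ) × Sp d => (z.1.1, z.2)) (by fun_prop)).pow 2)
    (ContDiff.add (ContDiff.norm_sq ℝ (by fun_prop)) (ContDiff.mul (by fun_prop)
      (hDs.comp (by fun_prop)))) (by fun_prop)
    (fun p ζ hζ => by simp only [amp_eq_zero _ hζ]; simp) (c := 1 / 2) (by norm_num)
    (by
      rintro ⟨w, α, κ, m, e, s⟩ ⟨_, h2, h3, h4, h5, h6⟩ ζ hζ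
      simp only [Metric.mem_closedBall, dist_zero_right, mem_sphere_zero_iff_norm] at h2 h3 h4 h5 h6
      have h7 := hM' α κ m e ζ (abs_le.2 h2) h3 (abs_le.2 h4) h5 hζ
      have h8 : |s * D (α, κ, m, e, ζ)| ≤ (2 * M')⁻¹ * M' := by
        rw [abs_mul]
        exact mul_le_mul (abs_le.2 h6) h7 (abs_nonneg _) (by positivity)
      have h9 : (2 * M')⁻¹ * M' = 1 / 2 := by field_simp
      rw [h9] at h8
      simp only [h5]
      have := (abs_le.1 h8).1
      rw [le_abs]; left; linarith) N
  obtain ⟨C₀, hC₀, hC₀'⟩ := exists_norm_osc_le d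
  refine ⟨C + C₀, by positivity, fun w α κ m y τ hw hα hκ hm hy => ?_⟩
  by_cases hy0 : y = 0
  · rw [hy0]; simp
    exact (hC₀' _ _ _ _ _ _ hw).trans (by linarith)
  have hyp : 0 < ‖y‖ := norm_pos_iff.2 hy0
  have hmem : ((w, α, κ, m, ‖y‖⁻¹ • y, τ / ‖y‖) : Sp d × ℝ × Sp d × ℝ × Sp d × ℝ) ∈ P₀ := by
    refine ⟨by simpa using hw, abs_le.1 hα, by simpa using hκ, abs_le.1 hm, ?_, ?_⟩
    · simp [norm_smul, hy0]
    · refine abs_le.1 ?_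
      rw [abs_div, abs_norm, div_le_iff₀ hyp, inv_mul_eq_div, le_div_iff₀ (by positivity)]
      linarith
  have := hC _ hmem (fun ζ => inner ℝ y ζ + τ * quart α κ m ζ) ‖y‖ (contDiff_phase α κ m y τ)
    (fun ζ => by
      refine (hasDerivAt_phase α κ m y τ ζ (‖y‖⁻¹ • y)).congr_deriv ?_
      simp only [hD]
      rw [inner_smul_right, real_inner_self_eq_norm_sq, norm_smul, norm_inv, norm_norm]
      field_simp)
  rw [abs_norm] at this
  refine this.trans ?_
  gcongr
  linarith

end MaxFun

/-! ### Dispersive decay for definite Hessians -/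

namespace MaxFun

variable {d : ℕ}

/-- The difference quotient `(∂_e quart(ζ + re) - ∂_e quart(ζ)) / r` for a unit vector `e`. -/
noncomputable def ddquart (α : ℝ) (κ : Sp d) (m : ℝ) (e : Sp d) (r : ℝ) (ζ : Sp d) : ℝ :=
  2 * α - 4 * ‖κ‖ ^ 2 - 8 * inner ℝ κ e ^ 2
    - 4 * m * (inner ℝ κ e * (2 * inner ℝ ζ e + r)
      + 2 * (inner ℝ κ ζ + inner ℝ κ e * inner ℝ ζ e + r * inner ℝ κ e))
    - 4 * m ^ 2 * (‖ζ‖ ^ 2 + (2 * inner ℝ ζ e + r) * (inner ℝ ζ e + r))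

/-- Along the ray the directional derivative is a cubic polynomial in r, so its increment is exactly
divisible by r. The phase difference at shift r e therefore has a derivative proportional to τ r,
with a smooth quotient that nonstationary phase can use. -/
theorem dquart_add_smul_sub (α : ℝ) (κ : Sp d) (m : ℝ) {e : Sp d} (he : ‖e‖ = 1) (r : ℝ)
    (ζ : Sp d) :
    dquart α κ m e (ζ + r • e) - dquart α κ m e ζ = r * ddquart α κ m e r ζ := by
  have h1 : inner ℝ (ζ + r • e) e = (inner ℝ ζ e + r : ℝ) := by
    rw [inner_add_left, real_inner_smul_left, real_inner_self_eq_norm_sq, he]; ring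
  have h2 : inner ℝ κ (ζ + r • e) = (inner ℝ κ ζ + r * inner ℝ κ e : ℝ) := by
    rw [inner_add_right, real_inner_smul_right]
  have h3 : ‖ζ + r • e‖ ^ 2 = ‖ζ‖ ^ 2 + 2 * r * inner ℝ ζ e + r ^ 2 := by
    rw [norm_add_sq_real, real_inner_smul_right, norm_smul, he, mul_one, Real.norm_eq_abs, sq_abs]
    ring
  unfold dquart ddquart
  rw [h1, h2, h3]
  ring

/-- The dispersive estimate for nondegenerate phases. -/
theorem exists_osc_sq_le_of_nondegenerate (hd : 0 < d) {𝒦 : Set (ℝ × Sp d × ℝ)}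
    (h𝒦 : IsCompact 𝒦) {c : ℝ} (hc : 0 < c)
    (hdd : ∀ z ∈ 𝒦, ∀ e : Sp d, ‖e‖ = 1 → ∀ r ∈ Set.Icc (0 : ℝ) (2 * rad d), ∀ ζ ∈ cube d,
      c ≤ |ddquart z.1 z.2.1 z.2.2 e r ζ|) :
    ∃ C : ℝ, 0 < C ∧ ∀ (w y : Sp d) (τ : ℝ), ‖w‖ ≤ 1 → ∀ z ∈ 𝒦,
      ‖osc w z.1 z.2.1 z.2.2 y τ‖ ^ 2 ≤ C / (1 + |τ|) ^ d := by
  set P₀ : Set (Sp d × (ℝ × Sp d × ℝ) × Sp d × ℝ) := (Metric.closedBall (0 : Sp d) 1) ×ˢ 𝒦 ×ˢ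
    (Metric.sphere (0 : Sp d) 1) ×ˢ (Set.Icc (0 : ℝ) (2 * rad d)) with hP₀
  have hP₀c : IsCompact P₀ := (isCompact_closedBall _ _).prod (h𝒦.prod
    ((isCompact_sphere _ _).prod isCompact_Icc))
  have hg : ContDiff ℝ ∞ fun z : (Sp d × (ℝ × Sp d × ℝ) × Sp d × ℝ) × Sp d =>
      ddquart z.1.2.1.1 z.1.2.1.2.1 z.1.2.1.2.2 z.1.2.2.1 z.1.2.2.2 z.2 := by
    unfold ddquart
    have e1 : ContDiff ℝ ∞ fun z : (Sp d × (ℝ × Sp d × ℝ) × Sp d × ℝ) × Sp d =>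
      (inner ℝ z.2 z.1.2.2.1 : ℝ) := ContDiff.inner ℝ (by fun_prop) (by fun_prop)
    have e2 : ContDiff ℝ ∞ fun z : (Sp d × (ℝ × Sp d × ℝ) × Sp d × ℝ) × Sp d =>
      (inner ℝ z.1.2.1.2.1 z.2 : ℝ) := ContDiff.inner ℝ (by fun_prop) (by fun_prop)
    have e3 : ContDiff ℝ ∞ fun z : (Sp d × (ℝ × Sp d × ℝ) × Sp d × ℝ) × Sp d =>
      (inner ℝ z.1.2.1.2.1 z.1.2.2.1 : ℝ) := ContDiff.inner ℝ (by fun_prop) (by fun_prop)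
    have e4 : ContDiff ℝ ∞ fun z : (Sp d × (ℝ × Sp d × ℝ) × Sp d × ℝ) × Sp d =>
      ‖z.1.2.1.2.1‖ ^ 2 := ContDiff.norm_sq ℝ (by fun_prop)
    have e5 : ContDiff ℝ ∞ fun z : (Sp d × (ℝ × Sp d × ℝ) × Sp d × ℝ) × Sp d =>
      ‖z.2‖ ^ 2 := ContDiff.norm_sq ℝ (by fun_prop)
    fun_prop
  obtain ⟨C, hC0, hC⟩ := exists_nonstationary_bound (volume : Measure (Sp d)) hP₀c
    (isCompact_cube (d := d))
    (a := fun z : (Sp d × (ℝ × Sp d × ℝ) × Sp d × ℝ) × Sp d =>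
      amp z.1.1 (z.2 + z.1.2.2.2 • z.1.2.2.1) ^ 2 * amp z.1.1 z.2 ^ 2)
    (e := fun p => p.2.2.1)
    (((contDiff_amp.comp (f := fun z : (Sp d × (ℝ × Sp d × ℝ) × Sp d × ℝ) × Sp d =>
      (z.1.1, z.2 + z.1.2.2.2 • z.1.2.2.1)) (by fun_prop)).pow 2).mul
      ((contDiff_amp.comp (f := fun z : (Sp d × (ℝ × Sp d × ℝ) × Sp d × ℝ) × Sp d =>
      (z.1.1, z.2)) (by fun_prop)).pow 2)) hg (by fun_prop)
    (fun p ζ hζ => by simp only [amp_eq_zero _ hζ]; simp) hc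
    (by
      rintro ⟨w, z, e, r⟩ ⟨_, h2, h3, h4⟩ ζ hζ
      exact hdd z h2 e (by simpa using h3) r h4 ζ hζ) (d + 1)
  obtain ⟨C₀, hC₀, hC₀'⟩ := exists_norm_osc_le d
  set J : ℝ := ∫ u : Sp d, (1 + ‖u‖) ^ (-((d : ℝ) + 1)) with hJ
  have hJ0 : 0 ≤ J := integral_nonneg fun u => by positivity
  have hfr : (Module.finrank ℝ (Sp d) : ℝ) < (d : ℝ) + 1 := by simp
  refine ⟨2 ^ d * (C * J + C₀ ^ 2), by positivity, fun w y τ hw z hz => ?_⟩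
  obtain ⟨α, κ, m⟩ := z
  simp only
  have htriv : ‖osc w α κ m y τ‖ ^ 2 ≤ C₀ ^ 2 := by
    gcongr; exact hC₀' _ _ _ _ _ _ hw
  -- the main bound
  have hmain : τ ≠ 0 → ‖osc w α κ m y τ‖ ^ 2 ≤ C * J / |τ| ^ d := by
    intro hτ
    set ph : Sp d → ℝ := fun ζ => inner ℝ y ζ + τ * quart α κ m ζ with hph
    have hphs : ContDiff ℝ ∞ ph := contDiff_phase α κ m y τ
    have hamp : Continuous (amp w) := by
      exact (contDiff_amp (d := d)).continuous.comp (Continuous.prodMk_right w)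
    set f : Sp d → ℂ := fun ζ => ((amp w ζ ^ 2 : ℝ) : ℂ) * Complex.exp (Complex.I * (ph ζ : ℝ))
      with hf
    have hfc : Continuous f := by
      have := hphs.continuous
      simp only [hf]; fun_prop
    have hf0 : ∀ ζ ∉ cube d, f ζ = 0 := fun ζ hζ => by simp [hf, amp_eq_zero w hζ]
    have hosc : osc w α κ m y τ = ∫ ζ, f ζ := rfl
    have hFub : Integrable (fun p : Sp d × Sp d => (starRingEnd ℂ) (f p.1) * f (p.1 + p.2))
        (volume.prod volume) := by
      refine Continuous.integrable_of_hasCompactSupport (by fun_prop) ?_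
      refine HasCompactSupport.intro ((isCompact_cube (d := d)).prod
        (((isCompact_cube (d := d)).prod (isCompact_cube (d := d))).image
          (f := fun p : Sp d × Sp d => p.1 - p.2) (by fun_prop))) ?_
      rintro ⟨ζ, u⟩ h
      by_cases h1 : ζ ∈ cube d
      · by_cases h2 : ζ + u ∈ cube d
        · exact absurd ⟨h1, (ζ + u, ζ), ⟨h2, h1⟩, by simp⟩ h
        · simp [hf0 _ h2]
      · simp [hf0 _ h1]
    -- The squared modulus as an integrated autocorrelation. At fixed shift u the linear term of the
    -- phase contributes only a constant, which is why the final bound is uniform in y.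
    have hsq : ((‖osc w α κ m y τ‖ ^ 2 : ℝ) : ℂ) =
        ∫ u, ∫ ζ, (starRingEnd ℂ) (f ζ) * f (ζ + u) := by
      rw [integral_integral_swap (f := fun u ζ => (starRingEnd ℂ) (f ζ) * f (ζ + u)) hFub.swap]
      have : ∀ ζ, ∫ u, (starRingEnd ℂ) (f ζ) * f (ζ + u) = (starRingEnd ℂ) (f ζ) * ∫ u, f u := by
        intro ζ
        rw [integral_const_mul, integral_add_left_eq_self f ζ]
      simp only [this]
      rw [integral_mul_const, integral_conj, hosc, ← Complex.normSq_eq_norm_sq, mul_comm,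
        Complex.mul_conj]
    -- Nonstationary phase at frequency τ|u| in the direction of u. The order d + 1 is the least
    -- integer order integrable in u, and scaling then produces |τ|^{-d}. Shifts longer than `2 *
    -- rad d` separate the supports.
    have hJu : ∀ u, ‖∫ ζ, (starRingEnd ℂ) (f ζ) * f (ζ + u)‖ ≤
        C * (1 + |τ| * ‖u‖) ^ (-((d : ℝ) + 1)) := by
      intro u
      by_cases hu : ‖u‖ ≤ 2 * rad d
      · obtain ⟨e, he, hue⟩ : ∃ e : Sp d, ‖e‖ = 1 ∧ u = ‖u‖ • e := by
          by_cases hu0 : u = 0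
          · refine ⟨EuclideanSpace.single ⟨0, hd⟩ 1, by simp, by simp [hu0]⟩
          · refine ⟨‖u‖⁻¹ • u, by simp [norm_smul, hu0], ?_⟩
            rw [smul_smul, mul_inv_cancel₀ (norm_ne_zero_iff.2 hu0), one_smul]
        have hs : ContDiff ℝ ∞ fun ζ => ph (ζ + u) - ph ζ :=
          (hphs.comp (contDiff_id.add contDiff_const)).sub hphs
        have := hC (w, (α, κ, m), e, ‖u‖)
          ⟨by simpa using hw, hz, by simpa using he, norm_nonneg u, hu⟩
          (fun ζ => ph (ζ + u) - ph ζ) (τ * ‖u‖) hs (fun ζ => by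
            have h1 := hasDerivAt_phase α κ m y τ (ζ + u) e
            have h2 := hasDerivAt_phase α κ m y τ ζ e
            have h3 := h1.sub h2
            have h4 := dquart_add_smul_sub α κ m he ‖u‖ ζ
            rw [← hue] at h4
            refine (h3.congr_deriv ?_).congr_of_eventuallyEq
              (Filter.Eventually.of_forall fun h => ?_)
            · simp only
              linear_combination τ * h4
            · simp only [hph, Pi.sub_apply]
              rw [add_right_comm])
        have hint : ∀ ζ, (starRingEnd ℂ) (f ζ) * f (ζ + u) =
            ((amp w (ζ + ‖u‖ • e) ^ 2 * amp w ζ ^ 2 : ℝ) : ℂ) *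
              Complex.exp (Complex.I * ((ph (ζ + u) - ph ζ : ℝ) : ℂ)) := by
          intro ζ
          rw [← hue]
          simp only [hf, map_mul, Complex.conj_ofReal, ← Complex.exp_conj, Complex.conj_I]
          have : Complex.exp (Complex.I * ((ph (ζ + u) - ph ζ : ℝ) : ℂ)) =
              Complex.exp (-Complex.I * (ph ζ : ℝ)) *
              Complex.exp (Complex.I * (ph (ζ + u) : ℝ)) := by
            rw [← Complex.exp_add]; congr 1; push_cast; ring
          rw [this]; push_cast; ring
        simp only [hint]
        refine this.trans (le_of_eq ?_)
        rw [abs_mul, abs_norm, Real.rpow_neg (by positivity), div_eq_mul_inv]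
        congr 2
        rw [← Real.rpow_natCast]; push_cast; rfl
      · have : ∀ ζ, (starRingEnd ℂ) (f ζ) * f (ζ + u) = 0 := by
          intro ζ
          by_cases h1 : ζ ∈ cube d
          · by_cases h2 : ζ + u ∈ cube d
            · exfalso; apply hu
              have : u = (ζ + u) - ζ := by simp
              rw [this]
              refine (norm_sub_le _ _).trans ?_
              linarith [norm_le_of_mem_cube h1, norm_le_of_mem_cube h2]
            · simp [hf0 _ h2]
          · simp [hf0 _ h1]
        simp only [this, integral_zero, norm_zero]
        positivity
    have hτ0 : 0 < |τ| := abs_pos.2 hτ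
    have hI1 := Measure.integral_comp_smul (volume : Measure (Sp d))
      (fun u : Sp d => (1 + ‖u‖) ^ (-((d : ℝ) + 1))) |τ|
    have hI2 : Integrable (fun u : Sp d => (1 + ‖|τ| • u‖) ^ (-((d : ℝ) + 1))) volume :=
      (integrable_one_add_norm hfr).comp_smul hτ0.ne'
    simp only [norm_smul, Real.norm_eq_abs, abs_abs] at hI1 hI2
    calc ‖osc w α κ m y τ‖ ^ 2 = ‖((‖osc w α κ m y τ‖ ^ 2 : ℝ) : ℂ)‖ := by
          rw [Complex.norm_real, Real.norm_of_nonneg (by positivity)]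
      _ ≤ ∫ u : Sp d, C * (1 + |τ| * ‖u‖) ^ (-((d : ℝ) + 1)) := by
          rw [hsq]
          exact norm_integral_le_of_norm_le (hI2.const_mul C) (Filter.Eventually.of_forall hJu)
      _ = C * J / |τ| ^ d := by
          rw [integral_const_mul, hI1, finrank_euclideanSpace_fin, abs_of_nonneg (by positivity),
            smul_eq_mul]
          field_simp
          exact hJ.symm
  by_cases hτ : 1 ≤ |τ|
  · have hτ0 : τ ≠ 0 := fun h => by rw [h, abs_zero] at hτ; linarith
    refine (hmain hτ0).trans ?_
    rw [div_le_div_iff₀ (by positivity) (by positivity)]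
    have : (1 + |τ|) ^ d ≤ 2 ^ d * |τ| ^ d := by
      rw [← mul_pow]; gcongr; linarith
    calc C * J * (1 + |τ|) ^ d ≤ C * J * (2 ^ d * |τ| ^ d) := by gcongr
      _ ≤ 2 ^ d * (C * J + C₀ ^ 2) * |τ| ^ d := by
        have : 0 ≤ 2 ^ d * C₀ ^ 2 * |τ| ^ d := by positivity
        linarith
  · refine htriv.trans ?_
    rw [le_div_iff₀ (by positivity)]
    have : (1 + |τ|) ^ d ≤ 2 ^ d := by gcongr; linarith
    calc C₀ ^ 2 * (1 + |τ|) ^ d ≤ C₀ ^ 2 * 2 ^ d := by gcongr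
      _ ≤ _ := by
        have : 0 ≤ 2 ^ d * (C * J) := by positivity
        linarith

/-- The parameters for which the Hessian of the rescaled phase is close to a multiple of the
identity, or is dominated by the quartic term. -/
def nondeg (d : ℕ) (δ : ℝ) : Set (ℝ × Sp d × ℝ) :=
  ({1} ×ˢ Metric.closedBall 0 δ ×ˢ Set.Icc 0 δ) ∪
    (Set.Icc 0 δ ×ˢ Metric.sphere 0 1 ×ˢ Set.Icc 0 δ)

theorem isCompact_nondeg (δ : ℝ) : IsCompact (nondeg d δ) :=
  (isCompact_singleton.prod ((isCompact_closedBall _ _).prod isCompact_Icc)).union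
    (isCompact_Icc.prod ((isCompact_sphere _ _).prod isCompact_Icc))

/-- In the first family 2α = 2 dominates. In the second -4‖κ‖² - 8⟨κ, e⟩² does: its two terms have
the same sign, so no direction degenerates. The smallness of m keeps the cubic and quartic
corrections below 3/5. -/
theorem le_abs_ddquart {z : ℝ × Sp d × ℝ} (hz : z ∈ nondeg d (1 / (100 * rad d ^ 2))) {e : Sp d}
    (he : ‖e‖ = 1) {r : ℝ} (hr : r ∈ Set.Icc (0 : ℝ) (2 * rad d)) {ζ : Sp d} (hζ : ζ ∈ cube d) :
    1 ≤ |ddquart z.1 z.2.1 z.2.2 e r ζ| := by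
  obtain ⟨α, κ, m⟩ := z
  set R := rad d with hR
  have hR1 : 1 ≤ R := one_le_rad
  set δ := 1 / (100 * R ^ 2) with hδ
  have hδR : δ * R ^ 2 = 1 / 100 := by rw [hδ]; field_simp
  have hδ0 : 0 < δ := by positivity
  have hδR1 : δ * R ≤ 1 / 100 := by nlinarith
  have hδ1 : δ ≤ 1 / 100 := by nlinarith
  have hζR := norm_le_of_mem_cube hζ
  have hz1 : |inner ℝ ζ e| ≤ R := (abs_real_inner_le_norm _ _).trans (by rw [he, mul_one]; exact hζR)
  have hke : |inner ℝ κ e| ≤ ‖κ‖ := (abs_real_inner_le_norm _ _).trans (by rw [he, mul_one])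
  have hkz : |inner ℝ κ ζ| ≤ ‖κ‖ * R := (abs_real_inner_le_norm _ _).trans (by gcongr)
  obtain ⟨hr0, hr2⟩ := hr
  -- the perturbation terms
  have hpert : ∀ K : ℝ, ‖κ‖ ≤ K → K ≤ 1 → 0 ≤ m → m ≤ δ →
      |4 * m * (inner ℝ κ e * (2 * inner ℝ ζ e + r)
        + 2 * (inner ℝ κ ζ + inner ℝ κ e * inner ℝ ζ e + r * inner ℝ κ e))
        + 4 * m ^ 2 * (‖ζ‖ ^ 2 + (2 * inner ℝ ζ e + r) * (inner ℝ ζ e + r))| ≤ 1 / 2 + 1 / 10 := by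
    intro K hK hK1 hm0 hm1
    have hκ1 : ‖κ‖ ≤ 1 := hK.trans hK1
    have a1 : |2 * inner ℝ ζ e + r| ≤ 4 * R := by
      rw [abs_le] at hz1 ⊢; constructor <;> linarith
    have a2 : |inner ℝ ζ e + r| ≤ 3 * R := by
      rw [abs_le] at hz1 ⊢; constructor <;> linarith
    have a3 : |inner ℝ κ e * (2 * inner ℝ ζ e + r)| ≤ 1 * (4 * R) := by
      rw [abs_mul]; exact mul_le_mul (hke.trans hκ1) a1 (abs_nonneg _) (by norm_num)
    have a4 : |inner ℝ κ e * inner ℝ ζ e| ≤ 1 * R := by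
      rw [abs_mul]; exact mul_le_mul (hke.trans hκ1) hz1 (abs_nonneg _) (by norm_num)
    have a5 : |r * inner ℝ κ e| ≤ (2 * R) * 1 := by
      rw [abs_mul, abs_of_nonneg hr0]
      exact mul_le_mul hr2 (hke.trans hκ1) (abs_nonneg _) (by linarith)
    have a6 : |inner ℝ κ ζ| ≤ 1 * R := hkz.trans (by gcongr)
    have a7 : |inner ℝ κ e * (2 * inner ℝ ζ e + r)
        + 2 * (inner ℝ κ ζ + inner ℝ κ e * inner ℝ ζ e + r * inner ℝ κ e)| ≤ 12 * R := by
      rw [abs_le] at *; constructor <;> linarith [a3.1, a3.2, a4.1, a4.2, a5.1, a5.2, a6.1, a6.2]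
    have a8 : |(2 * inner ℝ ζ e + r) * (inner ℝ ζ e + r)| ≤ (4 * R) * (3 * R) := by
      rw [abs_mul]; exact mul_le_mul a1 a2 (abs_nonneg _) (by positivity)
    have a9 : |‖ζ‖ ^ 2 + (2 * inner ℝ ζ e + r) * (inner ℝ ζ e + r)| ≤ 13 * R ^ 2 := by
      have : ‖ζ‖ ^ 2 ≤ R ^ 2 := by gcongr
      have h0 := sq_nonneg ‖ζ‖
      rw [abs_le] at a8 ⊢; constructor <;> linarith [a8.1, a8.2]
    refine (abs_add_le _ _).trans ?_
    rw [abs_mul, abs_mul (4 * m ^ 2), abs_of_nonneg (by positivity : 0 ≤ 4 * m),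
      abs_of_nonneg (by positivity : 0 ≤ 4 * m ^ 2)]
    have b1 : 4 * m * |inner ℝ κ e * (2 * inner ℝ ζ e + r)
        + 2 * (inner ℝ κ ζ + inner ℝ κ e * inner ℝ ζ e + r * inner ℝ κ e)| ≤
        4 * δ * (12 * R) := by gcongr
    have b2 : 4 * m ^ 2 * |‖ζ‖ ^ 2 + (2 * inner ℝ ζ e + r) * (inner ℝ ζ e + r)| ≤
        4 * δ ^ 2 * (13 * R ^ 2) := by gcongr
    have b3 : 4 * δ ^ 2 * (13 * R ^ 2) = 52 * δ * (δ * R ^ 2) := by ring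
    rw [hδR] at b3
    linarith
  have hk2 : inner ℝ κ e ^ 2 ≤ ‖κ‖ ^ 2 := by
    rw [← sq_abs (inner ℝ κ e)]; gcongr
  have hk0 := sq_nonneg (inner ℝ κ e : ℝ)
  have hsplit : ddquart α κ m e r ζ = 2 * α - 4 * ‖κ‖ ^ 2 - 8 * inner ℝ κ e ^ 2
      - (4 * m * (inner ℝ κ e * (2 * inner ℝ ζ e + r)
        + 2 * (inner ℝ κ ζ + inner ℝ κ e * inner ℝ ζ e + r * inner ℝ κ e))
        + 4 * m ^ 2 * (‖ζ‖ ^ 2 + (2 * inner ℝ ζ e + r) * (inner ℝ ζ e + r))) := by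
    unfold ddquart; ring
  simp only
  rw [hsplit]
  rcases hz with ⟨h1, h2, h3⟩ | ⟨h1, h2, h3⟩
  · simp only [Set.mem_singleton_iff, Metric.mem_closedBall, dist_zero_right] at h1 h2
    have := abs_le.1 (hpert δ h2 (by linarith) h3.1 h3.2)
    have hκ : ‖κ‖ ^ 2 ≤ δ ^ 2 := by gcongr
    have : δ ^ 2 ≤ 1 / 10000 := by nlinarith
    rw [h1, le_abs]; left; linarith
  · simp only [mem_sphere_zero_iff_norm] at h2
    have := abs_le.1 (hpert 1 h2.le le_rfl h3.1 h3.2)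
    rw [h2, le_abs]; right; linarith [h1.2]

/-- Joint decay of the model integral for nondegenerate parameters. -/
theorem exists_osc_decay (hd : 0 < d) : ∃ C : ℝ, 0 < C ∧ ∀ (w y : Sp d) (τ : ℝ), ‖w‖ ≤ 1 →
    ∀ z ∈ nondeg d (1 / (100 * rad d ^ 2)), ‖osc w z.1 z.2.1 z.2.2 y τ‖ ≤
      C * (1 + ‖y‖ + |τ|) ^ (-((d : ℝ) / 2)) := by
  obtain ⟨C₁, hC₁, h1⟩ := exists_osc_sq_le_of_nondegenerate hd (isCompact_nondeg _) one_pos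
    (fun z hz e he r hr ζ hζ => le_abs_ddquart (d := d) hz he hr hζ)
  obtain ⟨A₀, hA₀, h2⟩ := exists_osc_nonstationary d 1
  obtain ⟨C₂, hC₂, h3⟩ := h2 d
  -- This constant compares 1 + |y| + |τ| with 1 + |y| off the cone A₀|τ| > |y|, and with 1 + |τ|
  -- inside it.
  set B := 1 + A₀ + A₀⁻¹ with hB
  have hB1 : 1 ≤ B := by rw [hB]; linarith [inv_pos.2 hA₀]
  refine ⟨(√C₁ + C₂) * B ^ ((d : ℝ) / 2), by positivity, fun w y τ hw z hz => ?_⟩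
  have hδ : 1 / (100 * rad d ^ 2) ≤ 1 := by
    rw [div_le_one (by have := one_le_rad (d := d); positivity)]
    nlinarith [one_le_rad (d := d)]
  have hz' : |z.1| ≤ 1 ∧ ‖z.2.1‖ ≤ 1 ∧ |z.2.2| ≤ 1 := by
    rcases hz with ⟨g1, g2, g3⟩ | ⟨g1, g2, g3⟩
    · simp only [Set.mem_singleton_iff, Metric.mem_closedBall, dist_zero_right] at g1 g2
      refine ⟨by rw [g1]; simp, g2.trans hδ, ?_⟩
      rw [abs_of_nonneg g3.1]; exact g3.2.trans hδ
    · simp only [mem_sphere_zero_iff_norm] at g2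
      refine ⟨?_, g2.le, ?_⟩
      · rw [abs_of_nonneg g1.1]; exact g1.2.trans hδ
      · rw [abs_of_nonneg g3.1]; exact g3.2.trans hδ
  -- reduce to decay in the larger of the two quantities
  have hred : ∀ (X : ℝ), 0 ≤ X → 1 + ‖y‖ + |τ| ≤ B * (1 + X) →
      (1 + X) ^ (-((d : ℝ) / 2)) ≤ B ^ ((d : ℝ) / 2) * (1 + ‖y‖ + |τ|) ^ (-((d : ℝ) / 2)) := by
    intro X hX hle
    rw [Real.rpow_neg (by positivity), Real.rpow_neg (by positivity), ← div_eq_mul_inv,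
      inv_le_comm₀ (by positivity) (by positivity), inv_div,
      div_le_iff₀ (by positivity), mul_comm, ← Real.mul_rpow (by positivity) (by positivity)]
    exact Real.rpow_le_rpow (by positivity) hle (by positivity)
  by_cases hy : A₀ * |τ| ≤ ‖y‖
  · have h4 := h3 w z.1 z.2.1 z.2.2 y τ hw hz'.1 hz'.2.1 hz'.2.2 hy
    have h5 : C₂ / (1 + ‖y‖) ^ d ≤ C₂ * (1 + ‖y‖) ^ (-((d : ℝ) / 2)) := by
      rw [div_eq_mul_inv, ← Real.rpow_natCast, ← Real.rpow_neg (by positivity)]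
      refine mul_le_mul_of_nonneg_left (Real.rpow_le_rpow_of_exponent_le (by linarith [norm_nonneg y])
        ?_) hC₂.le
      have : (0 : ℝ) ≤ d := by positivity
      linarith
    have h6 := hred ‖y‖ (norm_nonneg y) (by
      have : |τ| ≤ A₀⁻¹ * ‖y‖ := by rw [inv_mul_eq_div, le_div_iff₀ hA₀]; linarith
      rw [hB]
      have := inv_pos.2 hA₀
      nlinarith [norm_nonneg y])
    calc ‖osc w z.1 z.2.1 z.2.2 y τ‖ ≤ C₂ * (1 + ‖y‖) ^ (-((d : ℝ) / 2)) := h4.trans h5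
      _ ≤ C₂ * (B ^ ((d : ℝ) / 2) * (1 + ‖y‖ + |τ|) ^ (-((d : ℝ) / 2))) := by gcongr
      _ ≤ _ := by
        have : 0 ≤ √C₁ * (B ^ ((d : ℝ) / 2) * (1 + ‖y‖ + |τ|) ^ (-((d : ℝ) / 2))) := by positivity
        linarith
  · have h4 := Real.le_sqrt_of_sq_le (h1 w y τ hw z hz)
    have h5 : √(C₁ / (1 + |τ|) ^ d) = √C₁ * (1 + |τ|) ^ (-((d : ℝ) / 2)) := by
      rw [Real.sqrt_div hC₁.le, div_eq_mul_inv, Real.rpow_neg (by positivity), Real.sqrt_eq_rpow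
        ((1 + |τ|) ^ d), ← Real.rpow_natCast, ← Real.rpow_mul (by positivity)]
      congr 3; ring
    rw [h5] at h4
    have h6 := hred |τ| (abs_nonneg τ) (by
      rw [hB]
      have := inv_pos.2 hA₀
      nlinarith [abs_nonneg τ, not_le.1 hy])
    calc ‖osc w z.1 z.2.1 z.2.2 y τ‖ ≤ √C₁ * (1 + |τ|) ^ (-((d : ℝ) / 2)) := h4
      _ ≤ √C₁ * (B ^ ((d : ℝ) / 2) * (1 + ‖y‖ + |τ|) ^ (-((d : ℝ) / 2))) := by gcongr
      _ ≤ _ := by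
        have : 0 ≤ C₂ * (B ^ ((d : ℝ) / 2) * (1 + ‖y‖ + |τ|) ^ (-((d : ℝ) / 2))) := by positivity
        linarith

end MaxFun

/-! ### One-sided decay in the quartic regime -/

namespace MaxFun

variable {d : ℕ}

/-- In the quartic regime the phase is nonstationary in the `i`-th frequency variable on the side
of the hyperplane `x_i = 0` opposite to the group velocity. -/
theorem exists_osc_one_sided (d N : ℕ) : ∃ C : ℝ, 0 < C ∧ ∀ (w : Sp d) (α : ℝ) (κ : Sp d) (m : ℝ)
    (i : Fin d) (y : Sp d) (τ X : ℝ), ‖w‖ ≤ 1 → α ∈ Set.Icc 0 (1 / (100 * rad d ^ 2)) → ‖κ‖ = 1 →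
      0 < m → m ≤ 1 / (100 * rad d ^ 2) → m ≤ |κ i| → y i = X + τ * (2 * α - 4) * κ i / m →
      X * (τ * κ i) ≤ 0 → ‖osc w α κ m y τ‖ ≤ C / (1 + (|X| + |τ| * |κ i| / m)) ^ N := by
  set R := rad d with hR
  have hR1 : 1 ≤ R := one_le_rad
  set δ := 1 / (100 * R ^ 2) with hδ
  have hδR : δ * R ^ 2 = 1 / 100 := by rw [hδ]; field_simp
  have hδ0 : 0 < δ := by positivity
  have hδR1 : δ * R ≤ 1 / 100 := by nlinarith
  have hδ1 : δ ≤ 1 / 100 := by nlinarith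
  -- parameters: `w, ι, α, κ, m, p, e`
  set P₀ : Set (Sp d × ℝ × ℝ × Sp d × ℝ × ℝ × Sp d) := (Metric.closedBall (0 : Sp d) 1) ×ˢ
    (Set.Icc (-1 : ℝ) 1) ×ˢ (Set.Icc (0 : ℝ) δ) ×ˢ (Metric.sphere (0 : Sp d) 1) ×ˢ
    (Set.Icc (0 : ℝ) δ) ×ˢ (Set.Icc (0 : ℝ) 1) ×ˢ
    (Set.range fun i : Fin d => (EuclideanSpace.single i (1 : ℝ) : Sp d)) with hP₀
  have hP₀c : IsCompact P₀ := (isCompact_closedBall _ _).prod (isCompact_Icc.prod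
    (isCompact_Icc.prod ((isCompact_sphere _ _).prod (isCompact_Icc.prod (isCompact_Icc.prod
      (Set.finite_range _).isCompact)))))
  have hg : ContDiff ℝ ∞ fun z : (Sp d × ℝ × ℝ × Sp d × ℝ × ℝ × Sp d) × Sp d =>
      z.1.2.2.2.2.2.1 + (1 - z.1.2.2.2.2.2.1) * (1 + z.1.2.1 * (inner ℝ z.2 z.1.2.2.2.2.2.2 : ℝ)) *
        (4 * ‖z.1.2.2.2.1 + z.1.2.2.2.2.1 • z.2‖ ^ 2 - 2 * z.1.2.2.1) := by
    have e1 : ContDiff ℝ ∞ fun z : (Sp d × ℝ × ℝ × Sp d × ℝ × ℝ × Sp d) × Sp d =>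
      (inner ℝ z.2 z.1.2.2.2.2.2.2 : ℝ) := ContDiff.inner ℝ (by fun_prop) (by fun_prop)
    have e2 : ContDiff ℝ ∞ fun z : (Sp d × ℝ × ℝ × Sp d × ℝ × ℝ × Sp d) × Sp d =>
      ‖z.1.2.2.2.1 + z.1.2.2.2.2.1 • z.2‖ ^ 2 := ContDiff.norm_sq ℝ (by fun_prop)
    fun_prop
  obtain ⟨C, hC0, hC⟩ := exists_nonstationary_bound (volume : Measure (Sp d)) hP₀c
    (isCompact_cube (d := d))
    (a := fun z : (Sp d × ℝ × ℝ × Sp d × ℝ × ℝ × Sp d) × Sp d => amp z.1.1 z.2 ^ 2)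
    (e := fun p => p.2.2.2.2.2.2)
    ((contDiff_amp.comp (f := fun z : (Sp d × ℝ × ℝ × Sp d × ℝ × ℝ × Sp d) × Sp d =>
      (z.1.1, z.2)) (by fun_prop)).pow 2) hg (by fun_prop)
    (fun p ζ hζ => by simp only [amp_eq_zero _ hζ]; simp) (c := 1 / 6) (by norm_num)
    (by
      rintro ⟨w, ι, α, κ, m, p, e⟩ ⟨_, hι, hα, hκ, hm, hp, i, rfl⟩ ζ hζ
      simp only [mem_sphere_zero_iff_norm] at hι hα hκ hm hp
      have h1 : inner ℝ ζ (EuclideanSpace.single i (1 : ℝ)) = ζ i := by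
        simp [EuclideanSpace.inner_single_right]
      simp only [h1]
      have h2 : |ι * ζ i| ≤ 1 * (5 / 6) := by
        rw [abs_mul]; exact mul_le_mul (abs_le.2 hι) (hζ i) (abs_nonneg _) (by norm_num)
      -- In the application ι = 1/k_i, so this factor is ξ_i/k_i. It stays positive because |ι| ≤ 1
      -- and the cube has half-width 5/6 < 1; 1/6 is the difference.
      have h3 : 1 / 6 ≤ 1 + ι * ζ i := by have := (abs_le.1 h2).1; linarith
      have h4 : 1 - 1 / 100 ≤ ‖κ + m • ζ‖ := by
        have h5 : ‖κ‖ ≤ ‖κ + m • ζ‖ + ‖m • ζ‖ := by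
          simpa using norm_sub_le (κ + m • ζ) (m • ζ)
        have h6 : ‖m • ζ‖ ≤ δ * R := by
          rw [norm_smul, Real.norm_of_nonneg hm.1]
          exact mul_le_mul hm.2 (norm_le_of_mem_cube hζ) (norm_nonneg _) hδ0.le
        linarith
      have h7 : 1 ≤ 4 * ‖κ + m • ζ‖ ^ 2 - 2 * α := by nlinarith [hα.2]
      have h8 : 1 / 6 ≤ (1 + ι * ζ i) * (4 * ‖κ + m • ζ‖ ^ 2 - 2 * α) := by nlinarith
      rw [le_abs]; left
      rw [mul_assoc]
      nlinarith [hp.1, hp.2]) N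
  refine ⟨C, hC0, fun w α κ m i y τ X hw hα hκ hm hmδ hmκ hy hX => ?_⟩
  have hκi : κ i ≠ 0 := fun h => by rw [h, abs_zero] at hmκ; linarith
  -- The hypothesis X τ κ_i ≤ 0 gives X and -τκ_i a common sign, so the contributions of position
  -- and velocity to the derivative add instead of cancelling.
  obtain ⟨s, hs1, hs2, hs3⟩ : ∃ s : ℝ, |s| = 1 ∧ X = s * |X| ∧ -(τ * κ i) = s * |τ * κ i| := by
    rcases le_total 0 X with h | h
    · rcases le_or_gt (τ * κ i) 0 with h' | h'
      · exact ⟨1, by simp, by rw [abs_of_nonneg h, one_mul], by rw [abs_of_nonpos h', one_mul]⟩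
      · have : X = 0 := le_antisymm (by by_contra hc; nlinarith [not_le.1 hc]) h
        exact ⟨-1, by simp, by simp [this], by rw [abs_of_pos h']; ring⟩
    · rcases lt_or_ge (τ * κ i) 0 with h' | h'
      · have : X = 0 := le_antisymm h (by by_contra hc; nlinarith [not_le.1 hc])
        exact ⟨1, by simp, by simp [this], by rw [abs_of_neg h', one_mul]⟩
      · exact ⟨-1, by simp, by rw [abs_of_nonpos h]; ring, by rw [abs_of_nonneg h']; ring⟩
  set M := |τ| * |κ i| / m with hM
  have hM0 : 0 ≤ M := by positivity
  -- Divided by |X| + M, the derivative is a convex combination of 1 and the velocity factor. Its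
  -- weight p joins the compact parameter set, where both are at least 1/6.
  obtain ⟨p, hp, hp1, hp2⟩ : ∃ p ∈ Set.Icc (0 : ℝ) 1, (|X| + M) * p = |X| ∧
      (|X| + M) * (1 - p) = M := by
    by_cases h : |X| + M = 0
    · refine ⟨1, by simp, ?_, ?_⟩ <;> nlinarith [abs_nonneg X]
    · have h' : 0 < |X| + M := lt_of_le_of_ne (by positivity) (Ne.symm h)
      refine ⟨|X| / (|X| + M), ⟨by positivity, ?_⟩, by field_simp, by field_simp; ring⟩
      rw [div_le_one h']; linarith
  have hmem : ((w, m / κ i, α, κ, m, p, EuclideanSpace.single i (1 : ℝ)) :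
      Sp d × ℝ × ℝ × Sp d × ℝ × ℝ × Sp d) ∈ P₀ := by
    refine ⟨by simpa using hw, abs_le.1 ?_, hα, by simpa using hκ, ⟨hm.le, hmδ⟩, hp, i, rfl⟩
    rw [abs_div, abs_of_pos hm, div_le_one (abs_pos.2 hκi)]
    exact hmκ
  have := hC _ hmem (fun ζ => inner ℝ y ζ + τ * quart α κ m ζ) (s * (|X| + M))
    (contDiff_phase α κ m y τ) (fun ζ => by
      refine (hasDerivAt_phase α κ m y τ ζ (EuclideanSpace.single i (1 : ℝ))).congr_deriv ?_
      have e1 : ∀ v : Sp d, inner ℝ v (EuclideanSpace.single i (1 : ℝ)) = v i := fun v => by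
        simp [EuclideanSpace.inner_single_right]
      simp only [dquart, e1]
      have e2 : ‖κ + m • ζ‖ ^ 2 = 1 + 2 * m * inner ℝ κ ζ + m ^ 2 * ‖ζ‖ ^ 2 := by
        rw [norm_add_sq_real, real_inner_smul_right, norm_smul, hκ, mul_pow, Real.norm_eq_abs,
          sq_abs]
        ring
      rw [e2, hκ, hy]
      have e3 : s * M = -(τ * κ i) / m := by rw [hs3, hM, abs_mul]; ring
      have e4 : s * (|X| + M) * (p + (1 - p) * (1 + m / κ i * ζ i) *
          (4 * (1 + 2 * m * inner ℝ κ ζ + m ^ 2 * ‖ζ‖ ^ 2) - 2 * α)) =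
          s * |X| + s * M * ((1 + m / κ i * ζ i) *
          (4 * (1 + 2 * m * inner ℝ κ ζ + m ^ 2 * ‖ζ‖ ^ 2) - 2 * α)) := by
        linear_combination s * hp1 + s * ((1 + m / κ i * ζ i) *
          (4 * (1 + 2 * m * inner ℝ κ ζ + m ^ 2 * ‖ζ‖ ^ 2) - 2 * α)) * hp2
      rw [e4, e3, ← hs2]
      field_simp
      ring)
  rw [abs_mul, hs1, one_mul, abs_of_nonneg (by positivity : 0 ≤ |X| + M)] at this
  exact this

end MaxFun

/-! ### The propagation kernel: rescaling, waves, and bounds in each frequency regime -/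

namespace MaxFun

variable {d : ℕ}

/-- A lattice point as a vector. -/
def kvec (k : Fin d → ℤ) : Sp d := WithLp.toLp 2 fun j => (k j : ℝ)

theorem latNorm_eq (k : Fin d → ℤ) : latNorm k = ‖kvec k‖ := by
  rw [EuclideanSpace.norm_eq]
  simp [latNorm, kvec]

@[simp] theorem kvec_apply (k : Fin d → ℤ) (i : Fin d) : kvec k i = k i := rfl

/-- The dispersion relation. -/
noncomputable def disp (c : ℝ) (ξ : Sp d) : ℝ := c ^ 2 + ‖ξ‖ ^ 2 - ‖ξ‖ ^ 4 / c ^ 2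

theorem continuous_disp (c : ℝ) : Continuous (disp c : Sp d → ℝ) := by unfold disp; fun_prop

/-- The factor `b` with `∇ disp (k) = b k`. -/
noncomputable def gradFactor (c : ℝ) (k : Sp d) : ℝ := 2 - 4 * ‖k‖ ^ 2 / c ^ 2

/-- The frequency localized propagation kernel. -/
noncomputable def ker (w : Sp d) (c : ℝ) (k : Sp d) (t : ℝ) (x : Sp d) : ℂ :=
  ∫ ξ : Sp d, ((amp w (ξ - k) ^ 2 : ℝ) : ℂ) *
    Complex.exp (Complex.I * ((inner ℝ x ξ + t * disp c ξ : ℝ) : ℂ))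

/-- The exact expansion of the quartic symbol about k. The scale L is free and will be c or |k|,
whichever brings the coefficients of `quart` into a compact set. -/
theorem disp_add {c L : ℝ} (hc : 0 < c) (hL : 0 < L) (k ζ : Sp d) :
    disp c (ζ + k) = disp c k + gradFactor c k * inner ℝ k ζ +
      L ^ 2 / c ^ 2 * quart (c ^ 2 / L ^ 2) (L⁻¹ • k) L⁻¹ ζ := by
  have h1 : ‖ζ + k‖ ^ 2 = ‖ζ‖ ^ 2 + 2 * inner ℝ k ζ + ‖k‖ ^ 2 := by
    rw [norm_add_sq_real, real_inner_comm]
  have h4 : ∀ v : Sp d, ‖v‖ ^ 4 = (‖v‖ ^ 2) ^ 2 := fun v => by ring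
  unfold disp gradFactor quart
  rw [h4, h4, h1, real_inner_smul_left, norm_smul, Real.norm_eq_abs, mul_pow, sq_abs]
  field_simp
  ring

/-- The constant term of the expansion is a unimodular factor and the linear term a translation by
the group velocity; only the nonlinear part is left in `osc`. The left side does not involve L. -/
theorem norm_ker_eq (w : Sp d) {c L : ℝ} (hc : 0 < c) (hL : 0 < L) (k : Sp d) (t : ℝ) (x : Sp d) :
    ‖ker w c k t x‖ = ‖osc w (c ^ 2 / L ^ 2) (L⁻¹ • k) L⁻¹ (x + (t * gradFactor c k) • k)
      (L ^ 2 / c ^ 2 * t)‖ := by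
  have h1 : ker w c k t x = Complex.exp (Complex.I * ((inner ℝ x k + t * disp c k : ℝ) : ℂ)) *
      osc w (c ^ 2 / L ^ 2) (L⁻¹ • k) L⁻¹ (x + (t * gradFactor c k) • k) (L ^ 2 / c ^ 2 * t) := by
    unfold ker osc
    rw [← integral_const_mul, ← integral_add_right_eq_self _ k]
    refine integral_congr_ae (Filter.Eventually.of_forall fun ζ => ?_)
    simp only [add_sub_cancel_right]
    rw [mul_left_comm, ← Complex.exp_add]
    congr 2
    rw [← mul_add]
    congr 1
    norm_cast
    rw [disp_add hc hL, inner_add_right, inner_add_left, real_inner_smul_left]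
    ring
  rw [h1, norm_mul, mul_comm Complex.I, Complex.norm_exp_ofReal_mul_I, one_mul]

theorem continuous_amp (w : Sp d) : Continuous (amp w) :=
  (contDiff_amp (d := d)).continuous.comp (Continuous.prodMk_right w)

theorem hasCompactSupport_amp (w k : Sp d) : HasCompactSupport fun ξ => amp w (ξ - k) := by
  refine HasCompactSupport.intro (isCompact_cube.image (f := fun ζ : Sp d => ζ + k) (by fun_prop))
    fun ξ hξ => amp_eq_zero w fun h => hξ ⟨ξ - k, h, by simp⟩

/-- The localized plane wave at the space-time point `(t, x)`, as a function of frequency. -/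
noncomputable def waveFun (w : Sp d) (c : ℝ) (k : Sp d) (p : ℝ × Sp d) (ξ : Sp d) : ℂ :=
  (amp w (ξ - k) : ℂ) * Complex.exp (-(Complex.I * ((inner ℝ p.2 ξ + p.1 * disp c ξ : ℝ) : ℂ)))

theorem memLp_waveFun (w : Sp d) (c : ℝ) (k : Sp d) (p : ℝ × Sp d) :
    MemLp (waveFun w c k p) 2 volume := by
  have h1 := continuous_amp w
  have h2 := continuous_disp (d := d) c
  refine Continuous.memLp_of_hasCompactSupport ?_ ?_
  · unfold waveFun; fun_prop
  · exact ((hasCompactSupport_amp w k).comp_left (g := Complex.ofReal) (by simp)).mul_right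

/-- The localized plane waves as vectors of `L²`. -/
noncomputable def wave (w : Sp d) (c : ℝ) (k : Sp d) (p : ℝ × Sp d) :
    Lp ℂ 2 (volume : Measure (Sp d)) := (memLp_waveFun w c k p).toLp _

theorem inner_wave (w : Sp d) (c : ℝ) (k : Sp d) (p p' : ℝ × Sp d) :
    inner ℂ (wave w c k p) (wave w c k p') = ker w c k (p.1 - p'.1) (p.2 - p'.2) := by
  rw [L2.inner_def]
  refine integral_congr_ae ?_
  filter_upwards [(memLp_waveFun w c k p).coeFn_toLp, (memLp_waveFun w c k p').coeFn_toLp] with ξ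
    h1 h2
  unfold wave
  rw [h1, h2, RCLike.inner_apply]
  simp only [waveFun, map_mul, Complex.conj_ofReal, ← Complex.exp_conj, map_neg, Complex.conj_I]
  have : Complex.exp (Complex.I * ((inner ℝ (p.2 - p'.2) ξ + (p.1 - p'.1) * disp c ξ : ℝ) : ℂ)) =
      Complex.exp (-(Complex.I * ((inner ℝ p'.2 ξ + p'.1 * disp c ξ : ℝ) : ℂ))) *
      Complex.exp (-(-Complex.I * ((inner ℝ p.2 ξ + p.1 * disp c ξ : ℝ) : ℂ))) := by
    rw [← Complex.exp_add, inner_sub_left]; congr 1; push_cast; ring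
  rw [this]; push_cast; ring

theorem continuous_ker (w : Sp d) (c : ℝ) (k : Sp d) :
    Continuous fun p : ℝ × Sp d => ker w c k p.1 p.2 := by
  have h1 := continuous_amp w
  have h2 := continuous_disp (d := d) c
  refine continuous_of_dominated (bound := fun ξ => amp w (ξ - k) ^ 2) ?_ ?_ ?_ ?_
  · intro p; exact Continuous.aestronglyMeasurable (by fun_prop)
  · intro p
    refine Filter.Eventually.of_forall fun ξ => ?_
    rw [norm_mul, mul_comm Complex.I, Complex.norm_exp_ofReal_mul_I, mul_one, Complex.norm_real,
      Real.norm_of_nonneg (sq_nonneg _)]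
  · refine Continuous.integrable_of_hasCompactSupport (by fun_prop) ?_
    exact (hasCompactSupport_amp w k).comp_left (g := fun r : ℝ => r ^ 2) (by simp)
  · refine Filter.Eventually.of_forall fun ξ => ?_
    fun_prop

/-- The squared distance of two waves is expanded through the Gram kernel, so continuity in L² is
inherited from `continuous_ker`. -/
theorem continuous_wave (w : Sp d) (c : ℝ) (k : Sp d) : Continuous (wave w c k) := by
  rw [continuous_iff_continuousAt]
  intro p
  have hker := continuous_ker w c k
  have h0 : Filter.Tendsto (fun p' => ‖wave w c k p' - wave w c k p‖ ^ 2) (nhds p) (nhds 0) := by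
    have h1 : ∀ p', ‖wave w c k p' - wave w c k p‖ ^ 2 = (ker w c k 0 0).re -
        2 * (ker w c k (p'.1 - p.1) (p'.2 - p.2)).re + (ker w c k 0 0).re := fun p' => by
      rw [@norm_sub_sq ℂ, inner_wave]
      have : ∀ p, ‖wave w c k p‖ ^ 2 = (ker w c k 0 0).re := fun p => by
        rw [@norm_sq_eq_re_inner ℂ, inner_wave, sub_self, sub_self]; rfl
      rw [this, this]; rfl
    simp only [h1]
    have h2 : Continuous fun p' : ℝ × Sp d => (ker w c k 0 0).re -
        2 * (ker w c k (p'.1 - p.1) (p'.2 - p.2)).re + (ker w c k 0 0).re := by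
      have := hker.comp (f := fun p' : ℝ × Sp d => (p'.1 - p.1, p'.2 - p.2)) (by fun_prop)
      have h3 : Continuous fun p' : ℝ × Sp d => (ker w c k (p'.1 - p.1) (p'.2 - p.2)).re :=
        Complex.continuous_re.comp this
      fun_prop
    have h3 := h2.tendsto p
    simp only [sub_self] at h3
    convert h3 using 2
    ring
  have h1 : Filter.Tendsto (fun p' => ‖wave w c k p' - wave w c k p‖) (nhds p) (nhds 0) := by
    have := (Real.continuous_sqrt.tendsto 0).comp h0
    simpa [Function.comp_def, Real.sqrt_sq] using this
  exact tendsto_iff_norm_sub_tendsto_zero.2 h1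

theorem norm_wave_le (d : ℕ) : ∃ C : ℝ, 0 < C ∧ ∀ (w : Sp d) (c : ℝ) (k : Sp d) (p : ℝ × Sp d),
    0 < c → ‖w‖ ≤ 1 → ‖wave w c k p‖ ≤ C := by
  obtain ⟨C, hC, h⟩ := exists_norm_osc_le d
  refine ⟨√C, by positivity, fun w c k p hc hw => Real.le_sqrt_of_sq_le ?_⟩
  rw [@norm_sq_eq_re_inner ℂ, inner_wave]
  refine (Complex.re_le_norm _).trans ?_
  rw [norm_ker_eq w hc one_pos]
  exact h _ _ _ _ _ _ hw

theorem one_le_jap (r : ℝ) : 1 ≤ jap r := by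
  unfold jap
  rw [Real.one_le_sqrt]; linarith [sq_nonneg r]

theorem abs_le_jap (r : ℝ) : |r| ≤ jap r := by
  unfold jap
  refine Real.le_sqrt_of_sq_le ?_
  rw [sq_abs]; linarith

/-- The nondegeneracy parameter of the dispersive regimes. -/
noncomputable def delta (d : ℕ) : ℝ := 1 / (100 * rad d ^ 2)

theorem delta_pos : 0 < delta d := by
  have := one_le_rad (d := d); unfold delta; positivity

theorem delta_le_one : delta d ≤ 1 := by
  have := one_le_rad (d := d)
  unfold delta
  rw [div_le_one (by positivity)]
  nlinarith

theorem norm_le_of_add_smul (x k : Sp d) (r : ℝ) : ‖x‖ ≤ ‖x + r • k‖ + |r| * ‖k‖ := by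
  have := norm_sub_le (x + r • k) (r • k)
  rwa [add_sub_cancel_right, norm_smul, Real.norm_eq_abs] at this

/-- The dispersive kernel bound. -/
theorem exists_ker_dispersive (hd : 0 < d) : ∃ C : ℝ, 0 < C ∧ ∀ (w : Sp d) (c : ℝ) (k : Sp d)
    (t : ℝ) (x : Sp d), ‖w‖ ≤ 1 → 1 ≤ c →
    ((1 ≤ delta d * c ∧ ‖k‖ ≤ delta d * c) ∨ c ≤ delta d * ‖k‖) →
    ‖ker w c k t x‖ ≤ C * (1 + (jap ‖k‖)⁻¹ * ‖x‖) ^ (-((d : ℝ) / 2)) := by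
  obtain ⟨C, hC, h⟩ := exists_osc_decay (d := d) hd
  have hδ0 := delta_pos (d := d)
  have hδ1 := delta_le_one (d := d)
  refine ⟨C * 7 ^ ((d : ℝ) / 2), by positivity, fun w c k t x hw hc hk => ?_⟩
  have hc0 : 0 < c := by linarith
  have hj1 := one_le_jap ‖k‖
  have hj2 := abs_le_jap ‖k‖
  rw [abs_norm] at hj2
  -- L = c at low and L = |k| at high frequency. In both cases the drift `gradFactor c k` is
  -- controlled by the rate L²/c² at which the rescaled time runs, so translating back costs only
  -- the factor ⟨k⟩ in the spatial scale.
  obtain ⟨L, hL, hmem, hb⟩ : ∃ L : ℝ, 0 < L ∧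
      (c ^ 2 / L ^ 2, L⁻¹ • k, L⁻¹) ∈ nondeg d (delta d) ∧
      |gradFactor c k| ≤ 6 * (L ^ 2 / c ^ 2) := by
    rcases hk with ⟨h1, h2⟩ | h1
    · refine ⟨c, hc0, Or.inl ⟨by simp [hc0.ne'], ?_, ?_⟩, ?_⟩
      · rw [mem_closedBall_zero_iff, norm_smul, norm_inv, Real.norm_of_nonneg hc0.le,
          inv_mul_eq_div, div_le_iff₀ hc0]
        exact h2
      · refine ⟨by positivity, ?_⟩
        rw [inv_le_iff_one_le_mul₀ hc0]; exact h1
      · have : ‖k‖ ^ 2 ≤ c ^ 2 := by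
          gcongr; nlinarith
        have h3 : 4 * ‖k‖ ^ 2 / c ^ 2 ≤ 4 := by
          rw [div_le_iff₀ (by positivity)]; linarith
        have h4 : 0 ≤ 4 * ‖k‖ ^ 2 / c ^ 2 := by positivity
        rw [div_self (by positivity), gradFactor, abs_le]
        constructor <;> linarith
    · have hk0 : 0 < ‖k‖ := by
        by_contra hneg; nlinarith [norm_nonneg k]
      have hck : c ≤ ‖k‖ := by nlinarith
      refine ⟨‖k‖, hk0, Or.inr ⟨⟨by positivity, ?_⟩, ?_, by positivity, ?_⟩, ?_⟩
      · rw [div_le_iff₀ (by positivity)]; nlinarith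
      · simp [norm_smul, hk0.ne']
      · rw [inv_le_iff_one_le_mul₀ hk0]; linarith
      · have h2 : 1 ≤ ‖k‖ ^ 2 / c ^ 2 := by
          rw [one_le_div (by positivity)]; gcongr
        have h3 : 4 * ‖k‖ ^ 2 / c ^ 2 = 4 * (‖k‖ ^ 2 / c ^ 2) := by ring
        rw [gradFactor, h3, abs_le]
        constructor <;> linarith
  have hm := h w (x + (t * gradFactor c k) • k) (L ^ 2 / c ^ 2 * t) hw _ hmem
  rw [norm_ker_eq w hc0 hL]
  refine hm.trans ?_
  set y := x + (t * gradFactor c k) • k with hy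
  set τ := L ^ 2 / c ^ 2 * t with hτ
  have hx : ‖x‖ ≤ ‖y‖ + 6 * |τ| * ‖k‖ := by
    refine (norm_le_of_add_smul x k (t * gradFactor c k)).trans ?_
    gcongr
    rw [abs_mul, hτ, abs_mul, abs_of_nonneg (by positivity : 0 ≤ L ^ 2 / c ^ 2)]
    nlinarith [abs_nonneg t]
  have hle : 1 + (jap ‖k‖)⁻¹ * ‖x‖ ≤ 7 * (1 + ‖y‖ + |τ|) := by
    have : (jap ‖k‖)⁻¹ * ‖x‖ ≤ ‖y‖ + 6 * |τ| := by
      rw [inv_mul_eq_div, div_le_iff₀ (by linarith)]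
      nlinarith [norm_nonneg y, abs_nonneg τ]
    linarith [norm_nonneg y, abs_nonneg τ]
  rw [mul_assoc]
  gcongr
  rw [Real.rpow_neg (by positivity), Real.rpow_neg (by positivity), ← div_eq_mul_inv,
    inv_le_comm₀ (by positivity) (by positivity), inv_div, div_le_iff₀ (by positivity),
    ← Real.mul_rpow (by positivity) (by positivity), mul_comm (1 + ‖y‖ + |τ|)]
  exact Real.rpow_le_rpow (by positivity) hle (by positivity)

theorem abs_gradFactor_le {c A : ℝ} (hc : 0 < c) {k : Sp d} (hk : ‖k‖ ≤ A * c) :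
    |gradFactor c k| ≤ 2 + 4 * A ^ 2 := by
  have h1 : 4 * ‖k‖ ^ 2 / c ^ 2 ≤ 4 * A ^ 2 := by
    rw [div_le_iff₀ (by positivity)]
    have : ‖k‖ ^ 2 ≤ (A * c) ^ 2 := by gcongr
    nlinarith
  have h2 : 0 ≤ 4 * ‖k‖ ^ 2 / c ^ 2 := by positivity
  rw [gradFactor, abs_le]; constructor <;> linarith

/-- The kernel in the regime `|k| ≤ A c`, in terms of the model integral. -/
theorem exists_ker_nonstationary (d : ℕ) (A : ℝ) : ∃ A₀ : ℝ, 0 < A₀ ∧ ∀ N : ℕ,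
    ∃ C : ℝ, 0 < C ∧ ∀ (w : Sp d) (c : ℝ) (k : Sp d) (t : ℝ) (x : Sp d), ‖w‖ ≤ 1 → 1 ≤ c →
      ‖k‖ ≤ A * c → A₀ * |t| ≤ ‖x + (t * gradFactor c k) • k‖ →
      ‖ker w c k t x‖ ≤ C / (1 + ‖x + (t * gradFactor c k) • k‖) ^ N := by
  obtain ⟨A₀, hA₀, h⟩ := exists_osc_nonstationary d A
  refine ⟨A₀, hA₀, fun N => ?_⟩
  obtain ⟨C, hC, h1⟩ := h N
  refine ⟨C, hC, fun w c k t x hw hc hk hx => ?_⟩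
  have hc0 : 0 < c := by linarith
  rw [norm_ker_eq w hc0 hc0]
  refine h1 _ _ _ _ _ _ hw ?_ ?_ ?_ ?_
  · rw [div_self (by positivity), abs_one]
  · rw [norm_smul, norm_inv, Real.norm_of_nonneg hc0.le, inv_mul_eq_div, div_le_iff₀ hc0]
    exact hk
  · rw [abs_inv, abs_of_pos hc0]; exact inv_le_one_of_one_le₀ hc
  · rwa [div_self (by positivity), one_mul]

/-- Finite speed of propagation on time intervals of length `M c²`, for `|k| ≤ A c`. -/
theorem exists_ker_speed (d : ℕ) (A M : ℝ) (hM : 0 ≤ M) : ∃ C : ℝ, 0 < C ∧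
    ∀ (w : Sp d) (c : ℝ) (k : Sp d) (t : ℝ) (x : Sp d), ‖w‖ ≤ 1 → 1 ≤ c → ‖k‖ ≤ A * c →
      |t| ≤ M * c ^ 2 →
      ‖ker w c k t x‖ ≤ C * (1 + (c ^ 2 * jap ‖k‖)⁻¹ * ‖x‖) ^ (-(2 : ℝ)) := by
  obtain ⟨A₀, hA₀, h⟩ := exists_ker_nonstationary d A
  obtain ⟨C₁, hC₁, h1⟩ := h 2
  obtain ⟨C₀, hC₀, h0⟩ := exists_norm_osc_le d
  set G := 2 + 4 * A ^ 2 with hG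
  set B := 1 + A₀ * M + M * G with hB
  have hB1 : 1 ≤ B := by have : 0 ≤ A₀ * M + M * G := by positivity
                         rw [hB]; linarith
  refine ⟨(C₁ + C₀) * B ^ 2, by positivity, fun w c k t x hw hc hk ht => ?_⟩
  have hc0 : 0 < c := by linarith
  have hc2 : 1 ≤ c ^ 2 := one_le_pow₀ hc
  have hj1 := one_le_jap ‖k‖
  have hj2 := abs_le_jap ‖k‖
  rw [abs_norm] at hj2
  have hb := abs_gradFactor_le hc0 hk
  set y := x + (t * gradFactor c k) • k with hy
  set j := jap ‖k‖ with hj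
  have hcj : 1 ≤ c ^ 2 * j := one_le_mul_of_one_le_of_one_le hc2 hj1
  have hx : ‖x‖ ≤ ‖y‖ + M * G * (c ^ 2 * j) := by
    refine (norm_le_of_add_smul x k (t * gradFactor c k)).trans ?_
    refine add_le_add le_rfl ?_
    rw [abs_mul]
    calc |t| * |gradFactor c k| * ‖k‖ ≤ (M * c ^ 2) * G * j := by gcongr
      _ = _ := by ring
  have hconv : ∀ z : ℝ, 0 ≤ z → z ^ (-(2 : ℝ)) = (z ^ 2)⁻¹ := fun z hz => by
    rw [Real.rpow_neg hz]; norm_cast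
  rw [hconv _ (by positivity), ← div_eq_mul_inv]
  by_cases hyt : A₀ * |t| ≤ ‖y‖
  · refine (h1 w c k t x hw hc hk hyt).trans ?_
    rw [div_le_div_iff₀ (by positivity) (by positivity)]
    have : 1 + (c ^ 2 * j)⁻¹ * ‖x‖ ≤ B * (1 + ‖y‖) := by
      have h2 : (c ^ 2 * j)⁻¹ * ‖x‖ ≤ ‖y‖ + M * G := by
        rw [inv_mul_eq_div, div_le_iff₀ (by linarith)]
        nlinarith [norm_nonneg y]
      have h3 : 0 ≤ A₀ * M := by positivity
      have h4 : 0 ≤ M * G := by positivity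
      rw [hB]
      nlinarith [norm_nonneg y]
    calc C₁ * (1 + (c ^ 2 * j)⁻¹ * ‖x‖) ^ 2 ≤ C₁ * (B * (1 + ‖y‖)) ^ 2 := by gcongr
      _ = C₁ * B ^ 2 * (1 + ‖y‖) ^ 2 := by ring
      _ ≤ (C₁ + C₀) * B ^ 2 * (1 + ‖y‖) ^ 2 := by gcongr; linarith
  -- Inside the cone |y| is at most a multiple of c², hence |x| is at most a multiple of c²⟨k⟩.
  -- There the weight is bounded and the trivial estimate suffices.
  · have h2 : ‖ker w c k t x‖ ≤ C₀ := by
      rw [norm_ker_eq w hc0 one_pos]; exact h0 _ _ _ _ _ _ hw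
    refine h2.trans ?_
    rw [le_div_iff₀ (by positivity)]
    have : 1 + (c ^ 2 * j)⁻¹ * ‖x‖ ≤ B := by
      have h3 : (c ^ 2 * j)⁻¹ * ‖x‖ ≤ A₀ * M + M * G := by
        rw [inv_mul_eq_div, div_le_iff₀ (by linarith)]
        have h5 : ‖y‖ ≤ A₀ * M * (c ^ 2 * j) := by
          calc ‖y‖ ≤ A₀ * |t| := (not_le.1 hyt).le
            _ ≤ A₀ * (M * c ^ 2) := by gcongr
            _ = A₀ * M * (c ^ 2 * 1) := by ring
            _ ≤ _ := by gcongr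
        linarith
      rw [hB]; linarith
    calc C₀ * (1 + (c ^ 2 * j)⁻¹ * ‖x‖) ^ 2 ≤ C₀ * B ^ 2 := by gcongr
      _ ≤ (C₁ + C₀) * B ^ 2 := by gcongr; linarith

/-- Rapid decay beyond distance `O(c³)` for `|k| ≤ A c` and `|t| ≤ M c²`. -/
theorem exists_ker_far (d : ℕ) (A M : ℝ) (hA : 0 ≤ A) (hM : 0 ≤ M) : ∃ C₁ : ℝ, 0 < C₁ ∧ ∀ N : ℕ,
    ∃ C : ℝ, 0 < C ∧ ∀ (w : Sp d) (c : ℝ) (k : Sp d) (t : ℝ) (x : Sp d), ‖w‖ ≤ 1 → 1 ≤ c →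
      ‖k‖ ≤ A * c → |t| ≤ M * c ^ 2 → C₁ * c ^ 3 ≤ ‖x‖ →
      ‖ker w c k t x‖ ≤ C / (1 + ‖x‖) ^ N := by
  obtain ⟨A₀, hA₀, h⟩ := exists_ker_nonstationary d A
  set G := 2 + 4 * A ^ 2 with hG
  -- Beyond this multiple of c³ the drift is at most |x|/2, so |y| ≥ |x|/2, and A₀|t| ≤ |y| holds
  -- for all admissible times.
  refine ⟨2 * (M * G * A + A₀ * M) + 1, by positivity, fun N => ?_⟩
  obtain ⟨C, hC, h1⟩ := h N
  refine ⟨C * 2 ^ N, by positivity, fun w c k t x hw hc hk ht hx => ?_⟩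
  have hc0 : 0 < c := by linarith
  have hb := abs_gradFactor_le hc0 hk
  set y := x + (t * gradFactor c k) • k with hy
  have hxy : ‖x‖ ≤ ‖y‖ + M * G * A * c ^ 3 := by
    refine (norm_le_of_add_smul x k (t * gradFactor c k)).trans ?_
    refine add_le_add le_rfl ?_
    rw [abs_mul]
    calc |t| * |gradFactor c k| * ‖k‖ ≤ (M * c ^ 2) * G * (A * c) := by gcongr
      _ = _ := by ring
  have hc3 : c ^ 2 ≤ c ^ 3 := pow_le_pow_right₀ hc (by norm_num)
  have hc30 : 0 < c ^ 3 := by positivity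
  have h2 : 2 * (M * G * A * c ^ 3) ≤ ‖x‖ := by
    have : 0 ≤ A₀ * M * c ^ 3 := by positivity
    nlinarith
  have h3 : A₀ * |t| ≤ ‖y‖ := by
    have h4 : A₀ * |t| ≤ A₀ * M * c ^ 3 := by
      calc A₀ * |t| ≤ A₀ * (M * c ^ 2) := by gcongr
        _ = A₀ * M * c ^ 2 := by ring
        _ ≤ _ := by gcongr
    have : 0 ≤ M * G * A * c ^ 3 := by positivity
    nlinarith
  refine (h1 w c k t x hw hc hk h3).trans ?_
  rw [div_le_div_iff₀ (by positivity) (by positivity), mul_assoc, ← mul_pow]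
  gcongr
  nlinarith [norm_nonneg y]

/-- The kernel in the quartic regime, on the side opposite to the group velocity. -/
theorem exists_ker_one_sided (d N : ℕ) : ∃ C : ℝ, 0 < C ∧ ∀ (w : Sp d) (c : ℝ) (k : Fin d → ℤ)
    (i : Fin d) (t : ℝ) (x : Sp d), ‖w‖ ≤ 1 → 1 ≤ c → c ≤ delta d * ‖kvec k‖ → k i ≠ 0 →
      x i * (t * k i) ≤ 0 →
      ‖ker w c (kvec k) t x‖ ≤ C / ((1 + (|x i| + |t| * (‖kvec k‖ ^ 2 * |(k i : ℝ)| / c ^ 2))) ^ N *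
        (1 + ‖x + (t * gradFactor c (kvec k)) • kvec k‖) ^ N) := by
  obtain ⟨A₀, hA₀, h⟩ := exists_osc_nonstationary d 1
  obtain ⟨C₁, hC₁, h1⟩ := h (2 * N)
  obtain ⟨C₂, hC₂, h2⟩ := exists_osc_one_sided d (2 * N)
  have hδ0 := delta_pos (d := d)
  have hδ1 := delta_le_one (d := d)
  refine ⟨C₁ + C₂ + C₂ * (1 + A₀) ^ N, by positivity, fun w c k i t x hw hc hk hki hx => ?_⟩
  have hc0 : 0 < c := by linarith
  set L := ‖kvec k‖ with hL
  have hL0 : 0 < L := by by_contra hneg; nlinarith [norm_nonneg (kvec k)]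
  have hcL : c ≤ L := by nlinarith
  rw [norm_ker_eq w hc0 hL0]
  set y := x + (t * gradFactor c (kvec k)) • kvec k with hy
  set τ := L ^ 2 / c ^ 2 * t with hτ
  have hα : c ^ 2 / L ^ 2 ∈ Set.Icc 0 (delta d) := by
    refine ⟨by positivity, ?_⟩
    rw [div_le_iff₀ (by positivity)]; nlinarith
  have hκ : ‖L⁻¹ • kvec k‖ = 1 := by
    rw [norm_smul, norm_inv, Real.norm_of_nonneg hL0.le, ← hL, inv_mul_cancel₀ hL0.ne']
  have hm : L⁻¹ ≤ delta d := by rw [inv_le_iff_one_le_mul₀ hL0]; linarith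
  have hki1 : 1 ≤ |(k i : ℝ)| := by
    rw [← Int.cast_abs]; exact_mod_cast Int.one_le_abs hki
  have e1 : (L⁻¹ • kvec k) i = L⁻¹ * k i := by simp
  have e2 : |L⁻¹ * (k i : ℝ)| = L⁻¹ * |(k i : ℝ)| := by rw [abs_mul, abs_of_pos (by positivity)]
  set S := |x i| + |t| * (L ^ 2 * |(k i : ℝ)| / c ^ 2) with hS
  have hS0 : 0 ≤ S := by positivity
  have hSτ : |x i| + |τ| * |(L⁻¹ • kvec k) i| / L⁻¹ = S := by
    rw [e1, e2, hτ, abs_mul, abs_of_nonneg (by positivity : 0 ≤ L ^ 2 / c ^ 2), hS]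
    field_simp
  have b2 := h2 w (c ^ 2 / L ^ 2) (L⁻¹ • kvec k) L⁻¹ i y τ (x i) hw hα hκ (by positivity) hm
    (by rw [e1, e2]; nlinarith [inv_pos.2 hL0])
    (by
      rw [e1, hy, hτ, gradFactor, ← hL]
      simp only [PiLp.add_apply, PiLp.smul_apply, kvec_apply, smul_eq_mul]
      field_simp)
    (by
      rw [e1, hτ]
      have : x i * (L ^ 2 / c ^ 2 * t * (L⁻¹ * k i)) = L ^ 2 / c ^ 2 * L⁻¹ * (x i * (t * k i)) := by
        ring
      rw [this]
      exact mul_nonpos_of_nonneg_of_nonpos (by positivity) hx)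
  rw [hSτ] at b2
  set O := ‖osc w (c ^ 2 / L ^ 2) (L⁻¹ • kvec k) L⁻¹ y τ‖ with hO
  have hO0 : 0 ≤ O := norm_nonneg _
  rw [le_div_iff₀ (by positivity)]
  by_cases hyt : A₀ * |τ| ≤ ‖y‖
  · have b1 := h1 w (c ^ 2 / L ^ 2) (L⁻¹ • kvec k) L⁻¹ y τ hw
      (by rw [abs_of_nonneg hα.1]; exact hα.2.trans hδ1) hκ.le
      (by rw [abs_of_nonneg (by positivity)]; exact hm.trans hδ1) hyt
    rw [le_div_iff₀ (by positivity), pow_mul'] at b1 b2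
    set a := (1 + ‖y‖) ^ N
    set b := (1 + S) ^ N
    have ha0 : 0 ≤ a := by positivity
    have hb0 : 0 ≤ b := by positivity
    -- The geometric mean of the decay in |y| and the decay in S. This is why both inputs are taken
    -- at order 2N.
    have hle : (O * (b * a)) ^ 2 ≤ (C₁ + C₂) ^ 2 := by
      calc (O * (b * a)) ^ 2 = (O * a ^ 2) * (O * b ^ 2) := by ring
        _ ≤ C₁ * C₂ := by gcongr
        _ ≤ (C₁ + C₂) ^ 2 := by nlinarith
    have := (pow_le_pow_iff_left₀ (by positivity) (by positivity) two_ne_zero).1 hle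
    have h3 : 0 ≤ C₂ * (1 + A₀) ^ N := by positivity
    linarith
  · rw [le_div_iff₀ (by positivity), two_mul, pow_add] at b2
    -- Inside the cone |y| < A₀|τ| the decay in S serves for both factors. The comparison |τ| ≤ S
    -- uses |k_i| ≥ 1.
    have hτS : |τ| ≤ S := by
      rw [hτ, abs_mul, abs_of_nonneg (by positivity : 0 ≤ L ^ 2 / c ^ 2), hS]
      have : L ^ 2 / c ^ 2 * |t| * 1 ≤ L ^ 2 / c ^ 2 * |t| * |(k i : ℝ)| := by gcongr
      have h4 : |t| * (L ^ 2 * |(k i : ℝ)| / c ^ 2) = L ^ 2 / c ^ 2 * |t| * |(k i : ℝ)| := by ring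
      rw [h4]
      linarith [abs_nonneg (x i)]
    have hyS : 1 + ‖y‖ ≤ (1 + A₀) * (1 + S) := by
      nlinarith [not_le.1 hyt]
    calc O * ((1 + S) ^ N * (1 + ‖y‖) ^ N)
        ≤ O * ((1 + S) ^ N * ((1 + A₀) * (1 + S)) ^ N) := by gcongr
      _ = (O * ((1 + S) ^ N * (1 + S) ^ N)) * (1 + A₀) ^ N := by rw [mul_pow]; ring
      _ ≤ C₂ * (1 + A₀) ^ N := by gcongr
      _ ≤ _ := by linarith

end MaxFun

/-! ### Minkowski's integral inequality and weighted square functions -/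

namespace MaxFun

section Minkowski

variable {α β : Type*} [MeasurableSpace α] [MeasurableSpace β] {ν : Measure α} {μ : Measure β}

/-- Minkowski's integral inequality. -/
theorem eLpNorm_lintegral_le [SFinite ν] [SFinite μ] {q : ℝ≥0∞} (hq : 1 ≤ q) {U : α → β → ℝ≥0∞}
    (hU : Measurable (Function.uncurry U)) {g : α → ℝ≥0∞} (hg : Measurable g)
    (h : ∀ᵐ s ∂ν, eLpNorm (U s) q μ ≤ g s) :
    eLpNorm (fun r => ∫⁻ s, U s r ∂ν) q μ ≤ ∫⁻ s, g s ∂ν := by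
  rcases eq_or_ne q ⊤ with rfl | hqt
  · have h1 : ∀ᵐ r ∂μ, ∀ᵐ s ∂ν, U s r ≤ g s := by
      rw [← Measure.ae_ae_comm]
      · filter_upwards [h] with s hs
        have := ae_le_eLpNormEssSup (f := U s) (μ := μ)
        filter_upwards [this] with r hr
        simp only [enorm_eq_self] at hr
        exact hr.trans (by rwa [eLpNorm_exponent_top] at hs)
      · exact measurableSet_le hU (hg.comp measurable_fst)
    rw [eLpNorm_exponent_top]
    refine eLpNormEssSup_le_of_ae_enorm_bound ?_
    filter_upwards [h1] with r hr
    exact lintegral_mono_ae hr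
  by_cases hS : ∫⁻ s, g s ∂ν = ⊤
  · rw [hS]; exact le_top
  have hq0 : q ≠ 0 := (zero_lt_one.trans_le hq).ne'
  set p := q.toReal with hp
  have hp1 : 1 ≤ p := by
    have := ENNReal.toReal_mono hqt hq
    simpa using this
  have hp0 : 0 < p := by linarith
  have hgt : ∀ᵐ s ∂ν, g s < ⊤ := ae_lt_top hg hS
  have hn : ∀ f : β → ℝ≥0∞, eLpNorm f q μ = (∫⁻ r, f r ^ p ∂μ) ^ (1 / p) := fun f => by
    rw [eLpNorm_eq_lintegral_rpow_enorm_toReal hq0 hqt, ← hp]; simp only [enorm_eq_self]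
  have hUr : ∀ r, Measurable fun s => U s r := fun r => hU.comp measurable_prodMk_right
  have hUs : ∀ s, Measurable fun r => U s r := fun s => hU.comp measurable_prodMk_left
  have h' : ∀ᵐ s ∂ν, ∫⁻ r, U s r ^ p ∂μ ≤ g s ^ p := by
    filter_upwards [h] with s hs
    rw [hn, one_div] at hs
    exact (ENNReal.rpow_inv_le_iff hp0).1 hs
  -- Negative powers of g appear below; where g vanishes, U vanishes almost everywhere, so these
  -- points do not contribute.
  have hz : ∀ᵐ r ∂μ, ∀ᵐ s ∂ν, g s = 0 → U s r = 0 := by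
    rw [← Measure.ae_ae_comm]
    · filter_upwards [h'] with s hs
      by_cases hgs : g s = 0
      · rw [hgs, ENNReal.zero_rpow_of_pos hp0, nonpos_iff_eq_zero,
          lintegral_eq_zero_iff ((hUs s).pow_const p)] at hs
        filter_upwards [hs] with r hr _
        simpa [hp0, hp0.not_gt] using hr
      · exact Filter.Eventually.of_forall fun r hr => absurd hr hgs
    · have : {x : α × β | g x.1 = 0 → U x.1 x.2 = 0} =
          {x | g x.1 = 0}ᶜ ∪ {x | Function.uncurry U x = 0} := by
        ext x; simp [imp_iff_not_or, Function.uncurry]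
      rw [this]
      exact ((hg.comp measurable_fst) (measurableSet_singleton 0)).compl.union
        (hU (measurableSet_singleton 0))
  rw [hn, one_div, ENNReal.rpow_inv_le_iff hp0]
  set S := ∫⁻ s, g s ∂ν with hSd
  -- Hölder's inequality in s for the splitting U = g^{1-1/p} (g^{1-p} U^p)^{1/p}.
  have hj : ∀ᵐ r ∂μ, (∫⁻ s, U s r ∂ν) ^ p ≤ S ^ (p - 1) * ∫⁻ s, g s ^ (1 - p) * U s r ^ p ∂ν := by
    filter_upwards [hz] with r hr
    have h1 : ∫⁻ s, U s r ∂ν ≤ ∫⁻ s, g s ^ (1 - 1 / p) * (g s ^ (1 - p) * U s r ^ p) ^ (1 / p) ∂ν := by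
      refine lintegral_mono_ae ?_
      filter_upwards [hr, hgt] with s h1 h2
      by_cases hgs : g s = 0
      · rw [h1 hgs]; exact zero_le
      · rw [ENNReal.mul_rpow_of_nonneg _ _ (by positivity), ← ENNReal.rpow_mul, ← ENNReal.rpow_mul,
          ← mul_assoc, ← ENNReal.rpow_add _ _ hgs h2.ne]
        have e1 : 1 - 1 / p + (1 - p) * (1 / p) = 0 := by field_simp; ring
        have e2 : p * (1 / p) = 1 := by field_simp
        rw [e1, e2]; simp
    have h2 := ENNReal.lintegral_mul_norm_pow_le (μ := ν) (f := g)
      (g := fun s => g s ^ (1 - p) * U s r ^ p) hg.aemeasurable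
      (((hg.pow_const _).mul ((hUr r).pow_const _)).aemeasurable) (p := 1 - 1 / p) (q := 1 / p)
      (by rw [sub_nonneg, div_le_one hp0]; exact hp1) (by positivity) (by ring)
    refine (ENNReal.rpow_le_rpow (h1.trans h2) hp0.le).trans (le_of_eq ?_)
    rw [ENNReal.mul_rpow_of_nonneg _ _ hp0.le, ← ENNReal.rpow_mul, ← ENNReal.rpow_mul]
    have e1 : (1 - 1 / p) * p = p - 1 := by field_simp
    have e2 : 1 / p * p = 1 := by field_simp
    rw [e1, e2, ENNReal.rpow_one]
  have hgm : Measurable fun x : α × β => g x.1 := hg.comp measurable_fst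
  have hm2 : Measurable fun x : α × β => U x.1 x.2 := hU
  calc ∫⁻ r, (∫⁻ s, U s r ∂ν) ^ p ∂μ
      ≤ ∫⁻ r, S ^ (p - 1) * ∫⁻ s, g s ^ (1 - p) * U s r ^ p ∂ν ∂μ := lintegral_mono_ae hj
    _ = S ^ (p - 1) * ∫⁻ s, ∫⁻ r, g s ^ (1 - p) * U s r ^ p ∂μ ∂ν := by
        rw [lintegral_const_mul]
        · congr 1
          rw [lintegral_lintegral_swap]
          exact (((hgm.pow_const _).mul (hm2.pow_const _)).comp measurable_swap).aemeasurable
        · exact Measurable.lintegral_prod_left' (f := fun x : α × β => g x.1 ^ (1 - p) * U x.1 x.2 ^ p)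
            ((hgm.pow_const _).mul (hm2.pow_const _))
    _ ≤ S ^ (p - 1) * S := by
        gcongr
        refine lintegral_mono_ae ?_
        filter_upwards [h', hgt] with s h1 h2
        rw [lintegral_const_mul _ ((hUs s).pow_const _)]
        refine (mul_le_mul_right h1 _).trans ?_
        by_cases hgs : g s = 0
        · rw [hgs, ENNReal.zero_rpow_of_pos hp0, mul_zero]
        · rw [← ENNReal.rpow_add _ _ hgs h2.ne]; simp
    _ = S ^ p := by
        rcases eq_or_ne S 0 with h0 | h0
        · rw [h0, ENNReal.zero_rpow_of_pos hp0, mul_zero]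
        · nth_rw 2 [← ENNReal.rpow_one S]
          rw [← ENNReal.rpow_add _ _ h0 hS]; simp

/-- A weighted square function along one coordinate. -/
theorem eLpNorm_sqrt_lintegral_weight_le [SFinite ν] {q : ℝ≥0∞} (hq : 2 ≤ q) {W : ℝ → ℝ≥0∞}
    (hW : Measurable W) {Y : α → ℝ} (hY : Measurable Y) {F : α → ℝ≥0∞} (hF : Measurable F) :
    eLpNorm (fun r => (∫⁻ z, W (r - Y z) * F z ^ 2 ∂ν) ^ (1 / 2 : ℝ)) q volume ≤
      (eLpNorm W (q / 2) volume * ∫⁻ z, F z ^ 2 ∂ν) ^ (1 / 2 : ℝ) := by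
  -- The L^q norm of a square root is the square root of an L^{q/2} norm. Since q/2 ≥ 1, Minkowski's
  -- inequality applies to the latter.
  have h0 := eLpNorm_enorm_rpow (μ := (volume : Measure ℝ)) (p := q)
    (fun r => ∫⁻ z, W (r - Y z) * F z ^ 2 ∂ν) (q := 1 / 2) (by norm_num)
  simp only [enorm_eq_self] at h0
  rw [h0]
  have e : q * ENNReal.ofReal (1 / 2) = q / 2 := by
    rw [ENNReal.div_eq_inv_mul, mul_comm]; congr 1
    rw [one_div, ENNReal.ofReal_inv_of_pos two_pos]; simp
  rw [e]
  refine ENNReal.rpow_le_rpow ?_ (by norm_num)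
  have hq1 : 1 ≤ q / 2 := by
    rw [ENNReal.le_div_iff_mul_le (by simp) (by simp), one_mul]; exact hq
  have hmeas : Measurable (Function.uncurry fun (z : α) (r : ℝ) => W (r - Y z) * F z ^ 2) := by
    have : Measurable fun x : α × ℝ => W (x.2 - Y x.1) * F x.1 ^ 2 := by fun_prop
    exact this
  have := eLpNorm_lintegral_le (ν := ν) (μ := volume) hq1 hmeas
    (g := fun z => eLpNorm W (q / 2) volume * F z ^ 2) (by fun_prop)
    (Filter.Eventually.of_forall fun z => ?_)
  · refine this.trans (le_of_eq ?_)
    rw [lintegral_const_mul _ (by fun_prop)]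
  · have h1 : eLpNorm (fun r => W (r - Y z)) (q / 2) volume = eLpNorm W (q / 2) volume :=
      eLpNorm_comp_measurePreserving hW.aestronglyMeasurable (measurePreserving_sub_right volume (Y z))
    rw [← h1, mul_comm]
    refine eLpNorm_le_mul_eLpNorm_of_ae_le_mul'' _ ?_ (Filter.Eventually.of_forall fun r => ?_)
    · exact (hW.comp (measurable_id.sub_const _)).aestronglyMeasurable
    · simp only [enorm_eq_self]; rw [mul_comm]

end Minkowski

end MaxFun

/-! ### Separating one coordinate -/

namespace MaxFun

variable {d : ℕ}

@[simp] theorem insertCoord_self (i : Fin d) (s : ℝ) (y : {j : Fin d // j ≠ i} → ℝ) :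
    insertCoord i s y i = s := by simp [insertCoord]

theorem insertCoord_ne (i : Fin d) (s : ℝ) (y : {j : Fin d // j ≠ i} → ℝ) (j : {j : Fin d // j ≠ i}) :
    insertCoord i s y j = y j := by simp [insertCoord, j.2]

theorem insertCoord_sub (i : Fin d) (s s' : ℝ) (y y' : {j : Fin d // j ≠ i} → ℝ) :
    insertCoord i s y - insertCoord i s' y' = insertCoord i (s - s') (y - y') := by
  ext j
  by_cases h : j = i <;> simp [insertCoord, h]

theorem insertCoord_eta (i : Fin d) (x : Sp d) : insertCoord i (x i) (fun j => x j) = x := by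
  ext j
  by_cases h : j = i
  · subst h; simp
  · simp [insertCoord, h]

theorem norm_le_norm_insertCoord (i : Fin d) (s : ℝ) (y : {j : Fin d // j ≠ i} → ℝ) :
    ‖y‖ ≤ ‖insertCoord i s y‖ := by
  rw [pi_norm_le_iff_of_nonneg (norm_nonneg _)]
  intro j
  rw [← insertCoord_ne i s y j]
  exact PiLp.norm_apply_le _ _

theorem continuous_insertCoord (i : Fin d) :
    Continuous fun p : ℝ × ({j : Fin d // j ≠ i} → ℝ) => insertCoord i p.1 p.2 := by
  unfold insertCoord
  refine (PiLp.continuous_toLp 2 _).comp (continuous_pi fun j => ?_)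
  by_cases h : j = i
  · simp only [h, dite_true]; fun_prop
  · simp only [h, dite_false]; fun_prop

/-- Splitting off one coordinate. -/
noncomputable def coordEquiv (i : Fin d) : ℝ × ({j : Fin d // j ≠ i} → ℝ) ≃ᵐ Sp d where
  toFun p := insertCoord i p.1 p.2
  invFun x := (x i, fun j => x j)
  left_inv p := by
    ext j
    · simp
    · simp [insertCoord_ne]
  right_inv x := insertCoord_eta i x
  measurable_toFun := (continuous_insertCoord i).measurable
  measurable_invFun := by
    refine Measurable.prodMk ?_ (measurable_pi_lambda _ fun j => ?_) <;>
    · exact (EuclideanSpace.proj (𝕜 := ℝ) _).continuous.measurable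

theorem measurePreserving_coordEquiv (i : Fin d) :
    MeasurePreserving (coordEquiv i) (volume.prod volume) volume := by
  have h1 := (volume_preserving_piEquivPiSubtypeProd (fun _ : Fin d => ℝ) (fun j => j = i)).symm
  have h2 := (volume_preserving_funUnique {j : Fin d // j = i} ℝ).symm
  have h3 := (EuclideanSpace.volume_preserving_symm_measurableEquiv_toLp (Fin d)).symm
  have h5 : MeasurePreserving _ (volume.prod volume)
      (volume : Measure (({j : Fin d // j = i} → ℝ) × ({j : Fin d // ¬ j = i} → ℝ))) :=
    h2.prod (MeasurePreserving.id (volume : Measure ({j : Fin d // ¬ j = i} → ℝ)))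
  have h1' : MeasurePreserving
      (MeasurableEquiv.piEquivPiSubtypeProd (fun _ : Fin d => ℝ) (fun j => j = i)).symm
      (volume : Measure (({j : Fin d // j = i} → ℝ) × ({j : Fin d // ¬ j = i} → ℝ))) volume := by
    convert h1 <;> rfl
  have h4 := h3.comp (h1'.comp h5)
  convert h4 using 1 <;> rfl

theorem integral_insertCoord {E : Type*} [NormedAddCommGroup E] [NormedSpace ℝ E] (i : Fin d)
    (f : Sp d → E) :
    ∫ x, f x = ∫ p : ℝ × ({j : Fin d // j ≠ i} → ℝ), f (insertCoord i p.1 p.2)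
      ∂(volume.prod volume) :=
  ((measurePreserving_coordEquiv i).integral_comp' f).symm

theorem lintegral_insertCoord (i : Fin d) (f : Sp d → ℝ≥0∞) :
    ∫⁻ x, f x = ∫⁻ p : ℝ × ({j : Fin d // j ≠ i} → ℝ), f (insertCoord i p.1 p.2)
      ∂(volume.prod volume) :=
  ((measurePreserving_coordEquiv i).lintegral_comp_emb (coordEquiv i).measurableEmbedding f).symm

end MaxFun

/-! ### Multiplier kernels and the reproducing formula -/

namespace MaxFun

variable {d : ℕ}

open scoped FourierTransform SchwartzMap in
theorem multKernel_eq (m : Sp d → ℂ) (x : Sp d) :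
    multKernel m x = (((2 * Real.pi) ^ d)⁻¹ : ℝ) * 𝓕⁻ m ((2 * Real.pi)⁻¹ • x) := by
  unfold multKernel
  rw [Real.fourierInv_eq']
  congr 1
  refine integral_congr_ae (Filter.Eventually.of_forall fun ξ => ?_)
  simp only [smul_eq_mul]
  congr 2
  rw [real_inner_smul_right, real_inner_comm]
  have : (Real.pi : ℂ) ≠ 0 := by exact_mod_cast Real.pi_ne_zero
  push_cast
  field_simp

-- The kernel is a dilated inverse Fourier transform of a Schwartz function. This yields decay of
-- every order and Fourier inversion in the normalization of `multKernel`.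
open scoped FourierTransform SchwartzMap in
theorem multKernel_schwartz (m : Sp d → ℂ) (hm : ContDiff ℝ ∞ m) (hs : HasCompactSupport m) :
    Continuous (multKernel m) ∧
    (∀ N : ℕ, ∃ C : ℝ, 0 < C ∧ ∀ x, ‖multKernel m x‖ ≤ C / (1 + ‖x‖) ^ N) ∧
    ∀ ξ : Sp d, ∫ z : Sp d, Complex.exp (-(Complex.I * (inner ℝ z ξ : ℝ))) * multKernel m z = m ξ := by
  set S : 𝓢(Sp d, ℂ) := hs.toSchwartzMap hm with hS
  have hSm : (S : Sp d → ℂ) = m := rfl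
  set Φ : 𝓢(Sp d, ℂ) := 𝓕⁻ S with hΦ
  have hΦm : (Φ : Sp d → ℂ) = 𝓕⁻ m := by rw [hΦ, SchwartzMap.fourierInv_coe, hSm]
  have hpi : 0 < 2 * Real.pi := by positivity
  have heq : ∀ x, multKernel m x = (((2 * Real.pi) ^ d)⁻¹ : ℝ) * Φ ((2 * Real.pi)⁻¹ • x) := fun x => by
    rw [multKernel_eq, hΦm]
  refine ⟨?_, fun N => ?_, fun ξ => ?_⟩
  · have : multKernel m = fun x => (((2 * Real.pi) ^ d)⁻¹ : ℝ) * Φ ((2 * Real.pi)⁻¹ • x) := funext heq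
    rw [this]
    have := Φ.continuous
    fun_prop
  · set D := 2 ^ N * ((Finset.Iic (N, 0)).sup fun m => SchwartzMap.seminorm ℝ m.1 m.2) Φ with hD
    have hb : ∀ v, (1 + ‖v‖) ^ N * ‖Φ v‖ ≤ D := fun v => by
      have := SchwartzMap.one_add_le_sup_seminorm_apply (𝕜 := ℝ) (m := (N, 0)) (le_refl N)
        (le_refl 0) Φ v
      simpa using this
    have hD0 : 0 ≤ D := (by positivity : 0 ≤ (1 + ‖(0 : Sp d)‖) ^ N * ‖Φ 0‖).trans (hb 0)
    refine ⟨((2 * Real.pi) ^ d)⁻¹ * ((2 * Real.pi) ^ N * D) + 1, by positivity, fun x => ?_⟩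
    rw [heq, norm_mul, Complex.norm_real, Real.norm_of_nonneg (by positivity),
      le_div_iff₀ (by positivity), mul_assoc]
    have h1 : (1 + ‖x‖) ≤ (2 * Real.pi) * (1 + ‖(2 * Real.pi)⁻¹ • x‖) := by
      rw [norm_smul, norm_inv, Real.norm_of_nonneg hpi.le, mul_add, ← mul_assoc,
        mul_inv_cancel₀ hpi.ne', one_mul, mul_one]
      have := Real.pi_gt_three
      linarith
    have h2 : ‖Φ ((2 * Real.pi)⁻¹ • x)‖ * (1 + ‖x‖) ^ N ≤ (2 * Real.pi) ^ N * D := by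
      calc _ ≤ ‖Φ ((2 * Real.pi)⁻¹ • x)‖ * ((2 * Real.pi) * (1 + ‖(2 * Real.pi)⁻¹ • x‖)) ^ N := by
            gcongr
        _ = (2 * Real.pi) ^ N * ((1 + ‖(2 * Real.pi)⁻¹ • x‖) ^ N * ‖Φ ((2 * Real.pi)⁻¹ • x)‖) := by
            rw [mul_pow]; ring
        _ ≤ _ := by gcongr; exact hb _
    have h3 : ((2 * Real.pi) ^ d)⁻¹ * (‖Φ ((2 * Real.pi)⁻¹ • x)‖ * (1 + ‖x‖) ^ N) ≤
        ((2 * Real.pi) ^ d)⁻¹ * ((2 * Real.pi) ^ N * D) := by gcongr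
    linarith
  · have h1 : 𝓕 (Φ : Sp d → ℂ) ξ = m ξ := by
      rw [← SchwartzMap.fourier_coe, hΦ, FourierTransform.fourier_fourierInv_eq, hSm]
    have h2 := Measure.integral_comp_inv_smul (volume : Measure (Sp d))
      (fun v => Complex.exp (((-2 * Real.pi * inner ℝ v ξ : ℝ) : ℂ) * Complex.I) * Φ v) (2 * Real.pi)
    rw [Real.fourier_eq'] at h1
    simp only [smul_eq_mul] at h1
    rw [h1, finrank_euclideanSpace_fin, abs_of_pos (by positivity)] at h2
    have h3 : ∀ z : Sp d, Complex.exp (-(Complex.I * (inner ℝ z ξ : ℝ))) * multKernel m z =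
        (((2 * Real.pi) ^ d)⁻¹ : ℝ) * (Complex.exp (((-2 * Real.pi *
          inner ℝ ((2 * Real.pi)⁻¹ • z) ξ : ℝ) : ℂ) * Complex.I) * Φ ((2 * Real.pi)⁻¹ • z)) := by
      intro z
      rw [heq, real_inner_smul_left]
      have : -2 * Real.pi * ((2 * Real.pi)⁻¹ * inner ℝ z ξ) = - inner ℝ z ξ := by
        field_simp
      rw [this, mul_left_comm]
      congr 3
      push_cast; ring
    simp only [h3]
    rw [integral_const_mul, h2, Complex.real_smul, ← mul_assoc, ← Complex.ofReal_mul,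
      inv_mul_cancel₀ (by positivity), Complex.ofReal_one, one_mul]

section Bump

variable {η : ℝ → ℝ}

theorem contDiff_sigma (hη : IsUniformBump η) (k : Fin d → ℤ) :
    ContDiff ℝ ∞ fun ξ : Sp d => (sigma η k ξ : ℂ) := by
  have h : ContDiff ℝ ∞ fun ξ : Sp d => ∏ j, η (ξ j - k j) :=
    contDiff_prod fun j _ => hη.smooth.comp
      (((EuclideanSpace.proj (𝕜 := ℝ) j).contDiff).sub contDiff_const)
  exact Complex.ofRealCLM.contDiff.comp h

theorem sub_mem_of_sigma_ne_zero (hη : IsUniformBump η) {k : Fin d → ℤ} {ξ : Sp d}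
    (h : sigma η k ξ ≠ 0) (j : Fin d) : |ξ j - k j| ≤ 2 / 3 := by
  have h1 := Finset.prod_ne_zero_iff.1 h j (Finset.mem_univ j)
  have := hη.supp (subset_tsupport _ h1)
  rw [abs_le]; exact this

/-- The cutoff `bump₁` equals 1 on [-2/3, 2/3], which contains the support of η; so `amp`
contributes only its affine factor on the support of `sigma η k`. -/
theorem amp_mul_sigma (hη : IsUniformBump η) (w : Sp d) (k : Fin d → ℤ) (ξ : Sp d) :
    amp w (ξ - kvec k) * sigma η k ξ = (1 + inner ℝ w (ξ - kvec k)) * sigma η k ξ := by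
  by_cases h : sigma η k ξ = 0
  · simp [h]
  · unfold amp
    rw [Finset.prod_eq_one, one_mul]
    intro j _
    refine bump₁.one_of_mem_closedBall ?_
    simpa [bump₁] using sub_mem_of_sigma_ne_zero hη h j

theorem hasCompactSupport_sigma (hη : IsUniformBump η) (k : Fin d → ℤ) :
    HasCompactSupport fun ξ : Sp d => (sigma η k ξ : ℂ) := by
  refine HasCompactSupport.intro
    (isCompact_cube.image (f := fun ζ : Sp d => ζ + kvec k) (by fun_prop)) fun ξ hξ => ?_
  by_contra h
  refine hξ ⟨ξ - kvec k, fun j => ?_, by simp⟩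
  have h0 : sigma η k ξ ≠ 0 := fun h' => h (by simp [h'])
  have := sub_mem_of_sigma_ne_zero hη h0 j
  simp only [PiLp.sub_apply, kvec_apply]
  linarith

/-- Rapid decay of the kernel for bounded times. -/
theorem exists_ker_decay {w : Sp d} {c : ℝ} (hw : ‖w‖ ≤ 1) (hc : 1 ≤ c) (k : Sp d) {R : ℝ}
    (hR : 0 ≤ R) (N : ℕ) : ∃ C : ℝ, 0 < C ∧ ∀ (t : ℝ) (x : Sp d), |t| ≤ R →
      ‖ker w c k t x‖ ≤ C / (1 + ‖x‖) ^ N := by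
  -- With A = |k| the far-field bound holds for every c ≥ 1. The resulting constant depends on k, c
  -- and R, and serves only to justify integrability.
  obtain ⟨C₁, hC₁, h⟩ := exists_ker_far d ‖k‖ R (norm_nonneg k) hR
  obtain ⟨C, hC, h1⟩ := h N
  obtain ⟨C₀, hC₀, h0⟩ := exists_norm_osc_le d
  have hc0 : 0 < c := by linarith
  refine ⟨C + C₀ * (1 + C₁ * c ^ 3) ^ N, by positivity, fun t x ht => ?_⟩
  by_cases hx : C₁ * c ^ 3 ≤ ‖x‖
  · refine (h1 w c k t x hw hc ?_ ?_ hx).trans ?_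
    · exact le_mul_of_one_le_right (norm_nonneg _) hc
    · exact ht.trans (le_mul_of_one_le_right hR (one_le_pow₀ hc))
    · gcongr
      have : 0 < C₀ * (1 + C₁ * c ^ 3) ^ N := by positivity
      linarith
  · have h2 : ‖ker w c k t x‖ ≤ C₀ := by
      rw [norm_ker_eq w hc0 one_pos]; exact h0 _ _ _ _ _ _ hw
    rw [le_div_iff₀ (by positivity)]
    calc ‖ker w c k t x‖ * (1 + ‖x‖) ^ N ≤ C₀ * (1 + C₁ * c ^ 3) ^ N := by
          have := not_le.1 hx
          gcongr
      _ ≤ _ := by linarith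

/-- Convolving kernels multiplies symbols: Fubini, then Fourier inversion for `multKernel m` at each
frequency. -/
theorem integral_ker_mul_multKernel (w : Sp d) (c : ℝ) (k : Sp d) (t : ℝ) (u : Sp d) {m : Sp d → ℂ}
    (hm : ContDiff ℝ ∞ m) (hs : HasCompactSupport m) :
    ∫ z, ker w c k t (u - z) * multKernel m z =
      ∫ ξ : Sp d, ((amp w (ξ - k) ^ 2 : ℝ) : ℂ) *
        Complex.exp (Complex.I * ((inner ℝ u ξ + t * disp c ξ : ℝ) : ℂ)) * m ξ := by
  obtain ⟨hcont, hdec, hinv⟩ := multKernel_schwartz m hm hs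
  have hA := continuous_amp w
  have hD := continuous_disp (d := d) c
  have hmi : Integrable (multKernel m) := by
    obtain ⟨C, hC, h⟩ := hdec (d + 1)
    have h1 : Integrable fun x : Sp d => C * (1 + ‖x‖) ^ (-((d + 1 : ℕ) : ℝ)) :=
      (integrable_one_add_norm (by simp)).const_mul C
    refine h1.mono' hcont.aestronglyMeasurable (Filter.Eventually.of_forall fun x => ?_)
    rw [Real.rpow_neg (by positivity), Real.rpow_natCast, ← div_eq_mul_inv]
    exact h x
  have hai : Integrable fun ξ : Sp d => ((amp w (ξ - k) ^ 2 : ℝ) : ℂ) := by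
    refine Continuous.integrable_of_hasCompactSupport (by fun_prop) ?_
    exact (hasCompactSupport_amp w k).comp_left (g := fun r : ℝ => ((r ^ 2 : ℝ) : ℂ)) (by simp)
  have hprod : Integrable (Function.uncurry fun (z ξ : Sp d) =>
      ((amp w (ξ - k) ^ 2 : ℝ) : ℂ) *
        Complex.exp (Complex.I * ((inner ℝ (u - z) ξ + t * disp c ξ : ℝ) : ℂ)) * multKernel m z)
      (volume.prod volume) := by
    have h1 := hmi.mul_prod hai
    refine h1.mono ?_ (Filter.Eventually.of_forall fun p => ?_)
    · refine Continuous.aestronglyMeasurable ?_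
      unfold Function.uncurry
      fun_prop
    · simp only [Function.uncurry, norm_mul]
      rw [mul_comm Complex.I, Complex.norm_exp_ofReal_mul_I, mul_one, mul_comm]
  calc ∫ z, ker w c k t (u - z) * multKernel m z
      = ∫ z, ∫ ξ : Sp d, ((amp w (ξ - k) ^ 2 : ℝ) : ℂ) *
          Complex.exp (Complex.I * ((inner ℝ (u - z) ξ + t * disp c ξ : ℝ) : ℂ)) *
            multKernel m z := by
        refine integral_congr_ae (Filter.Eventually.of_forall fun z => ?_)
        simp only [ker]
        rw [← integral_mul_const]
    _ = ∫ ξ : Sp d, ∫ z, ((amp w (ξ - k) ^ 2 : ℝ) : ℂ) *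
          Complex.exp (Complex.I * ((inner ℝ (u - z) ξ + t * disp c ξ : ℝ) : ℂ)) *
            multKernel m z := integral_integral_swap hprod
    _ = _ := by
        refine integral_congr_ae (Filter.Eventually.of_forall fun ξ => ?_)
        simp only
        rw [← hinv ξ, ← integral_const_mul]
        refine integral_congr_ae (Filter.Eventually.of_forall fun z => ?_)
        simp only
        rw [← mul_assoc, mul_assoc _ (Complex.exp _) (Complex.exp _), ← Complex.exp_add]
        congr 3
        rw [inner_sub_left]; push_cast; ring

/-- Weighted integrability justifying the interchange of the two convolutions. -/
theorem integrable_conv_conv {A B : Sp d → ℂ} (hA : Continuous A) (hB : Continuous B)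
    (hAd : ∀ N : ℕ, ∃ C : ℝ, 0 < C ∧ ∀ x, ‖A x‖ ≤ C / (1 + ‖x‖) ^ N)
    (hBd : ∀ N : ℕ, ∃ C : ℝ, 0 < C ∧ ∀ x, ‖B x‖ ≤ C / (1 + ‖x‖) ^ N) {ψ : Sp d → ℂ}
    (hψ : IsTempered ψ) (x : Sp d) :
    Integrable (Function.uncurry fun (z y : Sp d) => A (x - z) * (B (z - y) * ψ y))
      (volume.prod volume) := by
  obtain ⟨N, hN⟩ := hψ
  obtain ⟨C, hC, hA'⟩ := hAd (d + 1 + N)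
  obtain ⟨C', hC', hB'⟩ := hBd N
  have hψm : AEStronglyMeasurable ψ := by
    have h1 : Continuous fun x : Sp d => (1 + ‖x‖) ^ N := by fun_prop
    have := h1.aestronglyMeasurable (μ := volume).smul hN.1
    refine this.congr (Filter.Eventually.of_forall fun y => ?_)
    simp only [Pi.smul_apply']
    rw [smul_smul, mul_inv_cancel₀ (by positivity), one_smul]
  have h0 : Integrable (fun z : Sp d => (1 + ‖z‖) ^ (-((d + 1 : ℕ) : ℝ))) volume :=
    integrable_one_add_norm (by simp)
  have h1 : Integrable (fun z : Sp d => (1 + ‖x - z‖) ^ (-((d + 1 : ℕ) : ℝ))) volume :=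
    h0.comp_sub_left x
  have h2 := (h1.mul_prod hN.norm).const_mul (C * C' * (1 + ‖x‖) ^ N)
  refine h2.mono' ?_ (Filter.Eventually.of_forall fun p => ?_)
  · have c1 : Continuous fun p : Sp d × Sp d => A (x - p.1) := by fun_prop
    have c2 : Continuous fun p : Sp d × Sp d => B (p.1 - p.2) := by fun_prop
    exact c1.aestronglyMeasurable.mul (c2.aestronglyMeasurable.mul hψm.comp_snd)
  · obtain ⟨z, y⟩ := p
    simp only [Function.uncurry, norm_mul, norm_smul, norm_inv, norm_pow]
    rw [Real.rpow_neg (by positivity), Real.rpow_natCast, Real.norm_of_nonneg (by positivity)]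
    -- This moves the polynomial growth of ψ at y onto the decay of B at z - y and of A at x - z,
    -- with a factor depending only on x.
    have e1 : (1 + ‖y‖) ≤ (1 + ‖z - y‖) * (1 + ‖x - z‖) * (1 + ‖x‖) := by
      have h3 : ‖y‖ ≤ ‖z - y‖ + ‖x - z‖ + ‖x‖ := by
        calc ‖y‖ = ‖x - (x - z) - (z - y)‖ := by congr 1; abel
          _ ≤ ‖x‖ + ‖x - z‖ + ‖z - y‖ := (norm_sub_le _ _).trans (by
              gcongr; exact norm_sub_le _ _)
          _ = _ := by ring
      have p1 := norm_nonneg (z - y)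
      have p2 := norm_nonneg (x - z)
      have p3 := norm_nonneg x
      nlinarith [mul_nonneg p1 p2, mul_nonneg p1 p3, mul_nonneg p2 p3,
        mul_nonneg (mul_nonneg p1 p2) p3]
    calc ‖A (x - z)‖ * (‖B (z - y)‖ * ‖ψ y‖)
        ≤ C / (1 + ‖x - z‖) ^ (d + 1 + N) * (C' / (1 + ‖z - y‖) ^ N * ‖ψ y‖) := by
          gcongr
          · exact hA' _
          · exact hB' _
      _ = C * C' * ((1 + ‖x - z‖) ^ (d + 1))⁻¹ * (((1 + ‖z - y‖) * (1 + ‖x - z‖)) ^ N)⁻¹ *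
            ‖ψ y‖ := by
          rw [pow_add, mul_pow]; field_simp
      _ ≤ C * C' * ((1 + ‖x - z‖) ^ (d + 1))⁻¹ * ((1 + ‖x‖) ^ N * ((1 + ‖y‖) ^ N)⁻¹) * ‖ψ y‖ := by
          gcongr
          rw [← div_eq_mul_inv, inv_le_comm₀ (by positivity) (by positivity), inv_div,
            div_le_iff₀ (by positivity), ← mul_pow]
          gcongr
      _ = _ := by ring

theorem amp_sq_mul_sigma (hη : IsUniformBump η) (w : Sp d) (k : Fin d → ℤ) (ξ : Sp d) :
    ((amp w (ξ - kvec k) ^ 2 : ℝ) : ℂ) * (sigma η k ξ : ℂ) =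
      (sigma η k ξ : ℂ) * ((1 + inner ℝ w (ξ - kvec k) : ℝ) : ℂ) ^ 2 := by
  have h1 := amp_mul_sigma hη w k ξ
  have h2 : amp w (ξ - kvec k) ^ 2 * sigma η k ξ =
      sigma η k ξ * (1 + inner ℝ w (ξ - kvec k)) ^ 2 := by
    rw [sq, sq, mul_assoc, h1, mul_left_comm, h1]; ring
  exact_mod_cast h2

theorem multKernel_propagator (hη : IsUniformBump η) (w : Sp d) (c : ℝ) (k : Fin d → ℤ) (t : ℝ)
    (u : Sp d) :
    multKernel (fun ξ => (sigma η k ξ : ℂ) * ((1 + inner ℝ w (ξ - kvec k) : ℝ) : ℂ) ^ 2 *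
      symU c t ξ) u = (((2 * Real.pi) ^ d)⁻¹ : ℝ) *
      ∫ z, ker w c (kvec k) t (u - z) * multKernel (fun ξ => (sigma η k ξ : ℂ)) z := by
  rw [integral_ker_mul_multKernel w c (kvec k) t u (contDiff_sigma hη k)
    (hasCompactSupport_sigma hη k), multKernel]
  congr 1
  refine integral_congr_ae (Filter.Eventually.of_forall fun ξ => ?_)
  have h3 := amp_sq_mul_sigma hη w k ξ
  have h4 : Complex.exp (Complex.I * ((inner ℝ u ξ + t * disp c ξ : ℝ) : ℂ)) =
      Complex.exp (Complex.I * (inner ℝ u ξ : ℝ)) * symU c t ξ := by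
    rw [symU, ← Complex.exp_add, ← mul_add, ← Complex.ofReal_add, disp]
  simp only
  rw [← h3, h4]
  ring

theorem integral_conv_conv {A B : Sp d → ℂ} (hA : Continuous A) (hB : Continuous B)
    (hAd : ∀ N : ℕ, ∃ C : ℝ, 0 < C ∧ ∀ x, ‖A x‖ ≤ C / (1 + ‖x‖) ^ N)
    (hBd : ∀ N : ℕ, ∃ C : ℝ, 0 < C ∧ ∀ x, ‖B x‖ ≤ C / (1 + ‖x‖) ^ N) {ψ : Sp d → ℂ}
    (hψ : IsTempered ψ) (x : Sp d) :
    ∫ z, A (x - z) * ∫ y, B (z - y) * ψ y = ∫ y, (∫ z, A (x - y - z) * B z) * ψ y := by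
  calc ∫ z, A (x - z) * ∫ y, B (z - y) * ψ y
      = ∫ z, ∫ y, A (x - z) * (B (z - y) * ψ y) := by
        refine integral_congr_ae (Filter.Eventually.of_forall fun z => ?_)
        exact (integral_const_mul _ _).symm
    _ = ∫ y, ∫ z, A (x - z) * (B (z - y) * ψ y) :=
        integral_integral_swap (integrable_conv_conv hA hB hAd hBd hψ x)
    _ = _ := by
        refine integral_congr_ae (Filter.Eventually.of_forall fun y => ?_)
        simp only
        rw [← integral_mul_const, ← integral_add_right_eq_self _ y]
        refine integral_congr_ae (Filter.Eventually.of_forall fun z => ?_)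
        simp only [add_sub_cancel_right]
        rw [show x - (z + y) = x - y - z by abel, mul_assoc]

theorem continuous_ker_right (w : Sp d) (c : ℝ) (k : Sp d) (t : ℝ) :
    Continuous fun u => ker w c k t u :=
  Continuous.comp (g := fun p : ℝ × Sp d => ker w c k p.1 p.2) (f := fun u => (t, u))
    (continuous_ker w c k) (by fun_prop)

theorem integral_ker_mul_box (hη : IsUniformBump η) {w : Sp d} {c : ℝ} (hw : ‖w‖ ≤ 1)
    (hc : 1 ≤ c) (k : Fin d → ℤ) (t : ℝ) {ψ : Sp d → ℂ} (hψ : IsTempered ψ) (x : Sp d) :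
    ∫ z, ker w c (kvec k) t (x - z) * box η k ψ z =
      ∫ y, (∫ z, ker w c (kvec k) t (x - y - z) *
        multKernel (fun ξ => (sigma η k ξ : ℂ)) z) * ψ y := by
  have hm := multKernel_schwartz (fun ξ : Sp d => (sigma η k ξ : ℂ))
    (contDiff_sigma hη k) (hasCompactSupport_sigma hη k)
  have hkc := continuous_ker_right w c (kvec k) t
  have hkd : ∀ N : ℕ, ∃ C : ℝ, 0 < C ∧ ∀ x, ‖ker w c (kvec k) t x‖ ≤ C / (1 + ‖x‖) ^ N := fun N => by
    obtain ⟨C, hC, h⟩ := exists_ker_decay hw hc (kvec k) (abs_nonneg t) N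
    exact ⟨C, hC, fun x => h t x le_rfl⟩
  exact integral_conv_conv hkc hm.1 hkd hm.2.1 hψ x

/-- The reproducing formula: a smooth Fourier multiplier applied to a frequency box is an integral
operator acting on the frequency-localized function. -/
theorem mult_eq_integral_ker_mul_box (hη : IsUniformBump η) {w : Sp d} {c : ℝ} (hw : ‖w‖ ≤ 1)
    (hc : 1 ≤ c) (k : Fin d → ℤ) (t : ℝ) {ψ : Sp d → ℂ} (hψ : IsTempered ψ) (x : Sp d) :
    mult (fun ξ => (sigma η k ξ : ℂ) * ((1 + inner ℝ w (ξ - kvec k) : ℝ) : ℂ) ^ 2 * symU c t ξ) ψ x =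
      (((2 * Real.pi) ^ d)⁻¹ : ℝ) * ∫ z, ker w c (kvec k) t (x - z) * box η k ψ z := by
  rw [integral_ker_mul_box hη hw hc k t hψ x, ← integral_const_mul, mult]
  refine integral_congr_ae (Filter.Eventually.of_forall fun y => ?_)
  simp only
  rw [multKernel_propagator hη, mul_assoc]

end Bump

end MaxFun

/-! ### Maximal estimates for the free evolution -/

namespace MaxFun

variable {d : ℕ}

/-- At time zero the kernel does not see c, which may be replaced by `max 1 ‖k‖`. Every k then
satisfies |k| ≤ c, the nonstationary bound holds at every point, and the constant is uniform in k
and c. -/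
theorem exists_ker_schur (d : ℕ) : ∃ B : ℝ, 0 < B ∧ ∀ (w : Sp d) (c : ℝ) (k : Sp d), ‖w‖ ≤ 1 →
    ∫⁻ z, ‖ker w c k 0 z‖ₑ ≤ ENNReal.ofReal B := by
  obtain ⟨A₀, -, h⟩ := exists_ker_nonstationary d 1
  obtain ⟨C, hC, h1⟩ := h (d + 1)
  have hi : Integrable (fun x : Sp d => C * (1 + ‖x‖) ^ (-((d + 1 : ℕ) : ℝ))) volume :=
    (integrable_one_add_norm (by simp)).const_mul C
  refine ⟨(∫ x : Sp d, C * (1 + ‖x‖) ^ (-((d + 1 : ℕ) : ℝ))) + 1, ?_, fun w c k hw => ?_⟩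
  · have : 0 ≤ ∫ x : Sp d, C * (1 + ‖x‖) ^ (-((d + 1 : ℕ) : ℝ)) :=
      integral_nonneg fun x => by positivity
    linarith
  · refine le_trans (lintegral_mono fun z => ?_) ((ofReal_integral_eq_lintegral_ofReal hi
      (Filter.Eventually.of_forall fun x => by positivity)).symm.le.trans
        (ENNReal.ofReal_le_ofReal (by linarith)))
    rw [← ofReal_norm]
    refine ENNReal.ofReal_le_ofReal ?_
    have e1 : ker w c k 0 z = ker w (max 1 ‖k‖) k 0 z := by simp [ker]
    have := h1 w (max 1 ‖k‖) k 0 z hw (le_max_left _ _) (by simp) (by simp)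
    rw [e1, Real.rpow_neg (by positivity), Real.rpow_natCast, ← div_eq_mul_inv]
    simpa using this

/-- The waves along the hyperplanes `x_h = s`. -/
noncomputable def slabWave (w : Sp d) (c : ℝ) (k : Sp d) (h : Fin d) (T : ℝ) (s : ℝ)
    (z : ({j : Fin d // j ≠ h} → ℝ) × unitInterval) : Lp ℂ 2 (volume : Measure (Sp d)) :=
  wave w c k (T * (2 * z.2 - 1), insertCoord h s z.1)

/-- The affine change of time between [-T, T] and `unitInterval` keeps the parameter space of the
maximal function independent of T. -/
theorem exists_slabWave_eq (w : Sp d) (c : ℝ) (k : Sp d) (h : Fin d) {T t : ℝ} (hT : 0 < T)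
    (ht : t ∈ Set.Icc (-T) T) (x : Sp d) :
    ∃ z, slabWave w c k h T (x h) z = wave w c k (t, x) := by
  refine ⟨(fun j => x j, ⟨(t / T + 1) / 2, ?_, ?_⟩), ?_⟩
  · have : -1 ≤ t / T := by rw [le_div_iff₀ hT]; linarith [ht.1]
    linarith
  · have : t / T ≤ 1 := by rw [div_le_iff₀ hT]; linarith [ht.2]
    linarith
  · rw [slabWave, insertCoord_eta]
    congr 2
    field_simp
    ring

theorem continuous_slabWave (w : Sp d) (c : ℝ) (k : Sp d) (h : Fin d) (T : ℝ) :
    Continuous (Function.uncurry (slabWave w c k h T)) := by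
  have h1 : Continuous fun p : ℝ × (({j : Fin d // j ≠ h} → ℝ) × unitInterval) =>
      (T * (2 * (p.2.2 : ℝ) - 1), insertCoord h p.1 p.2.1) := by
    refine Continuous.prodMk (by fun_prop) ?_
    exact (continuous_insertCoord h).comp (f := fun p : ℝ × (({j : Fin d // j ≠ h} → ℝ) ×
      unitInterval) => (p.1, p.2.1)) (by fun_prop)
  exact (continuous_wave w c k).comp h1

/-- Of the distance between two points only the separation of their hyperplanes is kept. Time
differences reach 2T, hence the range assumed for the kernel. -/
theorem norm_inner_slabWave_le {w : Sp d} {c : ℝ} {k : Sp d} {h : Fin d} {T : ℝ} {C D m : ℝ}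
    (hT : 0 < T) (hC : 0 ≤ C) (hD : 0 < D) (hm : 0 ≤ m)
    (hker : ∀ t x, |t| ≤ 2 * T → ‖ker w c k t x‖ ≤ C * (1 + D⁻¹ * ‖x‖) ^ (-m)) (s : ℝ)
    (z : ({j : Fin d // j ≠ h} → ℝ) × unitInterval) (s' : ℝ)
    (z' : ({j : Fin d // j ≠ h} → ℝ) × unitInterval) :
    ‖inner ℂ (slabWave w c k h T s z) (slabWave w c k h T s' z')‖ ≤
      C * (1 + D⁻¹ * |s - s'|) ^ (-m) := by
  rw [slabWave, slabWave, inner_wave]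
  have h1 := z.2.2
  have h2 := z'.2.2
  refine (hker _ _ (by rw [abs_le]; constructor <;> nlinarith [h1.1, h1.2, h2.1, h2.2])).trans ?_
  simp only [insertCoord_sub]
  have h3 : |s - s'| ≤ ‖insertCoord h (s - s') (z.1 - z'.1)‖ := by
    have := PiLp.norm_apply_le (insertCoord h (s - s') (z.1 - z'.1)) h
    rwa [insertCoord_self, Real.norm_eq_abs] at this
  gcongr C * ?_
  refine Real.rpow_le_rpow_of_nonpos (by positivity) ?_ (by linarith)
  gcongr

/-- The dispersive kernel bound has scale ⟨k⟩ and order m = d/2, so the summability condition mq/2 >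
1 is q > 4/d. It holds at all times, hence no upper bound on T. -/
theorem exists_maximal_dispersive (hd : 0 < d) (q : ℝ≥0∞) (hq : 2 ≤ q)
    (hqd : 4 / (d : ℝ≥0∞) < q) : ∃ C : ℝ, 0 < C ∧ ∀ (w : Sp d) (c : ℝ) (k : Sp d) (h : Fin d) (T : ℝ)
    (Ψ : Lp ℂ 2 (volume : Measure (Sp d))), ‖w‖ ≤ 1 → 1 ≤ c → 0 < T →
    ((1 ≤ delta d * c ∧ ‖k‖ ≤ delta d * c) ∨ c ≤ delta d * ‖k‖) →
    eLpNorm (maxInner (slabWave w c k h T) Ψ) q volume ≤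
      ENNReal.ofReal (C * jap ‖k‖ ^ (1 / q).toReal) * ‖Ψ‖ₑ := by
  obtain ⟨C₁, hC₁, h1⟩ := exists_ker_dispersive hd
  obtain ⟨C₂, hC₂, h2⟩ := exists_eLpNorm_maxInner_le q hq ((d : ℝ) / 2) (fun hqt => by
    have hd0 : (0 : ℝ) < d := by exact_mod_cast hd
    have : (4 : ℝ) / d < q.toReal := by
      have h3 := (ENNReal.toReal_lt_toReal (by finiteness) hqt).2 hqd
      simpa using h3
    rw [div_lt_iff₀ hd0] at this
    linarith)
  refine ⟨C₂ * √C₁, by positivity, fun w c k h T Ψ hw hc hT hk => ?_⟩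
  have hj := one_le_jap ‖k‖
  exact h2 (slabWave w c k h T) (continuous_slabWave w c k h T) C₁ (jap ‖k‖) hC₁.le
    (by linarith) (norm_inner_slabWave_le hT hC₁.le (by linarith) (by positivity)
      fun t x _ => h1 w c k t x hw hc hk) Ψ

theorem toReal_one_div_le_half {q : ℝ≥0∞} (hq : 2 ≤ q) : (1 / q).toReal ≤ 1 / 2 := by
  have h1 : 1 / q ≤ 1 / 2 := ENNReal.div_le_div_left hq 1
  have := ENNReal.toReal_mono (by simp) h1
  simpa using this

/-- Outside the quartic regime finite speed replaces dispersion: scale c²⟨k⟩ and order 2, whose cost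
(c²)^{1/q} is at most c since q ≥ 2. Inside it the dispersive bound already suffices. -/
theorem exists_maximal_bound (hd : 0 < d) (q : ℝ≥0∞) (hq : 2 ≤ q)
    (hqd : 4 / (d : ℝ≥0∞) < q) (M : ℝ) (hM : 0 < M) :
    ∃ C : ℝ, 0 < C ∧ ∀ (w : Sp d) (c : ℝ) (k : Sp d) (h : Fin d) (T : ℝ)
    (Ψ : Lp ℂ 2 (volume : Measure (Sp d))), ‖w‖ ≤ 1 → 1 ≤ c → 0 < T → T ≤ M * c ^ 2 →
    eLpNorm (maxInner (slabWave w c k h T) Ψ) q volume ≤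
      ENNReal.ofReal (C * c * jap ‖k‖ ^ (1 / q).toReal) * ‖Ψ‖ₑ := by
  have hδ := delta_pos (d := d)
  obtain ⟨C₀, hC₀, h0⟩ := exists_maximal_dispersive hd q hq hqd
  obtain ⟨C₁, hC₁, h1⟩ := exists_ker_speed d (delta d)⁻¹ (2 * M) (by positivity)
  obtain ⟨C₂, hC₂, h2⟩ := exists_eLpNorm_maxInner_le q hq 2 (fun hqt => by
    have := ENNReal.toReal_mono hqt hq
    simp at this ⊢
    linarith)
  refine ⟨C₀ + C₂ * √C₁, by positivity, fun w c k h T Ψ hw hc hT hTM => ?_⟩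
  have hj := one_le_jap ‖k‖
  have hc0 : 0 < c := by linarith
  rcases le_total c (delta d * ‖k‖) with hk | hk
  · refine (h0 w c k h T Ψ hw hc hT (Or.inr hk)).trans ?_
    gcongr ENNReal.ofReal (?_ * _) * _
    have : 0 < C₂ * √C₁ := by positivity
    nlinarith
  · have : Nonempty (({j : Fin d // j ≠ h} → ℝ) × Set.Icc (-T) T) :=
      ⟨(0, ⟨0, by constructor <;> linarith⟩)⟩
    refine (h2 (slabWave w c k h T) (continuous_slabWave w c k h T) C₁ (c ^ 2 * jap ‖k‖) hC₁.le
      (by positivity) (norm_inner_slabWave_le hT hC₁.le (by positivity) (by norm_num)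
        fun t x ht => h1 w c k t x hw hc ?_ (by linarith)) Ψ).trans ?_
    · rw [inv_mul_eq_div, le_div_iff₀ hδ]; linarith
    · gcongr ENNReal.ofReal ?_ * _
      rw [Real.mul_rpow (by positivity) (by positivity), ← mul_assoc]
      gcongr ?_ * _
      have : (c ^ 2) ^ (1 / q).toReal ≤ c := by
        rw [← Real.rpow_natCast, ← Real.rpow_mul hc0.le]
        nth_rw 2 [← Real.rpow_one c]
        refine Real.rpow_le_rpow_of_exponent_le hc ?_
        have := toReal_one_div_le_half hq
        push_cast; linarith
      calc C₂ * √C₁ * (c ^ 2) ^ (1 / q).toReal ≤ C₂ * √C₁ * c := by gcongr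
        _ ≤ _ := by gcongr; linarith

theorem anisoNorm_top_le {q : ℝ≥0∞} {i : Fin d} {T : ℝ} {F : ℝ → Sp d → ℂ} {U : ℝ → ℝ≥0∞}
    (h : ∀ t ∈ Set.Icc (-T) T, ∀ x, ‖F t x‖ₑ ≤ U (x i)) :
    anisoNorm q ⊤ i T F ≤ eLpNorm U q volume := by
  unfold anisoNorm
  refine eLpNorm_mono_enorm fun s => ?_
  simp only [enorm_eq_self]
  rw [eLpNorm_exponent_top]
  refine eLpNormEssSup_le_of_ae_enorm_bound ?_
  have h1 : ∀ᵐ z : ({j : Fin d // j ≠ i} → ℝ) × ℝ ∂(volume.prod (volume.restrict (timeI T))),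
      z.2 ∈ timeI T :=
    Measure.quasiMeasurePreserving_snd.ae (ae_restrict_mem measurableSet_Icc)
  filter_upwards [h1] with z hz
  refine (h z.2 hz _).trans ?_
  simp

theorem aestronglyMeasurable_of_isTempered {ψ : Sp d → ℂ} (hψ : IsTempered ψ) :
    AEStronglyMeasurable ψ volume := by
  obtain ⟨N, hN⟩ := hψ
  have h1 : Continuous fun x : Sp d => (1 + ‖x‖) ^ N := by fun_prop
  have := h1.aestronglyMeasurable (μ := volume).smul hN.1
  refine this.congr (Filter.Eventually.of_forall fun y => ?_)
  simp only [Pi.smul_apply']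
  rw [smul_smul, mul_inv_cancel₀ (by positivity), one_smul]

theorem continuous_multKernel_sigma {η : ℝ → ℝ} (hη : IsUniformBump η) (k : Fin d → ℤ) :
    Continuous (multKernel fun ξ : Sp d => (sigma η k ξ : ℂ)) :=
  (multKernel_schwartz _ (contDiff_sigma hη k) (hasCompactSupport_sigma hη k)).1

theorem aestronglyMeasurable_box {η : ℝ → ℝ} (hη : IsUniformBump η) (k : Fin d → ℤ) {ψ : Sp d → ℂ}
    (hψ : AEStronglyMeasurable ψ volume) : AEStronglyMeasurable (box η k ψ) volume := by
  have hc := continuous_multKernel_sigma hη k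
  have h1 : Continuous fun p : Sp d × Sp d =>
      multKernel (fun ξ : Sp d => (sigma η k ξ : ℂ)) (p.1 - p.2) := by fun_prop
  have h2 : AEStronglyMeasurable (fun p : Sp d × Sp d =>
      multKernel (fun ξ : Sp d => (sigma η k ξ : ℂ)) (p.1 - p.2) * ψ p.2)
      (volume.prod volume) := h1.aestronglyMeasurable.mul hψ.comp_snd
  exact h2.integral_prod_right'

theorem boxU_eq {η : ℝ → ℝ} (hη : IsUniformBump η) {c : ℝ} (hc : 1 ≤ c) (k : Fin d → ℤ)
    {ψ : Sp d → ℂ} (hψ : IsTempered ψ) (t : ℝ) (x : Sp d) :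
    boxU η c k ψ t x =
      (((2 * Real.pi) ^ d)⁻¹ : ℝ) * ∫ z, ker 0 c (kvec k) t (x - z) * box η k ψ z := by
  rw [← mult_eq_integral_ker_mul_box hη (by simp) hc k t hψ x, boxU]
  congr 1
  ext ξ
  simp

/-- A maximal bound for the waves gives one for the free evolution. -/
theorem exists_anisoNorm_boxU_le (d : ℕ) : ∃ B : ℝ, 0 < B ∧ ∀ (η : ℝ → ℝ), IsUniformBump η →
    ∀ (q : ℝ≥0∞) (c T K : ℝ) (k : Fin d → ℤ) (i : Fin d), 1 ≤ c → 0 < T → 0 < K →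
    (∀ Ψ : Lp ℂ 2 (volume : Measure (Sp d)),
      eLpNorm (maxInner (slabWave 0 c (kvec k) i T) Ψ) q volume ≤ ENNReal.ofReal K * ‖Ψ‖ₑ) →
    ∀ ψ : Sp d → ℂ, IsTempered ψ →
      anisoNorm q ⊤ i T (boxU η c k ψ) ≤ ENNReal.ofReal (B * K) * eLpNorm (box η k ψ) 2 volume := by
  obtain ⟨B, hB, hS⟩ := exists_ker_schur d
  refine ⟨√B, by positivity, fun η hη q c T K k i hc hT hK hmax ψ hψ => ?_⟩
  by_cases hfin : eLpNorm (box η k ψ) 2 volume = ⊤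
  · rw [hfin, ENNReal.mul_top (by rw [Ne, ENNReal.ofReal_eq_zero, not_le]; positivity)]; exact le_top
  have hmem : MemLp (box η k ψ) 2 volume :=
    ⟨aestronglyMeasurable_box hη k (aestronglyMeasurable_of_isTempered hψ),
      lt_top_iff_ne_top.2 hfin⟩
  obtain ⟨C, -, hC⟩ := norm_wave_le d
  have hcw : Continuous fun z : Sp d => wave 0 c (kvec k) (0, z) :=
    (continuous_wave 0 c (kvec k)).comp (f := fun z : Sp d => ((0 : ℝ), z)) (by fun_prop)
  obtain ⟨Ψ, hΨ, hin⟩ := exists_synthesis (μ := volume) hcw.stronglyMeasurable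
    (fun z => hC 0 c (kvec k) (0, z) (by linarith) (by simp)) hB.le (fun z => by
      simp only [inner_wave, sub_self]
      rw [lintegral_sub_left_eq_self (fun z' => ‖ker 0 c (kvec k) 0 z'‖ₑ) z]
      exact hS 0 c (kvec k) (by simp)) hmem
  have hpt : ∀ t ∈ Set.Icc (-T) T, ∀ x,
      ‖boxU η c k ψ t x‖ₑ ≤ maxInner (slabWave 0 c (kvec k) i T) Ψ (x i) := by
    intro t ht x
    obtain ⟨z, hz⟩ := exists_slabWave_eq 0 c (kvec k) i hT ht x
    have h1 := enorm_inner_le_maxInner (continuous_slabWave 0 c (kvec k) i T) Ψ (x i) z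
    refine le_trans ?_ h1
    rw [hz, hin, boxU_eq hη hc k hψ, enorm_mul]
    simp only [inner_wave, sub_zero]
    have h2 : ‖((((2 * Real.pi) ^ d)⁻¹ : ℝ) : ℂ)‖ₑ ≤ 1 := by
      rw [← ofReal_norm, Complex.norm_real, Real.norm_of_nonneg (by positivity)]
      refine ENNReal.ofReal_le_one.2 (inv_le_one_of_one_le₀ (one_le_pow₀ ?_))
      linarith [Real.pi_gt_three]
    simp only [mul_comm (box η k ψ _)]
    exact mul_le_of_le_one_left' h2
  refine (anisoNorm_top_le hpt).trans ((hmax Ψ).trans ?_)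
  refine (mul_le_mul_right hΨ _).trans (le_of_eq ?_)
  rw [← mul_assoc, ← ENNReal.ofReal_mul hK.le, mul_comm K]

/-- The maximal function estimate for high frequencies. -/
theorem free_estimate_high (hd : 2 ≤ d) {η : ℝ → ℝ} (hη : IsUniformBump η) (q : ℝ≥0∞) (hq : 2 ≤ q)
    (hqd : 4 / (d : ℝ≥0∞) < q) (M : ℝ) (hM : 0 < M) :
    ∃ C : ℝ, 0 < C ∧ ∀ (c : ℝ), 1 ≤ c → ∀ T : ℝ, 0 < T → T ≤ M * c ^ 2 →
      ∀ (k : Fin d → ℤ) (i : Fin d) (ψ : Sp d → ℂ), IsTempered ψ →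
        anisoNorm q ⊤ i T (boxU η c k ψ) ≤
          ENNReal.ofReal (C * c * jap (latNorm k) ^ (1 / q).toReal) *
            eLpNorm (box η k ψ) 2 volume := by
  obtain ⟨B, hB, h⟩ := exists_anisoNorm_boxU_le d
  obtain ⟨C, hC, h1⟩ := exists_maximal_bound (by omega : 0 < d) q hq hqd M hM
  refine ⟨B * C, by positivity, fun c hc T hT hTM k i ψ hψ => ?_⟩
  have hj := one_le_jap (latNorm k)
  have := h η hη q c T (C * c * jap (latNorm k) ^ (1 / q).toReal) k i hc hT (by positivity)
    (fun Ψ => by rw [latNorm_eq]; exact h1 0 c (kvec k) i T Ψ (by simp) hc hT hTM) ψ hψ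
  refine this.trans (le_of_eq ?_)
  congr 2; ring

/-- The dispersive bound is uniform in time and needs no power of c; the factor c is given away to
match the other regimes. -/
theorem free_estimate_low (hd : 2 ≤ d) {η : ℝ → ℝ} (hη : IsUniformBump η) (q : ℝ≥0∞) (hq : 2 ≤ q)
    (hqd : 4 / (d : ℝ≥0∞) < q) :
    ∃ C : ℝ, 0 < C ∧ ∀ (c : ℝ), 1 ≤ c → 1 ≤ delta d * c → ∀ T : ℝ, 0 < T →
      ∀ (k : Fin d → ℤ), latNorm k ≤ delta d * c → ∀ (i : Fin d) (ψ : Sp d → ℂ), IsTempered ψ →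
        anisoNorm q ⊤ i T (boxU η c k ψ) ≤
          ENNReal.ofReal (C * c * jap (latNorm k) ^ (1 / q).toReal) *
            eLpNorm (box η k ψ) 2 volume := by
  obtain ⟨B, hB, h⟩ := exists_anisoNorm_boxU_le d
  obtain ⟨C, hC, h1⟩ := exists_maximal_dispersive (by omega : 0 < d) q hq hqd
  refine ⟨B * C, by positivity, fun c hc hδc T hT k hk i ψ hψ => ?_⟩
  have hj := one_le_jap (latNorm k)
  have := h η hη q c T (C * jap (latNorm k) ^ (1 / q).toReal) k i hc hT (by positivity)
    (fun Ψ => by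
      rw [latNorm_eq] at hk ⊢
      exact h1 0 c (kvec k) i T Ψ (by simp) hc hT (Or.inl ⟨hδc, hk⟩)) ψ hψ
  refine this.trans ?_
  gcongr ENNReal.ofReal ?_ * _
  rw [mul_assoc, mul_assoc]
  gcongr
  exact le_mul_of_one_le_left (by positivity) hc

theorem threshold_le (c : ℝ) : threshold c ≤ 10 + Real.logb 2 c := by
  have h1 := Int.le_ceil (Real.logb 2 ((c ^ 2)⁻¹))
  have h2 : Real.logb 2 ((c ^ 2)⁻¹) = -(2 * Real.logb 2 c) := by
    rw [Real.logb_inv, Real.logb_pow]; norm_num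
  unfold threshold
  linarith

theorem ten_le_threshold {c : ℝ} (hc : 1 ≤ c) : 10 ≤ threshold c := by
  have h1 : ⌈Real.logb 2 ((c ^ 2)⁻¹)⌉ ≤ 0 := by
    rw [Int.ceil_le, Real.logb_inv]
    have := Real.logb_nonneg (b := 2) (by norm_num) (one_le_pow₀ hc : 1 ≤ c ^ 2)
    push_cast; linarith
  have h2 : ((⌈Real.logb 2 ((c ^ 2)⁻¹)⌉ : ℤ) : ℝ) ≤ 0 := by exact_mod_cast h1
  unfold threshold
  linarith

/-- The threshold grows only logarithmically in c. With ε = `delta d` this puts all low frequencies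
into the dispersive range once c is large. -/
theorem exists_threshold_le (a ε : ℝ) (ha : 0 < a) (hε : 0 < ε) :
    ∃ c₀ : ℝ, 1 ≤ c₀ ∧ ∀ c, c₀ ≤ c → a * threshold c ≤ ε * c := by
  have h1 : Filter.Tendsto (fun c : ℝ => Real.log c / c) Filter.atTop (nhds 0) := by
    simpa using (Real.tendsto_pow_log_div_mul_add_atTop 1 0 1 one_ne_zero)
  have h2 : Filter.Tendsto (fun c : ℝ => a * (10 * c⁻¹ + (Real.log c / c) / Real.log 2))
      Filter.atTop (nhds (a * (10 * 0 + 0 / Real.log 2))) :=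
    ((tendsto_inv_atTop_zero.const_mul 10).add (h1.div_const _)).const_mul a
  have h3 := h2.eventually_le_const (u := ε) (by simpa using hε)
  obtain ⟨c₀, h4⟩ := Filter.eventually_atTop.1 h3
  refine ⟨max 1 c₀, le_max_left _ _, fun c hc => ?_⟩
  have hc1 : 1 ≤ c := (le_max_left _ _).trans hc
  have h5 := h4 c ((le_max_right _ _).trans hc)
  have h6 := threshold_le c
  have hc0 : 0 < c := by linarith
  calc a * threshold c ≤ a * (10 + Real.logb 2 c) := by gcongr
    _ = a * (10 * c⁻¹ + (Real.log c / c) / Real.log 2) * c := by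
        rw [Real.logb]; field_simp
    _ ≤ ε * c := by gcongr

end MaxFun

/-! ### Weakly singular kernels and the square function in time -/

namespace MaxFun

variable {d : ℕ}

section Singular

/-- The weakly singular kernel `|x|^{θ-1}`. -/
noncomputable def sing (θ x : ℝ) : ℝ≥0∞ := ENNReal.ofReal |x| ^ (θ - 1)

theorem measurable_sing (θ : ℝ) : Measurable (sing θ) := by unfold sing; fun_prop

theorem sing_eq {θ x : ℝ} (hx : x ≠ 0) : sing θ x = ENNReal.ofReal (|x| ^ (θ - 1)) :=
  ENNReal.ofReal_rpow_of_pos (abs_pos.2 hx)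

theorem lintegral_sing_lt_top {θ : ℝ} (hθ : 0 < θ) :
    ∫⁻ x in Set.Icc (-1 : ℝ) 1, sing θ x < ⊤ := by
  have h1 : ∫⁻ x in Set.Ioc (0 : ℝ) 1, sing θ x < ⊤ := by
    have h2 : IntegrableOn (fun x : ℝ => x ^ (θ - 1)) (Set.Ioc 0 1) :=
      (intervalIntegrable_iff_integrableOn_Ioc_of_le zero_le_one).1
        (intervalIntegral.intervalIntegrable_rpow' (by linarith))
    refine lt_of_eq_of_lt (setLIntegral_congr_fun measurableSet_Ioc fun x hx => ?_) h2.2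
    simp only
    rw [sing_eq hx.1.ne', abs_of_pos hx.1, ← ofReal_norm, Real.norm_of_nonneg]
    exact Real.rpow_nonneg hx.1.le _
  have h3 : ∫⁻ x in Set.Ico (-1 : ℝ) 0, sing θ x < ⊤ := by
    have h4 : ∫⁻ x in Set.Ico (-1 : ℝ) 0, sing θ x = ∫⁻ x in Set.Ioc (0 : ℝ) 1, sing θ x := by
      rw [← (Measure.measurePreserving_neg (volume : Measure ℝ)).setLIntegral_comp_preimage
        measurableSet_Ioc (measurable_sing θ)]
      simp [sing]
    rw [h4]; exact h1
  have h5 : Set.Icc (-1 : ℝ) 1 ⊆ (Set.Ico (-1) 0 ∪ {0}) ∪ Set.Ioc 0 1 := by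
    intro x hx
    rcases lt_trichotomy x 0 with h | h | h
    · exact Or.inl (Or.inl ⟨hx.1, h⟩)
    · exact Or.inl (Or.inr h)
    · exact Or.inr ⟨h, hx.2⟩
  refine (lintegral_mono_set h5).trans_lt ((lintegral_union_le _ _ _).trans_lt ?_)
  refine ENNReal.add_lt_top.2 ⟨(lintegral_union_le _ _ _).trans_lt ?_, h1⟩
  refine ENNReal.add_lt_top.2 ⟨h3, ?_⟩
  simp

/-- Within distance 1 of the singularity the kernel is integrable, and elsewhere it is at most 1.
The bound does not depend on where the singularity lies, which matters because its position will
vary with the other variable. -/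
theorem exists_setLIntegral_sing_le {θ : ℝ} (hθ : 0 < θ) (hθ1 : θ < 1) : ∃ L : ℝ, 0 < L ∧
    ∀ (b : ℝ) (s : Set ℝ), ∫⁻ x in s, sing θ (x - b) ≤ ENNReal.ofReal L + volume s := by
  set L₀ := ∫⁻ x in Set.Icc (-1 : ℝ) 1, sing θ x with hL₀
  have hfin : L₀ < ⊤ := lintegral_sing_lt_top hθ
  refine ⟨L₀.toReal + 1, by positivity, fun b s => ?_⟩
  have h1 : ∀ x, sing θ (x - b) ≤ (Set.Icc (-1 : ℝ) 1).indicator (sing θ) (x - b) + 1 := by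
    intro x
    by_cases hx : x - b ∈ Set.Icc (-1 : ℝ) 1
    · rw [Set.indicator_of_mem hx]; exact le_self_add
    · rw [Set.indicator_of_notMem hx, zero_add]
      refine ENNReal.rpow_le_one_of_one_le_of_neg ?_ (by linarith)
      rw [ENNReal.one_le_ofReal]
      by_contra h
      exact hx (abs_le.1 (not_le.1 h).le)
  calc ∫⁻ x in s, sing θ (x - b)
      ≤ ∫⁻ x in s, ((Set.Icc (-1 : ℝ) 1).indicator (sing θ) (x - b) + 1) := lintegral_mono h1
    _ ≤ L₀ + volume s := by
        rw [lintegral_add_right _ measurable_const]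
        refine add_le_add ?_ (by simp)
        refine (setLIntegral_le_lintegral _ _).trans (le_of_eq ?_)
        rw [lintegral_sub_right_eq_self (fun x => (Set.Icc (-1 : ℝ) 1).indicator (sing θ) x) b,
          lintegral_indicator measurableSet_Icc]
    _ ≤ _ := by
        gcongr
        rw [ENNReal.ofReal_add (by positivity) zero_le_one, ENNReal.ofReal_toReal hfin.ne]
        exact le_self_add

/-- Interpolation between the trivial bound 2R and the oscillatory bound 2/|Δ|. The loss R^θ buys a
singularity |Δ|^{θ-1} that is integrable, unlike |Δ|^{-1}. At Δ = 0 the right side is infinite. -/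
theorem enorm_integral_exp_le {θ R : ℝ} (hθ : 0 < θ) (hθ1 : θ < 1) (hR : 0 < R) (Δ : ℝ) :
    ‖∫ t in Set.Icc (-R) R, Complex.exp (Complex.I * ((t * Δ : ℝ) : ℂ))‖ₑ ≤
      ENNReal.ofReal (2 * R ^ θ) * sing θ Δ := by
  have hRθ : 0 < 2 * R ^ θ := by positivity
  rcases eq_or_ne Δ 0 with rfl | hΔ
  · have : sing θ 0 = ⊤ := by
      unfold sing
      rw [abs_zero, ENNReal.ofReal_zero, ENNReal.zero_rpow_of_neg (by linarith)]
    rw [this, ENNReal.mul_top (by simpa using hRθ)]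
    exact le_top
  have hΔ0 : 0 < |Δ| := abs_pos.2 hΔ
  rw [sing_eq hΔ, ← ENNReal.ofReal_mul hRθ.le, ← ofReal_norm]
  refine ENNReal.ofReal_le_ofReal ?_
  have hint : ∫ t in Set.Icc (-R) R, Complex.exp (Complex.I * ((t * Δ : ℝ) : ℂ)) =
      ∫ t in (-R)..R, Complex.exp ((Complex.I * Δ) * t) := by
    rw [integral_Icc_eq_integral_Ioc, intervalIntegral.integral_of_le (by linarith)]
    refine integral_congr_ae (Filter.Eventually.of_forall fun t => ?_)
    simp only
    congr 1; push_cast; ring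
  have hone : ∀ t : ℝ, ‖Complex.exp ((Complex.I * Δ) * t)‖ = 1 := fun t => by
    rw [mul_assoc, ← Complex.ofReal_mul, mul_comm, Complex.norm_exp_ofReal_mul_I]
  rw [hint]
  rcases le_total R |Δ|⁻¹ with h | h
  · have h1 := intervalIntegral.norm_integral_le_of_norm_le_const (a := -R) (b := R)
      (f := fun t : ℝ => Complex.exp ((Complex.I * Δ) * t)) (C := 1) (fun t _ => (hone t).le)
    rw [one_mul, abs_of_nonneg (by linarith)] at h1
    calc _ ≤ R - -R := h1
      _ = 2 * (R ^ θ * R ^ (1 - θ)) := by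
          rw [← Real.rpow_add hR, add_sub_cancel, Real.rpow_one]; ring
      _ ≤ 2 * (R ^ θ * |Δ|⁻¹ ^ (1 - θ)) := by gcongr
      _ = _ := by
          rw [Real.inv_rpow hΔ0.le, ← Real.rpow_neg hΔ0.le, neg_sub, mul_assoc]
  · have hc : Complex.I * (Δ : ℂ) ≠ 0 := mul_ne_zero Complex.I_ne_zero (by exact_mod_cast hΔ)
    rw [integral_exp_mul_complex hc, norm_div, norm_mul, Complex.norm_I, one_mul,
      Complex.norm_real, Real.norm_eq_abs]
    have h2 : |Δ|⁻¹ ^ θ ≤ R ^ θ := by gcongr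
    calc _ ≤ 2 / |Δ| := by
          gcongr
          refine (norm_sub_le _ _).trans ?_
          rw [hone, hone, one_add_one_eq_two]
      _ = 2 * (|Δ|⁻¹ ^ θ * |Δ| ^ (θ - 1)) := by
          rw [Real.inv_rpow hΔ0.le, ← Real.rpow_neg hΔ0.le, ← Real.rpow_add hΔ0]
          have : -θ + (θ - 1) = -1 := by ring
          rw [this, Real.rpow_neg_one]; ring
      _ ≤ 2 * (R ^ θ * |Δ| ^ (θ - 1)) := by gcongr
      _ = _ := by ring

/-- The square function in time of an oscillatory integral, via its expansion as a double
integral. -/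
theorem lintegral_osc_sq_le {θ R : ℝ} (hθ : 0 < θ) (hθ1 : θ < 1) (hR : 0 < R) {H : ℝ → ℂ}
    (hH : Integrable H) {φ : ℝ → ℝ} (hφ : Continuous φ) :
    ∫⁻ t in Set.Icc (-R) R, ‖∫ s, H s * Complex.exp (Complex.I * ((t * φ s : ℝ) : ℂ))‖ₑ ^ 2 ≤
      ENNReal.ofReal (2 * R ^ θ) * ∫⁻ s, ∫⁻ s', ‖H s‖ₑ * ‖H s'‖ₑ * sing θ (φ s - φ s') := by
  set f : ℝ → ℂ := fun t => ∫ s, H s * Complex.exp (Complex.I * ((t * φ s : ℝ) : ℂ)) with hf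
  set μ := (volume : Measure ℝ).restrict (Set.Icc (-R) R) with hμ
  have hnexp : ∀ x : ℝ, ‖Complex.exp (Complex.I * (x : ℂ))‖ = 1 := fun x => by
    rw [mul_comm, Complex.norm_exp_ofReal_mul_I]
  have hsq : ∀ t, ((‖f t‖ ^ 2 : ℝ) : ℂ) = ∫ p : ℝ × ℝ, H p.1 * (starRingEnd ℂ) (H p.2) *
      Complex.exp (Complex.I * ((t * (φ p.1 - φ p.2) : ℝ) : ℂ)) ∂(volume.prod volume) := fun t => by
    have h1 : ((‖f t‖ ^ 2 : ℝ) : ℂ) = f t * (starRingEnd ℂ) (f t) := by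
      rw [Complex.mul_conj, Complex.normSq_eq_norm_sq]
    rw [h1, hf]
    simp only
    rw [← integral_conj, ← integral_prod_mul]
    refine integral_congr_ae (Filter.Eventually.of_forall fun p => ?_)
    simp only [map_mul, ← Complex.exp_conj, Complex.conj_I, Complex.conj_ofReal]
    rw [mul_mul_mul_comm, ← Complex.exp_add]
    congr 2
    push_cast; ring
  have hHH : Integrable (fun p : ℝ × ℝ => H p.1 * (starRingEnd ℂ) (H p.2))
      (volume.prod volume) := hH.mul_prod (by
        have := (Complex.conjCLE : ℂ →L[ℝ] ℂ).integrable_comp hH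
        exact this)
  have hfub : Integrable (Function.uncurry fun (t : ℝ) (p : ℝ × ℝ) =>
      H p.1 * (starRingEnd ℂ) (H p.2) *
        Complex.exp (Complex.I * ((t * (φ p.1 - φ p.2) : ℝ) : ℂ))) (μ.prod (volume.prod volume)) := by
    have h1 : Integrable (fun x : ℝ × (ℝ × ℝ) => (1 : ℂ) * (H x.2.1 * (starRingEnd ℂ) (H x.2.2)))
        (μ.prod (volume.prod volume)) := (integrable_const (1 : ℂ)).mul_prod hHH
    refine h1.mono ?_ (Filter.Eventually.of_forall fun x => ?_)
    · have h2 := h1.aestronglyMeasurable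
      simp only [one_mul] at h2
      refine h2.mul (Continuous.aestronglyMeasurable ?_)
      fun_prop
    · simp only [Function.uncurry, norm_mul, hnexp]
      simp
  have hfc : Continuous f := by
    refine continuous_of_dominated (bound := fun s => ‖H s‖) (fun t => ?_) (fun t => ?_) hH.norm ?_
    · exact hH.aestronglyMeasurable.mul (Continuous.aestronglyMeasurable (by fun_prop))
    · refine Filter.Eventually.of_forall fun s => ?_
      rw [norm_mul, hnexp, mul_one]
    · exact Filter.Eventually.of_forall fun s => by fun_prop
  have hfi : Integrable (fun t => ‖f t‖ ^ 2) μ := by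
    have : Continuous fun t => ‖f t‖ ^ 2 := by fun_prop
    exact this.integrableOn_Icc
  have hL : ∫⁻ t, ‖f t‖ₑ ^ 2 ∂μ = ‖∫ t, ((‖f t‖ ^ 2 : ℝ) : ℂ) ∂μ‖ₑ := by
    rw [integral_complex_ofReal, ← ofReal_norm, Complex.norm_real, Real.norm_of_nonneg
      (integral_nonneg fun t => by positivity), ofReal_integral_eq_lintegral_ofReal hfi
      (Filter.Eventually.of_forall fun t => by positivity)]
    refine lintegral_congr fun t => ?_
    rw [ENNReal.ofReal_pow (norm_nonneg _), ofReal_norm]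
  rw [hL]
  simp only [hsq]
  rw [integral_integral_swap hfub]
  refine (enorm_integral_le_lintegral_enorm _).trans ?_
  have hm : AEMeasurable (fun p : ℝ × ℝ => ‖H p.1‖ₑ * ‖H p.2‖ₑ * sing θ (φ p.1 - φ p.2))
      (volume.prod volume) := by
    have h1 : AEMeasurable (fun p : ℝ × ℝ => ‖H p.1‖ₑ) (volume.prod volume) :=
      hH.aestronglyMeasurable.comp_fst.enorm
    have h2 : AEMeasurable (fun p : ℝ × ℝ => ‖H p.2‖ₑ) (volume.prod volume) :=
      hH.aestronglyMeasurable.comp_snd.enorm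
    have h3 : Measurable fun p : ℝ × ℝ => sing θ (φ p.1 - φ p.2) :=
      (measurable_sing θ).comp (by fun_prop)
    exact (h1.mul h2).mul h3.aemeasurable
  calc ∫⁻ p : ℝ × ℝ, ‖∫ t, H p.1 * (starRingEnd ℂ) (H p.2) *
        Complex.exp (Complex.I * ((t * (φ p.1 - φ p.2) : ℝ) : ℂ)) ∂μ‖ₑ ∂(volume.prod volume)
      ≤ ∫⁻ p : ℝ × ℝ, ENNReal.ofReal (2 * R ^ θ) *
          (‖H p.1‖ₑ * ‖H p.2‖ₑ * sing θ (φ p.1 - φ p.2)) ∂(volume.prod volume) := by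
        refine lintegral_mono fun p => ?_
        rw [integral_const_mul, enorm_mul, enorm_mul, RCLike.enorm_conj]
        refine (mul_le_mul_right (enorm_integral_exp_le hθ hθ1 hR _) _).trans (le_of_eq ?_)
        ring
    _ = ENNReal.ofReal (2 * R ^ θ) *
          ∫⁻ s, ∫⁻ s', ‖H s‖ₑ * ‖H s'‖ₑ * sing θ (φ s - φ s') := by
        rw [lintegral_const_mul' _ _ ENNReal.ofReal_ne_top, lintegral_prod _ hm]

theorem sing_anti {θ x y : ℝ} (hθ : θ ≤ 1) (h : |x| ≤ |y|) : sing θ y ≤ sing θ x := by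
  have h1 : θ - 1 = -(1 - θ) := by ring
  unfold sing
  rw [h1, ENNReal.rpow_neg, ENNReal.rpow_neg]
  exact ENNReal.inv_le_inv.2 (ENNReal.rpow_le_rpow (ENNReal.ofReal_le_ofReal h) (by linarith))

theorem sing_mul (θ x y : ℝ) : sing θ (x * y) = sing θ x * sing θ y := by
  unfold sing
  rw [abs_mul, ENNReal.ofReal_mul (abs_nonneg x), ENNReal.mul_rpow_of_ne_top (by simp) (by simp)]

/-- Lower bound for the phase difference of the quartic dispersion relation in one variable. -/
theorem phase_diff_lower {c κ r s s' Δ : ℝ} (hc : 0 < c) (hκ : 1 ≤ |κ|)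
    (hs : |s - κ| ≤ 5 / 6) (hs' : |s' - κ| ≤ 5 / 6)
    (hΔ : Δ = (s ^ 2 - s' ^ 2) * (1 - (2 * r + s ^ 2 + s' ^ 2) / c ^ 2)) :
    |κ ^ 2 / (18 * c ^ 2) * ((s - s') *
      (s + s' - SignType.sign κ * √(max 0 (2 * c ^ 2 - 4 * r - (s - s') ^ 2))))| ≤ |Δ| := by
  set z := √(max 0 (2 * c ^ 2 - 4 * r - (s - s') ^ 2)) with hz
  set E := 2 * c ^ 2 - 4 * r - (s - s') ^ 2 with hE
  have hz0 : 0 ≤ z := Real.sqrt_nonneg _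
  have hz2 : z ^ 2 = max 0 E := Real.sq_sqrt (le_max_left _ _)
  set S := s + s' with hS
  -- In the variables s - s' and S = s + s' the zeros become explicit: s = s', S = 0 and S² = E. The
  -- second is excluded because |S| ≥ |κ|/3, and the sign of κ decides which root of the third S can
  -- meet.
  have hΔ2 : Δ = (s - s') * S * ((E - S ^ 2) / (2 * c ^ 2)) := by
    rw [hΔ, hE, hS]; field_simp; ring
  rw [abs_le] at hs hs'
  -- the sum has the sign of `κ` and size at least `|κ| / 3`
  have hSκ : |κ| / 3 ≤ |S| ∧ |S - SignType.sign κ * z| = |(|S|) - z| := by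
    rcases lt_trichotomy κ 0 with h | h | h
    · rw [abs_of_neg h] at hκ ⊢
      have hS0 : S < 0 := by rw [hS]; linarith
      rw [abs_of_neg hS0, sign_neg h]
      refine ⟨by rw [hS]; linarith, ?_⟩
      simp only [SignType.coe_neg, SignType.coe_one]
      rw [← abs_neg]; congr 1; ring
    · rw [h, abs_zero] at hκ; linarith
    · rw [abs_of_pos h] at hκ ⊢
      have hS0 : 0 < S := by rw [hS]; linarith
      rw [abs_of_pos hS0, sign_pos h]
      exact ⟨by rw [hS]; linarith, by simp⟩
  obtain ⟨hS1, hS2⟩ := hSκ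
  -- For E ≥ 0 this is a difference of squares. For E ≤ 0 the truncated root z is zero and |E - S²|
  -- ≥ S².
  have hE2 : |(|S|) - z| * |S| ≤ |E - S ^ 2| := by
    have hSS : S ^ 2 = |S| ^ 2 := (sq_abs S).symm
    rcases le_total 0 E with h | h
    · rw [max_eq_right h] at hz2
      rw [← hz2, hSS, show z ^ 2 - |S| ^ 2 = -((|S| - z) * (|S| + z)) by ring, abs_neg, abs_mul]
      have : |S| ≤ |(|S| + z)| := by
        rw [abs_of_nonneg (by positivity : 0 ≤ |S| + z)]; linarith
      gcongr
    · rw [max_eq_left h] at hz2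
      have hz' : z = 0 := by simpa using hz2
      rw [hz', sub_zero, abs_abs, abs_of_nonpos (by nlinarith [sq_nonneg S] : E - S ^ 2 ≤ 0)]
      nlinarith [abs_nonneg S]
  rw [hΔ2, abs_mul, abs_mul, hS2, abs_of_nonneg (by positivity : 0 ≤ κ ^ 2 / (18 * c ^ 2)),
    abs_mul, abs_mul, abs_div, abs_of_pos (by positivity : 0 < 2 * c ^ 2)]
  have hκ2 : κ ^ 2 = |κ| ^ 2 := (sq_abs κ).symm
  rw [hκ2]
  have h1 : |κ| ^ 2 / 9 * |(|S|) - z| ≤ |S| * |E - S ^ 2| := by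
    calc |κ| ^ 2 / 9 * |(|S|) - z| = |κ| / 3 * (|(|S|) - z| * (|κ| / 3)) := by ring
      _ ≤ |S| * (|(|S|) - z| * |S|) := by gcongr
      _ ≤ _ := by gcongr
  calc |κ| ^ 2 / (18 * c ^ 2) * (|s - s'| * |(|S|) - z|)
      = |s - s'| * (|κ| ^ 2 / 9 * |(|S|) - z|) / (2 * c ^ 2) := by field_simp; ring
    _ ≤ |s - s'| * (|S| * |E - S ^ 2|) / (2 * c ^ 2) := by gcongr
    _ = _ := by ring

/-- In the variables s and p = s - s' the lower bound for the phase difference is a multiple of |p|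
· |2s - p - ζ(p)|. For fixed p the second factor has a single integrable singularity in s, and the
first is then integrable in p. Homogeneity of `sing` extracts κ²/c². -/
theorem exists_double_sing_le {θ : ℝ} (hθ : 0 < θ) (hθ1 : θ < 1) : ∃ C : ℝ, 0 < C ∧
    ∀ (c κ r A : ℝ) (H : ℝ → ℂ) (φ : ℝ → ℝ), 0 < c → 1 ≤ |κ| → 0 ≤ A →
      (∀ s, ‖H s‖ ≤ A) → (∀ s, 5 / 6 < |s - κ| → H s = 0) →
      (∀ s s', φ s - φ s' = (s ^ 2 - s' ^ 2) * (1 - (2 * r + s ^ 2 + s' ^ 2) / c ^ 2)) →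
      ∫⁻ s, ∫⁻ s', ‖H s‖ₑ * ‖H s'‖ₑ * sing θ (φ s - φ s') ≤
        ENNReal.ofReal (C * A ^ 2 * (κ ^ 2 / c ^ 2) ^ (θ - 1)) := by
  obtain ⟨L, hL, hsing⟩ := exists_setLIntegral_sing_le hθ hθ1
  refine ⟨18 ^ (1 - θ) * ((L + 4) * (L + 2)), by positivity, ?_⟩
  intro c κ r A H φ hc hκ hA hHA hH0 hφ
  set I := Set.Icc (κ - 1) (κ + 1) with hI
  set J := Set.Icc (-2 : ℝ) 2 with hJ
  set ζ : ℝ → ℝ := fun p => SignType.sign κ * √(max 0 (2 * c ^ 2 - 4 * r - p ^ 2)) with hζ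
  have hζm : Measurable ζ := by rw [hζ]; fun_prop
  set K := κ ^ 2 / (18 * c ^ 2) with hK
  have hκ0 : 0 < κ ^ 2 := by rw [← sq_abs]; positivity
  have hK0 : 0 < K := by positivity
  set g : ℝ → ℝ → ℝ≥0∞ := fun s p => J.indicator (sing θ) p *
    I.indicator (fun s => sing θ (s - (p + ζ p) / 2)) s with hg
  have hgm : Measurable (Function.uncurry g) := by
    have h1 : Measurable fun x : ℝ × ℝ => J.indicator (sing θ) x.2 :=
      ((measurable_sing θ).indicator measurableSet_Icc).comp measurable_snd
    have h2 : Measurable fun x : ℝ × ℝ => sing θ (x.1 - (x.2 + ζ x.2) / 2) :=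
      (measurable_sing θ).comp (by fun_prop)
    have h3 := h2.indicator (measurable_fst (measurableSet_Icc : MeasurableSet I))
    exact h1.mul h3
  have hpt : ∀ s s', ‖H s‖ₑ * ‖H s'‖ₑ * sing θ (φ s - φ s') ≤
      ENNReal.ofReal (A ^ 2 * K ^ (θ - 1)) * g s (s - s') := by
    intro s s'
    by_cases hs : 5 / 6 < |s - κ|
    · simp [hH0 s hs]
    by_cases hs' : 5 / 6 < |s' - κ|
    · simp [hH0 s' hs']
    rw [not_lt] at hs hs'
    have h1 := phase_diff_lower hc hκ hs hs' (hφ s s')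
    have h2 := sing_anti (θ := θ) hθ1.le h1
    rw [sing_mul, sing_mul] at h2
    have hHe : ∀ s, ‖H s‖ₑ ≤ ENNReal.ofReal A := fun s => by
      rw [← ofReal_norm]; exact ENNReal.ofReal_le_ofReal (hHA s)
    rw [abs_le] at hs hs'
    have hg' : g s (s - s') = sing θ (s - s') * sing θ (s - ((s - s') + ζ (s - s')) / 2) := by
      simp only [hg]
      rw [Set.indicator_of_mem (show s - s' ∈ J from ⟨by linarith, by linarith⟩),
        Set.indicator_of_mem (show s ∈ I from ⟨by linarith, by linarith⟩)]
    have h3 : sing θ (s + s' - ζ (s - s')) ≤ sing θ (s - ((s - s') + ζ (s - s')) / 2) := by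
      refine sing_anti hθ1.le ?_
      have : s + s' - ζ (s - s') = 2 * (s - ((s - s') + ζ (s - s')) / 2) := by ring
      rw [this, abs_mul, abs_two]
      linarith [abs_nonneg (s - ((s - s') + ζ (s - s')) / 2)]
    rw [hg', ENNReal.ofReal_mul (by positivity), ENNReal.ofReal_pow hA, sq]
    have hKs : sing θ K = ENNReal.ofReal (K ^ (θ - 1)) := by
      rw [sing_eq hK0.ne', abs_of_pos hK0]
    rw [mul_assoc (ENNReal.ofReal A * _), ← hKs]
    refine mul_le_mul' (mul_le_mul' (hHe s) (hHe s')) (h2.trans ?_)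
    gcongr
  have hvI : volume I = ENNReal.ofReal 2 := by rw [hI, Real.volume_Icc]; congr 1; ring
  have hvJ : volume J = ENNReal.ofReal 4 := by rw [hJ, Real.volume_Icc]; congr 1; norm_num
  have hgi : ∫⁻ s, ∫⁻ p, g s p ≤ ENNReal.ofReal ((L + 4) * (L + 2)) := by
    rw [lintegral_lintegral_swap hgm.aemeasurable]
    have hin : ∀ p, ∫⁻ s, g s p ≤ J.indicator (sing θ) p * ENNReal.ofReal (L + 2) := fun p => by
      simp only [hg]
      rw [lintegral_const_mul]
      · refine mul_le_mul_right ?_ _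
        rw [lintegral_indicator measurableSet_Icc, ENNReal.ofReal_add hL.le (by norm_num), ← hvI]
        exact hsing _ _
      · exact ((measurable_sing θ).comp (by fun_prop)).indicator measurableSet_Icc
    refine (lintegral_mono hin).trans ?_
    rw [lintegral_mul_const _ ((measurable_sing θ).indicator measurableSet_Icc),
      ENNReal.ofReal_mul (by positivity)]
    refine mul_le_mul_left ?_ _
    rw [lintegral_indicator measurableSet_Icc, ENNReal.ofReal_add hL.le (by norm_num), ← hvJ]
    simpa using hsing 0 J
  calc ∫⁻ s, ∫⁻ s', ‖H s‖ₑ * ‖H s'‖ₑ * sing θ (φ s - φ s')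
      ≤ ∫⁻ s, ∫⁻ s', ENNReal.ofReal (A ^ 2 * K ^ (θ - 1)) * g s (s - s') :=
        lintegral_mono fun s => lintegral_mono fun s' => hpt s s'
    _ = ENNReal.ofReal (A ^ 2 * K ^ (θ - 1)) * ∫⁻ s, ∫⁻ p, g s p := by
        rw [← lintegral_const_mul' _ _ ENNReal.ofReal_ne_top]
        refine lintegral_congr fun s => ?_
        rw [lintegral_const_mul' _ _ ENNReal.ofReal_ne_top,
          lintegral_sub_left_eq_self (fun p => g s p) s]
    _ ≤ ENNReal.ofReal (A ^ 2 * K ^ (θ - 1)) * ENNReal.ofReal ((L + 4) * (L + 2)) := by gcongr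
    _ = _ := by
        rw [← ENNReal.ofReal_mul (by positivity)]
        congr 1
        have : K = 18⁻¹ * (κ ^ 2 / c ^ 2) := by rw [hK]; field_simp
        rw [this, Real.mul_rpow (by positivity) (by positivity), Real.inv_rpow (by positivity),
          ← Real.rpow_neg (by positivity), neg_sub]
        ring

end Singular

end MaxFun

/-! ### Square integrability of the kernel on hyperplanes -/

namespace MaxFun

variable {d : ℕ}

/-- The cutoff in the coordinates other than the `i`-th. -/
noncomputable def sideCut (i : Fin d) (k : Sp d) (y : {j : Fin d // j ≠ i} → ℝ) : ℝ :=
  ∏ j, bump₁ (y j - k j)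

theorem amp_insertCoord (w k : Sp d) (i : Fin d) (σ : ℝ) (y : {j : Fin d // j ≠ i} → ℝ) :
    amp w (insertCoord i σ y - k) =
      sideCut i k y * bump₁ (σ - k i) * (1 + inner ℝ w (insertCoord i σ y - k)) := by
  unfold amp sideCut
  rw [Fintype.prod_eq_mul_prod_subtype_ne _ i]
  simp only [PiLp.sub_apply, insertCoord_self, insertCoord_ne]
  ring

/-- The box of the coordinates other than the `i`-th. -/
def sideBox (i : Fin d) (k : Sp d) : Set ({j : Fin d // j ≠ i} → ℝ) :=
  Set.Icc (fun j => k j - 5 / 6) (fun j => k j + 5 / 6)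

theorem sideCut_eq_zero {i : Fin d} {k : Sp d} {y : {j : Fin d // j ≠ i} → ℝ}
    (hy : y ∉ sideBox i k) : sideCut i k y = 0 := by
  have : ∃ j, 5 / 6 < |y j - k j| := by
    by_contra! h
    refine hy ⟨fun j => ?_, fun j => ?_⟩
    · linarith [(abs_le.1 (h j)).1]
    · linarith [(abs_le.1 (h j)).2]
  obtain ⟨j, hj⟩ := this
  refine Finset.prod_eq_zero (Finset.mem_univ j) (bump₁.zero_of_le_dist ?_)
  rw [dist_zero_right, Real.norm_eq_abs]
  exact hj.le

theorem bump₁_eq_zero {x : ℝ} (hx : 5 / 6 < |x|) : bump₁ x = 0 :=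
  bump₁.zero_of_le_dist (by rw [dist_zero_right, Real.norm_eq_abs]; exact hx.le)

theorem abs_sideCut_le_one (i : Fin d) (k : Sp d) (y : {j : Fin d // j ≠ i} → ℝ) :
    |sideCut i k y| ≤ 1 := by
  unfold sideCut
  rw [Finset.abs_prod]
  refine Finset.prod_le_one (fun j _ => abs_nonneg _) fun j _ => ?_
  rw [abs_of_nonneg bump₁.nonneg]; exact bump₁.le_one

theorem continuous_sideCut (i : Fin d) (k : Sp d) : Continuous (sideCut i k) := by
  have := bump₁.continuous
  unfold sideCut
  fun_prop

/-- The amplitude of the one-dimensional integrals in the `i`-th frequency. -/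
noncomputable def lineAmp (w k : Sp d) (i : Fin d) (s : ℝ) (y : {j : Fin d // j ≠ i} → ℝ) (σ : ℝ) :
    ℂ :=
  ((sideCut i k y * bump₁ (σ - k i) ^ 2 * (1 + inner ℝ w (insertCoord i σ y - k)) ^ 2 : ℝ) : ℂ) *
    Complex.exp (Complex.I * ((s * σ : ℝ) : ℂ))

theorem continuous_lineAmp (w k : Sp d) (i : Fin d) (s : ℝ) :
    Continuous fun p : ({j : Fin d // j ≠ i} → ℝ) × ℝ => lineAmp w k i s p.1 p.2 := by
  have h1 := bump₁.continuous
  have h2 := continuous_sideCut i k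
  have h3 : Continuous fun p : ({j : Fin d // j ≠ i} → ℝ) × ℝ => insertCoord i p.2 p.1 :=
    (continuous_insertCoord i).comp continuous_swap
  unfold lineAmp
  fun_prop

theorem lineAmp_eq_zero_of_lt (w k : Sp d) (i : Fin d) (s : ℝ) (y : {j : Fin d // j ≠ i} → ℝ)
    {σ : ℝ} (h : 5 / 6 < |σ - k i|) : lineAmp w k i s y σ = 0 := by
  simp [lineAmp, bump₁_eq_zero h]

theorem lineAmp_eq_zero_of_notMem (w : Sp d) {k : Sp d} {i : Fin d} (s : ℝ)
    {y : {j : Fin d // j ≠ i} → ℝ} (hy : y ∉ sideBox i k) (σ : ℝ) : lineAmp w k i s y σ = 0 := by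
  simp [lineAmp, sideCut_eq_zero hy]

theorem norm_lineAmp_le {w : Sp d} (hw : ‖w‖ ≤ 1) (k : Sp d) (i : Fin d) (s : ℝ)
    (y : {j : Fin d // j ≠ i} → ℝ) (σ : ℝ) : ‖lineAmp w k i s y σ‖ ≤ (1 + rad d) ^ 2 := by
  have hr := one_le_rad (d := d)
  by_cases hσ : 5 / 6 < |σ - k i|
  · rw [lineAmp_eq_zero_of_lt w k i s y hσ, norm_zero]; positivity
  by_cases hy : y ∈ sideBox i k
  · have hcube : insertCoord i σ y - k ∈ cube d := by
      intro j
      rw [PiLp.sub_apply]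
      by_cases hj : j = i
      · subst hj; rw [insertCoord_self]; exact not_lt.1 hσ
      · have := insertCoord_ne i σ y ⟨j, hj⟩
        simp only at this
        rw [this, abs_le]
        have h1 := hy.1 ⟨j, hj⟩
        have h2 := hy.2 ⟨j, hj⟩
        simp only at h1 h2
        constructor <;> linarith
    have h1 := norm_le_of_mem_cube hcube
    have h2 : |inner ℝ w (insertCoord i σ y - k)| ≤ rad d := by
      refine (abs_real_inner_le_norm _ _).trans ?_
      calc ‖w‖ * ‖insertCoord i σ y - k‖ ≤ 1 * rad d := by gcongr
        _ = _ := one_mul _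
    unfold lineAmp
    rw [norm_mul, mul_comm Complex.I, Complex.norm_exp_ofReal_mul_I, mul_one, Complex.norm_real,
      Real.norm_eq_abs, abs_mul, abs_mul, abs_pow, abs_pow, abs_of_nonneg (bump₁.nonneg)]
    have h3 : |1 + inner ℝ w (insertCoord i σ y - k)| ≤ 1 + rad d := by
      refine (abs_add_le _ _).trans ?_
      rw [abs_one]; gcongr
    calc _ ≤ 1 * 1 ^ 2 * (1 + rad d) ^ 2 := by
          have := abs_sideCut_le_one i k y
          have := bump₁.le_one (x := σ - k i)
          have := bump₁.nonneg (x := σ - k i)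
          gcongr
      _ = _ := by ring
  · rw [lineAmp_eq_zero_of_notMem w s hy, norm_zero]; positivity

theorem continuous_lineAmp_right (w k : Sp d) (i : Fin d) (s : ℝ) (y : {j : Fin d // j ≠ i} → ℝ) :
    Continuous (lineAmp w k i s y) :=
  Continuous.comp (g := fun p : ({j : Fin d // j ≠ i} → ℝ) × ℝ => lineAmp w k i s p.1 p.2)
    (f := fun σ => (y, σ)) (continuous_lineAmp w k i s) (by fun_prop)

theorem continuous_disp_insertCoord (c : ℝ) (i : Fin d) (y : {j : Fin d // j ≠ i} → ℝ) :
    Continuous fun σ => disp c (insertCoord i σ y) :=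
  Continuous.comp (g := fun p : ℝ × ({j : Fin d // j ≠ i} → ℝ) => disp c (insertCoord i p.1 p.2))
    (f := fun σ => (σ, y)) ((continuous_disp c).comp (continuous_insertCoord i)) (by fun_prop)

/-- The partial Fourier transform of the kernel in the directions other than the `i`-th. -/
noncomputable def lineInt (w : Sp d) (c : ℝ) (k : Sp d) (i : Fin d) (s t : ℝ)
    (y : {j : Fin d // j ≠ i} → ℝ) : ℂ :=
  ∫ σ, lineAmp w k i s y σ * Complex.exp (Complex.I * ((t * disp c (insertCoord i σ y) : ℝ) : ℂ))

theorem continuous_lineInt {w : Sp d} (hw : ‖w‖ ≤ 1) (c : ℝ) (k : Sp d) (i : Fin d) (s : ℝ) :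
    Continuous fun p : ℝ × ({j : Fin d // j ≠ i} → ℝ) => lineInt w c k i s p.1 p.2 := by
  have h1 := continuous_lineAmp w k i s
  have h2 := continuous_disp (d := d) c
  have h3 := continuous_insertCoord i
  refine continuous_of_dominated
    (bound := (Set.Icc (k i - 1) (k i + 1)).indicator fun _ => (1 + rad d) ^ 2) ?_ ?_ ?_ ?_
  · intro p
    have h4 := continuous_lineAmp_right w k i s p.2
    have h5 := continuous_disp_insertCoord c i p.2
    exact Continuous.aestronglyMeasurable (by fun_prop)
  · intro p
    refine Filter.Eventually.of_forall fun σ => ?_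
    rw [norm_mul, mul_comm Complex.I, Complex.norm_exp_ofReal_mul_I, mul_one]
    by_cases hσ : σ ∈ Set.Icc (k i - 1) (k i + 1)
    · rw [Set.indicator_of_mem hσ]; exact norm_lineAmp_le hw k i s p.2 σ
    · rw [Set.indicator_of_notMem hσ, lineAmp_eq_zero_of_lt, norm_zero]
      by_contra h
      rw [not_lt, abs_le] at h
      exact hσ ⟨by linarith, by linarith⟩
  · exact (integrable_indicator_iff measurableSet_Icc).2 (integrableOn_const (by simp))
  · refine Filter.Eventually.of_forall fun σ => ?_
    have h4 : Continuous fun p : ℝ × ({j : Fin d // j ≠ i} → ℝ) => lineAmp w k i s p.2 σ :=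
      Continuous.comp (g := fun p : ({j : Fin d // j ≠ i} → ℝ) × ℝ => lineAmp w k i s p.1 p.2)
        (f := fun p : ℝ × ({j : Fin d // j ≠ i} → ℝ) => (p.2, σ)) h1 (by fun_prop)
    have h5 : Continuous fun p : ℝ × ({j : Fin d // j ≠ i} → ℝ) => disp c (insertCoord i σ p.2) :=
      Continuous.comp (g := fun p : ℝ × ({j : Fin d // j ≠ i} → ℝ) => disp c (insertCoord i p.1 p.2))
        (f := fun p : ℝ × ({j : Fin d // j ≠ i} → ℝ) => (σ, p.2)) (h2.comp h3) (by fun_prop)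
    fun_prop

/-- The square function of the partial transform. -/
theorem exists_lintegral_lineInt_sq_le {θ : ℝ} (hθ : 0 < θ) (hθ1 : θ < 1) (d : ℕ) :
    ∃ C : ℝ, 0 < C ∧ ∀ (w : Sp d) (c : ℝ) (k : Sp d) (i : Fin d) (s R : ℝ), ‖w‖ ≤ 1 → 1 ≤ c →
      1 ≤ |k i| → 0 < R →
      ∫⁻ t in Set.Icc (-R) R, ∫⁻ y, ‖lineInt w c k i s t y‖ₑ ^ 2 ≤
        ENNReal.ofReal (C * (R ^ θ * (k i ^ 2 / c ^ 2) ^ (θ - 1))) := by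
  obtain ⟨C, hC, h⟩ := exists_double_sing_le hθ hθ1
  have hr := one_le_rad (d := d)
  refine ⟨2 ^ d * (2 * (C * ((1 + rad d) ^ 2) ^ 2)), by positivity, ?_⟩
  intro w c k i s R hw hc hk hR
  have hc0 : 0 < c := by linarith
  set V := ENNReal.ofReal (2 * R ^ θ) *
    ENNReal.ofReal (C * ((1 + rad d) ^ 2) ^ 2 * (k i ^ 2 / c ^ 2) ^ (θ - 1)) with hV
  have h1 : ∀ y, ∫⁻ t in Set.Icc (-R) R, ‖lineInt w c k i s t y‖ₑ ^ 2 ≤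
      (sideBox i k).indicator (fun _ => V) y := by
    intro y
    by_cases hy : y ∈ sideBox i k
    · rw [Set.indicator_of_mem hy]
      have hcont := continuous_lineAmp_right w k i s y
      have hH : Integrable (lineAmp w k i s y) := by
        refine hcont.integrable_of_hasCompactSupport (HasCompactSupport.intro
          (isCompact_Icc (a := k i - 1) (b := k i + 1)) fun σ hσ => lineAmp_eq_zero_of_lt _ _ _ _ _ ?_)
        by_contra h
        rw [not_lt, abs_le] at h
        exact hσ ⟨by linarith, by linarith⟩
      have hφ := continuous_disp_insertCoord c i y
      refine (lintegral_osc_sq_le hθ hθ1 hR hH hφ).trans ?_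
      rw [hV]
      refine mul_le_mul_right ?_ _
      -- The frozen frequencies enter the one-dimensional phase only through r = Σ y_j², and the
      -- bound is uniform in r.
      refine h c (k i) (∑ j, y j ^ 2) ((1 + rad d) ^ 2) (lineAmp w k i s y)
        (fun σ => disp c (insertCoord i σ y)) hc0 hk (by positivity)
        (norm_lineAmp_le hw k i s y) (fun σ hσ => lineAmp_eq_zero_of_lt _ _ _ _ _ hσ)
        fun σ σ' => ?_
      have hn : ∀ σ, ‖insertCoord i σ y‖ ^ 2 = σ ^ 2 + ∑ j, y j ^ 2 := fun σ => by
        rw [EuclideanSpace.norm_sq_eq, Fintype.sum_eq_add_sum_subtype_ne _ i]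
        simp only [insertCoord_self, insertCoord_ne, Real.norm_eq_abs, sq_abs]
      have h4 : ∀ v : Sp d, ‖v‖ ^ 4 = (‖v‖ ^ 2) ^ 2 := fun v => by ring
      simp only [disp, h4, hn]
      field_simp
      ring
    · have h0 : ∀ t, lineInt w c k i s t y = 0 := fun t => by
        unfold lineInt
        simp [lineAmp_eq_zero_of_notMem w s hy]
      simp [h0, Set.indicator_of_notMem hy]
  have hm : Measurable (Function.uncurry fun (t : ℝ) y => ‖lineInt w c k i s t y‖ₑ ^ 2) :=
    ((continuous_lineInt hw c k i s).measurable.enorm).pow_const 2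
  rw [lintegral_lintegral_swap hm.aemeasurable]
  refine (lintegral_mono h1).trans ?_
  have hms : MeasurableSet (sideBox i k) := measurableSet_Icc
  rw [lintegral_indicator_const hms, hV, sideBox, Real.volume_Icc_pi,
    ← ENNReal.ofReal_mul (by positivity)]
  have hvol : ∏ j : {j : Fin d // j ≠ i}, ENNReal.ofReal (k j + 5 / 6 - (k j - 5 / 6)) ≤
      ENNReal.ofReal (2 ^ d) := by
    calc _ ≤ ∏ j : {j : Fin d // j ≠ i}, (2 : ℝ≥0∞) := by
          refine Finset.prod_le_prod' fun j _ => ?_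
          exact (ENNReal.ofReal_le_ofReal (by linarith)).trans_eq (ENNReal.ofReal_ofNat 2)
      _ ≤ 2 ^ d := by
          rw [Finset.prod_const]
          refine pow_le_pow_right₀ (by norm_num) ?_
          rw [Finset.card_univ]
          exact (Fintype.card_subtype_le _).trans (by simp)
      _ = _ := by rw [ENNReal.ofReal_pow (by norm_num)]; simp
  refine (mul_le_mul_right hvol _).trans (le_of_eq ?_)
  rw [← ENNReal.ofReal_mul (by positivity)]
  congr 1; ring

theorem inner_insertCoord (i : Fin d) (s σ : ℝ) (x y : {j : Fin d // j ≠ i} → ℝ) :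
    inner ℝ (insertCoord i s x) (insertCoord i σ y) = s * σ + ∑ j, x j * y j := by
  rw [PiLp.inner_apply, Fintype.sum_eq_add_sum_subtype_ne _ i]
  simp only [insertCoord_self, insertCoord_ne, RCLike.inner_apply, conj_trivial]
  rw [mul_comm]
  congr 1
  exact Finset.sum_congr rfl fun j _ => mul_comm _ _

/-- The mass of the one-dimensional cutoff. -/
noncomputable def bumpMass : ℝ := ∫ σ : ℝ, bump₁ σ ^ 2

theorem integrable_bump_sq : Integrable fun σ : ℝ => bump₁ σ ^ 2 := by
  have := bump₁.continuous
  refine Continuous.integrable_of_hasCompactSupport (by fun_prop) ?_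
  exact bump₁.hasCompactSupport.comp_left (g := fun r : ℝ => r ^ 2) (by simp)

theorem bumpMass_pos : 0 < bumpMass := by
  have hc := bump₁.continuous
  have hcont : Continuous fun σ : ℝ => bump₁ σ ^ 2 := by fun_prop
  refine hcont.integral_pos_of_hasCompactSupport_nonneg_nonzero
    (bump₁.hasCompactSupport.comp_left (g := fun r : ℝ => r ^ 2) (by simp))
    (fun σ => sq_nonneg _) (x := 0) ?_
  have : bump₁ (0 : ℝ) = 1 := bump₁.one_of_mem_closedBall (by norm_num [bump₁])
  rw [this]; norm_num

theorem bumpMass_shift (a : ℝ) : ∫ σ : ℝ, bump₁ (σ - a) ^ 2 = bumpMass :=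
  integral_sub_right_eq_self (fun σ => bump₁ σ ^ 2) a

/-- The kernel as an integral of the partial transform. -/
theorem ker_insertCoord {w : Sp d} (c : ℝ) (k : Sp d) (i : Fin d) (s t : ℝ)
    (x : {j : Fin d // j ≠ i} → ℝ) :
    ker w c k t (insertCoord i s x) = ∫ y : {j : Fin d // j ≠ i} → ℝ,
      (sideCut i k y : ℂ) * Complex.exp (Complex.I * ((∑ j, x j * y j : ℝ) : ℂ)) *
        lineInt w c k i s t y := by
  have hA := continuous_amp w
  have hD := continuous_disp (d := d) c
  have hint : Integrable fun ξ : Sp d => ((amp w (ξ - k) ^ 2 : ℝ) : ℂ) *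
      Complex.exp (Complex.I * ((inner ℝ (insertCoord i s x) ξ + t * disp c ξ : ℝ) : ℂ)) := by
    refine Continuous.integrable_of_hasCompactSupport (by fun_prop) (HasCompactSupport.mul_right ?_)
    exact (hasCompactSupport_amp w k).comp_left (g := fun r : ℝ => ((r ^ 2 : ℝ) : ℂ)) (by simp)
  have hint2 : Integrable (fun p : ℝ × ({j : Fin d // j ≠ i} → ℝ) =>
      ((amp w (insertCoord i p.1 p.2 - k) ^ 2 : ℝ) : ℂ) *
      Complex.exp (Complex.I * ((inner ℝ (insertCoord i s x) (insertCoord i p.1 p.2) +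
        t * disp c (insertCoord i p.1 p.2) : ℝ) : ℂ))) (volume.prod volume) :=
    (measurePreserving_coordEquiv i).integrable_comp_of_integrable hint
  rw [ker, integral_insertCoord i, integral_prod_symm _ hint2]
  refine integral_congr_ae (Filter.Eventually.of_forall fun y => ?_)
  simp only
  rw [lineInt, ← integral_const_mul]
  refine integral_congr_ae (Filter.Eventually.of_forall fun σ => ?_)
  simp only
  rw [amp_insertCoord, inner_insertCoord, lineAmp]
  have e : Complex.exp (Complex.I * ((s * σ + ∑ j, x j * y j + t * disp c (insertCoord i σ y) : ℝ) : ℂ)) =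
      Complex.exp (Complex.I * ((∑ j, x j * y j : ℝ) : ℂ)) *
      Complex.exp (Complex.I * ((s * σ : ℝ) : ℂ)) *
      Complex.exp (Complex.I * ((t * disp c (insertCoord i σ y) : ℝ) : ℂ)) := by
    rw [← Complex.exp_add, ← Complex.exp_add]
    congr 1; push_cast; ring
  rw [e]
  push_cast
  ring

/-- As in `exists_ker_schur`, c is immaterial at time zero and may be enlarged to reach |k|. Decay
of order d + 1 is integrable on the hyperplane, and summing over i makes the constant independent of
the direction. -/
theorem exists_slab_schur (d : ℕ) : ∃ B : ℝ, 0 < B ∧ ∀ (c : ℝ) (k : Sp d) (i : Fin d),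
    ∫⁻ y, ‖ker 0 c k 0 (insertCoord i 0 y)‖ₑ ≤ ENNReal.ofReal B := by
  obtain ⟨A₀, -, h⟩ := exists_ker_nonstationary d 1
  obtain ⟨C, hC, h1⟩ := h (d + 1)
  set f : (i : Fin d) → ({j : Fin d // j ≠ i} → ℝ) → ℝ :=
    fun i y => C * (1 + ‖y‖) ^ (-((d + 1 : ℕ) : ℝ)) with hf
  have hi : ∀ i, Integrable (f i) volume := fun i => by
    refine (integrable_one_add_norm ?_).const_mul C
    rw [Module.finrank_fintype_fun_eq_card]
    have := Fintype.card_subtype_le fun j : Fin d => j ≠ i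
    rw [Fintype.card_fin] at this
    exact_mod_cast Nat.lt_succ_of_le this
  have hf0 : ∀ i y, 0 ≤ f i y := fun i y => by positivity
  have hfi : ∀ i, 0 ≤ ∫ y, f i y := fun i => integral_nonneg (hf0 i)
  refine ⟨(∑ i, ∫ y, f i y) + 1, add_pos_of_nonneg_of_pos (Finset.sum_nonneg fun i _ => hfi i)
    one_pos, fun c k i => ?_⟩
  have hle : ∫ y, f i y ≤ ∑ i, ∫ y, f i y :=
    Finset.single_le_sum (f := fun i => ∫ y, f i y) (fun i _ => hfi i) (Finset.mem_univ i)
  refine le_trans (lintegral_mono fun y => ?_) ((ofReal_integral_eq_lintegral_ofReal (hi i)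
    (Filter.Eventually.of_forall (hf0 i))).symm.le.trans (ENNReal.ofReal_le_ofReal (by linarith)))
  rw [← ofReal_norm]
  refine ENNReal.ofReal_le_ofReal ?_
  set x := insertCoord i 0 y with hx
  have e1 : ker 0 c k 0 x = ker 0 (max 1 ‖k‖) k 0 x := by simp [ker]
  have h2 := h1 0 (max 1 ‖k‖) k 0 x (by simp) (le_max_left _ _) (by simp) (by simp)
  have h3 := norm_le_norm_insertCoord i 0 y
  simp only [zero_mul, zero_smul, add_zero] at h2
  rw [e1, hf]
  simp only
  rw [Real.rpow_neg (by positivity), Real.rpow_natCast, ← div_eq_mul_inv]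
  refine h2.trans ?_
  gcongr

/-- Bessel's inequality on a hyperplane bounds the kernel by its partial transform. -/
theorem exists_lintegral_ker_sq_le_lineInt (d : ℕ) : ∃ B : ℝ, 0 < B ∧ ∀ (w : Sp d) (c : ℝ) (k : Sp d)
    (i : Fin d) (s t : ℝ), ‖w‖ ≤ 1 → 0 < c →
    ∫⁻ x, ‖ker w c k t (insertCoord i s x)‖ₑ ^ 2 ≤
      ENNReal.ofReal B * ∫⁻ y, ‖lineInt w c k i s t y‖ₑ ^ 2 := by
  obtain ⟨B, hB, hS⟩ := exists_slab_schur d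
  have hβ := bumpMass_pos
  set β := bumpMass with hβd
  refine ⟨B / β, by positivity, fun w c k i s t hw hc => ?_⟩
  have hbc := bump₁.continuous
  have hJ : Continuous (lineInt w c k i s t) :=
    Continuous.comp (g := fun p : ℝ × ({j : Fin d // j ≠ i} → ℝ) => lineInt w c k i s p.1 p.2)
      (f := fun y => (t, y)) (continuous_lineInt hw c k i s) (by fun_prop)
  -- The partial transform is tensored with a cutoff in the i-th frequency. Its inner products with
  -- the time-zero waves on the hyperplane are then β times the kernel, so Bessel's inequality plays
  -- the role of Plancherel in the tangential variables.
  set ψ : Sp d → ℂ := fun ξ => (bump₁ (ξ i - k i) : ℂ) * lineInt w c k i s t fun j => ξ j with hψ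
  have hψi : ∀ σ y, ψ (insertCoord i σ y) = (bump₁ (σ - k i) : ℂ) * lineInt w c k i s t y :=
    fun σ y => by
      simp only [hψ, insertCoord_self, insertCoord_ne]
  have hψc : Continuous ψ := by
    have h1 : Continuous fun ξ : Sp d => lineInt w c k i s t fun j => ξ j :=
      hJ.comp (continuous_pi fun j => (EuclideanSpace.proj (𝕜 := ℝ) (j : Fin d)).continuous)
    have h2 : Continuous fun ξ : Sp d => bump₁ (ξ i - k i) :=
      hbc.comp ((EuclideanSpace.proj (𝕜 := ℝ) i).continuous.sub continuous_const)
    exact (Complex.continuous_ofReal.comp h2).mul h1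
  have hψs : HasCompactSupport ψ := by
    refine HasCompactSupport.intro (isCompact_cube.image (f := fun ζ : Sp d => ζ + k) (by fun_prop))
      fun ξ hξ => ?_
    by_contra h0
    simp only [hψ, mul_eq_zero, not_or] at h0
    refine hξ ⟨ξ - k, fun j => ?_, by simp⟩
    rw [PiLp.sub_apply]
    by_cases hj : j = i
    · subst hj
      by_contra hlt
      exact h0.1 (by rw [bump₁_eq_zero (not_le.1 hlt)]; simp)
    · have hy : (fun j : {j : Fin d // j ≠ i} => ξ j) ∈ sideBox i k := by
        by_contra hy
        refine h0.2 ?_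
        unfold lineInt
        simp [lineAmp_eq_zero_of_notMem w s hy]
      have h1 := hy.1 ⟨j, hj⟩
      have h2 := hy.2 ⟨j, hj⟩
      simp only at h1 h2
      rw [abs_le]; constructor <;> linarith
  have hψm : MemLp ψ 2 volume := hψc.memLp_of_hasCompactSupport hψs
  have hin : ∀ x, inner ℂ (wave 0 c k (0, insertCoord i 0 x)) (hψm.toLp ψ) =
      (β : ℂ) * ker w c k t (insertCoord i s x) := by
    intro x
    rw [L2.inner_def]
    have h1 : ∫ ξ, inner ℂ ((wave 0 c k (0, insertCoord i 0 x) : Lp ℂ 2 volume) ξ)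
        ((hψm.toLp ψ : Lp ℂ 2 volume) ξ) =
        ∫ ξ, (amp 0 (ξ - k) : ℂ) * Complex.exp (Complex.I * (inner ℝ (insertCoord i 0 x) ξ : ℝ)) *
          ψ ξ := by
      refine integral_congr_ae ?_
      filter_upwards [(memLp_waveFun 0 c k (0, insertCoord i 0 x)).coeFn_toLp, hψm.coeFn_toLp] with
        ξ h2 h3
      unfold wave
      rw [h2, h3, RCLike.inner_apply, mul_comm]
      congr 1
      simp only [waveFun, map_mul, Complex.conj_ofReal, ← Complex.exp_conj, map_neg,
        Complex.conj_I, zero_mul, add_zero]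
      congr 2
      ring
    rw [h1, integral_insertCoord i, ker_insertCoord]
    have h4 : ∫ p : ℝ × ({j : Fin d // j ≠ i} → ℝ), (amp 0 (insertCoord i p.1 p.2 - k) : ℂ) *
        Complex.exp (Complex.I * (inner ℝ (insertCoord i 0 x) (insertCoord i p.1 p.2) : ℝ)) *
          ψ (insertCoord i p.1 p.2) ∂(volume.prod volume) =
        ∫ p : ℝ × ({j : Fin d // j ≠ i} → ℝ), ((bump₁ (p.1 - k i) ^ 2 : ℝ) : ℂ) *
          ((sideCut i k p.2 : ℂ) * Complex.exp (Complex.I * ((∑ j, x j * p.2 j : ℝ) : ℂ)) *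
            lineInt w c k i s t p.2) ∂(volume.prod volume) := by
      refine integral_congr_ae (Filter.Eventually.of_forall fun p => ?_)
      simp only
      rw [hψi, amp_insertCoord, inner_insertCoord, inner_zero_left]
      push_cast
      simp only [zero_mul, zero_add, add_zero]
      ring
    rw [h4, integral_prod_mul (fun σ : ℝ => ((bump₁ (σ - k i) ^ 2 : ℝ) : ℂ))
      (fun y : {j : Fin d // j ≠ i} → ℝ => (sideCut i k y : ℂ) *
        Complex.exp (Complex.I * ((∑ j, x j * y j : ℝ) : ℂ)) * lineInt w c k i s t y),
      integral_complex_ofReal, bumpMass_shift]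
  have hnorm : ‖hψm.toLp ψ‖ₑ ^ 2 =
      ENNReal.ofReal β * ∫⁻ y, ‖lineInt w c k i s t y‖ₑ ^ 2 := by
    have h1 := eLpNorm_nnreal_pow_eq_lintegral (f := ψ) (μ := volume) (p := 2) (by norm_num)
    norm_num at h1
    rw [Lp.enorm_def, eLpNorm_congr_ae hψm.coeFn_toLp, h1, lintegral_insertCoord i]
    simp only [hψi, enorm_mul, mul_pow]
    rw [lintegral_prod_mul (f := fun σ : ℝ => ‖(bump₁ (σ - k i) : ℂ)‖ₑ ^ 2)
      (g := fun y => ‖lineInt w c k i s t y‖ₑ ^ 2)]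
    · congr 1
      rw [hβd, ← bumpMass_shift (k i), ofReal_integral_eq_lintegral_ofReal
        (integrable_bump_sq.comp_sub_right (k i)) (Filter.Eventually.of_forall fun σ => sq_nonneg _)]
      refine lintegral_congr fun σ => ?_
      rw [← ofReal_norm, Complex.norm_real, Real.norm_eq_abs,
        ← ENNReal.ofReal_pow (abs_nonneg _), sq_abs]
    · exact (Continuous.measurable (by fun_prop)).aemeasurable
    · exact (hJ.measurable.enorm.pow_const 2).aemeasurable
  obtain ⟨b, -, hb⟩ := norm_wave_le d
  have hec : Continuous fun x : {j : Fin d // j ≠ i} → ℝ => wave 0 c k (0, insertCoord i 0 x) :=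
    Continuous.comp (g := wave 0 c k) (f := fun x => ((0 : ℝ), insertCoord i 0 x))
      (continuous_wave 0 c k) (by
        refine continuous_const.prodMk ?_
        exact Continuous.comp (g := fun p : ℝ × ({j : Fin d // j ≠ i} → ℝ) => insertCoord i p.1 p.2)
          (f := fun x => ((0 : ℝ), x)) (continuous_insertCoord i) (by fun_prop))
  have hbes := lintegral_inner_sq_le (μ := volume) hec.stronglyMeasurable
    (fun x => hb 0 c k (0, insertCoord i 0 x) hc (by simp)) (B := ENNReal.ofReal B) (fun x => by
      simp only [inner_wave, sub_self, insertCoord_sub]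
      rw [lintegral_sub_left_eq_self (fun y => ‖ker 0 c k 0 (insertCoord i 0 y)‖ₑ) x]
      exact hS c k i) (hψm.toLp ψ)
  rw [hnorm] at hbes
  simp only [hin, enorm_mul, mul_pow] at hbes
  have hβe : ‖(β : ℂ)‖ₑ = ENNReal.ofReal β := by
    rw [← ofReal_norm, Complex.norm_real, Real.norm_of_nonneg hβ.le]
  rw [hβe, lintegral_const_mul' _ _ (by finiteness)] at hbes
  have hβ0 : ENNReal.ofReal β ≠ 0 := by simpa using hβ
  calc ∫⁻ x, ‖ker w c k t (insertCoord i s x)‖ₑ ^ 2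
      = (ENNReal.ofReal β ^ 2)⁻¹ *
          (ENNReal.ofReal β ^ 2 * ∫⁻ x, ‖ker w c k t (insertCoord i s x)‖ₑ ^ 2) := by
        rw [← mul_assoc, ENNReal.inv_mul_cancel (by positivity) (by finiteness), one_mul]
    _ ≤ (ENNReal.ofReal β ^ 2)⁻¹ * (ENNReal.ofReal B * (ENNReal.ofReal β *
          ∫⁻ y, ‖lineInt w c k i s t y‖ₑ ^ 2)) := by gcongr
    _ = _ := by
        rw [← ENNReal.ofReal_pow hβ.le, ← ENNReal.ofReal_inv_of_pos (by positivity), ← mul_assoc,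
          ← mul_assoc, ← ENNReal.ofReal_mul (by positivity), ← ENNReal.ofReal_mul (by positivity)]
        congr 2
        field_simp

/-- The space-time square function of the kernel on a hyperplane. -/
theorem exists_lintegral_ker_slab_sq_le {θ : ℝ} (hθ : 0 < θ) (hθ1 : θ < 1) (d : ℕ) :
    ∃ C : ℝ, 0 < C ∧ ∀ (w : Sp d) (c : ℝ) (k : Sp d) (i : Fin d) (s R : ℝ), ‖w‖ ≤ 1 → 1 ≤ c →
      1 ≤ |k i| → 0 < R →
      ∫⁻ t in Set.Icc (-R) R, ∫⁻ x, ‖ker w c k t (insertCoord i s x)‖ₑ ^ 2 ≤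
        ENNReal.ofReal (C * (R ^ θ * (k i ^ 2 / c ^ 2) ^ (θ - 1))) := by
  obtain ⟨C, hC, h⟩ := exists_lintegral_lineInt_sq_le hθ hθ1 d
  obtain ⟨B, hB, h1⟩ := exists_lintegral_ker_sq_le_lineInt d
  refine ⟨B * C, by positivity, fun w c k i s R hw hc hk hR => ?_⟩
  refine (lintegral_mono fun t => h1 w c k i s t hw (by linarith)).trans ?_
  rw [lintegral_const_mul' _ _ (by finiteness), mul_assoc, ENNReal.ofReal_mul hB.le]
  exact mul_le_mul_right (h w c k i s R hw hc hk hR) _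

end MaxFun

/-! ### Slicing the Duhamel integral along hyperplanes -/

namespace MaxFun

variable {d : ℕ}

/-- The measure on the hyperplanes `x_i = s` times the time interval. -/
noncomputable def slabMeasure (i : Fin d) (T : ℝ) : Measure (({j : Fin d // j ≠ i} → ℝ) × ℝ) :=
  volume.prod (volume.restrict (timeI T))

instance (i : Fin d) (T : ℝ) : SigmaFinite (slabMeasure i T) := by
  unfold slabMeasure; infer_instance

/-- The restriction of a space-time function to a hyperplane. -/
def slabFun (i : Fin d) (g : ℝ → Sp d → ℂ) (s : ℝ) (z : ({j : Fin d // j ≠ i} → ℝ) × ℝ) : ℂ :=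
  g z.2 (insertCoord i s z.1)

/-- The integrand of the Duhamel operator on a hyperplane. -/
noncomputable def slabInt (w : Sp d) (c : ℝ) (k : Sp d) (i : Fin d) (g : ℝ → Sp d → ℂ) (t : ℝ)
    (x : Sp d) (s : ℝ) (z : ({j : Fin d // j ≠ i} → ℝ) × ℝ) : ℂ :=
  ker w c k (t - z.2) (x - insertCoord i s z.1) * slabFun i g s z

/-- The `L²` norm on a hyperplane. -/
noncomputable def slabNorm (i : Fin d) (T : ℝ) (g : ℝ → Sp d → ℂ) (s : ℝ) : ℝ≥0∞ :=
  eLpNorm (slabFun i g s) 2 (slabMeasure i T)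

/-- The retarded convolution with the kernel. -/
noncomputable def retarded (w : Sp d) (c : ℝ) (k : Sp d) (g : ℝ → Sp d → ℂ) (t : ℝ) (x : Sp d) : ℂ :=
  ∫ τ in (0 : ℝ)..t, ∫ z, ker w c k (t - τ) (x - z) * g τ z

theorem measurable_insertCoord_fst (i : Fin d) :
    Measurable fun p : ℝ × (({j : Fin d // j ≠ i} → ℝ) × ℝ) => (p.2.2, insertCoord i p.1 p.2.1) := by
  have h1 : Measurable fun p : ℝ × (({j : Fin d // j ≠ i} → ℝ) × ℝ) => insertCoord i p.1 p.2.1 :=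
    (continuous_insertCoord i).measurable.comp (by fun_prop : Measurable
      fun p : ℝ × (({j : Fin d // j ≠ i} → ℝ) × ℝ) => (p.1, p.2.1))
  fun_prop

theorem stronglyMeasurable_slabFun (i : Fin d) {g : ℝ → Sp d → ℂ}
    (hg : StronglyMeasurable (Function.uncurry g)) :
    StronglyMeasurable fun p : ℝ × (({j : Fin d // j ≠ i} → ℝ) × ℝ) => slabFun i g p.1 p.2 :=
  hg.comp_measurable (measurable_insertCoord_fst i)

theorem stronglyMeasurable_slabFun_right (i : Fin d) {g : ℝ → Sp d → ℂ}
    (hg : StronglyMeasurable (Function.uncurry g)) (s : ℝ) : StronglyMeasurable (slabFun i g s) :=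
  (stronglyMeasurable_slabFun i hg).comp_measurable measurable_prodMk_left

theorem slabNorm_eq (i : Fin d) (T : ℝ) (g : ℝ → Sp d → ℂ) (s : ℝ) :
    slabNorm i T g s = (∫⁻ z, ‖slabFun i g s z‖ₑ ^ 2 ∂slabMeasure i T) ^ (1 / 2 : ℝ) := by
  rw [slabNorm, eLpNorm_eq_lintegral_rpow_enorm_toReal (by norm_num) (by norm_num)]
  simp

theorem measurable_slabNorm (i : Fin d) (T : ℝ) {g : ℝ → Sp d → ℂ}
    (hg : StronglyMeasurable (Function.uncurry g)) : Measurable (slabNorm i T g) := by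
  simp only [funext fun s => slabNorm_eq i T g s]
  refine Measurable.pow_const ?_ _
  exact Measurable.lintegral_prod_right' (ν := slabMeasure i T)
    (f := fun p : ℝ × (({j : Fin d // j ≠ i} → ℝ) × ℝ) => ‖slabFun i g p.1 p.2‖ₑ ^ 2)
    ((stronglyMeasurable_slabFun i hg).enorm.pow_const 2)

theorem anisoNorm_one_two (i : Fin d) (T : ℝ) (g : ℝ → Sp d → ℂ) :
    anisoNorm 1 2 i T g = ∫⁻ s, slabNorm i T g s := by
  unfold anisoNorm
  rw [eLpNorm_one_eq_lintegral_enorm]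
  rfl

theorem continuous_ker_sub (w : Sp d) (c : ℝ) (k : Sp d) (t : ℝ) (x : Sp d) :
    Continuous fun p : ℝ × Sp d => ker w c k (t - p.1) (x - p.2) :=
  Continuous.comp (g := fun p : ℝ × Sp d => ker w c k p.1 p.2)
    (f := fun p : ℝ × Sp d => (t - p.1, x - p.2)) (continuous_ker w c k) (by fun_prop)

theorem stronglyMeasurable_ker_slab (w : Sp d) (c : ℝ) (k : Sp d) (i : Fin d) (t : ℝ) (x : Sp d) :
    StronglyMeasurable fun p : ℝ × (({j : Fin d // j ≠ i} → ℝ) × ℝ) =>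
      ker w c k (t - p.2.2) (x - insertCoord i p.1 p.2.1) :=
  StronglyMeasurable.comp_measurable (f := fun p : ℝ × Sp d => ker w c k (t - p.1) (x - p.2))
    (g := fun p : ℝ × (({j : Fin d // j ≠ i} → ℝ) × ℝ) => (p.2.2, insertCoord i p.1 p.2.1))
    (continuous_ker_sub w c k t x).stronglyMeasurable (measurable_insertCoord_fst i)

theorem stronglyMeasurable_ker_slab_right (w : Sp d) (c : ℝ) (k : Sp d) (i : Fin d) (t : ℝ)
    (x : Sp d) (s : ℝ) : StronglyMeasurable fun z : ({j : Fin d // j ≠ i} → ℝ) × ℝ =>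
      ker w c k (t - z.2) (x - insertCoord i s z.1) :=
  StronglyMeasurable.comp_measurable
    (f := fun p : ℝ × (({j : Fin d // j ≠ i} → ℝ) × ℝ) =>
      ker w c k (t - p.2.2) (x - insertCoord i p.1 p.2.1))
    (g := fun z : ({j : Fin d // j ≠ i} → ℝ) × ℝ => (s, z))
    (stronglyMeasurable_ker_slab w c k i t x) measurable_prodMk_left

theorem stronglyMeasurable_slabInt (w : Sp d) (c : ℝ) (k : Sp d) (i : Fin d) {g : ℝ → Sp d → ℂ}
    (hg : StronglyMeasurable (Function.uncurry g)) (t : ℝ) (x : Sp d) :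
    StronglyMeasurable fun p : ℝ × (({j : Fin d // j ≠ i} → ℝ) × ℝ) =>
      slabInt w c k i g t x p.1 p.2 := by
  simp only [slabInt]
  exact (stronglyMeasurable_ker_slab w c k i t x).mul (stronglyMeasurable_slabFun i hg)

/-- A weighted Cauchy-Schwarz inequality. -/
theorem lintegral_mul_le_weight {Ω : Type*} [MeasurableSpace Ω] {μ : Measure Ω} {K F W : Ω → ℝ≥0∞}
    (hK : Measurable K) (hF : Measurable F) (hW : Measurable W) (hW0 : ∀ z, W z ≠ 0)
    (hWt : ∀ z, W z ≠ ⊤) {B : ℝ≥0∞} (hB : ∫⁻ z, K z ^ 2 * (W z)⁻¹ ∂μ ≤ B) :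
    ∫⁻ z, K z * F z ∂μ ≤ (B * ∫⁻ z, W z * F z ^ 2 ∂μ) ^ (1 / 2 : ℝ) := by
  have h1 := ENNReal.lintegral_mul_norm_pow_le (μ := μ) (f := fun z => K z ^ 2 * (W z)⁻¹)
    (g := fun z => W z * F z ^ 2) (by fun_prop) (by fun_prop) (p := 1 / 2) (q := 1 / 2)
    (by norm_num) (by norm_num) (by norm_num)
  have h2 : ∀ z, (K z ^ 2 * (W z)⁻¹) ^ (1 / 2 : ℝ) * (W z * F z ^ 2) ^ (1 / 2 : ℝ) = K z * F z := by
    intro z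
    rw [← ENNReal.mul_rpow_of_nonneg _ _ (by norm_num)]
    have : K z ^ 2 * (W z)⁻¹ * (W z * F z ^ 2) = (K z * F z) ^ 2 := by
      rw [mul_assoc, ← mul_assoc (W z)⁻¹, ENNReal.inv_mul_cancel (hW0 z) (hWt z), one_mul, mul_pow]
    rw [this, ← ENNReal.rpow_natCast, ← ENNReal.rpow_mul]
    norm_num
  simp only [h2] at h1
  rw [ENNReal.mul_rpow_of_nonneg _ _ (by norm_num)]
  exact h1.trans (mul_le_mul_left (ENNReal.rpow_le_rpow hB (by norm_num)) _)

/-- The kernel is square integrable over slabs, locally uniformly in time. -/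
theorem exists_slab_ker_sq_le {w : Sp d} {c : ℝ} (hw : ‖w‖ ≤ 1) (hc : 1 ≤ c) (k : Sp d) (i : Fin d)
    {T : ℝ} (hT : 0 < T) : ∃ B : ℝ, 0 < B ∧ ∀ t ∈ Set.Icc (-T) T, ∀ (x : Sp d) (s : ℝ),
      ∫⁻ z, ‖ker w c k (t - z.2) (x - insertCoord i s z.1)‖ₑ ^ 2 ∂slabMeasure i T ≤
        ENNReal.ofReal B := by
  obtain ⟨C, hC, h⟩ := exists_ker_decay hw hc k (R := 2 * T) (by linarith) (d + 1)
  set f : ({j : Fin d // j ≠ i} → ℝ) → ℝ := fun y => C ^ 2 * (1 + ‖y‖) ^ (-((d + 1 : ℕ) : ℝ)) with hf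
  have hi : Integrable f volume := by
    refine (integrable_one_add_norm ?_).const_mul _
    rw [Module.finrank_fintype_fun_eq_card]
    have := Fintype.card_subtype_le fun j : Fin d => j ≠ i
    rw [Fintype.card_fin] at this
    exact_mod_cast Nat.lt_succ_of_le this
  have hf0 : ∀ y, 0 ≤ f y := fun y => by positivity
  have hfi : 0 ≤ ∫ y, f y := integral_nonneg hf0
  refine ⟨2 * T * (∫ y, f y) + 1, by positivity, fun t ht x s => ?_⟩
  have hm : Measurable fun z : ({j : Fin d // j ≠ i} → ℝ) × ℝ => ENNReal.ofReal (f ((fun j : {j : Fin d // j ≠ i} => x j) - z.1)) := by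
    have : Measurable f := by rw [hf]; fun_prop
    fun_prop
  have hae : ∀ᵐ z ∂slabMeasure i T, z.2 ∈ timeI T :=
    Measure.quasiMeasurePreserving_snd.ae (ae_restrict_mem measurableSet_Icc)
  calc ∫⁻ z, ‖ker w c k (t - z.2) (x - insertCoord i s z.1)‖ₑ ^ 2 ∂slabMeasure i T
      ≤ ∫⁻ z, ENNReal.ofReal (f ((fun j : {j : Fin d // j ≠ i} => x j) - z.1)) ∂slabMeasure i T := by
        refine lintegral_mono_ae ?_
        filter_upwards [hae] with z hz
        rw [← ofReal_norm, ← ENNReal.ofReal_pow (norm_nonneg _)]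
        refine ENNReal.ofReal_le_ofReal ?_
        have h1 := h (t - z.2) (x - insertCoord i s z.1)
          (by rw [abs_le]; constructor <;> linarith [ht.1, ht.2, hz.1, hz.2])
        have h2 : ‖(fun j : {j : Fin d // j ≠ i} => x j) - z.1‖ ≤ ‖x - insertCoord i s z.1‖ := by
          nth_rw 2 [← insertCoord_eta i x]
          rw [insertCoord_sub]
          exact norm_le_norm_insertCoord _ _ _
        rw [hf]
        simp only
        rw [Real.rpow_neg (by positivity), Real.rpow_natCast]
        calc ‖ker w c k (t - z.2) (x - insertCoord i s z.1)‖ ^ 2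
            ≤ (C / (1 + ‖x - insertCoord i s z.1‖) ^ (d + 1)) ^ 2 := by gcongr
          _ ≤ (C / (1 + ‖(fun j : {j : Fin d // j ≠ i} => x j) - z.1‖) ^ (d + 1)) ^ 2 := by gcongr
          _ = C ^ 2 * ((1 + ‖(fun j : {j : Fin d // j ≠ i} => x j) - z.1‖) ^ (d + 1))⁻¹ *
                ((1 + ‖(fun j : {j : Fin d // j ≠ i} => x j) - z.1‖) ^ (d + 1))⁻¹ := by
              field_simp
          _ ≤ _ := by
              refine mul_le_of_le_one_right (by positivity) (inv_le_one_of_one_le₀ ?_)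
              exact one_le_pow₀ (by linarith [norm_nonneg ((fun j : {j : Fin d // j ≠ i} => x j) - z.1)])
    _ = ENNReal.ofReal (∫ y, f y) * ENNReal.ofReal (2 * T) := by
        rw [slabMeasure, lintegral_prod _ hm.aemeasurable]
        simp only [lintegral_const, Measure.restrict_apply MeasurableSet.univ, Set.univ_inter, timeI,
          Real.volume_Icc]
        rw [lintegral_mul_const' _ _ (by finiteness),
          lintegral_sub_left_eq_self (fun y => ENNReal.ofReal (f y)) (fun j : {j : Fin d // j ≠ i} => x j),
          ← ofReal_integral_eq_lintegral_ofReal hi (Filter.Eventually.of_forall hf0)]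
        congr 2; ring
    _ ≤ _ := by
        rw [← ENNReal.ofReal_mul hfi]
        exact ENNReal.ofReal_le_ofReal (by nlinarith)

/-- Cauchy-Schwarz with trivial weight. Here B depends on all parameters; it only makes Fubini and
the splitting of integrals legitimate. -/
theorem exists_lintegral_slabInt_le {w : Sp d} {c : ℝ} (hw : ‖w‖ ≤ 1) (hc : 1 ≤ c) (k : Sp d)
    (i : Fin d) {T : ℝ} (hT : 0 < T) : ∃ B : ℝ, 0 < B ∧ ∀ g : ℝ → Sp d → ℂ,
      StronglyMeasurable (Function.uncurry g) → ∀ t ∈ Set.Icc (-T) T, ∀ (x : Sp d) (s : ℝ),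
      ∫⁻ z, ‖slabInt w c k i g t x s z‖ₑ ∂slabMeasure i T ≤ ENNReal.ofReal B * slabNorm i T g s := by
  obtain ⟨B, hB, h⟩ := exists_slab_ker_sq_le hw hc k i hT
  refine ⟨B ^ (1 / 2 : ℝ), by positivity, fun g hg t ht x s => ?_⟩
  have hK := (stronglyMeasurable_ker_slab_right w c k i t x s).enorm
  have h1 := lintegral_mul_le_weight (μ := slabMeasure i T) hK
    (stronglyMeasurable_slabFun_right i hg s).enorm (W := fun _ => 1) measurable_const (by simp)
    (by simp) (B := ENNReal.ofReal B) (by simpa using h t ht x s)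
  simp only [one_mul] at h1
  simp only [slabInt, enorm_mul]
  refine h1.trans (le_of_eq ?_)
  rw [ENNReal.mul_rpow_of_nonneg _ _ (by norm_num), slabNorm_eq,
    ENNReal.ofReal_rpow_of_pos hB]

theorem uIoc_subset_timeI {T t : ℝ} (ht : t ∈ timeI T) (hT : 0 < T) : Set.uIoc 0 t ⊆ timeI T := by
  intro τ hτ
  have h1 := ht.1
  have h2 := ht.2
  rcases Set.mem_uIoc.1 hτ with h | h
  · exact ⟨by linarith [h.1], by linarith [h.2]⟩
  · exact ⟨by linarith [h.1], by linarith [h.2]⟩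

/-- Slicing of the retarded convolution along one coordinate. -/
theorem enorm_retarded_le {w : Sp d} {c : ℝ} (hw : ‖w‖ ≤ 1) (hc : 1 ≤ c) (k : Sp d) (i : Fin d)
    {T : ℝ} (hT : 0 < T) {g : ℝ → Sp d → ℂ} (hg : StronglyMeasurable (Function.uncurry g))
    (hfin : ∫⁻ s, slabNorm i T g s ≠ ⊤) {t : ℝ} (ht : t ∈ Set.Icc (-T) T) (x : Sp d) :
    ‖retarded w c k g t x‖ₑ ≤
      ∫⁻ s, ‖∫ z in {z | z.2 ∈ Set.uIoc 0 t}, slabInt w c k i g t x s z ∂slabMeasure i T‖ₑ := by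
  obtain ⟨B, hB, hb⟩ := exists_lintegral_slabInt_le hw hc k i hT
  set ν := (volume : Measure ℝ).restrict (Set.uIoc 0 t) with hν
  have hsub := uIoc_subset_timeI ht hT
  have hres : (slabMeasure i T).restrict {z | z.2 ∈ Set.uIoc 0 t} =
      (volume : Measure ({j : Fin d // j ≠ i} → ℝ)).prod ν := by
    have h1 : {z : ({j : Fin d // j ≠ i} → ℝ) × ℝ | z.2 ∈ Set.uIoc 0 t} =
        Set.univ ×ˢ Set.uIoc 0 t := by ext z; simp
    rw [slabMeasure, h1, ← Measure.prod_restrict, Measure.restrict_univ,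
      Measure.restrict_restrict measurableSet_uIoc, Set.inter_eq_left.2 hsub]
  rw [hres]
  have hsm := stronglyMeasurable_slabInt w c k i hg t x
  have hint : Integrable (fun p : ℝ × (({j : Fin d // j ≠ i} → ℝ) × ℝ) =>
      slabInt w c k i g t x p.1 p.2) (volume.prod (volume.prod ν)) := by
    refine ⟨hsm.aestronglyMeasurable, ?_⟩
    rw [hasFiniteIntegral_iff_enorm, lintegral_prod _ hsm.enorm.aemeasurable]
    refine lt_of_le_of_lt (b := ∫⁻ s, ENNReal.ofReal B * slabNorm i T g s) ?_ ?_
    · refine lintegral_mono fun s => le_trans ?_ (hb g hg t ht x s)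
      rw [← hres]
      exact setLIntegral_le_lintegral _ _
    · rw [lintegral_const_mul' _ _ (by finiteness)]
      exact ENNReal.mul_lt_top (by finiteness) (lt_top_iff_ne_top.2 hfin)
  have heq : ∫ τ in Set.uIoc 0 t, ∫ z, ker w c k (t - τ) (x - z) * g τ z =
      ∫ s, ∫ z, slabInt w c k i g t x s z ∂(volume.prod ν) := by
    have e1 : MeasurePreserving (MeasurableEquiv.prodAssoc :
        (ℝ × ({j : Fin d // j ≠ i} → ℝ)) × ℝ ≃ᵐ ℝ × (({j : Fin d // j ≠ i} → ℝ) × ℝ))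
        ((volume.prod volume).prod ν) (volume.prod (volume.prod ν)) :=
      measurePreserving_prodAssoc _ _ _
    have hint2 : Integrable (fun p => slabInt w c k i g t x (MeasurableEquiv.prodAssoc p).1
        (MeasurableEquiv.prodAssoc p).2) ((volume.prod volume).prod ν) :=
      e1.integrable_comp_of_integrable hint
    rw [← integral_prod _ hint, ← e1.integral_comp', integral_prod_symm _ hint2]
    refine integral_congr_ae (Filter.Eventually.of_forall fun τ => ?_)
    simp only
    rw [integral_insertCoord i]
    rfl
  have h2 : ‖retarded w c k g t x‖ₑ =
      ‖∫ τ in Set.uIoc 0 t, ∫ z, ker w c k (t - τ) (x - z) * g τ z‖ₑ := by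
    rw [retarded, ← ofReal_norm, ← ofReal_norm, intervalIntegral.norm_intervalIntegral_eq]
  rw [h2, heq]
  exact enorm_integral_le_lintegral_enorm _

/-- Reduction of the mixed norm bound of the retarded convolution to a bound on hyperplanes. -/
theorem anisoNorm_retarded_le {w : Sp d} {c : ℝ} (hw : ‖w‖ ≤ 1) (hc : 1 ≤ c) (k : Sp d) (h i : Fin d)
    {T : ℝ} (hT : 0 < T) {q : ℝ≥0∞} (hq : 1 ≤ q) {K : ℝ} (hK : 0 < K) {g : ℝ → Sp d → ℂ}
    (hg : StronglyMeasurable (Function.uncurry g)) {U : ℝ → ℝ → ℝ≥0∞}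
    (hU : Measurable (Function.uncurry U))
    (hpt : ∀ s, slabNorm i T g s < ⊤ → ∀ t ∈ Set.Icc (-T) T, ∀ x,
      ‖∫ z in {z | z.2 ∈ Set.uIoc 0 t}, slabInt w c k i g t x s z ∂slabMeasure i T‖ₑ ≤ U s (x h))
    (hUn : ∀ s, slabNorm i T g s < ⊤ →
      eLpNorm (U s) q volume ≤ ENNReal.ofReal K * slabNorm i T g s) :
    anisoNorm q ⊤ h T (retarded w c k g) ≤ ENNReal.ofReal K * anisoNorm 1 2 i T g := by
  rw [anisoNorm_one_two]
  by_cases hfin : ∫⁻ s, slabNorm i T g s = ⊤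
  · rw [hfin, ENNReal.mul_top (by rw [Ne, ENNReal.ofReal_eq_zero, not_le]; exact hK)]
    exact le_top
  have hGm := measurable_slabNorm i T hg
  have hae : ∀ᵐ s, slabNorm i T g s < ⊤ := ae_lt_top hGm hfin
  refine (anisoNorm_top_le (U := fun r => ∫⁻ s, U s r) fun t ht x => ?_).trans ?_
  · refine (enorm_retarded_le hw hc k i hT hg hfin ht x).trans (lintegral_mono_ae ?_)
    filter_upwards [hae] with s hs
    exact hpt s hs t ht x
  · refine (eLpNorm_lintegral_le hq hU (g := fun s => ENNReal.ofReal K * slabNorm i T g s)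
      (hGm.const_mul _) ?_).trans (le_of_eq ?_)
    · filter_upwards [hae] with s hs
      exact hUn s hs
    · rw [lintegral_const_mul' _ _ (by finiteness)]

end MaxFun

/-! ### Weighted Cauchy-Schwarz on slabs -/

namespace MaxFun

variable {d : ℕ}

/-- A decaying weight at scale `D`. -/
noncomputable def scaleWeight (D r : ℝ) : ℝ≥0∞ := ENNReal.ofReal ((1 + D⁻¹ * ‖r‖) ^ (-2 : ℝ))

theorem measurable_scaleWeight (D : ℝ) : Measurable (scaleWeight D) := by
  unfold scaleWeight; fun_prop

/-- Raised to the power q/2 the weight decays with order q ≥ 2, hence is integrable on the line;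
dilation then gives D^{1/q}. -/
theorem exists_eLpNorm_scaleWeight_le {q : ℝ≥0∞} (hq : 2 ≤ q) : ∃ C : ℝ, 0 < C ∧ ∀ D : ℝ, 0 < D →
    eLpNorm (scaleWeight D) (q / 2) volume ^ (1 / 2 : ℝ) ≤
      ENNReal.ofReal (C * D ^ (1 / q).toReal) := by
  set J : ℝ := ∫ s : ℝ, (1 + ‖s‖) ^ (-q.toReal) with hJ
  have hJ0 : 0 ≤ J := integral_nonneg fun s => by positivity
  refine ⟨J ^ (1 / q).toReal + 1, by positivity, fun D hD => ?_⟩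
  rcases eq_or_ne q ⊤ with rfl | hqt
  · rw [ENNReal.top_div_of_ne_top (by norm_num), eLpNorm_exponent_top]
    have h1 : ∀ r, ‖scaleWeight D r‖ₑ ≤ 1 := fun r => by
      rw [enorm_eq_self, scaleWeight]
      refine ENNReal.ofReal_le_one.2 (Real.rpow_le_one_of_one_le_of_nonpos ?_ (by norm_num))
      have : 0 ≤ D⁻¹ * ‖r‖ := by positivity
      linarith
    have h2 := eLpNormEssSup_le_of_ae_enorm_bound (μ := volume) (Filter.Eventually.of_forall h1)
    refine (ENNReal.rpow_le_rpow h2 (by norm_num)).trans ?_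
    simp
  · have hq0 : q ≠ 0 := fun h => by rw [h] at hq; simp at hq
    have hp2 : 2 ≤ q.toReal := by simpa using ENNReal.toReal_mono hqt hq
    have e1 : (q / 2).toReal = q.toReal / 2 := by simp
    have hq20 : q / 2 ≠ 0 := by simp [hq0]
    have hq2t : q / 2 ≠ ⊤ := ENNReal.div_ne_top hqt (by norm_num)
    rw [eLpNorm_eq_lintegral_rpow_enorm_toReal hq20 hq2t, e1]
    have h1 : ∀ r, ‖scaleWeight D r‖ₑ ^ (q.toReal / 2) =
        ENNReal.ofReal ((1 + D⁻¹ * ‖r‖) ^ (-q.toReal)) := fun r => by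
      rw [enorm_eq_self, scaleWeight, ENNReal.ofReal_rpow_of_nonneg (by positivity) (by positivity),
        ← Real.rpow_mul (by positivity)]
      congr 2; ring
    simp only [h1]
    rw [lintegral_one_add_mul_norm volume (by simp; linarith) (by positivity), ← hJ,
      ← ENNReal.rpow_mul]
    have e2 : 1 / (q.toReal / 2) * (1 / 2) = (1 / q).toReal := by
      simp; ring
    rw [e2, ENNReal.ofReal_rpow_of_nonneg (by positivity) (by positivity)]
    refine ENNReal.ofReal_le_ofReal ?_
    rw [Real.mul_rpow hJ0 (by positivity)]
    simp only [Module.finrank_self, pow_one, inv_inv]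
    gcongr
    linarith

/-- A weighted average of a function over hyperplanes. -/
noncomputable def slabMaj (i : Fin d) (T : ℝ) (g : ℝ → Sp d → ℂ) (h : Fin d) (D s r : ℝ) : ℝ≥0∞ :=
  (∫⁻ z, scaleWeight D (r - insertCoord i s z.1 h) * ‖slabFun i g s z‖ₑ ^ 2 ∂slabMeasure i T) ^
    (1 / 2 : ℝ)

theorem measurable_insertCoord_apply (i h : Fin d) :
    Measurable fun p : ℝ × ({j : Fin d // j ≠ i} → ℝ) => insertCoord i p.1 p.2 h :=
  (by fun_prop : Measurable fun x : Sp d => x h).comp (continuous_insertCoord i).measurable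

theorem measurable_slabMaj (i : Fin d) (T : ℝ) {g : ℝ → Sp d → ℂ}
    (hg : StronglyMeasurable (Function.uncurry g)) (h : Fin d) (D : ℝ) :
    Measurable (Function.uncurry (slabMaj i T g h D)) := by
  have h1 : Measurable fun p : (ℝ × ℝ) × (({j : Fin d // j ≠ i} → ℝ) × ℝ) =>
      insertCoord i p.1.1 p.2.1 h :=
    (measurable_insertCoord_apply i h).comp (by fun_prop : Measurable fun p : (ℝ × ℝ) ×
      (({j : Fin d // j ≠ i} → ℝ) × ℝ) => (p.1.1, p.2.1))
  have h2 : Measurable fun p : (ℝ × ℝ) × (({j : Fin d // j ≠ i} → ℝ) × ℝ) =>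
      scaleWeight D (p.1.2 - insertCoord i p.1.1 p.2.1 h) :=
    (measurable_scaleWeight D).comp ((by fun_prop : Measurable fun p : (ℝ × ℝ) ×
      (({j : Fin d // j ≠ i} → ℝ) × ℝ) => p.1.2).sub h1)
  have h3 : Measurable fun p : (ℝ × ℝ) × (({j : Fin d // j ≠ i} → ℝ) × ℝ) =>
      ‖slabFun i g p.1.1 p.2‖ₑ ^ 2 :=
    ((stronglyMeasurable_slabFun i hg).comp_measurable (by fun_prop : Measurable fun p : (ℝ × ℝ) ×
      (({j : Fin d // j ≠ i} → ℝ) × ℝ) => (p.1.1, p.2))).enorm.pow_const 2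
  exact (Measurable.lintegral_prod_right' (ν := slabMeasure i T) (h2.mul h3)).pow_const _

theorem measurable_slabMaj_right (i : Fin d) (T : ℝ) {g : ℝ → Sp d → ℂ}
    (hg : StronglyMeasurable (Function.uncurry g)) (h : Fin d) (D s : ℝ) :
    Measurable (slabMaj i T g h D s) :=
  Measurable.comp (g := Function.uncurry (slabMaj i T g h D)) (f := fun r => (s, r))
    (measurable_slabMaj i T hg h D) measurable_prodMk_left

theorem measurable_const_mul_slabMaj (i : Fin d) (T : ℝ) {g : ℝ → Sp d → ℂ}
    (hg : StronglyMeasurable (Function.uncurry g)) (h : Fin d) (D : ℝ) (N : ℝ≥0∞) :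
    Measurable (Function.uncurry fun s r => N * slabMaj i T g h D s r) :=
  Measurable.const_mul (f := Function.uncurry (slabMaj i T g h D)) (measurable_slabMaj i T hg h D) N

/-- Minkowski's inequality in L^{q/2}, all translates of the weight having the same norm. This turns
L² data on a slab into an L^q function of x_h at the cost of D^{1/q}. -/
theorem exists_eLpNorm_slabMaj_le {q : ℝ≥0∞} (hq : 2 ≤ q) : ∃ C : ℝ, 0 < C ∧ ∀ (i : Fin d) (T : ℝ)
    (g : ℝ → Sp d → ℂ), StronglyMeasurable (Function.uncurry g) → ∀ (h : Fin d) (D : ℝ), 0 < D →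
    ∀ s, eLpNorm (slabMaj i T g h D s) q volume ≤
      ENNReal.ofReal (C * D ^ (1 / q).toReal) * slabNorm i T g s := by
  obtain ⟨C, hC, h1⟩ := exists_eLpNorm_scaleWeight_le hq
  refine ⟨C, hC, fun i T g hg h D hD s => ?_⟩
  have hY : Measurable fun z : ({j : Fin d // j ≠ i} → ℝ) × ℝ => insertCoord i s z.1 h :=
    (measurable_insertCoord_apply i h).comp (by fun_prop : Measurable fun z :
      ({j : Fin d // j ≠ i} → ℝ) × ℝ => (s, z.1))
  have h2 := eLpNorm_sqrt_lintegral_weight_le (ν := slabMeasure i T) hq (measurable_scaleWeight D)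
    hY (stronglyMeasurable_slabFun_right i hg s).enorm
  refine h2.trans ?_
  rw [ENNReal.mul_rpow_of_nonneg _ _ (by norm_num), slabNorm_eq]
  exact mul_le_mul_left (h1 D hD) _

/-- Weighted square integrability of the kernel bounds the Duhamel integrand. -/
theorem setLIntegral_slabInt_le {w : Sp d} {c : ℝ} {k : Sp d} {i : Fin d} {T : ℝ}
    {g : ℝ → Sp d → ℂ} (hg : StronglyMeasurable (Function.uncurry g)) {h : Fin d} {D N t s : ℝ}
    {x : Sp d} (hD : 0 < D) (hN : 0 ≤ N) {S : Set (({j : Fin d // j ≠ i} → ℝ) × ℝ)}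
    (hker : ∫⁻ z in S, ENNReal.ofReal (‖ker w c k (t - z.2) (x - insertCoord i s z.1)‖ ^ 2 *
      (1 + D⁻¹ * |x h - insertCoord i s z.1 h|) ^ 2) ∂slabMeasure i T ≤ ENNReal.ofReal (N ^ 2)) :
    ∫⁻ z in S, ‖slabInt w c k i g t x s z‖ₑ ∂slabMeasure i T ≤
      ENNReal.ofReal N * slabMaj i T g h D s (x h) := by
  have hY : Measurable fun z : ({j : Fin d // j ≠ i} → ℝ) × ℝ => insertCoord i s z.1 h :=
    (measurable_insertCoord_apply i h).comp (by fun_prop : Measurable fun z :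
      ({j : Fin d // j ≠ i} → ℝ) × ℝ => (s, z.1))
  have hpos : ∀ r : ℝ, 0 < 1 + D⁻¹ * ‖r‖ := fun r => by positivity
  have h1 := lintegral_mul_le_weight (μ := (slabMeasure i T).restrict S)
    (stronglyMeasurable_ker_slab_right w c k i t x s).enorm
    (stronglyMeasurable_slabFun_right i hg s).enorm
    (W := fun z => scaleWeight D (x h - insertCoord i s z.1 h))
    ((measurable_scaleWeight D).comp (hY.const_sub _))
    (fun z => by
      rw [scaleWeight, Ne, ENNReal.ofReal_eq_zero, not_le]
      exact Real.rpow_pos_of_pos (hpos _) _) (fun z => by simp [scaleWeight])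
    (B := ENNReal.ofReal (N ^ 2)) (by
      refine le_trans (le_of_eq (lintegral_congr fun z => ?_)) hker
      rw [scaleWeight, ← ENNReal.ofReal_inv_of_pos (Real.rpow_pos_of_pos (hpos _) _),
        ← Real.rpow_neg (hpos _).le, neg_neg, ← ofReal_norm, ← ENNReal.ofReal_pow (norm_nonneg _),
        ← ENNReal.ofReal_mul (by positivity)]
      norm_num)
  simp only [slabInt, enorm_mul]
  refine h1.trans ?_
  rw [ENNReal.mul_rpow_of_nonneg _ _ (by norm_num), ENNReal.ofReal_rpow_of_nonneg (by positivity)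
    (by norm_num), ← Real.sqrt_eq_rpow, Real.sqrt_sq hN, slabMaj]
  exact mul_le_mul_right (ENNReal.rpow_le_rpow (setLIntegral_le_lintegral _ _) (by norm_num)) _

end MaxFun

/-! ### The retarded estimate for |k| ≲ c -/

namespace MaxFun

variable {d : ℕ}

theorem sub_insertCoord (i : Fin d) (x : Sp d) (s : ℝ) (y : {j : Fin d // j ≠ i} → ℝ) :
    x - insertCoord i s y =
      insertCoord i (x i - s) ((fun j : {j : Fin d // j ≠ i} => x j) - y) := by
  nth_rw 1 [← insertCoord_eta i x]
  rw [insertCoord_sub]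

/-- Translation in time and in the tangential variables removes the base point: t - τ stays in [-R,
R], and only x_i - s survives. -/
theorem lintegral_slab_ker_sq_le (w : Sp d) (c : ℝ) (k : Sp d) (i : Fin d) {T R t : ℝ}
    (hR : 2 * T ≤ R) (ht : t ∈ Set.Icc (-T) T) (x : Sp d) (s : ℝ) :
    ∫⁻ z, ‖ker w c k (t - z.2) (x - insertCoord i s z.1)‖ₑ ^ 2 ∂slabMeasure i T ≤
      ∫⁻ τ in Set.Icc (-R) R, ∫⁻ y, ‖ker w c k τ (insertCoord i (x i - s) y)‖ₑ ^ 2 := by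
  set H : ℝ → ℝ≥0∞ := fun τ => ∫⁻ y, ‖ker w c k τ (insertCoord i (x i - s) y)‖ₑ ^ 2 with hH
  have hm := (stronglyMeasurable_ker_slab_right w c k i t x s).enorm.pow_const 2
  rw [slabMeasure, lintegral_prod_symm _ hm.aemeasurable]
  have h1 : ∀ τ, ∫⁻ y, ‖ker w c k (t - τ) (x - insertCoord i s y)‖ₑ ^ 2 = H (t - τ) := fun τ => by
    simp only [sub_insertCoord, hH]
    exact lintegral_sub_left_eq_self
      (fun y => ‖ker w c k (t - τ) (insertCoord i (x i - s) y)‖ₑ ^ 2) _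
  simp only [h1]
  rw [← lintegral_indicator measurableSet_Icc, timeI, ← lintegral_indicator measurableSet_Icc,
    ← lintegral_sub_left_eq_self (Set.indicator (Set.Icc (-R) R) H) t]
  refine lintegral_mono fun τ => ?_
  by_cases hτ : τ ∈ Set.Icc (-T) T
  · rw [Set.indicator_of_mem hτ, Set.indicator_of_mem]
    exact ⟨by linarith [hτ.2, ht.1], by linarith [hτ.1, ht.2]⟩
  · rw [Set.indicator_of_notMem hτ]; exact zero_le

theorem norm_le_norm_sub_insertCoord (i : Fin d) (x : Sp d) (s : ℝ)
    (y : {j : Fin d // j ≠ i} → ℝ) :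
    ‖(fun j : {j : Fin d // j ≠ i} => x j) - y‖ ≤ ‖x - insertCoord i s y‖ := by
  rw [sub_insertCoord]
  exact norm_le_norm_insertCoord _ _ _

/-- Integrals of polynomially decaying functions over slabs. -/
theorem exists_lintegral_slab_decay_le (d : ℕ) : ∃ J : ℝ, 0 < J ∧ ∀ (i : Fin d) (T B : ℝ) (x : Sp d)
    (s : ℝ), 0 < T → 0 ≤ B →
    ∫⁻ z, ENNReal.ofReal (B * ((1 + ‖x - insertCoord i s z.1‖) ^ d)⁻¹) ∂slabMeasure i T ≤
      ENNReal.ofReal (J * B * T) := by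
  set J₀ : Fin d → ℝ := fun i => ∫ y : {j : Fin d // j ≠ i} → ℝ, (1 + ‖y‖) ^ (-(d : ℝ)) with hJ
  have hJ0 : ∀ i, 0 ≤ J₀ i := fun i => integral_nonneg fun y => by positivity
  refine ⟨2 * ∑ i, J₀ i + 1, by positivity [Finset.sum_nonneg fun i (_ : i ∈ Finset.univ) => hJ0 i],
    fun i T B x s hT hB => ?_⟩
  set f : ({j : Fin d // j ≠ i} → ℝ) → ℝ := fun y => B * (1 + ‖y‖) ^ (-(d : ℝ)) with hf
  have hi : Integrable f volume := by
    refine (integrable_one_add_norm ?_).const_mul _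
    rw [Module.finrank_fintype_fun_eq_card]
    have := Fintype.card_subtype_lt (p := fun j : Fin d => j ≠ i) (x := i) (by simp)
    rw [Fintype.card_fin] at this
    exact_mod_cast this
  have hf0 : ∀ y, 0 ≤ f y := fun y => by positivity
  have hm : Measurable fun z : ({j : Fin d // j ≠ i} → ℝ) × ℝ =>
      ENNReal.ofReal (f ((fun j : {j : Fin d // j ≠ i} => x j) - z.1)) := by
    have : Measurable f := by rw [hf]; fun_prop
    fun_prop
  calc _ ≤ ∫⁻ z, ENNReal.ofReal (f ((fun j : {j : Fin d // j ≠ i} => x j) - z.1))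
          ∂slabMeasure i T := by
        refine lintegral_mono fun z => ENNReal.ofReal_le_ofReal ?_
        rw [hf]
        simp only
        rw [Real.rpow_neg (by positivity), Real.rpow_natCast]
        have := norm_le_norm_sub_insertCoord i x s z.1
        gcongr
    _ = ENNReal.ofReal (∫ y, f y) * ENNReal.ofReal (2 * T) := by
        rw [slabMeasure, lintegral_prod _ hm.aemeasurable]
        simp only [lintegral_const, Measure.restrict_apply MeasurableSet.univ, Set.univ_inter, timeI,
          Real.volume_Icc]
        rw [lintegral_mul_const' _ _ (by finiteness),
          lintegral_sub_left_eq_self (fun y => ENNReal.ofReal (f y))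
            (fun j : {j : Fin d // j ≠ i} => x j),
          ← ofReal_integral_eq_lintegral_ofReal hi (Filter.Eventually.of_forall hf0)]
        congr 2; ring
    _ ≤ _ := by
        rw [← ENNReal.ofReal_mul (integral_nonneg hf0)]
        refine ENNReal.ofReal_le_ofReal ?_
        rw [hf, integral_const_mul]
        have h1 : J₀ i ≤ ∑ i, J₀ i := Finset.single_le_sum (fun i _ => hJ0 i) (Finset.mem_univ i)
        have h2 : 0 ≤ B * T := by positivity
        change B * J₀ i * (2 * T) ≤ _
        nlinarith [mul_le_mul_of_nonneg_right h1 h2]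

/-- The weighted square integral of the kernel over a slab, for frequencies bounded by a multiple of
`c`. -/
theorem exists_lintegral_slab_weight_le {θ A M : ℝ} (hθ : 0 < θ) (hθ1 : θ < 1) (hA : 1 ≤ A)
    (hM : 0 < M) (d : ℕ) : ∃ C : ℝ, 0 < C ∧ ∀ (w : Sp d) (c : ℝ) (k : Sp d) (h i : Fin d)
    (T t s : ℝ) (x : Sp d), ‖w‖ ≤ 1 → 1 ≤ c → 1 ≤ |k i| → ‖k‖ ≤ A * c → 0 < T → T ≤ M * c ^ 2 →
    t ∈ Set.Icc (-T) T →
    ∫⁻ z, ENNReal.ofReal (‖ker w c k (t - z.2) (x - insertCoord i s z.1)‖ ^ 2 *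
      (1 + (c ^ 3)⁻¹ * |x h - insertCoord i s z.1 h|) ^ 2) ∂slabMeasure i T ≤
      ENNReal.ofReal ((C * (c ^ θ * (|k i| / c) ^ (θ - 1))) ^ 2) := by
  obtain ⟨C₁, hC₁, hf⟩ := exists_ker_far d A (2 * M) (by linarith) (by linarith)
  obtain ⟨C₂, hC₂, hf⟩ := hf (d + 2)
  obtain ⟨C₃, hC₃, hn⟩ := exists_lintegral_ker_slab_sq_le hθ hθ1 d
  obtain ⟨J, hJ, hd⟩ := exists_lintegral_slab_decay_le d
  set B : ℝ := (1 + C₁) ^ 2 * (C₃ * (2 * M) ^ θ) + J * (C₂ ^ 2 / C₁) * M * A ^ (2 * (1 - θ)) with hB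
  have hB0 : 0 < B := by positivity
  refine ⟨√B, by positivity, fun w c k h i T t s x hw hc hk hkA hT hTM ht => ?_⟩
  have hc0 : 0 < c := by linarith
  have hm : Measurable fun z : ({j : Fin d // j ≠ i} → ℝ) × ℝ => ENNReal.ofReal ((1 + C₁) ^ 2) *
      ‖ker w c k (t - z.2) (x - insertCoord i s z.1)‖ₑ ^ 2 :=
    ((stronglyMeasurable_ker_slab_right w c k i t x s).enorm.pow_const 2).const_mul _
  have hae : ∀ᵐ z ∂slabMeasure i T, z.2 ∈ timeI T :=
    Measure.quasiMeasurePreserving_snd.ae (ae_restrict_mem measurableSet_Icc)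
  set κ := |k i| with hκ
  have hκA : κ ≤ A * c := (PiLp.norm_apply_le k i).trans hkA
  have hκ2 : k i ^ 2 / c ^ 2 = (κ / c) ^ 2 := by rw [hκ, div_pow, sq_abs]
  set V : ℝ := (c ^ θ * (κ / c) ^ (θ - 1)) ^ 2 with hV
  have hV' : V = (c ^ 2) ^ θ * (k i ^ 2 / c ^ 2) ^ (θ - 1) := by
    rw [hV, hκ2, mul_pow]
    rw [Real.rpow_pow_comm hc0.le, Real.rpow_pow_comm (by positivity)]
  -- A lower bound for the main term, so that the bounded far-field contribution can be absorbed
  -- into it.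
  have hV1 : A ^ (2 * (θ - 1)) ≤ V := by
    have h1 : (κ / c) ^ (θ - 1) ≥ A ^ (θ - 1) := by
      refine Real.rpow_le_rpow_of_nonpos (by positivity) ?_ (by linarith)
      rw [div_le_iff₀ hc0]; exact hκA
    have h2 : 1 ≤ c ^ θ := Real.one_le_rpow hc hθ.le
    have h3 : A ^ (2 * (θ - 1)) = (A ^ (θ - 1)) ^ 2 := by
      rw [← Real.rpow_natCast, ← Real.rpow_mul (by linarith)]; congr 1; push_cast; ring
    rw [h3, hV]
    gcongr
    have h4 : 0 ≤ A ^ (θ - 1) := by positivity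
    nlinarith
  calc _ ≤ ∫⁻ z, (ENNReal.ofReal ((1 + C₁) ^ 2) *
            ‖ker w c k (t - z.2) (x - insertCoord i s z.1)‖ₑ ^ 2 + ENNReal.ofReal
            (C₂ ^ 2 / (C₁ * c ^ 3) * ((1 + ‖x - insertCoord i s z.1‖) ^ d)⁻¹)) ∂slabMeasure i T := by
        refine lintegral_mono_ae ?_
        filter_upwards [hae] with z hz
        set y := x - insertCoord i s z.1 with hy
        have hyh : |x h - insertCoord i s z.1 h| ≤ ‖y‖ := by
          simpa [hy] using PiLp.norm_apply_le y h
        have hc3 : 1 ≤ c ^ 3 := one_le_pow₀ hc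
        -- Up to distance C₁c³ the weight is bounded and the square function on slabs applies.
        -- Beyond it rapid decay absorbs the weight and leaves c^{-3}, which beats the length c² of
        -- the time interval.
        rcases le_total ‖y‖ (C₁ * c ^ 3) with hn | hn
        · refine le_trans ?_ le_self_add
          rw [← ofReal_norm, ← ENNReal.ofReal_pow (norm_nonneg _),
            ← ENNReal.ofReal_mul (by positivity), mul_comm]
          refine ENNReal.ofReal_le_ofReal ?_
          gcongr
          rw [inv_mul_le_iff₀ (by positivity)]
          linarith
        · refine le_trans (ENNReal.ofReal_le_ofReal ?_) le_add_self
          have h1 := hf w c k (t - z.2) y hw hc hkA (by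
            rw [abs_le]; constructor <;> linarith [ht.1, ht.2, hz.1, hz.2]) hn
          have h2 : (c ^ 3)⁻¹ * |x h - insertCoord i s z.1 h| ≤ ‖y‖ := by
            refine le_trans ?_ hyh
            exact mul_le_of_le_one_left (abs_nonneg _) (inv_le_one_of_one_le₀ hc3)
          calc ‖ker w c k (t - z.2) y‖ ^ 2 * (1 + (c ^ 3)⁻¹ * |x h - insertCoord i s z.1 h|) ^ 2
              ≤ (C₂ / (1 + ‖y‖) ^ (d + 2)) ^ 2 * (1 + ‖y‖) ^ 2 := by gcongr
            _ = C₂ ^ 2 / (1 + ‖y‖) * ((1 + ‖y‖) ^ d)⁻¹ * ((1 + ‖y‖) ^ (d + 1))⁻¹ := by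
                field_simp; ring
            _ ≤ C₂ ^ 2 / (1 + ‖y‖) * ((1 + ‖y‖) ^ d)⁻¹ := by
                refine mul_le_of_le_one_right (by positivity) (inv_le_one_of_one_le₀ ?_)
                exact one_le_pow₀ (by linarith [norm_nonneg y])
            _ ≤ _ := by gcongr; linarith
    _ ≤ ENNReal.ofReal ((1 + C₁) ^ 2 * (C₃ * ((2 * (M * c ^ 2)) ^ θ * (k i ^ 2 / c ^ 2) ^ (θ - 1)))) +
          ENNReal.ofReal (J * (C₂ ^ 2 / (C₁ * c ^ 3)) * T) := by
        rw [lintegral_add_left hm, lintegral_const_mul' _ _ (by finiteness)]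
        refine add_le_add ?_ (hd i T _ x s hT (by positivity))
        rw [ENNReal.ofReal_mul (by positivity)]
        refine mul_le_mul_right ?_ _
        exact (lintegral_slab_ker_sq_le w c k i (by linarith) ht x s).trans
          (hn w c k i _ _ hw hc hk (by positivity))
    _ ≤ _ := by
        rw [← ENNReal.ofReal_add (by positivity) (by positivity)]
        refine ENNReal.ofReal_le_ofReal ?_
        rw [mul_pow, Real.sq_sqrt hB0.le, ← hV, hB, add_mul]
        refine add_le_add (le_of_eq ?_) ?_
        · rw [hV', show 2 * (M * c ^ 2) = 2 * M * c ^ 2 by ring,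
            Real.mul_rpow (by positivity) (by positivity)]
          ring
        · have h1 : J * (C₂ ^ 2 / (C₁ * c ^ 3)) * T ≤ J * (C₂ ^ 2 / C₁) * M := by
            calc J * (C₂ ^ 2 / (C₁ * c ^ 3)) * T
                ≤ J * (C₂ ^ 2 / (C₁ * c ^ 3)) * (M * c ^ 2) := by gcongr
              _ = J * (C₂ ^ 2 / C₁) * M * c⁻¹ := by field_simp
              _ ≤ _ := mul_le_of_le_one_right (by positivity) (inv_le_one_of_one_le₀ hc)
          have h2 : 1 ≤ A ^ (2 * (1 - θ)) * V := by
            calc (1 : ℝ) = A ^ (2 * (1 - θ)) * A ^ (2 * (θ - 1)) := by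
                  rw [← Real.rpow_add (by linarith)]
                  rw [show 2 * (1 - θ) + 2 * (θ - 1) = 0 by ring, Real.rpow_zero]
              _ ≤ _ := by gcongr
          calc _ ≤ J * (C₂ ^ 2 / C₁) * M := h1
            _ ≤ J * (C₂ ^ 2 / C₁) * M * (A ^ (2 * (1 - θ)) * V) :=
                le_mul_of_one_le_right (by positivity) h2
            _ = _ := by ring

theorem eLpNorm_const_mul_le {α : Type*} [MeasurableSpace α] {μ : Measure α} {q : ℝ≥0∞} {N : ℝ}
    {f : α → ℝ≥0∞} (hf : Measurable f) :
    eLpNorm (fun r => ENNReal.ofReal N * f r) q μ ≤ ENNReal.ofReal N * eLpNorm f q μ :=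
  eLpNorm_le_mul_eLpNorm_of_ae_le_mul'' _ hf.aestronglyMeasurable
    (Filter.Eventually.of_forall fun r => by simp [ENNReal.ofReal])

theorem toReal_one_div_lt {q : ℝ≥0∞} (hd : 0 < d) (hqd : 8 / (d : ℝ≥0∞) < q) :
    (1 / q).toReal < d / 8 := by
  have hd0 : (d : ℝ≥0∞) ≠ 0 := by exact_mod_cast hd.ne'
  have h1 : 1 / q < d / 8 := by
    rw [one_div, ← ENNReal.inv_lt_inv, inv_inv, ENNReal.inv_div (by simp) (by simp)]
    exact hqd
  have h2 := (ENNReal.toReal_lt_toReal h1.ne_top (by finiteness)).2 h1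
  simpa using h2

/-- The retarded estimate for frequencies bounded by a multiple of `c`. -/
theorem exists_retarded_low (hd : 2 ≤ d) {q : ℝ≥0∞} (hq : 2 ≤ q) (hqd : 8 / (d : ℝ≥0∞) < q)
    {A M : ℝ} (hA : 1 ≤ A) (hM : 0 < M) : ∃ C : ℝ, 0 < C ∧ ∀ (w : Sp d) (c : ℝ) (k : Sp d)
    (h i : Fin d) (T : ℝ) (g : ℝ → Sp d → ℂ), ‖w‖ ≤ 1 → 1 ≤ c → 1 ≤ |k i| → ‖k‖ ≤ A * c →
    0 < T → T ≤ M * c ^ 2 → StronglyMeasurable (Function.uncurry g) →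
    anisoNorm q ⊤ h T (retarded w c k g) ≤
      ENNReal.ofReal (C * (c ^ (1 + (d : ℝ) / 2) * |k i| ^ (-(3 / 2) + (1 / q).toReal))) *
        anisoNorm 1 2 i T g := by
  set p := (1 / q).toReal with hp
  have hp0 : 0 ≤ p := ENNReal.toReal_nonneg
  have hp1 : p ≤ 1 / 2 := toReal_one_div_le_half hq
  have hp2 : p < d / 8 := toReal_one_div_lt (by omega) hqd
  have hd2 : (2 : ℝ) ≤ d := by exact_mod_cast hd
  -- The final power of c is 3/2 + 2p + θ, which is at most 1 + d/2 exactly when θ ≤ d/2 - 1/2 - 2p.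
  -- Since q > 8/d means p < d/8, and d ≥ 2, this leaves room for some θ > 0.
  set θ := min (1 / 2) ((d : ℝ) / 2 - 1 / 2 - 2 * p) with hθd
  have hθ : 0 < θ := lt_min (by norm_num) (by linarith)
  have hθ1 : θ < 1 := lt_of_le_of_lt (min_le_left _ _) (by norm_num)
  have hθ2 : θ ≤ (d : ℝ) / 2 - 1 / 2 - 2 * p := min_le_right _ _
  obtain ⟨C₁, hC₁, h1⟩ := exists_lintegral_slab_weight_le hθ hθ1 hA hM d
  obtain ⟨C₂, hC₂, h2⟩ := exists_eLpNorm_slabMaj_le (d := d) hq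
  refine ⟨C₁ * C₂ * A ^ (θ + 1 / 2 - p), by positivity,
    fun w c k h i T g hw hc hk hkA hT hTM hg => ?_⟩
  have hc0 : 0 < c := by linarith
  have hκ0 : 0 < |k i| := by linarith
  have hκA : |k i| ≤ A * c := (PiLp.norm_apply_le k i).trans hkA
  set N := C₁ * (c ^ θ * (|k i| / c) ^ (θ - 1)) with hN
  have hN0 : 0 < N := by positivity
  -- The power |k_i|^{θ-1} is split into the desired -3/2 + p and a surplus θ + 1/2 - p ≥ 0, which
  -- |k_i| ≤ A c turns into a power of c.
  have hKle : N * (C₂ * (c ^ 3) ^ p) ≤ C₁ * C₂ * A ^ (θ + 1 / 2 - p) *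
      (c ^ (1 + (d : ℝ) / 2) * |k i| ^ (-(3 / 2) + p)) := by
    have e1 : N * (C₂ * (c ^ 3) ^ p) = C₁ * C₂ * (c ^ (1 + 3 * p) *
        (|k i| ^ (-(3 / 2) + p) * |k i| ^ (θ + 1 / 2 - p))) := by
      rw [← Real.rpow_add hκ0, hN, Real.div_rpow hκ0.le hc0.le, ← Real.rpow_natCast,
        ← Real.rpow_mul hc0.le, div_eq_mul_inv, ← Real.rpow_neg hc0.le,
        show 1 + 3 * p = θ + -(θ - 1) + (3 : ℕ) * p by push_cast; ring, Real.rpow_add hc0,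
        Real.rpow_add hc0, show -(3 / 2) + p + (θ + 1 / 2 - p) = θ - 1 by ring]
      ring
    rw [e1]
    calc _ ≤ C₁ * C₂ * (c ^ (1 + 3 * p) * (|k i| ^ (-(3 / 2) + p) * (A * c) ^ (θ + 1 / 2 - p))) := by
          have : 0 ≤ θ + 1 / 2 - p := by linarith
          gcongr
      _ = C₁ * C₂ * A ^ (θ + 1 / 2 - p) *
            (c ^ (1 + 3 * p + (θ + 1 / 2 - p)) * |k i| ^ (-(3 / 2) + p)) := by
          rw [Real.mul_rpow (by linarith) hc0.le, Real.rpow_add hc0 (1 + 3 * p)]; ring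
      _ ≤ _ := by
          refine mul_le_mul_of_nonneg_left (mul_le_mul_of_nonneg_right ?_ (by positivity))
            (by positivity)
          exact Real.rpow_le_rpow_of_exponent_le hc (by linarith)
  refine (anisoNorm_retarded_le hw hc k h i hT (one_le_two.trans hq)
    (K := N * (C₂ * (c ^ 3) ^ p)) (by positivity) hg
    (U := fun s r => ENNReal.ofReal N * slabMaj i T g h (c ^ 3) s r)
    (measurable_const_mul_slabMaj i T hg h _ _) (fun s _ t ht x => ?_) (fun s _ => ?_)).trans
    (mul_le_mul_left (ENNReal.ofReal_le_ofReal hKle) _)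
  · refine (enorm_integral_le_lintegral_enorm _).trans (setLIntegral_slabInt_le hg (by positivity)
      hN0.le ?_)
    exact (setLIntegral_le_lintegral _ _).trans (h1 w c k h i T t s x hw hc hk hkA hT hTM ht)
  · refine (eLpNorm_const_mul_le (measurable_slabMaj_right i T hg h _ s)).trans ?_
    rw [ENNReal.ofReal_mul hN0.le, mul_assoc]
    exact mul_le_mul_right (h2 i T g hg h _ (by positivity) s) _

end MaxFun

/-! ### Slab estimates in the quartic regime -/

namespace MaxFun

variable {d : ℕ}

/-- Integrals over slabs of functions that decay along a space-time direction. -/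
theorem exists_lintegral_slab_drift_le (d : ℕ) : ∃ J : ℝ, 0 < J ∧ ∀ (i : Fin d) (T v B t s : ℝ)
    (x b : Sp d), 0 < v → 0 ≤ B →
    ∫⁻ z, ENNReal.ofReal (B * (((1 + |t - z.2| * v) ^ 2)⁻¹ *
      ((1 + ‖x - insertCoord i s z.1 + (t - z.2) • b‖) ^ d)⁻¹)) ∂slabMeasure i T ≤
      ENNReal.ofReal (J * B / v) := by
  set J₀ : Fin d → ℝ := fun i => ∫ y : {j : Fin d // j ≠ i} → ℝ, (1 + ‖y‖) ^ (-(d : ℝ)) with hJ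
  set J₁ : ℝ := ∫ y : ℝ, (1 + ‖y‖) ^ (-(2 : ℝ)) with hJ1
  have hJ0 : ∀ i, 0 ≤ J₀ i := fun i => integral_nonneg fun y => by positivity
  have hJ10 : 0 ≤ J₁ := integral_nonneg fun y => by positivity
  have hJs : 0 ≤ ∑ i, J₀ i := Finset.sum_nonneg fun i _ => hJ0 i
  refine ⟨(∑ i, J₀ i) * J₁ + 1, by positivity, fun i T v B t s x b hv hB => ?_⟩
  set f : ({j : Fin d // j ≠ i} → ℝ) → ℝ := fun y => (1 + ‖y‖) ^ (-(d : ℝ)) with hf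
  have hi : Integrable f volume := by
    refine integrable_one_add_norm ?_
    rw [Module.finrank_fintype_fun_eq_card]
    have := Fintype.card_subtype_lt (p := fun j : Fin d => j ≠ i) (x := i) (by simp)
    rw [Fintype.card_fin] at this
    exact_mod_cast this
  have hfm : Measurable f := by rw [hf]; fun_prop
  have hf0 : ∀ y, 0 ≤ f y := fun y => by positivity
  set rest : Sp d → {j : Fin d // j ≠ i} → ℝ := fun x j => x j with hrest
  set φ : ℝ → ℝ≥0∞ := fun τ => ENNReal.ofReal (B * (1 + v * ‖τ‖) ^ (-(2 : ℝ))) with hφ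
  have hφm : Measurable φ := by rw [hφ]; fun_prop
  have hm : Measurable fun z : ({j : Fin d // j ≠ i} → ℝ) × ℝ =>
      φ (t - z.2) * ENNReal.ofReal (f (rest x - z.1 + (t - z.2) • rest b)) := by fun_prop
  have hpt : ∀ z : ({j : Fin d // j ≠ i} → ℝ) × ℝ,
      ENNReal.ofReal (B * (((1 + |t - z.2| * v) ^ 2)⁻¹ *
      ((1 + ‖x - insertCoord i s z.1 + (t - z.2) • b‖) ^ d)⁻¹)) ≤
      φ (t - z.2) * ENNReal.ofReal (f (rest x - z.1 + (t - z.2) • rest b)) := fun z => by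
    rw [hφ, hf]
    simp only
    rw [← ENNReal.ofReal_mul (by positivity)]
    refine ENNReal.ofReal_le_ofReal ?_
    rw [Real.rpow_neg (by positivity), Real.rpow_neg (by positivity), Real.rpow_natCast, mul_assoc,
      mul_comm v, Real.norm_eq_abs]
    have h1 : ‖rest x - z.1 + (t - z.2) • rest b‖ ≤
        ‖x - insertCoord i s z.1 + (t - z.2) • b‖ := by
      rw [pi_norm_le_iff_of_nonneg (norm_nonneg _)]
      intro j
      refine le_trans (le_of_eq ?_) (PiLp.norm_apply_le _ (j : Fin d))
      simp [hrest, insertCoord_ne]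
    have h2 : (1 + |t - z.2| * v) ^ (2 : ℝ) = (1 + |t - z.2| * v) ^ 2 := by
      exact_mod_cast Real.rpow_natCast _ 2
    rw [h2]
    gcongr
  calc _ ≤ ∫⁻ z, φ (t - z.2) * ENNReal.ofReal (f (rest x - z.1 + (t - z.2) • rest b))
          ∂slabMeasure i T := lintegral_mono hpt
    _ = ∫⁻ τ in timeI T, φ (t - τ) * ENNReal.ofReal (J₀ i) := by
        rw [slabMeasure, lintegral_prod_symm _ hm.aemeasurable]
        refine lintegral_congr fun τ => ?_
        simp only
        rw [lintegral_const_mul' _ _ (by simp [hφ])]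
        congr 1
        have : ∀ y, rest x - y + (t - τ) • rest b = (rest x + (t - τ) • rest b) - y := fun y => by abel
        simp only [this]
        rw [lintegral_sub_left_eq_self (fun y => ENNReal.ofReal (f y)),
          ← ofReal_integral_eq_lintegral_ofReal hi (Filter.Eventually.of_forall hf0)]
    _ ≤ (∫⁻ τ, φ (t - τ)) * ENNReal.ofReal (J₀ i) := by
        rw [lintegral_mul_const' _ _ (by finiteness)]
        exact mul_le_mul_left (setLIntegral_le_lintegral _ _) _
    _ = ENNReal.ofReal (B * (J₁ * v⁻¹) * J₀ i) := by
        rw [lintegral_sub_left_eq_self φ t, ENNReal.ofReal_mul (by positivity)]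
        congr 1
        simp only [hφ]
        simp only [ENNReal.ofReal_mul hB]
        rw [lintegral_const_mul' _ _ (by finiteness),
          lintegral_one_add_mul_norm volume (by simp) hv]
        simp [hJ1]
    _ ≤ _ := by
        refine ENNReal.ofReal_le_ofReal ?_
        have h1 : J₀ i ≤ ∑ i, J₀ i := Finset.single_le_sum (fun i _ => hJ0 i) (Finset.mem_univ i)
        calc B * (J₁ * v⁻¹) * J₀ i ≤ B * (J₁ * v⁻¹) * ∑ i, J₀ i := by gcongr
          _ ≤ ((∑ i, J₀ i) * J₁ + 1) * B / v := by
            rw [div_eq_mul_inv]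
            have : 0 ≤ B * v⁻¹ := by positivity
            nlinarith

/-- A lower bound for the characteristic speed. -/
noncomputable def speed (c : ℝ) (k : Sp d) (i : Fin d) : ℝ := ‖k‖ ^ 2 * |k i| / c ^ 2

/-- The Schur bound for the plane waves based on one hyperplane. -/
theorem exists_lintegral_slab_ker_le (d : ℕ) : ∃ C : ℝ, 0 < C ∧ ∀ (w : Sp d) (c : ℝ) (k : Fin d → ℤ)
    (i : Fin d) (T t s : ℝ) (y : {j : Fin d // j ≠ i} → ℝ), ‖w‖ ≤ 1 → 1 ≤ c →
    c ≤ delta d * ‖kvec k‖ → k i ≠ 0 →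
    ∫⁻ z, ‖ker w c (kvec k) (t - z.2) (insertCoord i s y - insertCoord i s z.1)‖ₑ ∂slabMeasure i T ≤
      ENNReal.ofReal (C / speed c (kvec k) i) := by
  obtain ⟨C, hC, h⟩ := exists_ker_one_sided d (d + 2)
  obtain ⟨J, hJ, hd⟩ := exists_lintegral_slab_drift_le d
  refine ⟨J * C, by positivity, fun w c k i T t s y hw hc hk hki => ?_⟩
  have hki' : 0 < |(k i : ℝ)| := by positivity
  have hL : |(k i : ℝ)| ≤ ‖kvec k‖ := PiLp.norm_apply_le (kvec k) i
  have hL0 : 0 < ‖kvec k‖ := by linarith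
  have hv : 0 < speed c (kvec k) i := by
    unfold speed
    have : 0 < |kvec k i| := hki'
    positivity
  refine le_trans (lintegral_mono fun z => ?_) (hd i T (speed c (kvec k) i) C t s (insertCoord i s y)
    (gradFactor c (kvec k) • kvec k) hv hC.le)
  rw [← ofReal_norm]
  refine ENNReal.ofReal_le_ofReal ?_
  -- Both points lie on the same hyperplane, so x_i = 0 and the one-sided condition holds for either
  -- sign of time.
  refine (h w c k i (t - z.2) _ hw hc hk hki (by simp)).trans ?_
  rw [smul_smul]
  set X := 1 + ‖insertCoord i s y - insertCoord i s z.1 +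
    ((t - z.2) * gradFactor c (kvec k)) • kvec k‖ with hX
  have hX1 : 1 ≤ X := by rw [hX]; linarith [norm_nonneg (insertCoord i s y - insertCoord i s z.1 +
    ((t - z.2) * gradFactor c (kvec k)) • kvec k)]
  set V := 1 + |t - z.2| * speed c (kvec k) i with hV
  have hV1 : 1 ≤ V := by rw [hV]; have : 0 ≤ |t - z.2| * speed c (kvec k) i := by positivity
                         linarith
  rw [div_eq_mul_inv, mul_inv]
  have h1 : (V ^ (d + 2)) ≤ (1 + (|(insertCoord i s y - insertCoord i s z.1) i| +
      |t - z.2| * (‖kvec k‖ ^ 2 * |(k i : ℝ)| / c ^ 2))) ^ (d + 2) := by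
    have e : |t - z.2| * (‖kvec k‖ ^ 2 * |(k i : ℝ)| / c ^ 2) = |t - z.2| * speed c (kvec k) i := rfl
    rw [e]
    gcongr
    rw [hV]
    linarith [abs_nonneg ((insertCoord i s y - insertCoord i s z.1) i)]
  have h2 : V ^ 2 ≤ V ^ (d + 2) := pow_le_pow_right₀ hV1 (by omega)
  have h3 : X ^ d ≤ X ^ (d + 2) := pow_le_pow_right₀ hX1 (by omega)
  gcongr
  exact h2.trans h1

/-- The weighted square integral of the kernel over the one-sided part of a slab. -/
theorem exists_slab_one_sided_le (d : ℕ) : ∃ C : ℝ, 0 < C ∧ ∀ (w : Sp d) (c : ℝ) (k : Fin d → ℤ)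
    (h i : Fin d) (T t s : ℝ) (x : Sp d), ‖w‖ ≤ 1 → 1 ≤ c →
    c ≤ delta d * ‖kvec k‖ → k i ≠ 0 →
    ∫⁻ z in {z | (x i - s) * ((t - z.2) * k i) ≤ 0},
      ENNReal.ofReal (‖ker w c (kvec k) (t - z.2) (x - insertCoord i s z.1)‖ ^ 2 *
      (1 + (‖kvec k‖ / |(k i : ℝ)|)⁻¹ * |x h - insertCoord i s z.1 h|) ^ 2) ∂slabMeasure i T ≤
      ENNReal.ofReal (C / speed c (kvec k) i) := by
  obtain ⟨C, hC, hk1⟩ := exists_ker_one_sided d (d + 2)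
  obtain ⟨J, hJ, hd⟩ := exists_lintegral_slab_drift_le d
  refine ⟨J * (36 * C ^ 2), by positivity, fun w c k h i T t s x hw hc hk hki => ?_⟩
  have hc0 : 0 < c := by linarith
  have hki' : 0 < |(k i : ℝ)| := by positivity
  have hL : |(k i : ℝ)| ≤ ‖kvec k‖ := PiLp.norm_apply_le (kvec k) i
  have hL0 : 0 < ‖kvec k‖ := by linarith
  have hcL : c ≤ ‖kvec k‖ := hk.trans (mul_le_of_le_one_left hL0.le delta_le_one)
  set v := speed c (kvec k) i with hvd
  have hvd' : v = ‖kvec k‖ ^ 2 * |(k i : ℝ)| / c ^ 2 := rfl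
  have hv : 0 < v := by rw [hvd']; positivity
  -- The scale |k|/|k_i| of the weight is chosen so that, measured in it, the drift has speed at
  -- most 6v. The time decay at rate v then absorbs the growth of the weight.
  have hγ : |gradFactor c (kvec k)| * ‖kvec k‖ * (‖kvec k‖ / |(k i : ℝ)|)⁻¹ ≤ 6 * v := by
    have h1 : |gradFactor c (kvec k)| ≤ 6 * (‖kvec k‖ ^ 2 / c ^ 2) := by
      have h2 := abs_gradFactor_le (A := ‖kvec k‖ / c) hc0 (k := kvec k) (by field_simp; rfl)
      rw [div_pow] at h2
      have h3 : 1 ≤ ‖kvec k‖ ^ 2 / c ^ 2 := by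
        rw [one_le_div (by positivity)]; gcongr
      linarith
    calc _ = |gradFactor c (kvec k)| * |(k i : ℝ)| := by field_simp
      _ ≤ 6 * (‖kvec k‖ ^ 2 / c ^ 2) * |(k i : ℝ)| := by gcongr
      _ = _ := by rw [hvd']; ring
  have hD1 : (‖kvec k‖ / |(k i : ℝ)|)⁻¹ ≤ 1 := by
    rw [inv_div, div_le_one hL0]; exact hL
  have hD0 : 0 ≤ (‖kvec k‖ / |(k i : ℝ)|)⁻¹ := by positivity
  have hms : MeasurableSet {z : ({j : Fin d // j ≠ i} → ℝ) × ℝ |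
      (x i - s) * ((t - z.2) * k i) ≤ 0} := measurableSet_le (by fun_prop) (by fun_prop)
  refine le_trans ((setLIntegral_mono' hms fun z hz => ?_).trans (setLIntegral_le_lintegral _ _))
    (hd i T v (36 * C ^ 2) t s x (gradFactor c (kvec k) • kvec k) hv (by positivity))
  refine ENNReal.ofReal_le_ofReal ?_
  have hzi : (x - insertCoord i s z.1) i = x i - s := by simp
  have h1 := hk1 w c k i (t - z.2) (x - insertCoord i s z.1) hw hc hk hki (by rw [hzi]; exact hz)
  rw [smul_smul]
  set y := x - insertCoord i s z.1 + ((t - z.2) * gradFactor c (kvec k)) • kvec k with hy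
  have hyh : |x h - insertCoord i s z.1 h| ≤ ‖y‖ + |t - z.2| * (|gradFactor c (kvec k)| * ‖kvec k‖) := by
    have e : x - insertCoord i s z.1 = y - ((t - z.2) * gradFactor c (kvec k)) • kvec k := by
      rw [hy]; abel
    have h2 : |x h - insertCoord i s z.1 h| ≤ ‖x - insertCoord i s z.1‖ := by
      simpa using PiLp.norm_apply_le (x - insertCoord i s z.1) h
    refine h2.trans ?_
    rw [e]
    refine (norm_sub_le _ _).trans (le_of_eq ?_)
    rw [norm_smul, norm_mul, Real.norm_eq_abs, Real.norm_eq_abs, mul_assoc]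
  set V := 1 + |t - z.2| * v with hV
  set X := 1 + ‖y‖ with hX
  have hV1 : 1 ≤ V := by
    have : 0 ≤ |t - z.2| * v := by positivity
    linarith
  have hX1 : 1 ≤ X := by linarith [norm_nonneg y]
  have hW : 1 + (‖kvec k‖ / |(k i : ℝ)|)⁻¹ * |x h - insertCoord i s z.1 h| ≤ 6 * (V * X) := by
    have h2 : (‖kvec k‖ / |(k i : ℝ)|)⁻¹ * |x h - insertCoord i s z.1 h| ≤
        ‖y‖ + |t - z.2| * (6 * v) := by
      calc _ ≤ (‖kvec k‖ / |(k i : ℝ)|)⁻¹ *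
            (‖y‖ + |t - z.2| * (|gradFactor c (kvec k)| * ‖kvec k‖)) := by gcongr
        _ = (‖kvec k‖ / |(k i : ℝ)|)⁻¹ * ‖y‖ + |t - z.2| *
            (|gradFactor c (kvec k)| * ‖kvec k‖ * (‖kvec k‖ / |(k i : ℝ)|)⁻¹) := by ring
        _ ≤ _ := by
          gcongr
          exact mul_le_of_le_one_left (norm_nonneg _) hD1
    have h3 : V * X = 1 + |t - z.2| * v + ‖y‖ + |t - z.2| * v * ‖y‖ := by rw [hV, hX]; ring
    have h4 : 0 ≤ |t - z.2| * v := by positivity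
    have h5 : 0 ≤ |t - z.2| * v * ‖y‖ := by positivity
    nlinarith [norm_nonneg y]
  have h4 : ‖ker w c (kvec k) (t - z.2) (x - insertCoord i s z.1)‖ ≤ C / (V ^ (d + 2) * X ^ (d + 2)) := by
    refine h1.trans ?_
    have : V ≤ 1 + (|(x - insertCoord i s z.1) i| +
        |t - z.2| * (‖kvec k‖ ^ 2 * |(k i : ℝ)| / c ^ 2)) := by
      rw [hV, ← hvd']; linarith [abs_nonneg ((x - insertCoord i s z.1) i)]
    gcongr
  calc _ ≤ (C / (V ^ (d + 2) * X ^ (d + 2))) ^ 2 * (6 * (V * X)) ^ 2 := by gcongr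
    _ = 36 * C ^ 2 * ((V ^ 2)⁻¹ * (X ^ d)⁻¹) * ((V ^ (2 * d))⁻¹ * (X ^ (d + 2))⁻¹) := by
        field_simp; ring
    _ ≤ _ := by
        refine mul_le_of_le_one_right (by positivity) (mul_le_one₀ ?_ (by positivity) ?_)
        · exact inv_le_one_of_one_le₀ (one_le_pow₀ hV1)
        · exact inv_le_one_of_one_le₀ (one_le_pow₀ hX1)

/-- This trades the causal set S, which moves with t, for the fixed set P: the integral over S is
either negligible itself or differs from the one over P by a negligible amount. -/
theorem enorm_setIntegral_le_of_subset_or {Ω : Type*} [MeasurableSpace Ω] {μ : Measure Ω} {a : Ω → ℂ}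
    (ha : Integrable a μ) {S P Q : Set Ω} (hS : MeasurableSet S) (hSP : S ⊆ P)
    (hQ : S ⊆ Q ∨ P \ S ⊆ Q) :
    ‖∫ z in S, a z ∂μ‖ₑ ≤ ‖∫ z in P, a z ∂μ‖ₑ + ∫⁻ z in Q, ‖a z‖ₑ ∂μ := by
  rcases hQ with hQ | hQ
  · refine le_trans ?_ le_add_self
    exact (enorm_integral_le_lintegral_enorm _).trans (lintegral_mono_set hQ)
  · have h1 : ∫ z in S, a z ∂μ = ∫ z in P, a z ∂μ - ∫ z in P \ S, a z ∂μ := by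
      rw [setIntegral_sdiff hS ha.integrableOn hSP]; ring
    rw [h1]
    refine enorm_sub_le.trans (add_le_add le_rfl ?_)
    exact (enorm_integral_le_lintegral_enorm _).trans (lintegral_mono_set hQ)

end MaxFun

/-! ### The retarded estimate for |k| large compared to c -/

namespace MaxFun

variable {d : ℕ}

/-- The supremum over a hyperplane of the Duhamel integral over a fixed set of sources. -/
noncomputable def slabSup (w : Sp d) (c : ℝ) (k : Sp d) (i h : Fin d) (T : ℝ) (g : ℝ → Sp d → ℂ)
    (P : Set ℝ) (s r : ℝ) : ℝ≥0∞ :=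
  ⨆ n, ‖∫ z in {z | z.2 ∈ P}, slabInt w c k i g
    (T * (2 * (TopologicalSpace.denseSeq (({j : Fin d // j ≠ h} → ℝ) × unitInterval) n).2 - 1))
    (insertCoord h r (TopologicalSpace.denseSeq (({j : Fin d // j ≠ h} → ℝ) × unitInterval) n).1)
    s z ∂slabMeasure i T‖ₑ

theorem stronglyMeasurable_slabInt_insertCoord (w : Sp d) (c : ℝ) (k : Sp d) (i h : Fin d)
    {g : ℝ → Sp d → ℂ} (hg : StronglyMeasurable (Function.uncurry g)) (t : ℝ)
    (y : {j : Fin d // j ≠ h} → ℝ) :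
    StronglyMeasurable fun p : (ℝ × ℝ) × (({j : Fin d // j ≠ i} → ℝ) × ℝ) =>
      slabInt w c k i g t (insertCoord h p.1.2 y) p.1.1 p.2 := by
  simp only [slabInt]
  refine StronglyMeasurable.mul ?_ ((stronglyMeasurable_slabFun i hg).comp_measurable
    (by fun_prop : Measurable fun p : (ℝ × ℝ) × (({j : Fin d // j ≠ i} → ℝ) × ℝ) => (p.1.1, p.2)))
  have h1 : Continuous fun p : (ℝ × ℝ) × (({j : Fin d // j ≠ i} → ℝ) × ℝ) =>
      insertCoord h p.1.2 y := (continuous_insertCoord h).comp (by fun_prop :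
        Continuous fun p : (ℝ × ℝ) × (({j : Fin d // j ≠ i} → ℝ) × ℝ) => (p.1.2, y))
  have h2 : Continuous fun p : (ℝ × ℝ) × (({j : Fin d // j ≠ i} → ℝ) × ℝ) =>
      insertCoord i p.1.1 p.2.1 := (continuous_insertCoord i).comp (by fun_prop :
        Continuous fun p : (ℝ × ℝ) × (({j : Fin d // j ≠ i} → ℝ) × ℝ) => (p.1.1, p.2.1))
  exact (Continuous.comp (g := fun p : ℝ × Sp d => ker w c k p.1 p.2)
    (f := fun p : (ℝ × ℝ) × (({j : Fin d // j ≠ i} → ℝ) × ℝ) =>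
      (t - p.2.2, insertCoord h p.1.2 y - insertCoord i p.1.1 p.2.1)) (continuous_ker w c k)
    (by fun_prop)).stronglyMeasurable

theorem measurable_slabSup (w : Sp d) (c : ℝ) (k : Sp d) (i h : Fin d) (T : ℝ) {g : ℝ → Sp d → ℂ}
    (hg : StronglyMeasurable (Function.uncurry g)) (P : Set ℝ) :
    Measurable (Function.uncurry (slabSup w c k i h T g P)) := by
  refine Measurable.iSup fun n => ?_
  exact (StronglyMeasurable.integral_prod_right' (ν := (slabMeasure i T).restrict {z | z.2 ∈ P})
    (stronglyMeasurable_slabInt_insertCoord w c k i h hg _ _)).enorm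

/-- Duhamel integrals over a fixed set of sources are free waves. -/
theorem exists_slab_synthesis (d : ℕ) : ∃ C : ℝ, 0 < C ∧ ∀ (w : Sp d) (c : ℝ) (k : Fin d → ℤ)
    (i : Fin d) (T s : ℝ) (g : ℝ → Sp d → ℂ) (P : Set ℝ), ‖w‖ ≤ 1 → 1 ≤ c →
    c ≤ delta d * ‖kvec k‖ → k i ≠ 0 → StronglyMeasurable (Function.uncurry g) → MeasurableSet P →
    slabNorm i T g s < ⊤ → ∃ Ψ : Lp ℂ 2 (volume : Measure (Sp d)),
      ‖Ψ‖ₑ ≤ ENNReal.ofReal (√(C / speed c (kvec k) i)) * slabNorm i T g s ∧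
      ∀ t x, ∫ z in {z | z.2 ∈ P}, slabInt w c (kvec k) i g t x s z ∂slabMeasure i T =
        inner ℂ (wave w c (kvec k) (t, x)) Ψ := by
  obtain ⟨C, hC, h1⟩ := exists_lintegral_slab_ker_le d
  obtain ⟨b, hb, h2⟩ := norm_wave_le d
  refine ⟨C, hC, fun w c k i T s g P hw hc hk hki hg hP hs => ?_⟩
  have hc0 : 0 < c := by linarith
  have hv : 0 ≤ speed c (kvec k) i := by unfold speed; positivity
  have hPm : MeasurableSet {z : ({j : Fin d // j ≠ i} → ℝ) × ℝ | z.2 ∈ P} := measurable_snd hP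
  have hy : Continuous fun z : ({j : Fin d // j ≠ i} → ℝ) × ℝ => insertCoord i s z.1 :=
    (continuous_insertCoord i).comp (by fun_prop : Continuous fun z :
      ({j : Fin d // j ≠ i} → ℝ) × ℝ => (s, z.1))
  have he : Continuous fun z : ({j : Fin d // j ≠ i} → ℝ) × ℝ =>
      wave w c (kvec k) (z.2, insertCoord i s z.1) :=
    Continuous.comp (g := wave w c (kvec k)) (f := fun z : ({j : Fin d // j ≠ i} → ℝ) × ℝ =>
      (z.2, insertCoord i s z.1)) (continuous_wave w c (kvec k)) (by fun_prop)
  have hmem : MemLp (slabFun i g s) 2 (slabMeasure i T) :=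
    ⟨(stronglyMeasurable_slabFun_right i hg s).aestronglyMeasurable, hs⟩
  obtain ⟨Ψ, hΨ, hi⟩ := exists_synthesis (μ := slabMeasure i T) he.stronglyMeasurable (b := b)
    (fun z => h2 w c (kvec k) _ hc0 hw) (B := C / speed c (kvec k) i) (by positivity)
    (fun z => by
      simp only [inner_wave]
      exact h1 w c k i T z.2 s z.1 hw hc hk hki) (hmem.indicator hPm)
  refine ⟨Ψ, hΨ.trans (mul_le_mul_right (eLpNorm_indicator_le _) _), fun t x => ?_⟩
  rw [hi, ← integral_indicator hPm]
  refine integral_congr_ae (Filter.Eventually.of_forall fun z => ?_)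
  simp only [inner_wave]
  by_cases hz : z ∈ {z : ({j : Fin d // j ≠ i} → ℝ) × ℝ | z.2 ∈ P}
  · rw [Set.indicator_of_mem hz, Set.indicator_of_mem hz, slabInt, mul_comm]
  · rw [Set.indicator_of_notMem hz, Set.indicator_of_notMem hz, zero_mul]

/-- The maximal bound for Duhamel integrals over a fixed set of sources. -/
theorem exists_slabSup_le (hd : 0 < d) {q : ℝ≥0∞} (hq : 2 ≤ q) (hqd : 4 / (d : ℝ≥0∞) < q) :
    ∃ C : ℝ, 0 < C ∧ ∀ (w : Sp d) (c : ℝ) (k : Fin d → ℤ) (h i : Fin d) (T s : ℝ)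
    (g : ℝ → Sp d → ℂ) (P : Set ℝ), ‖w‖ ≤ 1 → 1 ≤ c → c ≤ delta d * ‖kvec k‖ → k i ≠ 0 → 0 < T →
    StronglyMeasurable (Function.uncurry g) → MeasurableSet P → slabNorm i T g s < ⊤ →
    (∀ t ∈ Set.Icc (-T) T, ∀ x : Sp d,
      ‖∫ z in {z | z.2 ∈ P}, slabInt w c (kvec k) i g t x s z ∂slabMeasure i T‖ₑ ≤
        slabSup w c (kvec k) i h T g P s (x h)) ∧
    eLpNorm (slabSup w c (kvec k) i h T g P s) q volume ≤
      ENNReal.ofReal (C * jap ‖kvec k‖ ^ (1 / q).toReal / √(speed c (kvec k) i)) *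
        slabNorm i T g s := by
  obtain ⟨C₁, hC₁, h1⟩ := exists_slab_synthesis d
  obtain ⟨C₂, hC₂, h2⟩ := exists_maximal_dispersive hd q hq hqd
  refine ⟨C₂ * √C₁, by positivity, fun w c k h i T s g P hw hc hk hki hT hg hP hs => ?_⟩
  obtain ⟨Ψ, hΨ, hi⟩ := h1 w c k i T s g P hw hc hk hki hg hP hs
  have heq : slabSup w c (kvec k) i h T g P s = maxInner (slabWave w c (kvec k) h T) Ψ := by
    funext r
    simp only [slabSup, maxInner, hi, slabWave]
  refine ⟨fun t ht x => ?_, ?_⟩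
  · rw [heq, hi]
    obtain ⟨z, hz⟩ := exists_slabWave_eq w c (kvec k) h hT ht x
    rw [← hz]
    exact enorm_inner_le_maxInner (continuous_slabWave w c (kvec k) h T) Ψ (x h) z
  · rw [heq]
    refine (h2 w c (kvec k) h T Ψ hw hc hT (Or.inr hk)).trans ?_
    refine (mul_le_mul_right hΨ _).trans (le_of_eq ?_)
    have hj := one_le_jap ‖kvec k‖
    rw [← mul_assoc, ← ENNReal.ofReal_mul (by positivity), Real.sqrt_div hC₁.le]
    congr 2
    ring

/-- The retarded estimate for frequencies large compared to `c`. -/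
theorem exists_retarded_high (hd : 0 < d) {q : ℝ≥0∞} (hq : 2 ≤ q) (hqd : 4 / (d : ℝ≥0∞) < q) :
    ∃ C : ℝ, 0 < C ∧ ∀ (w : Sp d) (c : ℝ) (k : Fin d → ℤ) (h i : Fin d) (T : ℝ)
    (g : ℝ → Sp d → ℂ), ‖w‖ ≤ 1 → 1 ≤ c → c ≤ delta d * ‖kvec k‖ → k i ≠ 0 → 0 < T →
    StronglyMeasurable (Function.uncurry g) →
    anisoNorm q ⊤ h T (retarded w c (kvec k) g) ≤
      ENNReal.ofReal (C * (c * |(k i : ℝ)| ^ (-(3 / 2) + (1 / q).toReal))) *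
        anisoNorm 1 2 i T g := by
  set p := (1 / q).toReal with hp
  have hp0 : 0 ≤ p := ENNReal.toReal_nonneg
  have hp1 : p ≤ 1 / 2 := toReal_one_div_le_half hq
  obtain ⟨C₁, hC₁, h1⟩ := exists_slabSup_le hd hq hqd
  obtain ⟨C₂, hC₂, h2⟩ := exists_slab_one_sided_le d
  obtain ⟨C₃, hC₃, h3⟩ := exists_eLpNorm_slabMaj_le (d := d) hq
  refine ⟨2 * C₁ * 2 ^ p + √C₂ * C₃, by positivity, fun w c k h i T g hw hc hk hki hT hg => ?_⟩
  have hc0 : 0 < c := by linarith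
  have hκ1 : 1 ≤ |(k i : ℝ)| := by exact_mod_cast Int.one_le_abs hki
  set κ := |(k i : ℝ)| with hκ
  have hκ0 : 0 < κ := by linarith
  have hL : κ ≤ ‖kvec k‖ := PiLp.norm_apply_le (kvec k) i
  set L := ‖kvec k‖ with hLd
  have hL1 : 1 ≤ L := hκ1.trans hL
  have hL0 : 0 < L := by linarith
  set v := speed c (kvec k) i with hvd
  have hvd' : v = L ^ 2 * κ / c ^ 2 := rfl
  have hv : 0 < v := by rw [hvd']; positivity
  have hsv : (√v)⁻¹ = c * (L ^ (-1 : ℝ) * κ ^ (-(1 / 2) : ℝ)) := by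
    rw [hvd', Real.sqrt_div (by positivity), Real.sqrt_sq hc0.le, Real.sqrt_mul (by positivity),
      Real.sqrt_sq hL0.le, Real.sqrt_eq_rpow, Real.rpow_neg hκ0.le, Real.rpow_neg_one]
    field_simp
  have hj : jap L ≤ 2 * L := by
    unfold jap
    rw [Real.sqrt_le_iff]
    constructor
    · positivity
    · nlinarith
  have hj0 : 0 ≤ jap L := by linarith [one_le_jap L]
  -- The power of |k| is negative since p ≤ 1/2, so |k| may be replaced by |k_i|. Together with the
  -- κ^{-1/2} in v^{-1/2} this gives -3/2 + p.
  have hLp : L ^ (-1 + p) ≤ κ ^ (-1 + p) := Real.rpow_le_rpow_of_nonpos hκ0 hL (by linarith)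
  have hmain : L ^ p * (√v)⁻¹ ≤ c * κ ^ (-(3 / 2) + p) := by
    calc L ^ p * (√v)⁻¹ = c * (L ^ (-1 + p) * κ ^ (-(1 / 2) : ℝ)) := by
          rw [hsv, Real.rpow_add hL0]; ring
      _ ≤ c * (κ ^ (-1 + p) * κ ^ (-(1 / 2) : ℝ)) := by gcongr
      _ = _ := by rw [← Real.rpow_add hκ0]; congr 2; ring
  set K₁ := C₁ * jap L ^ p / √v with hK₁
  set K₂ := √(C₂ / v) * (C₃ * (L / κ) ^ p) with hK₂
  have hK₁0 : 0 ≤ K₁ := by positivity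
  have hK₂0 : 0 < K₂ := by positivity
  have hKle : K₁ + K₁ + K₂ ≤ (2 * C₁ * 2 ^ p + √C₂ * C₃) * (c * κ ^ (-(3 / 2) + p)) := by
    have e1 : K₁ ≤ C₁ * 2 ^ p * (c * κ ^ (-(3 / 2) + p)) := by
      calc K₁ ≤ C₁ * (2 * L) ^ p / √v := by rw [hK₁]; gcongr
        _ = C₁ * 2 ^ p * (L ^ p * (√v)⁻¹) := by
            rw [Real.mul_rpow (by norm_num) hL0.le]; ring
        _ ≤ _ := by gcongr
    have e2 : K₂ ≤ √C₂ * C₃ * (c * κ ^ (-(3 / 2) + p)) := by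
      calc K₂ ≤ √(C₂ / v) * (C₃ * L ^ p) := by
            rw [hK₂]
            gcongr
            exact div_le_self hL0.le hκ1
        _ = √C₂ * C₃ * (L ^ p * (√v)⁻¹) := by rw [Real.sqrt_div hC₂.le]; ring
        _ ≤ _ := by gcongr
    linarith
  -- The majorant must not depend on t, so it contains the free waves generated by the sources at
  -- positive and at nonpositive times, and the one-sided error.
  set U : ℝ → ℝ → ℝ≥0∞ := fun s r => slabSup w c (kvec k) i h T g (Set.Ioi 0) s r +
    slabSup w c (kvec k) i h T g (Set.Iic 0) s r +
    ENNReal.ofReal √(C₂ / v) * slabMaj i T g h (L / κ) s r with hU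
  have hm1 := fun P => measurable_slabSup w c (kvec k) i h T hg P
  have hm2 := measurable_const_mul_slabMaj i T hg h (L / κ) (ENNReal.ofReal √(C₂ / v))
  have hm1' : ∀ P s, Measurable (slabSup w c (kvec k) i h T g P s) := fun P s =>
    Measurable.comp (g := Function.uncurry (slabSup w c (kvec k) i h T g P)) (f := fun r => (s, r))
      (hm1 P) measurable_prodMk_left
  have hm2' := fun s => measurable_slabMaj_right i T hg h (L / κ) s
  refine (anisoNorm_retarded_le hw hc (kvec k) h i hT (one_le_two.trans hq)
    (K := K₁ + K₁ + K₂) (by positivity) hg (U := U) (((hm1 _).add (hm1 _)).add hm2)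
    (fun s hs t ht x => ?_) (fun s hs => ?_)).trans (mul_le_mul_left (ENNReal.ofReal_le_ofReal hKle) _)
  · have hint : Integrable (slabInt w c (kvec k) i g t x s) (slabMeasure i T) := by
      obtain ⟨B, hB, h4⟩ := exists_lintegral_slabInt_le hw hc (kvec k) i hT
      refine ⟨((stronglyMeasurable_ker_slab_right w c (kvec k) i t x s).mul
        (stronglyMeasurable_slabFun_right i hg s)).aestronglyMeasurable, ?_⟩
      rw [hasFiniteIntegral_iff_enorm]
      exact lt_of_le_of_lt (h4 g hg t ht x s) (ENNReal.mul_lt_top (by finiteness) hs)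
    have hQ := setLIntegral_slabInt_le (w := w) (c := c) (k := kvec k) (T := T) (h := h) (t := t) (s := s)
      (x := x) hg (D := L / κ) (N := √(C₂ / v)) (by positivity) (by positivity)
      (S := {z | (x i - s) * ((t - z.2) * k i) ≤ 0}) (by
        rw [Real.sq_sqrt (by positivity)]
        exact h2 w c k h i T t s x hw hc hk hki)
    have hSm : MeasurableSet {z : ({j : Fin d // j ≠ i} → ℝ) × ℝ | z.2 ∈ Set.uIoc 0 t} :=
      measurable_snd measurableSet_uIoc
    have hsign : ∀ z : ({j : Fin d // j ≠ i} → ℝ) × ℝ,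
        (x i - s) * ((t - z.2) * k i) = (t - z.2) * ((x i - s) * k i) := fun z => by ring
    -- Packets travel in the direction of sign k_i. For t ≥ 0 and (x_i - s)k_i ≤ 0, the point is not
    -- reached from earlier sources and the causal part is negligible. In the opposite case the
    -- sources at times after t are negligible and may be added. For t < 0 the two cases are
    -- interchanged.
    rcases le_or_gt 0 t with ht0 | ht0
    · refine (enorm_setIntegral_le_of_subset_or hint hSm
        (P := {z | z.2 ∈ Set.Ioi 0}) (Q := {z | (x i - s) * ((t - z.2) * k i) ≤ 0}) ?_ ?_).trans
        (add_le_add ?_ hQ)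
      · intro z hz
        rw [Set.mem_ofPred_eq, Set.uIoc_of_le ht0] at hz
        exact hz.1
      · simp only [hsign]
        rcases le_total ((x i - s) * k i) 0 with hρ | hρ
        · left
          intro z hz
          rw [Set.mem_ofPred_eq, Set.uIoc_of_le ht0] at hz
          exact mul_nonpos_of_nonneg_of_nonpos (by linarith [hz.2]) hρ
        · right
          rintro z ⟨hz1, hz2⟩
          rw [Set.mem_ofPred_eq, Set.uIoc_of_le ht0] at hz2
          refine mul_nonpos_of_nonpos_of_nonneg ?_ hρ
          by_contra hcon
          exact hz2 ⟨hz1, by linarith⟩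
      · exact ((h1 w c k h i T s g _ hw hc hk hki hT hg measurableSet_Ioi hs).1 t ht x).trans
          le_self_add
    · refine (enorm_setIntegral_le_of_subset_or hint hSm
        (P := {z | z.2 ∈ Set.Iic 0}) (Q := {z | (x i - s) * ((t - z.2) * k i) ≤ 0}) ?_ ?_).trans
        (add_le_add ?_ hQ)
      · intro z hz
        rw [Set.mem_ofPred_eq, Set.uIoc_of_ge ht0.le] at hz
        exact hz.2
      · simp only [hsign]
        rcases le_total ((x i - s) * k i) 0 with hρ | hρ
        · right
          rintro z ⟨hz1, hz2⟩
          rw [Set.mem_ofPred_eq, Set.uIoc_of_ge ht0.le] at hz2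
          refine mul_nonpos_of_nonneg_of_nonpos ?_ hρ
          by_contra hcon
          exact hz2 ⟨by linarith, hz1⟩
        · left
          intro z hz
          rw [Set.mem_ofPred_eq, Set.uIoc_of_ge ht0.le] at hz
          exact mul_nonpos_of_nonpos_of_nonneg (by linarith [hz.1]) hρ
      · exact ((h1 w c k h i T s g _ hw hc hk hki hT hg measurableSet_Iic hs).1 t ht x).trans
          le_add_self
  · have hq1 : 1 ≤ q := one_le_two.trans hq
    refine (eLpNorm_add_le ((hm1' _ s).add (hm1' _ s)).aestronglyMeasurable
      ((hm2' s).const_mul _).aestronglyMeasurable hq1).trans ?_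
    rw [ENNReal.ofReal_add (by positivity) hK₂0.le, ENNReal.ofReal_add hK₁0 hK₁0, add_mul, add_mul]
    refine add_le_add ((eLpNorm_add_le (hm1' _ s).aestronglyMeasurable
      (hm1' _ s).aestronglyMeasurable hq1).trans (add_le_add ?_ ?_)) ?_
    · exact (h1 w c k h i T s g _ hw hc hk hki hT hg measurableSet_Ioi hs).2
    · exact (h1 w c k h i T s g _ hw hc hk hki hT hg measurableSet_Iic hs).2
    · refine (eLpNorm_const_mul_le (hm2' s)).trans ?_
      rw [hK₂, ENNReal.ofReal_mul (by positivity), mul_assoc]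
      exact mul_le_mul_right (h3 i T g hg h _ (by positivity) s) _

end MaxFun

/-! ### The Duhamel estimates at all frequencies -/

namespace MaxFun

variable {d : ℕ}

theorem jap_le_two_mul_abs {r : ℝ} (hr : 1 ≤ |r|) : jap r ≤ 2 * |r| := by
  unfold jap
  rw [Real.sqrt_le_iff]
  refine ⟨by positivity, ?_⟩
  rw [mul_pow, sq_abs]
  have : 1 ≤ r ^ 2 := by rw [← sq_abs]; exact one_le_pow₀ hr
  linarith

/-- The retarded estimate at all frequencies. -/
theorem exists_retarded_le (hd : 2 ≤ d) {q : ℝ≥0∞} (hq : 2 ≤ q) (hqd : 8 / (d : ℝ≥0∞) < q)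
    {M : ℝ} (hM : 0 < M) : ∃ C : ℝ, 0 < C ∧ ∀ (w : Sp d) (c : ℝ) (k : Fin d → ℤ)
    (h i : Fin d) (T : ℝ) (g : ℝ → Sp d → ℂ), ‖w‖ ≤ 1 → 1 ≤ c → k i ≠ 0 →
    0 < T → T ≤ M * c ^ 2 → StronglyMeasurable (Function.uncurry g) →
    anisoNorm q ⊤ h T (retarded w c (kvec k) g) ≤
      ENNReal.ofReal (C * (c ^ (1 + (d : ℝ) / 2) * jap (k i) ^ (-(3 / 2) + (1 / q).toReal))) *
        anisoNorm 1 2 i T g := by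
  have hqd' : 4 / (d : ℝ≥0∞) < q :=
    lt_of_le_of_lt (ENNReal.div_le_div_right (by norm_num) _) hqd
  set p := (1 / q).toReal with hp
  have hp1 : p ≤ 1 / 2 := toReal_one_div_le_half hq
  have hδ : 0 < delta d := delta_pos
  obtain ⟨C₁, hC₁, h1⟩ := exists_retarded_low hd hq hqd (A := (delta d)⁻¹)
    ((one_le_inv₀ hδ).2 delta_le_one) hM
  obtain ⟨C₂, hC₂, h2⟩ := exists_retarded_high (by omega : 0 < d) hq hqd'
  refine ⟨(C₁ + C₂) * 2 ^ (3 / 2 - p), by positivity, fun w c k h i T g hw hc hki hT hTM hg => ?_⟩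
  have hc0 : 0 < c := by linarith
  have hκ1 : 1 ≤ |(k i : ℝ)| := by exact_mod_cast Int.one_le_abs hki
  have hj0 : 0 < jap (k i) := by linarith [one_le_jap (k i : ℝ)]
  have hc1 : c ≤ c ^ (1 + (d : ℝ) / 2) := by
    nth_rw 1 [← Real.rpow_one c]
    exact Real.rpow_le_rpow_of_exponent_le hc (by linarith [(Nat.cast_nonneg d : (0 : ℝ) ≤ d)])
  have hpow : |(k i : ℝ)| ^ (-(3 / 2) + p) ≤ 2 ^ (3 / 2 - p) * jap (k i) ^ (-(3 / 2) + p) := by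
    have h3 : jap (k i) / 2 ≤ |(k i : ℝ)| := by linarith [jap_le_two_mul_abs hκ1]
    refine (Real.rpow_le_rpow_of_nonpos (by positivity) h3 (by linarith)).trans (le_of_eq ?_)
    rw [Real.div_rpow hj0.le (by norm_num), div_eq_mul_inv, ← Real.rpow_neg (by norm_num), mul_comm]
    congr 2; ring
  set κp := |(k i : ℝ)| ^ (-(3 / 2) + p) with hκp
  set jp := jap (k i) ^ (-(3 / 2) + p) with hjp
  have hκp0 : 0 ≤ κp := by positivity
  have hbound : ∀ C', 0 < C' → C' ≤ C₁ + C₂ → C' * (c ^ (1 + (d : ℝ) / 2) * κp) ≤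
      (C₁ + C₂) * 2 ^ (3 / 2 - p) * (c ^ (1 + (d : ℝ) / 2) * jp) := fun C' h0 hC' => by
    calc C' * (c ^ (1 + (d : ℝ) / 2) * κp)
        ≤ (C₁ + C₂) * (c ^ (1 + (d : ℝ) / 2) * (2 ^ (3 / 2 - p) * jp)) := by gcongr
      _ = _ := by ring
  rcases le_total c (delta d * ‖kvec k‖) with hk | hk
  · refine (h2 w c k h i T g hw hc hk hki hT hg).trans (mul_le_mul_left
      (ENNReal.ofReal_le_ofReal ?_) _)
    refine le_trans ?_ (hbound C₂ hC₂ (by linarith))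
    gcongr
  · refine (h1 w c (kvec k) h i T g hw hc hκ1 ?_ hT hTM hg).trans (mul_le_mul_left
      (ENNReal.ofReal_le_ofReal (hbound C₁ hC₁ (by linarith))) _)
    rw [inv_mul_eq_div, le_div_iff₀ hδ, mul_comm]
    exact hk

theorem anisoNorm_le_mul {p₁ p₂ : ℝ≥0∞} {i : Fin d} {T : ℝ} {F G : ℝ → Sp d → ℂ} (a : NNReal)
    (h : ∀ᵐ t ∂(volume.restrict (timeI T)), ∀ x, ‖F t x‖ₑ ≤ a * ‖G t x‖ₑ) :
    anisoNorm p₁ p₂ i T F ≤ a * anisoNorm p₁ p₂ i T G := by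
  unfold anisoNorm
  refine eLpNorm_le_nnreal_smul_eLpNorm_of_ae_le_mul' (Filter.Eventually.of_forall fun s => ?_) p₁
  simp only [enorm_eq_self]
  refine eLpNorm_le_nnreal_smul_eLpNorm_of_ae_le_mul' ?_ p₂
  filter_upwards [Measure.quasiMeasurePreserving_snd.ae h] with z hz
  exact hz _

/-- A measurable representative of the frequency localization of a tempered function. -/
theorem exists_stronglyMeasurable_box {η : ℝ → ℝ} (hη : IsUniformBump η) (k : Fin d → ℤ) {T : ℝ}
    {f : ℝ → Sp d → ℂ} (hf : IsTemperedOn T f) : ∃ g : ℝ → Sp d → ℂ,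
      StronglyMeasurable (Function.uncurry g) ∧ ∀ᵐ τ ∂(volume.restrict (timeI T)),
        IsTempered (f τ) ∧ g τ = box η k (f τ) := by
  obtain ⟨N, hN⟩ := hf
  set F := hN.1.mk _ with hF
  -- Undoing the weight on a strongly measurable version of the weighted function gives a version of
  -- f, so the localization becomes jointly measurable.
  set f' : ℝ × Sp d → ℂ := fun p => ((1 + ‖p.2‖) ^ N) • F p with hf'
  have hf'm : StronglyMeasurable f' :=
    (by fun_prop : Continuous fun p : ℝ × Sp d => (1 + ‖p.2‖) ^ N).stronglyMeasurable.smul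
      hN.1.stronglyMeasurable_mk
  have hK := continuous_multKernel_sigma hη k
  have hKm : StronglyMeasurable fun p : (ℝ × Sp d) × Sp d =>
      multKernel (fun ξ : Sp d => (sigma η k ξ : ℂ)) (p.1.2 - p.2) * f' (p.1.1, p.2) :=
    (Continuous.comp (g := multKernel fun ξ : Sp d => (sigma η k ξ : ℂ))
      (f := fun p : (ℝ × Sp d) × Sp d => p.1.2 - p.2) hK (by fun_prop)).stronglyMeasurable.mul
      (hf'm.comp_measurable (by fun_prop : Measurable fun p : (ℝ × Sp d) × Sp d => (p.1.1, p.2)))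
  refine ⟨fun τ x => ∫ y, multKernel (fun ξ : Sp d => (sigma η k ξ : ℂ)) (x - y) * f' (τ, y),
    hKm.integral_prod_right' (ν := volume), ?_⟩
  filter_upwards [hN.prod_right_ae, Measure.ae_ae_of_ae_prod hN.1.ae_eq_mk] with τ h1 h2
  refine ⟨⟨N, h1⟩, funext fun x => ?_⟩
  unfold box mult
  refine integral_congr_ae ?_
  filter_upwards [h2] with y hy
  have h3 : f' (τ, y) = f τ y := by
    simp only [hf', hF]
    rw [← hy, smul_smul, mul_inv_cancel₀ (by positivity), one_smul]
  rw [h3]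

/-- The maximal estimate for Duhamel operators. -/
theorem exists_duhamel_le (hd : 2 ≤ d) {η : ℝ → ℝ} (hη : IsUniformBump η) {q : ℝ≥0∞} (hq : 2 ≤ q)
    (hqd : 8 / (d : ℝ≥0∞) < q) {M : ℝ} (hM : 0 < M) : ∃ C : ℝ, 0 < C ∧ ∀ (w : Sp d) (a : ℝ) (c : ℝ)
    (k : Fin d → ℤ) (h i : Fin d) (T : ℝ) (f F : ℝ → Sp d → ℂ), ‖w‖ ≤ 1 → 1 ≤ c → k i ≠ 0 →
    0 < T → T ≤ M * c ^ 2 → IsTemperedOn T f →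
    (∀ t x, F t x = ∫ τ in (0 : ℝ)..t, (a : ℂ) * mult (fun ξ => (sigma η k ξ : ℂ) *
      ((1 + inner ℝ w (ξ - kvec k) : ℝ) : ℂ) ^ 2 * symU c (t - τ) ξ) (f τ) x) →
    anisoNorm q ⊤ h T F ≤
      ENNReal.ofReal (|a| * (C * (c ^ (1 + (d : ℝ) / 2) *
        jap (k i) ^ (-(3 / 2) + (1 / q).toReal)))) *
        anisoNorm 1 2 i T (fun t => box η k (f t)) := by
  obtain ⟨C, hC, h1⟩ := exists_retarded_le hd hq hqd hM
  set b : ℝ := ((2 * Real.pi) ^ d)⁻¹ with hb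
  have hb0 : 0 < b := by positivity
  refine ⟨b * C, by positivity, fun w a c k h i T f F hw hc hki hT hTM hf hF => ?_⟩
  obtain ⟨g, hg, hgae⟩ := exists_stronglyMeasurable_box hη k hf
  have hFg : ∀ t ∈ timeI T, ∀ x, F t x = ((a * b : ℝ) : ℂ) * retarded w c (kvec k) g t x := by
    intro t ht x
    rw [hF, retarded, ← intervalIntegral.integral_const_mul]
    -- The reproducing formula is available only for almost every τ, because f τ is tempered only
    -- for almost every τ.
    refine intervalIntegral.integral_congr_ae ?_
    have h2 := (ae_restrict_iff' measurableSet_Icc).1 hgae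
    filter_upwards [h2] with τ hτ hτt
    obtain ⟨h3, h4⟩ := hτ (uIoc_subset_timeI ht hT hτt)
    rw [mult_eq_integral_ker_mul_box hη hw hc k (t - τ) h3 x, h4, ← hb, Complex.ofReal_mul]
    ring
  have h2 : anisoNorm q ⊤ h T F ≤
      Real.toNNReal (|a| * b) * anisoNorm q ⊤ h T (retarded w c (kvec k) g) := by
    refine anisoNorm_le_mul _ ?_
    filter_upwards [ae_restrict_mem measurableSet_Icc] with t ht x
    rw [hFg t ht x, enorm_mul]
    refine le_of_eq ?_
    congr 1
    rw [← ofReal_norm, Complex.norm_real, Real.norm_eq_abs, abs_mul, abs_of_pos hb0]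
    rfl
  have h3 : anisoNorm 1 2 i T g ≤ anisoNorm 1 2 i T (fun t => box η k (f t)) := by
    have := anisoNorm_le_mul (p₁ := 1) (p₂ := 2) (i := i) (T := T) (F := g)
      (G := fun t => box η k (f t)) 1 (by
        filter_upwards [hgae] with t ht x
        rw [ht.2]; simp)
    simpa using this
  refine h2.trans ((mul_le_mul_right ((h1 w c k h i T g hw hc hki hT hTM hg).trans
    (mul_le_mul_right h3 _)) _).trans (le_of_eq ?_))
  change ENNReal.ofReal (|a| * b) * _ = _
  rw [← mul_assoc, ← ENNReal.ofReal_mul (by positivity)]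
  congr 2
  ring

/-- The maximal estimate for the Duhamel operator. -/
theorem exists_boxA_le (hd : 2 ≤ d) {η : ℝ → ℝ} (hη : IsUniformBump η) {q : ℝ≥0∞} (hq : 2 ≤ q)
    (hqd : 8 / (d : ℝ≥0∞) < q) {M : ℝ} (hM : 0 < M) : ∃ C : ℝ, 0 < C ∧ ∀ (c : ℝ), 1 ≤ c →
    ∀ T : ℝ, 0 < T → T ≤ M * c ^ 2 → ∀ (k : Fin d → ℤ) (h i : Fin d), k i ≠ 0 →
    ∀ f : ℝ → Sp d → ℂ, IsTemperedOn T f →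
    anisoNorm q ⊤ h T (boxA η c k f) ≤
      ENNReal.ofReal (C * c ^ (1 + (d : ℝ) / 2) * jap (k i) ^ (-(3 / 2) + (1 / q).toReal)) *
        anisoNorm 1 2 i T (fun t => box η k (f t)) := by
  obtain ⟨C, hC, h1⟩ := exists_duhamel_le hd hη hq hqd hM
  refine ⟨C, hC, fun c hc T hT hTM k h i hki f hf => ?_⟩
  have := h1 0 1 c k h i T f (boxA η c k f) (by simp) hc hki hT hTM hf (fun t x => by
    simp [boxA, boxU])
  rwa [abs_one, one_mul, ← mul_assoc] at this

/-- The maximal estimate for two derivatives of the Duhamel operator. -/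
theorem exists_boxD2A_le (hd : 2 ≤ d) {η : ℝ → ℝ} (hη : IsUniformBump η) {q : ℝ≥0∞} (hq : 2 ≤ q)
    (hqd : 8 / (d : ℝ≥0∞) < q) {M : ℝ} (hM : 0 < M) : ∃ C : ℝ, 0 < C ∧ ∀ (c : ℝ), 1 ≤ c →
    ∀ T : ℝ, 0 < T → T ≤ M * c ^ 2 → ∀ (k : Fin d → ℤ) (h i : Fin d), k i ≠ 0 →
    ∀ f : ℝ → Sp d → ℂ, IsTemperedOn T f →
    anisoNorm q ⊤ h T (boxD2A η c k i f) ≤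
      ENNReal.ofReal (C * c ^ (1 + (d : ℝ) / 2) * jap (k i) ^ (1 / 2 + (1 / q).toReal)) *
        anisoNorm 1 2 i T (fun t => box η k (f t)) := by
  obtain ⟨C, hC, h1⟩ := exists_duhamel_le hd hη hq hqd hM
  refine ⟨C, hC, fun c hc T hT hTM k h i hki f hf => ?_⟩
  have hκ1 : 1 ≤ |(k i : ℝ)| := by exact_mod_cast Int.one_le_abs hki
  have hκ0 : (k i : ℝ) ≠ 0 := by exact_mod_cast hki
  have hj0 : 0 < jap (k i) := by linarith [one_le_jap (k i : ℝ)]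
  -- With this w the affine factor is ξ_i/k_i, so its square times -k_i² is the symbol of the second
  -- derivative. The bound |w| ≤ 1 is |k_i| ≥ 1.
  set w : Sp d := EuclideanSpace.single i ((k i : ℝ)⁻¹) with hw
  have hwn : ‖w‖ ≤ 1 := by
    rw [hw, PiLp.norm_single, norm_inv]
    exact inv_le_one_of_one_le₀ hκ1
  have hwi : ∀ ξ : Sp d, 1 + inner ℝ w (ξ - kvec k) = (k i : ℝ)⁻¹ * ξ i := fun ξ => by
    rw [hw, EuclideanSpace.inner_single_left]
    have : (ξ - kvec k) i = ξ i - k i := rfl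
    rw [this]
    simp
    field_simp
    ring
  have hsym : ∀ t, (fun ξ : Sp d => (sigma η k ξ : ℂ) * (Complex.I * (ξ i : ℂ)) ^ 2 * symU c t ξ) =
      fun ξ => ((-(k i : ℝ) ^ 2 : ℝ) : ℂ) * ((sigma η k ξ : ℂ) *
        ((1 + inner ℝ w (ξ - kvec k) : ℝ) : ℂ) ^ 2 * symU c t ξ) := fun t => by
    funext ξ
    rw [hwi, mul_pow, Complex.I_sq]
    have : (k i : ℂ) ≠ 0 := by exact_mod_cast hki
    push_cast
    field_simp
  have hmult : ∀ (a : ℂ) (m : Sp d → ℂ) (ψ : Sp d → ℂ) (x : Sp d),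
      mult (fun ξ => a * m ξ) ψ x = a * mult m ψ x := fun a m ψ x => by
    unfold mult multKernel
    rw [← integral_const_mul]
    refine integral_congr_ae (Filter.Eventually.of_forall fun y => ?_)
    simp only
    have : ∀ ξ : Sp d, Complex.exp (Complex.I * (inner ℝ (x - y) ξ : ℝ)) * (a * m ξ) =
        a * (Complex.exp (Complex.I * (inner ℝ (x - y) ξ : ℝ)) * m ξ) := fun ξ => by ring
    simp only [this]
    rw [integral_const_mul]
    ring
  refine (h1 w (-(k i : ℝ) ^ 2) c k h i T f (boxD2A η c k i f) hwn hc hki hT hTM hf (fun t x => by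
    simp only [boxD2A, hsym, hmult])).trans (mul_le_mul_left (ENNReal.ofReal_le_ofReal ?_) _)
  have h2 : |(-(k i : ℝ) ^ 2)| ≤ jap (k i) ^ (2 : ℝ) := by
    rw [abs_neg, abs_pow]
    have : jap (k i) ^ (2 : ℝ) = jap (k i) ^ 2 := by exact_mod_cast Real.rpow_natCast _ 2
    rw [this]
    have := abs_le_jap (k i : ℝ)
    gcongr
  calc _ ≤ jap (k i) ^ (2 : ℝ) * (C * (c ^ (1 + (d : ℝ) / 2) *
          jap (k i) ^ (-(3 / 2) + (1 / q).toReal))) := by gcongr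
    _ = C * c ^ (1 + (d : ℝ) / 2) * (jap (k i) ^ (2 : ℝ) *
          jap (k i) ^ (-(3 / 2) + (1 / q).toReal)) := by ring
    _ = _ := by rw [← Real.rpow_add hj0]; congr 2; ring

end MaxFun

/-! ### Assembly of the five estimates -/

theorem mainTheorem9 (d : ℕ) (hd : 2 ≤ d) (η : ℝ → ℝ) (hη : MaxFun.IsUniformBump η)
    (q : ℝ≥0∞) (hq : 2 ≤ q) (a : ℝ) (ha : 0 < a) (M : ℝ) (hM : 0 < M) :
    -- free evolution, frequencies `|k| ≳ K(c)`
    (8 / (d : ℝ≥0∞) < q →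
      ∃ C : ℝ, 0 < C ∧ ∀ c : ℝ, 1 ≤ c → ∀ T : ℝ, 0 < T → T ≤ M * c ^ 2 →
        ∀ k : Fin d → ℤ, a * MaxFun.threshold c ≤ MaxFun.latNorm k →
        ∀ (i : Fin d) (ψ : MaxFun.Sp d → ℂ), MaxFun.IsTempered ψ →
          MaxFun.anisoNorm q ∞ i T (MaxFun.boxU η c k ψ) ≤
            ENNReal.ofReal (C * c ^ ((d : ℝ) / 2) *
              MaxFun.jap (MaxFun.latNorm k) ^ (1 / q).toReal) *
            eLpNorm (MaxFun.box η k ψ) 2 volume) ∧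
    -- free evolution, frequencies `|k| ≲ K(c)`
    (4 / (d : ℝ≥0∞) < q →
      ∃ C : ℝ, 0 < C ∧ ∃ c₀ : ℝ, 1 ≤ c₀ ∧
        ∀ c : ℝ, 1 ≤ c → ∀ T : ℝ, 0 < T → (T ≤ M * c ^ 2 ∨ c₀ ≤ c) →
        ∀ k : Fin d → ℤ, MaxFun.latNorm k ≤ a * MaxFun.threshold c →
        ∀ (i : Fin d) (ψ : MaxFun.Sp d → ℂ), MaxFun.IsTempered ψ →
          MaxFun.anisoNorm q ∞ i T (MaxFun.boxU η c k ψ) ≤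
            ENNReal.ofReal (C * c * MaxFun.jap (MaxFun.latNorm k) ^ (1 / q).toReal) *
            eLpNorm (MaxFun.box η k ψ) 2 volume) ∧
    -- Duhamel operator, same direction, frequencies `|k_i| ≳ K(c)²`
    (8 / (d : ℝ≥0∞) < q →
      ∃ C : ℝ, 0 < C ∧ ∀ c : ℝ, 1 ≤ c → ∀ T : ℝ, 0 < T → T ≤ M * c ^ 2 →
        ∀ (k : Fin d → ℤ) (i : Fin d), a * MaxFun.threshold c ^ 2 ≤ |(k i : ℝ)| →
        ∀ f : ℝ → MaxFun.Sp d → ℂ, MaxFun.IsTemperedOn T f →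
          MaxFun.anisoNorm q ∞ i T (MaxFun.boxA η c k f) ≤
            ENNReal.ofReal (C * c ^ (1 + (d : ℝ) / 2) *
              MaxFun.jap (k i) ^ (-(3 / 2) + (1 / q).toReal)) *
            MaxFun.anisoNorm 1 2 i T (fun t => MaxFun.box η k (f t))) ∧
    -- Duhamel operator, different directions, frequencies `|k_i| ≳ c`
    (8 / (d : ℝ≥0∞) < q →
      ∃ C : ℝ, 0 < C ∧ ∀ c : ℝ, 1 ≤ c → ∀ T : ℝ, 0 < T → T ≤ M * c ^ 2 →
        ∀ (k : Fin d → ℤ) (h i : Fin d), h ≠ i → a * c ≤ |(k i : ℝ)| →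
        ∀ f : ℝ → MaxFun.Sp d → ℂ, MaxFun.IsTemperedOn T f →
          MaxFun.anisoNorm q ∞ h T (MaxFun.boxA η c k f) ≤
            ENNReal.ofReal (C * c ^ (1 + (d : ℝ) / 2) *
              MaxFun.jap (k i) ^ (-(3 / 2) + (1 / q).toReal)) *
            MaxFun.anisoNorm 1 2 i T (fun t => MaxFun.box η k (f t))) ∧
    -- Duhamel operator with two derivatives, arbitrary directions, frequencies `|k_i| ≳ c`
    (8 / (d : ℝ≥0∞) < q →
      ∃ C : ℝ, 0 < C ∧ ∀ c : ℝ, 1 ≤ c → ∀ T : ℝ, 0 < T → T ≤ M * c ^ 2 →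
        ∀ (k : Fin d → ℤ) (h i : Fin d), a * c ≤ |(k i : ℝ)| →
        ∀ f : ℝ → MaxFun.Sp d → ℂ, MaxFun.IsTemperedOn T f →
          MaxFun.anisoNorm q ∞ h T (MaxFun.boxD2A η c k i f) ≤
            ENNReal.ofReal (C * c ^ (1 + (d : ℝ) / 2) *
              MaxFun.jap (k i) ^ (1 / 2 + (1 / q).toReal)) *
            MaxFun.anisoNorm 1 2 i T (fun t => MaxFun.box η k (f t))) := by
  have h84 : 8 / (d : ℝ≥0∞) < q → 4 / (d : ℝ≥0∞) < q :=
    fun h => lt_of_le_of_lt (ENNReal.div_le_div_right (by norm_num) _) h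
  -- From the lower bounds on |k_i| only k_i ≠ 0 is extracted; the regimes are separated by
  -- comparing |k| with c.
  have hne : ∀ {b : ℝ} (n : ℤ), 0 < b → b ≤ |(n : ℝ)| → n ≠ 0 := by
    rintro b n hb hn rfl
    simp at hn
    linarith
  have hthr : ∀ c : ℝ, 1 ≤ c → 0 < a * MaxFun.threshold c ^ 2 := fun c hc => by
    have := MaxFun.ten_le_threshold hc
    positivity
  refine ⟨fun hqd => ?_, fun hqd => ?_, fun hqd => ?_, fun hqd => ?_, fun hqd => ?_⟩
  · obtain ⟨C, hC, h⟩ := MaxFun.free_estimate_high hd hη q hq (h84 hqd) M hM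
    refine ⟨C, hC, fun c hc T hT hTM k _ i ψ hψ => (h c hc T hT hTM k i ψ hψ).trans
      (mul_le_mul_left (ENNReal.ofReal_le_ofReal ?_) _)⟩
    -- This is where d ≥ 2 enters: the bound already proved carries only the factor c.
    have h1 : c ≤ c ^ ((d : ℝ) / 2) := by
      nth_rw 1 [← Real.rpow_one c]
      refine Real.rpow_le_rpow_of_exponent_le hc ?_
      have : (2 : ℝ) ≤ d := by exact_mod_cast hd
      linarith
    have h2 := MaxFun.one_le_jap (MaxFun.latNorm k)
    gcongr
  · obtain ⟨C₁, hC₁, h1⟩ := MaxFun.free_estimate_high hd hη q hq hqd M hM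
    obtain ⟨C₂, hC₂, h2⟩ := MaxFun.free_estimate_low hd hη q hq hqd
    have hδ : 0 < MaxFun.delta d := MaxFun.delta_pos
    obtain ⟨c₀, hc₀, h3⟩ := MaxFun.exists_threshold_le a (MaxFun.delta d) ha hδ
    -- The two entries secure the two conditions of the low dispersive regime: a K(c) ≤ δc and 1 ≤
    -- δc, with δ = `delta d`.
    refine ⟨C₁ + C₂, by positivity, max c₀ (MaxFun.delta d)⁻¹, hc₀.trans (le_max_left _ _),
      fun c hc T hT hTc k hk i ψ hψ => ?_⟩
    have hj := MaxFun.one_le_jap (MaxFun.latNorm k)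
    have hmono : ∀ C, C ≤ C₁ + C₂ → ENNReal.ofReal (C * c *
        MaxFun.jap (MaxFun.latNorm k) ^ (1 / q).toReal) ≤ ENNReal.ofReal ((C₁ + C₂) * c *
        MaxFun.jap (MaxFun.latNorm k) ^ (1 / q).toReal) := fun C hC =>
      ENNReal.ofReal_le_ofReal (by gcongr)
    rcases hTc with hTM | hcc
    · exact (h1 c hc T hT hTM k i ψ hψ).trans (mul_le_mul_left (hmono C₁ (by linarith)) _)
    · refine (h2 c hc ?_ T hT k (hk.trans (h3 c ((le_max_left _ _).trans hcc))) i ψ hψ).trans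
        (mul_le_mul_left (hmono C₂ (by linarith)) _)
      have := (le_max_right _ _).trans hcc
      rwa [inv_le_iff_one_le_mul₀' hδ] at this
  · obtain ⟨C, hC, h⟩ := MaxFun.exists_boxA_le hd hη hq hqd hM
    exact ⟨C, hC, fun c hc T hT hTM k i hk f hf =>
      h c hc T hT hTM k i i (hne _ (hthr c hc) hk) f hf⟩
  · obtain ⟨C, hC, h⟩ := MaxFun.exists_boxA_le hd hη hq hqd hM
    exact ⟨C, hC, fun c hc T hT hTM k j i _ hk f hf =>
      h c hc T hT hTM k j i (hne _ (by positivity) hk) f hf⟩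
  · obtain ⟨C, hC, h⟩ := MaxFun.exists_boxD2A_le hd hη hq hqd hM
    exact ⟨C, hC, fun c hc T hT hTM k j i hk f hf =>
      h c hc T hT hTM k j i (hne _ (by positivity) hk) f hf⟩
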